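/- Conventions. $T^2$ is the torus and $I=(-1,1)$. An \emph{ideal torihedron} is the cone $T^2\times[0,1]/(T^2\times\{1\})$ with a finite graph $G$ embedded in $T^2\times\{0\}$ (loops and multiple edges allowed) all of whose complementary regions are open disks, with the cone point and the vertices of $G$ removed; so it is $T^2\times[0,1)$ with the vertices of $G\times\{0\}$ removed. The edges and faces of $G$ are its edges and faces. A \emph{decomposition} of a space into two ideal torihedra is a proper surjection from their disjoint union such that interior points are identified with nothing else, every open face is embedded and is identified with exactly one other face, every open edge is embedded, the images of faces and edges are disjoint, and any two edges have equal or disjoint images. Let $K$ be a link diagram on $T^2$ that is cellular (every region of its projection is an open disk) and whose crossings are grouped into twist regions, each a single crossing or a string of crossings in which consecutive ones bound bigons; for instance, a cellular twist-reduced diagram with its twist regions. \emph{Fully augmenting} $K$ means adding to each twist region a crossing circle $C_i$, perpendicular to $T^2\times\{0\}$ and bounding a disk $D_i$ that meets the rest of the link in one point of each of the two strands, and removing all full twists, so that at each twist region no half-twist or one half-twist remains, according to whether its number of crossings is even or odd. A link $L\subset T^2\times I$ is a \emph{fully augmented link} if it is equivalent, by a homeomorphism of $T^2\times I$ (for example the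 end of an ambient isotopy), to the link so obtained from such a $K$. Proposition. Let $L$ be a fully augmented link in $T^2\times I$. Then $(T^2\times I)- L$ has a decomposition into two ideal torihedra $P_+,P_-$ such that: (1) The graphs of $P_\pm$ are 4-valent. (2) The faces of $P_\pm$ can be checkerboard coloured, shaded and white, so that every shaded face is a triangle. In each of $P_\pm$ the shaded faces come in pairs (bow-ties), one for each crossing circle $C_i$; the two triangles of the $i$-th bow-tie share an ideal vertex to which $C_i$ is collapsed (points tending to this ideal vertex tend to $C_i$ in $T^2\times I$), and points tending to any ideal vertex coming from the graph tend to $L$. (3) $P_+$ and $P_-$ are combinatorially isomorphic: a homeomorphism of $T^2$ takes the graph of one to that of the other, respecting vertices, edges and the triangles of the bow-ties. (4) The decomposition is the one given by cutting along the projection torus, slicing along the halves of the disks $D_i$, and flattening. That is, under the equivalence of $L$ with the diagram: each triangle of the $i$-th bow-ties is mapped onto the open upper or lower half of $D_i$; both triangles of the bow-tie in $P_+$ go to the upper half and both in $P_-$ to the lower half if there is no half-twist at $C_i$, while if there is one, one triangle of each of $P_+$ and $P_-$ goes to either half. White faces are glued to the corresponding white faces. Outside the twist regions with a half-twist, white faces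 are mapped into $T^2\times\{0\}$, the interior of $P_+$ above it and the interior of $P_-$ below it. -/

import Mathlib

open Set Filter Topology

/-- The torus `T² = (ℝ/ℤ)²`. -/
abbrev Torus : Type := UnitAddCircle × UnitAddCircle

/-- The thickened torus `T² × I` with `I = (-1, 1)`. -/
abbrev ThickTorus : Type := Torus × Ioo (-1 : ℝ) 1

/-- A subset of the torus that is homeomorphic to an open disk. -/
def IsOpenDisk (U : Set Torus) : Prop :=
  Nonempty (U ≃ₜ Metric.ball (0 : EuclideanSpace ℝ (Fin 2)) 1)

/-- The sign of a label: `true` is `+1` (right, top), `false` is `-1` (left, bottom). -/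
noncomputable def sgn (b : Bool) : ℝ := if b then 1 else -1

/-- The coordinate square `[-1,1] × [-1,1]`. -/
def square : Set (ℝ × ℝ) := Icc (-1) 1 ×ˢ Icc (-1) 1

/-! ### Cellular graphs on the torus and torihedra -/

/-- A finite graph embedded in the torus (loops and multiple edges are allowed), all of whose
complementary regions are open disks. -/
structure CellularGraph where
  /-- the set of vertices -/
  vert : Set Torus
  /-- the index type of the edges -/
  Edge : Type
  /-- a parametrisation of every edge -/
  arc : Edge → C(unitInterval, Torus)
  vert_finite : vert.Finite
  edge_finite : Finite Edge
  arc_zero : ∀ e, arc e 0 ∈ vert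
  arc_one : ∀ e, arc e 1 ∈ vert
  arc_notMem : ∀ e, ∀ s ∈ Ioo (0 : unitInterval) 1, arc e s ∉ vert
  arc_inj : ∀ e e', ∀ s ∈ Ioo (0 : unitInterval) 1, ∀ s' ∈ Ioo (0 : unitInterval) 1,
    arc e s = arc e' s' → e = e' ∧ s = s'
  cellular : ∀ x ∉ vert ∪ ⋃ e, arc e '' Ioo 0 1,
    IsOpenDisk (connectedComponentIn (vert ∪ ⋃ e, arc e '' Ioo 0 1)ᶜ x)

namespace CellularGraph

/-- An edge without its endpoints. -/
def openEdge (G : CellularGraph) (e : G.Edge) : Set Torus := G.arc e '' Ioo 0 1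

/-- The union of the vertices and the edges. -/
def carrier (G : CellularGraph) : Set Torus := G.vert ∪ ⋃ e, G.openEdge e

/-- The (open) faces: the connected components of the complement of the graph. -/
def Face (G : CellularGraph) : Type :=
  {F : Set Torus // ∃ x ∉ G.carrier, F = connectedComponentIn G.carrierᶜ x}

/-- The valence of a point: the number of ends of edges at it (a loop counts twice). -/
noncomputable def valence (G : CellularGraph) (v : Torus) : ℕ :=
  Nat.card {e : G.Edge // G.arc e 0 = v} + Nat.card {e : G.Edge // G.arc e 1 = v}

/-- Every vertex has valence four. -/
def IsFourValent (G : CellularGraph) : Prop := ∀ v ∈ G.vert, G.valence v = 4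

/-- The face is a triangle: it is the homeomorphic image of the interior of a 2-simplex under a
continuous map of the closed simplex that takes corners to vertices and open sides injectively
onto edges. -/
def IsTriangle (G : CellularGraph) (F : G.Face) : Prop :=
  ∃ χ : C(stdSimplex ℝ (Fin 3), Torus),
    IsEmbedding (fun w : {w : stdSimplex ℝ (Fin 3) // ∀ j, 0 < w.1 j} => χ w.1) ∧
    χ '' {w | ∀ j, 0 < w.1 j} = F.1 ∧
    (∀ w, (∃ j, w.1 j = 1) → χ w ∈ G.vert) ∧
    ∀ m : Fin 3, ∃ e : G.Edge,
      InjOn χ {w | w.1 m = 0 ∧ ∀ j, j ≠ m → 0 < w.1 j} ∧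
      χ '' {w | w.1 m = 0 ∧ ∀ j, j ≠ m → 0 < w.1 j} = G.openEdge e

/-- The set `S` of shaded faces is a checkerboard colouring: every edge has a shaded face on one
side and a white (that is, not shaded) face on the other side. -/
def IsCheckerboard (G : CellularGraph) (S : Set G.Face) : Prop :=
  ∀ e : G.Edge,
    (∃! F : G.Face, F ∈ S ∧ G.openEdge e ⊆ closure F.1) ∧
    (∃! F : G.Face, F ∉ S ∧ G.openEdge e ⊆ closure F.1)

/-- An isomorphism of cellular graphs on the torus: a homeomorphism of the torus that takes
vertices to vertices and edges to edges (and hence faces to faces). -/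
structure Iso (G H : CellularGraph) where
  /-- the homeomorphism -/
  toHomeo : Torus ≃ₜ Torus
  /-- the induced bijection of the edges -/
  edgeEquiv : G.Edge ≃ H.Edge
  map_vert : toHomeo '' G.vert = H.vert
  map_edge : ∀ e, toHomeo '' G.openEdge e = H.openEdge (edgeEquiv e)

/-- The ideal torihedron with graph `G`. The cone `T² × [0,1] / (T² × {1})` without its cone point
is `T² × [0,1)`; the vertices of `G`, which lies on `T² × {0}`, are removed as well. -/
def IdealTorihedron (G : CellularGraph) : Type :=
  {p : Torus × Ico (0 : ℝ) 1 // ¬ (p.1 ∈ G.vert ∧ (p.2 : ℝ) = 0)}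

instance (G : CellularGraph) : TopologicalSpace G.IdealTorihedron :=
  inferInstanceAs (TopologicalSpace {p : Torus × Ico (0 : ℝ) 1 // ¬ (p.1 ∈ G.vert ∧ (p.2 : ℝ) = 0)})

/-- The interior of the ideal torihedron. -/
def interiorPart (G : CellularGraph) : Set G.IdealTorihedron := {x | 0 < (x.1.2 : ℝ)}

/-- The part of the bottom `T² × {0}` of the ideal torihedron that lies over a set `A`; for an open
face or an open edge `A` of the graph this is the open face or edge of the torihedron. -/
def bottom (G : CellularGraph) (A : Set Torus) : Set G.IdealTorihedron :=
  {x | x.1.1 ∈ A ∧ (x.1.2 : ℝ) = 0}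

/-- The points of the ideal torihedron that are close to the ideal vertex `v`. -/
def nearVertex (G : CellularGraph) (v : Torus) : Filter G.IdealTorihedron :=
  comap (fun x => x.1) (𝓝 (v, (⟨0, by simp⟩ : Ico (0 : ℝ) 1)))

end CellularGraph

/-- The maps `f false`, `f true` exhibit the space `M` as a decomposition into the two ideal
torihedra with graphs `G false`, `G true`: `M` is their union, glued along faces. That is,
`M` carries the quotient topology (`f` is proper and onto), no interior point is identified with
another point, each open face is embedded and identified with exactly one other face, each open
edge is embedded, and edges are identified with edges. -/
structure IsTorihedralDecomposition {M : Type} [TopologicalSpace M] (G : Bool → CellularGraph)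
    (f : ∀ k, (G k).IdealTorihedron → M) : Prop where
  proper : IsProperMap (fun x : Σ k, (G k).IdealTorihedron => f x.1 x.2)
  surjective : ∀ m : M, ∃ k x, f k x = m
  interior_inj : ∀ x y : Σ k, (G k).IdealTorihedron,
    x.2 ∈ (G x.1).interiorPart → f x.1 x.2 = f y.1 y.2 → x = y
  face_inj : ∀ k, ∀ F : (G k).Face, InjOn (f k) ((G k).bottom F.1)
  face_pairing : ∃ τ : (Σ k, (G k).Face) → (Σ k, (G k).Face),
    (∀ A, τ (τ A) = A) ∧ (∀ A, τ A ≠ A) ∧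
    (∀ A, f (τ A).1 '' (G (τ A).1).bottom (τ A).2.1 = f A.1 '' (G A.1).bottom A.2.1) ∧
    ∀ A B, B ≠ A → B ≠ τ A →
      Disjoint (f A.1 '' (G A.1).bottom A.2.1) (f B.1 '' (G B.1).bottom B.2.1)
  face_edge : ∀ k l, ∀ F : (G k).Face, ∀ e : (G l).Edge,
    Disjoint (f k '' (G k).bottom F.1) (f l '' (G l).bottom ((G l).openEdge e))
  edge_inj : ∀ k, ∀ e : (G k).Edge, InjOn (f k) ((G k).bottom ((G k).openEdge e))
  edge_edge : ∀ k l, ∀ e : (G k).Edge, ∀ e' : (G l).Edge,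
    f k '' (G k).bottom ((G k).openEdge e) = f l '' (G l).bottom ((G l).openEdge e') ∨
    Disjoint (f k '' (G k).bottom ((G k).openEdge e)) (f l '' (G l).bottom ((G l).openEdge e'))

/-! ### Link diagrams on the torus and their full augmentations -/

/-- A link diagram on the torus whose crossings are grouped into twist regions. Every twist region
lies in a coordinate box and is a vertical string of crossings in which consecutive crossings
bound bigons; `crossings` lists the signs of its crossings from bottom to top. A box
meets the rest of the diagram in four points, its ports `(±1/2, ±1)`. Outside the boxes the diagram
consists of disjoint arcs joining the ports in pairs, each with a band around it. (A component
without crossings does not occur in a diagram whose regions are disks.) -/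
structure TwistDiagram where
  /-- the index type of the twist regions -/
  Twist : Type
  /-- the index type of the arcs outside the twist regions -/
  Arc : Type
  twist_finite : Finite Twist
  /-- the signs of the crossings of a twist region -/
  crossings : Twist → List ℤˣ
  crossings_ne : ∀ i, crossings i ≠ []
  /-- coordinates on the box of a twist region -/
  box : Twist → ℝ × ℝ → Torus
  /-- coordinates on the band around an arc; the arc itself is `{0} × [-1,1]` -/
  band : Arc → ℝ × ℝ → Torus
  /-- the two ends of the arcs are the ports (region, left or right, bottom or top) -/
  ends : Arc × Bool ≃ Twist × Bool × Bool
  /-- whether the band runs into the box with or against the horizontal coordinate -/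
  flip : Arc × Bool → Bool
  box_cont : ∀ i, ContinuousOn (box i) square
  band_cont : ∀ e, ContinuousOn (band e) square
  box_inj : ∀ i j, ∀ u ∈ square, ∀ v ∈ square, box i u = box j v → i = j ∧ u = v
  band_inj : ∀ e e', ∀ u ∈ square, ∀ v ∈ square, band e u = band e' v → e = e' ∧ u = v
  band_end : ∀ e b, ∀ x ∈ Icc (-1 : ℝ) 1,
    band e (x, sgn b) = box (ends (e, b)).1
      (sgn (ends (e, b)).2.1 / 2 + sgn (flip (e, b)) * x / 4, sgn (ends (e, b)).2.2)
  band_box : ∀ e i, ∀ x ∈ Icc (-1 : ℝ) 1, ∀ s ∈ Ioo (-1 : ℝ) 1, band e (x, s) ∉ box i '' square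

namespace TwistDiagram

/-- The core arc of a band. -/
def core (K : TwistDiagram) (e : K.Arc) : Set Torus := (fun s => K.band e (0, s)) '' Icc (-1) 1

/-- Horizontal coordinate of the two strands (`b = true, false`) with `n` half twists, which take
place in the upper half of the box. -/
noncomputable def strandX (n : ℤ) (b : Bool) (y : ℝ) : ℝ :=
  sgn b / 2 * Real.cos (Real.pi * n * max 0 y)

/-- Height of the two strands with `n` half twists. -/
noncomputable def strandZ (n : ℤ) (b : Bool) (y : ℝ) : ℝ :=
  sgn b / 2 * Real.sin (Real.pi * n * max 0 y)

/-- The underlying 4-valent projection of the diagram. In a box with `m` crossings, the two strands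
cross `m` times. -/
def projection (K : TwistDiagram) : Set Torus :=
  (⋃ e, K.core e) ∪
  ⋃ i, {p | ∃ b, ∃ y ∈ Icc (-1 : ℝ) 1, p = K.box i (strandX (K.crossings i).length b y, y)}

/-- The diagram is cellular: the regions of the torus cut out by it are disks. -/
def IsCellular (K : TwistDiagram) : Prop :=
  ∀ p ∉ K.projection, IsOpenDisk (connectedComponentIn K.projectionᶜ p)

/-- The number of half twists (`0`, `1` or `-1`) that is left in a twist region when all full twists
are removed: the sum of the signs of the crossings, reduced by multiples of two towards zero. -/
def halfTwist (K : TwistDiagram) (i : K.Twist) : ℤ :=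
  Int.tmod ((K.crossings i).map (fun u => (u : ℤ))).sum 2

/-- The crossing circle around the two strands in a box; it is perpendicular to the projection
torus and bounds the round disk `y = -1/2`, `x² + z² ≤ (3/4)²`. -/
def crossingCircle (K : TwistDiagram) (i : K.Twist) : Set ThickTorus :=
  {q | ∃ x : ℝ, q.1 = K.box i (x, -1 / 2) ∧ x ^ 2 + (q.2 : ℝ) ^ 2 = (3 / 4) ^ 2}

/-- The open upper (`s = true`) or lower (`s = false`) half of the disk bounded by a crossing
circle. The two punctures of the disk lie on its diameter, in the projection torus. -/
def crossingHalfDisk (K : TwistDiagram) (i : K.Twist) (s : Bool) : Set ThickTorus :=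
  {q | ∃ x : ℝ, q.1 = K.box i (x, -1 / 2) ∧ x ^ 2 + (q.2 : ℝ) ^ 2 < (3 / 4) ^ 2 ∧
    0 < sgn s * (q.2 : ℝ)}

/-- The link obtained from the diagram by fully augmenting it: a crossing circle is added to every
twist region and all full twists are removed. The remaining arcs lie on the projection torus. -/
def augmentedLink (K : TwistDiagram) : Set ThickTorus :=
  (⋃ e, {q | q.1 ∈ K.core e ∧ (q.2 : ℝ) = 0}) ∪
  (⋃ i, {q | ∃ b, ∃ y ∈ Icc (-1 : ℝ) 1,
    q.1 = K.box i (strandX (K.halfTwist i) b y, y) ∧ (q.2 : ℝ) = strandZ (K.halfTwist i) b y}) ∪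
  ⋃ i, K.crossingCircle i

/-- The union of the boxes in which a half twist is left. -/
def halfTwistBoxes (K : TwistDiagram) : Set Torus :=
  ⋃ i, {p | K.halfTwist i ≠ 0 ∧ p ∈ K.box i '' square}

end TwistDiagram

/-- `L` is a fully augmented link with fully augmented diagram coming from `K`: a homeomorphism `Φ`
of the thickened torus (for instance the end of an ambient isotopy) takes the augmentation of the
cellular diagram `K` to `L`. -/
structure IsFullyAugmentedLink (K : TwistDiagram) (Φ : ThickTorus ≃ₜ ThickTorus)
    (L : Set ThickTorus) : Prop where
  cellular : K.IsCellular
  image_eq : Φ '' K.augmentedLink = L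

/-!
The complement of a fully augmented link is cut along the projection torus, sliced along the halves
of the crossing disks, and flattened. The proof runs this process backwards: both torihedra are
copies of one cone `T² × [0, 1)`, and an explicit map folds the two copies together.

*The graph.* Each box of a twist region contains a hexagon, whose horizontal diameter is the slot
of the twist region. The strands of the link, once the crossings are removed, leave the hexagon at
four of its corners and follow the arcs of the diagram. Collapsing the strands and the slots to
points (`collapseSpine`) turns the six open sides of each hexagon into edges, and its two open
halves into triangles that share the vertex of the slot: these are the bow-ties. The collapse is a
self-map of the torus that is injective off the collapsed arcs, so by invariance of domain it is
open there (`isOpen_image_of_injOn`), and the complement of the graph consists of the triangles and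
of the image of the white region (`compl_graph_eq'`). The white faces are disks because the white
region is homeomorphic to the complement of the projection without its bigons (`regionMap`,
`isOpenDisk_white`), to which cellularity applies. A vertex of a slot has the four slanted sides of
its hexagon as edge ends, and a vertex of an arc has two edge ends at each end of the arc
(`card_ends_inl`, `card_ends_inr`), so the graph is 4-valent.

*The map.* On each side of the torus, `unfold` opens the slits: `lift` raises the hexagon onto the
disk bounded by the crossing circle, so that its two halves are folded together onto the upper or
the lower half of the disk, the slot goes to the crossing circle and the sides to the diameter, and
`slide` moves the points next to the hexagon together accordingly. A half twist is inserted by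
rotating one of the two parts into which the disk divides the box about the axis of the box, by a
half turn next to the disk that decreases to nothing at the end of the box (`twistAngle`). The jump
of the angle at the disk does no harm, because the torihedra are cut open there: it only moves the
triangle next to the rotated part to the opposite half disk, and `swap` records this. The map
`develop` of a torihedron first expands the ideal vertices to the collapsed arcs (`stretch`) and
then unfolds.

*The decomposition.* Off the crossing disks, `unfold` has the inverse `refold`, and the sign of the
height before the half twists are inserted tells the two torihedra apart, so interior points are
identified with no other points (`develop_interior_inj`). On the disks everything is explicit:
triangles go to open halves (`unfold_image_half`), edges to the intervals into which the two
strands cut the diameter (`unfold_image_rim`), and off the link nothing else is left of a disk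
(`disks_cases`). This gives surjectivity (`exists_develop_eq`) and the pairing of the faces
(`pairing`): white faces are glued by the identity, and the two triangles with the same half disk
to each other. At an ideal vertex `develop` does not extend continuously, but compactness of the
torus gives limits along ultrafilters, and these lie on the part of the link that was collapsed to
the vertex (`exists_tendsto_develop`). Hence the map is proper, and points that tend to an ideal
vertex tend to the link. A homeomorphism of the thickened torus carries the decomposition from the
augmented diagram to an equivalent link (`IsTorihedralDecomposition.comp_homeomorph`).
-/

/-! ### Invariance of domain on the torus -/

/-- A continuous map of the closed disk that moves boundary points by less than the radius has a
zero: otherwise it would have a continuous logarithm, and so would the inclusion of the unit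
circle. -/
theorem exists_eq_zero_of_norm_sub_lt {g : ℂ → ℂ} (hg : ContinuousOn g (Metric.closedBall 0 1))
    (h : ∀ x, ‖x‖ = 1 → ‖g x - x‖ < 1) : ∃ x ∈ Metric.closedBall (0 : ℂ) 1, g x = 0 := by
  by_contra! hne
  -- `r` is the retraction of the plane to the disk; `g ∘ r` has a logarithm `F` on the whole plane
  let r : ℂ → ℂ := fun x => ((max 1 ‖x‖ : ℝ) : ℂ)⁻¹ * x
  have hpos : ∀ x : ℂ, (0 : ℝ) < max 1 ‖x‖ := fun x => lt_max_of_lt_left one_pos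
  have hr : Continuous r := by
    refine Continuous.mul (Continuous.inv₀ (by fun_prop) fun x => ?_) continuous_id
    exact_mod_cast (hpos x).ne'
  have hrm : ∀ x, r x ∈ Metric.closedBall (0 : ℂ) 1 := by
    intro x
    rw [mem_closedBall_zero_iff, norm_mul, norm_inv, Complex.norm_real, Real.norm_eq_abs,
      abs_of_pos (hpos x), inv_mul_le_iff₀ (hpos x), mul_one]
    exact le_max_right _ _
  have hrid : ∀ x : ℂ, ‖x‖ = 1 → r x = x := by
    intro x hx
    simp [r, hx]
  have hgr : Continuous (g ∘ r) := hg.comp_continuous hr hrm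
  let f₁ : C(ℂ, {z : ℂ // z ≠ 0}) := ⟨fun x => ⟨g (r x), hne _ (hrm x)⟩, hgr.subtype_mk _⟩
  obtain ⟨F, ⟨-, hF⟩, -⟩ := Complex.isCoveringMap_exp.existsUnique_continuousMap_lifts f₁ 0
    (Complex.log (g (r 0))) (Subtype.ext (Complex.exp_log (hne _ (hrm 0))))
  have hF' : ∀ x, Complex.exp (F x) = g (r x) := fun x => congrArg Subtype.val (congrFun hF x)
  -- on the circle `g (e θ) / e θ` stays in the slit plane, so `F - log (g / id)` is a continuous
  -- logarithm of `e θ` that depends on the point `e θ` only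
  let e : ℝ → ℂ := fun θ => Complex.exp (θ * Complex.I)
  have he : Continuous e := by fun_prop
  have hen : ∀ θ, ‖e θ‖ = 1 := fun θ => Complex.norm_exp_ofReal_mul_I θ
  have he0 : ∀ θ, e θ ≠ 0 := fun θ => Complex.exp_ne_zero _
  have hq : ∀ θ, g (e θ) / e θ ∈ Complex.slitPlane := by
    intro θ
    have h1 : ‖g (e θ) / e θ - 1‖ < 1 := by
      rw [div_sub_one (he0 θ), norm_div, hen, div_one]
      exact h _ (hen θ)
    simpa using Complex.mem_slitPlane_of_norm_lt_one h1
  have hcq : Continuous fun θ => g (e θ) / e θ := by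
    refine Continuous.div ?_ he he0
    refine hg.comp_continuous he fun θ => ?_
    rw [mem_closedBall_zero_iff, hen]
  let A : ℝ → ℂ := fun θ => F (e θ) - Complex.log (g (e θ) / e θ)
  have hA : Continuous A := (F.continuous.comp he).sub (hcq.clog hq)
  let B : ℝ → ℂ := fun θ => θ * Complex.I + A 0
  have hB : Continuous B := by fun_prop
  have hAe : ∀ θ, Complex.exp (A θ) = e θ := by
    intro θ
    have h1 : g (e θ) ≠ 0 := hne _ (by rw [mem_closedBall_zero_iff, hen])
    rw [Complex.exp_sub, hF', hrid _ (hen θ), Complex.exp_log (div_ne_zero h1 (he0 θ))]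
    field_simp
  have hBe : ∀ θ, Complex.exp (B θ) = e θ := by
    intro θ
    rw [Complex.exp_add, hAe]
    simp [e]
  -- logarithms of a path are unique, so it is `θ * I` up to a constant, which is not periodic
  have hAB : A = B := Complex.isCoveringMap_exp.eq_of_comp_eq hA hB
    (funext fun θ => Subtype.ext ((hAe θ).trans (hBe θ).symm)) 0 (by simp [B])
  have h2 : e (2 * Real.pi) = e 0 := by
    simp [e, Complex.exp_two_pi_mul_I]
  have h3 : A (2 * Real.pi) = A 0 := by simp only [A, h2]
  rw [congrFun hAB (2 * Real.pi)] at h3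
  simp [B, Real.pi_ne_zero] at h3

/-- Invariance of domain in the plane. If the value at the centre of the disk were a boundary point
of the image, the inverse map could be perturbed to one without zeros; composed with the map itself
this is excluded by `exists_eq_zero_of_norm_sub_lt`. -/
theorem image_closedBall_mem_nhds {f : ℂ → ℂ} (hf : ContinuousOn f (Metric.closedBall 0 1))
    (hinj : InjOn f (Metric.closedBall 0 1)) : f '' Metric.closedBall 0 1 ∈ 𝓝 (f 0) := by
  set B := Metric.closedBall (0 : ℂ) 1 with hBdef
  have h0B : (0 : ℂ) ∈ B := by simp [B]
  have hBc : IsCompact B := isCompact_closedBall 0 1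
  have hKc : IsCompact (f '' B) := hBc.image_of_continuousOn hf
  -- the inverse of `f`, extended to the plane
  have hemb : IsClosedEmbedding (B.domRestrict f) := by
    have : CompactSpace B := isCompact_iff_compactSpace.1 hBc
    exact (continuousOn_iff_continuous_domRestrict.1 hf).isClosedEmbedding hinj.injective
  obtain ⟨G, hG⟩ := (⟨Subtype.val, continuous_subtype_val⟩ : C(B, ℂ)).exists_extension' hemb
  have hGf : ∀ x ∈ B, G (f x) = x := fun x hx => congrFun hG ⟨x, hx⟩
  by_contra hnot
  obtain ⟨ε, hε, hGε⟩ : ∃ ε > 0, ∀ y, dist y (f 0) < 2 * ε → ‖G y‖ < 1 / 10 := by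
    have h1 : Tendsto (fun y => ‖G y‖) (𝓝 (f 0)) (𝓝 0) := by
      have := (G.continuous.norm).tendsto (f 0)
      simpa [hGf 0 h0B] using this
    obtain ⟨δ, hδ, h2⟩ := Metric.eventually_nhds_iff.1
      (h1.eventually (gt_mem_nhds (by norm_num : (0 : ℝ) < 1 / 10)))
    exact ⟨δ / 2, half_pos hδ, fun y hy => h2 (by linarith)⟩
  -- a point off the image close to `f 0`
  obtain ⟨c, hc, hcK⟩ : ∃ c, dist c (f 0) < ε ∧ c ∉ f '' B := by
    by_contra! hcon
    exact hnot (Filter.mem_of_superset (Metric.ball_mem_nhds _ hε) fun c hc => hcon c hc)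
  have hsmall : ∀ y, dist y c ≤ ε → ‖G y‖ < 1 / 10 := fun y hy =>
    hGε y (by linarith [dist_triangle y c (f 0)])
  -- `G` has no zero on the part of the image away from `c`
  let S₁ := f '' B ∩ {y | ε ≤ dist y c}
  have hS₁ : IsCompact S₁ := hKc.inter_right (isClosed_le continuous_const (by fun_prop))
  obtain ⟨δ, hδ, hδG⟩ : ∃ δ > 0, ∀ y ∈ S₁, δ ≤ ‖G y‖ := by
    rcases S₁.eq_empty_or_nonempty with he | hne
    · exact ⟨1, one_pos, by simp [he]⟩
    · obtain ⟨y₀, hy₀, hmin⟩ := hS₁.exists_isMinOn hne (G.continuous.norm.continuousOn)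
      refine ⟨‖G y₀‖, ?_, fun y hy => hmin hy⟩
      refine norm_pos_iff.2 fun h0 => ?_
      obtain ⟨⟨x, hx, rfl⟩, hy₀'⟩ := hy₀
      rw [hGf x hx] at h0
      subst h0
      have : ε ≤ dist (f 0) c := hy₀'
      rw [dist_comm] at this
      linarith
  let η := min δ (1 / 10) / 2
  have hη : 0 < η := by positivity
  obtain ⟨P, hPd, hP, -⟩ := G.continuous.exists_contDiff_approx (n := 1) (ε := fun _ => η)
    continuous_const (fun _ => hη)
  -- a small shift of the smooth approximation misses the image of the circle around `c`
  have hnull : MeasureTheory.volume (P '' Metric.sphere c ε) = 0 :=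
    MeasureTheory.addHaar_image_eq_zero_of_differentiableOn_of_addHaar_eq_zero _
      ((hPd.differentiable (by simp)).differentiableOn) (MeasureTheory.Measure.addHaar_sphere _ _ _)
  obtain ⟨a, ha, haP⟩ : ∃ a ∈ Metric.ball (0 : ℂ) η, a ∉ P '' Metric.sphere c ε := by
    by_contra! hcon
    have : MeasureTheory.volume (Metric.ball (0 : ℂ) η) ≤ 0 :=
      hnull ▸ MeasureTheory.measure_mono hcon
    exact (Metric.measure_ball_pos MeasureTheory.volume _ hη).not_ge this
  have hclose : ∀ y, ‖G y - (P y - a)‖ < 2 * η := by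
    intro y
    have h1 : ‖P y - G y‖ < η := by simpa [dist_eq_norm] using hP y
    have h2 : ‖a‖ < η := by simpa using ha
    calc ‖G y - (P y - a)‖ = ‖-(P y - G y) + a‖ := by ring_nf
      _ ≤ ‖P y - G y‖ + ‖a‖ := (norm_add_le _ _).trans (by rw [norm_neg])
      _ < 2 * η := by linarith
  have hη1 : 2 * η ≤ δ := by
    have := min_le_left δ (1 / 10)
    simp only [η]; linarith
  have hη2 : 2 * η ≤ 1 / 10 := by
    have := min_le_right δ (1 / 10)
    simp only [η]; linarith
  -- push the image off the disk around `c`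
  let Φ : ℂ → ℂ := fun y => c + ((max (ε / dist y c) 1 : ℝ) : ℂ) * (y - c)
  have hne : ∀ x ∈ B, f x ≠ c := fun x hx he => hcK ⟨x, hx, he⟩
  have hΦfar : ∀ y, y ≠ c → ε ≤ dist y c → Φ y = y := by
    intro y hy hyc
    have : max (ε / dist y c) 1 = 1 := max_eq_right ((div_le_one (dist_pos.2 hy)).2 hyc)
    simp [Φ, this]
  have hΦnear : ∀ y, y ≠ c → dist y c ≤ ε → dist (Φ y) c = ε := by
    intro y hy hyc
    have hpos := dist_pos.2 hy
    have : max (ε / dist y c) 1 = ε / dist y c := max_eq_left ((one_le_div hpos).2 hyc)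
    simp only [Φ, this]
    rw [dist_eq_norm, add_sub_cancel_left, norm_mul, Complex.norm_real, ← dist_eq_norm,
      Real.norm_of_nonneg (by positivity), div_mul_cancel₀ _ hpos.ne']
  obtain ⟨x, hx, hx0⟩ := exists_eq_zero_of_norm_sub_lt (g := fun x => P (Φ (f x)) - a) (by
      have hd : ContinuousOn (fun x => ε / dist (f x) c) B :=
        continuousOn_const.div (by fun_prop) fun x hx => (dist_pos.2 (hne x hx)).ne'
      have hΦc : ContinuousOn (fun x => Φ (f x)) B := by
        refine continuousOn_const.add (ContinuousOn.mul ?_ (hf.sub continuousOn_const))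
        exact Complex.continuous_ofReal.comp_continuousOn (hd.sup continuousOn_const)
      exact (hPd.continuous.comp_continuousOn hΦc).sub continuousOn_const) (by
      intro x hx
      have hxB : x ∈ B := by simp [B, hx]
      rcases le_total ε (dist (f x) c) with hd | hd
      · rw [hΦfar _ (hne x hxB) hd, norm_sub_rev]
        have := hclose (f x)
        rw [hGf x hxB] at this
        linarith
      · have h1 := hsmall _ hd
        rw [hGf x hxB] at h1
        linarith)
  rcases le_total ε (dist (f x) c) with hd | hd
  · have h1 := hclose (f x)
    simp only [hΦfar _ (hne x hx) hd] at hx0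
    rw [hx0, sub_zero] at h1
    exact absurd (hδG (f x) ⟨⟨x, hx, rfl⟩, hd⟩) (by linarith)
  · exact haP ⟨Φ (f x), hΦnear _ (hne x hx) hd, sub_eq_zero.1 hx0⟩

/-- The universal covering of the torus. -/
noncomputable def torusProj (u : ℝ × ℝ) : Torus := ((u.1 : UnitAddCircle), (u.2 : UnitAddCircle))

theorem exists_openPartialHomeomorph_torusProj (u : ℝ × ℝ) :
    ∃ e : OpenPartialHomeomorph (ℝ × ℝ) Torus, u ∈ e.source ∧ ∀ v, e v = torusProj v := by
  obtain ⟨e₁, h₁, h₁'⟩ := AddCircle.isLocalHomeomorph_coe (1 : ℝ) u.1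
  obtain ⟨e₂, h₂, h₂'⟩ := AddCircle.isLocalHomeomorph_coe (1 : ℝ) u.2
  refine ⟨e₁.prod e₂, ⟨h₁, h₂⟩, fun v => ?_⟩
  exact Prod.ext (congrFun h₁'.symm _) (congrFun h₂'.symm _)

theorem torusProj_surjective : Function.Surjective torusProj := by
  rintro ⟨a, b⟩
  obtain ⟨x, rfl⟩ := QuotientAddGroup.mk_surjective a
  obtain ⟨y, rfl⟩ := QuotientAddGroup.mk_surjective b
  exact ⟨(x, y), rfl⟩

/-- Invariance of domain for maps from the plane to the torus. -/
theorem isOpen_image_of_injOn_plane {U : Set (ℝ × ℝ)} (hU : IsOpen U) {g : ℝ × ℝ → Torus}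
    (hg : ContinuousOn g U) (hinj : InjOn g U) : IsOpen (g '' U) := by
  rw [isOpen_iff_mem_nhds]
  rintro _ ⟨u, hu, rfl⟩
  obtain ⟨w, hw⟩ := torusProj_surjective (g u)
  obtain ⟨e, hew, he⟩ := exists_openPartialHomeomorph_torusProj w
  have hgt : g u ∈ e.target := by rw [← hw, ← he]; exact e.map_source hew
  -- in suitable coordinates, the closed unit disk is mapped to a chart of the torus
  let c := Complex.equivRealProdCLM
  obtain ⟨r, hr, hball⟩ : ∃ r : ℝ, 0 < r ∧ ∀ z : ℂ, ‖z‖ ≤ 1 → u + r • c z ∈ U ∩ g ⁻¹' e.target := by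
    have h1 : U ∩ g ⁻¹' e.target ∈ 𝓝 u :=
      (hg.isOpen_inter_preimage hU e.open_target).mem_nhds ⟨hu, hgt⟩
    have h2 : Tendsto (fun z : ℂ => u + c z) (𝓝 0) (𝓝 u) := by
      have : Continuous fun z : ℂ => u + c z := by fun_prop
      simpa using this.tendsto 0
    obtain ⟨r, hr, h3⟩ := Metric.eventually_nhds_iff.1 (h2 h1)
    refine ⟨r / 2, half_pos hr, fun z hz => ?_⟩
    rw [← map_smul]
    refine h3 ?_
    rw [dist_zero_right, norm_smul, Real.norm_eq_abs, abs_of_pos (half_pos hr)]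
    nlinarith
  let f : ℂ → ℂ := fun z => c.symm (e.symm (g (u + r • c z)))
  have hmap : ∀ z ∈ Metric.closedBall (0 : ℂ) 1, u + r • c z ∈ U ∩ g ⁻¹' e.target := fun z hz =>
    hball z (by simpa using hz)
  have hf : ContinuousOn f (Metric.closedBall 0 1) := by
    refine c.symm.continuous.comp_continuousOn (e.continuousOn_symm.comp
      (hg.comp (by fun_prop) fun z hz => (hmap z hz).1) fun z hz => (hmap z hz).2)
  have hfi : InjOn f (Metric.closedBall 0 1) := by
    intro z hz z' hz' h
    have h1 := hinj (hmap z hz).1 (hmap z' hz').1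
      (e.symm.injOn (hmap z hz).2 (hmap z' hz').2 (c.symm.injective h))
    exact c.injective (smul_right_injective _ hr.ne' (add_left_cancel h1))
  have h1 := image_closedBall_mem_nhds hf hfi
  have h2 : f 0 = c.symm (e.symm (g u)) := by simp [f]
  have h3 : Tendsto (fun p => c.symm (e.symm p)) (𝓝 (g u)) (𝓝 (f 0)) := by
    rw [h2]
    exact (c.symm.continuous.tendsto _).comp (e.symm.continuousAt hgt)
  filter_upwards [h3 h1, e.open_target.mem_nhds hgt] with p hp hpt
  obtain ⟨z, hz, hzp⟩ := hp
  refine ⟨_, (hmap z hz).1, ?_⟩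
  exact e.symm.injOn (hmap z hz).2 hpt (c.symm.injective hzp)

/-- Invariance of domain on the torus. -/
theorem isOpen_image_of_injOn {U : Set Torus} (hU : IsOpen U) {g : Torus → Torus}
    (hg : ContinuousOn g U) (hinj : InjOn g U) : IsOpen (g '' U) := by
  rw [isOpen_iff_mem_nhds]
  rintro _ ⟨p, hp, rfl⟩
  obtain ⟨w, rfl⟩ := torusProj_surjective p
  obtain ⟨e, hew, he⟩ := exists_openPartialHomeomorph_torusProj w
  have hmaps : MapsTo e (e.source ∩ e ⁻¹' U) U := fun x hx => hx.2
  have h1 : IsOpen ((g ∘ e) '' (e.source ∩ e ⁻¹' U)) :=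
    isOpen_image_of_injOn_plane (e.continuousOn.isOpen_inter_preimage e.open_source hU)
      (hg.comp (e.continuousOn.mono inter_subset_left) hmaps)
      (hinj.comp (e.injOn.mono inter_subset_left) hmaps)
  refine Filter.mem_of_superset (h1.mem_nhds ⟨w, ⟨hew, ?_⟩, by simp [he]⟩) ?_
  · simpa [he] using hp
  · rintro _ ⟨x, hx, rfl⟩
    exact ⟨e x, hx.2, rfl⟩

/-! ### Modifying maps inside disjoint embedded squares -/

/-- The interior of the coordinate square. -/
def openSquare : Set (ℝ × ℝ) := Ioo (-1) 1 ×ˢ Ioo (-1) 1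

theorem isOpen_openSquare : IsOpen openSquare := isOpen_Ioo.prod isOpen_Ioo

theorem openSquare_subset : openSquare ⊆ square := prod_mono Ioo_subset_Icc_self Ioo_subset_Icc_self

theorem isCompact_square : IsCompact square := isCompact_Icc.prod isCompact_Icc

theorem mem_square {u : ℝ × ℝ} : u ∈ square ↔ |u.1| ≤ 1 ∧ |u.2| ≤ 1 := by
  simp only [square, mem_prod, mem_Icc, abs_le]

theorem mem_openSquare {u : ℝ × ℝ} : u ∈ openSquare ↔ |u.1| < 1 ∧ |u.2| < 1 := by
  simp only [openSquare, mem_prod, mem_Ioo, abs_lt]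

theorem abs_eq_one_of_mem_diff {u : ℝ × ℝ} (hu : u ∈ square \ openSquare) :
    |u.1| = 1 ∨ |u.2| = 1 := by
  have h1 := mem_square.1 hu.1
  by_contra! h
  exact hu.2 (mem_openSquare.2 ⟨lt_of_le_of_ne h1.1 h.1, lt_of_le_of_ne h1.2 h.2⟩)

/-- A finite family of disjoint embedded closed squares on the torus. -/
structure IsSquareFamily {J : Type} (β : J → ℝ × ℝ → Torus) : Prop where
  finite : Finite J
  cont : ∀ j, ContinuousOn (β j) square
  inj : ∀ i j, ∀ u ∈ square, ∀ v ∈ square, β i u = β j v → i = j ∧ u = v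

/-- The map that is given by `g j` in the coordinates of the `j`-th square, and by `g₀` outside the
squares. -/
noncomputable def patch {J Y : Type} (β : J → ℝ × ℝ → Torus) (g : J → ℝ × ℝ → Y) (g₀ : Torus → Y)
    (p : Torus) : Y :=
  open Classical in
  if h : ∃ j u, u ∈ square ∧ β j u = p then g h.choose h.choose_spec.choose else g₀ p

namespace IsSquareFamily

variable {J Y Z : Type} {β : J → ℝ × ℝ → Torus} (hβ : IsSquareFamily β)

include hβ

theorem injOn (j : J) : InjOn (β j) square := fun u hu v hv h => (hβ.inj j j u hu v hv h).2

theorem patch_apply (g : J → ℝ × ℝ → Y) (g₀ : Torus → Y) (j : J) {u : ℝ × ℝ} (hu : u ∈ square) :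
    patch β g g₀ (β j u) = g j u := by
  have h : ∃ j' u', u' ∈ square ∧ β j' u' = β j u := ⟨j, u, hu, rfl⟩
  have h1 := h.choose_spec.choose_spec
  obtain ⟨h2, h3⟩ := hβ.inj _ _ _ h1.1 _ hu h1.2
  rw [patch, dif_pos h, h3, h2]

omit hβ in
theorem patch_of_notMem (g : J → ℝ × ℝ → Y) (g₀ : Torus → Y) {p : Torus}
    (hp : ∀ j, p ∉ β j '' square) : patch β g g₀ p = g₀ p := by
  rw [patch, dif_neg]
  rintro ⟨j, u, hu, h⟩
  exact hp j ⟨u, hu, h⟩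

omit hβ in
theorem mem_square_or (β : J → ℝ × ℝ → Torus) (p : Torus) :
    (∃ j, ∃ u ∈ square, β j u = p) ∨ ∀ j, p ∉ β j '' square := by
  by_cases h : ∃ j, ∃ u ∈ square, β j u = p
  · exact Or.inl h
  · exact Or.inr fun j ⟨u, hu, hp⟩ => h ⟨j, u, hu, hp⟩

theorem isOpen_image (j : J) {U : Set (ℝ × ℝ)} (hU : IsOpen U) (hs : U ⊆ square) :
    IsOpen (β j '' U) :=
  isOpen_image_of_injOn_plane hU ((hβ.cont j).mono hs) ((hβ.injOn j).mono hs)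

theorem isClosed_image (j : J) {A : Set (ℝ × ℝ)} (hA : IsClosed A) (hs : A ⊆ square) :
    IsClosed (β j '' A) :=
  ((isCompact_square.of_isClosed_subset hA hs).image_of_continuousOn
    ((hβ.cont j).mono hs)).isClosed

theorem continuousOn_invFunOn (j : J) :
    ContinuousOn (Function.invFunOn (β j) square) (β j '' square) := by
  rw [continuousOn_iff_isClosed]
  intro A hA
  refine ⟨β j '' (A ∩ square),
    hβ.isClosed_image j (hA.inter isCompact_square.isClosed) inter_subset_right, ?_⟩
  ext p
  constructor
  · rintro ⟨hp, u, hu, rfl⟩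
    rw [mem_preimage, (hβ.injOn j).leftInvOn_invFunOn hu] at hp
    exact ⟨⟨u, ⟨hp, hu⟩, rfl⟩, u, hu, rfl⟩
  · rintro ⟨⟨u, hu, rfl⟩, -⟩
    refine ⟨?_, u, hu.2, rfl⟩
    rw [mem_preimage, (hβ.injOn j).leftInvOn_invFunOn hu.2]
    exact hu.1

/-- Continuity on a closed square can be checked in its coordinates. -/
theorem continuousOn_of_comp [TopologicalSpace Y] [TopologicalSpace Z] (j : J) {h : Torus × Z → Y}
    {E : Set (Torus × Z)}
    (hh : ContinuousOn (fun q : (ℝ × ℝ) × Z => h (β j q.1, q.2))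
      {q | q.1 ∈ square ∧ (β j q.1, q.2) ∈ E}) :
    ContinuousOn h (E ∩ {q | q.1 ∈ β j '' square}) := by
  have h1 : ∀ p ∈ β j '' square, Function.invFunOn (β j) square p ∈ square ∧
      β j (Function.invFunOn (β j) square p) = p := by
    intro p hp
    exact ⟨Function.invFunOn_mem hp, Function.invFunOn_eq hp⟩
  have h2 : ContinuousOn (fun q : Torus × Z => (Function.invFunOn (β j) square q.1, q.2))
      (E ∩ {q | q.1 ∈ β j '' square}) :=
    ((hβ.continuousOn_invFunOn j).comp continuousOn_fst fun q hq => hq.2).prodMk continuousOn_snd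
  refine (hh.comp h2 ?_).congr ?_
  · rintro ⟨p, z⟩ ⟨hE, hp⟩
    refine ⟨(h1 p hp).1, ?_⟩
    rw [(h1 p hp).2]
    exact hE
  · rintro ⟨p, z⟩ ⟨hE, hp⟩
    simp only [Function.comp_apply]
    rw [(h1 p hp).2]

/-- The gluing lemma: a map given on the squares and outside them is continuous if the pieces agree
on the boundaries of the squares. That the boundary of the coordinate square contains the frontier
of the embedded square is invariance of domain. -/
theorem continuousOn_patch [TopologicalSpace Y] [TopologicalSpace Z] {E : Set (Torus × Z)}
    {g : J → ℝ × ℝ → Z → Y} {g₀ : Torus → Z → Y}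
    (hg : ∀ j, ContinuousOn (fun q : (ℝ × ℝ) × Z => g j q.1 q.2)
      {q | q.1 ∈ square ∧ (β j q.1, q.2) ∈ E})
    (h₀ : ContinuousOn (fun q : Torus × Z => g₀ q.1 q.2) E)
    (hb : ∀ j u z, u ∈ square \ openSquare → (β j u, z) ∈ E → g j u z = g₀ (β j u) z) :
    ContinuousOn (fun q : Torus × Z => patch β (fun j u => g j u q.2) (fun p => g₀ p q.2) q.1)
      E := by
  have := hβ.finite
  set h := fun q : Torus × Z => patch β (fun j u => g j u q.2) (fun p => g₀ p q.2) q.1 with hh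
  -- the closed squares and the complement `O` of the open squares are a finite closed cover
  let O : Set Torus := (⋃ j, β j '' openSquare)ᶜ
  have hO : IsClosed O := (isOpen_iUnion fun j =>
    hβ.isOpen_image j isOpen_openSquare openSquare_subset).isClosed_compl
  have hout : ContinuousOn h (E ∩ {q | q.1 ∈ O}) := by
    refine (h₀.mono inter_subset_left).congr ?_
    rintro ⟨p, z⟩ ⟨hE, hp⟩
    rcases mem_square_or β p with ⟨j, u, hu, rfl⟩ | hn
    · rw [hh]
      simp only
      rw [hβ.patch_apply _ _ j hu]
      refine hb j u z ⟨hu, fun hu' => hp (mem_iUnion.2 ⟨j, u, hu', rfl⟩)⟩ hE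
    · exact patch_of_notMem _ _ hn
  have hin : ∀ j, ContinuousOn h (E ∩ {q | q.1 ∈ β j '' square}) := by
    intro j
    refine hβ.continuousOn_of_comp j ((hg j).congr ?_)
    rintro ⟨u, z⟩ ⟨hu, -⟩
    exact hβ.patch_apply _ _ j hu
  let C : Option J → Set (Torus × Z) := fun a => a.elim {q | q.1 ∈ O} fun j =>
    {q | q.1 ∈ β j '' square}
  have hC : ∀ a, IsClosed (C a) := by
    rintro (_ | j)
    · exact hO.preimage continuous_fst
    · exact (hβ.isClosed_image j isCompact_square.isClosed subset_rfl).preimage continuous_fst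
  have hCc : ∀ a, ContinuousOn h (E ∩ C a) := by
    rintro (_ | j)
    · exact hout
    · exact hin j
  rw [continuousOn_iff_continuous_domRestrict]
  refine (locallyFinite_of_finite fun a => (Subtype.val ⁻¹' C a : Set E)).continuous ?_
    (fun a => (hC a).preimage continuous_subtype_val) fun a => ?_
  · refine eq_univ_of_forall fun x => mem_iUnion.2 ?_
    by_cases hx : x.1.1 ∈ O
    · exact ⟨none, hx⟩
    · rw [mem_compl_iff, not_not, mem_iUnion] at hx
      obtain ⟨j, hj⟩ := hx
      exact ⟨some j, image_mono openSquare_subset hj⟩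
  · exact (hCc a).comp continuous_subtype_val.continuousOn fun x hx => ⟨x.2, hx⟩

end IsSquareFamily

/-! ### Collapsing arcs to points -/

/-- For `0 < τ`, an increasing bijection of `[-1,1]`, equal to the identity for `τ = 1`. As `τ`
tends to `0`, it expands smaller and smaller neighbourhoods of `0` to `[-3/4,3/4]`. -/
noncomputable def pull (s τ : ℝ) : ℝ := s / 4 + 3 / 4 * (s / max |s| τ)

/-- The inverse of `pull · τ` on `[-1,1]`; for `τ = 0` it takes `[-3/4,3/4]` to `0`. -/
noncomputable def push (s τ : ℝ) : ℝ := 4 * s - 3 * max (-1) (min 1 (4 * s / (τ + 3)))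

theorem pull_neg (s τ : ℝ) : pull (-s) τ = -pull s τ := by
  simp only [pull, abs_neg]; ring

theorem push_neg (s τ : ℝ) : push (-s) τ = -push s τ := by
  have h : 4 * -s / (τ + 3) = -(4 * s / (τ + 3)) := by ring
  simp only [push, h]
  generalize 4 * s / (τ + 3) = a
  grind

theorem pull_of_le {s τ : ℝ} (hs : 0 ≤ s) (h : s ≤ τ) : pull s τ = s / 4 + 3 / 4 * (s / τ) := by
  rw [pull, abs_of_nonneg hs, max_eq_right h]

theorem pull_of_ge {s τ : ℝ} (hs : 0 < s) (h : τ ≤ s) : pull s τ = s / 4 + 3 / 4 := by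
  rw [pull, abs_of_pos hs, max_eq_left h, div_self hs.ne']; ring

theorem push_of_le {s τ : ℝ} (hτ : 0 ≤ τ) (hs : 0 ≤ s) (h : 4 * s ≤ τ + 3) :
    push s τ = 4 * s * τ / (τ + 3) := by
  have h3 : 0 < τ + 3 := by linarith
  rw [push, min_eq_right ((div_le_one h3).2 h), max_eq_right]
  · field_simp; ring
  · have : 0 ≤ 4 * s / (τ + 3) := by positivity
    linarith

theorem push_of_ge {s τ : ℝ} (hτ : 0 ≤ τ) (h : τ + 3 ≤ 4 * s) : push s τ = 4 * s - 3 := by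
  have h3 : 0 < τ + 3 := by linarith
  rw [push, min_eq_left ((one_le_div h3).2 h), max_eq_right (by norm_num)]; ring

/-- Odd functions: a property invariant under `s ↦ -s` only needs to be checked for `0 ≤ s`. -/
theorem forall_of_nonneg {P : ℝ → Prop} (hneg : ∀ s, P (-s) → P s) (h : ∀ s, 0 ≤ s → P s) (s : ℝ) :
    P s := by
  rcases le_total 0 s with hs | hs
  · exact h s hs
  · exact hneg s (h _ (by linarith))

/-- `pull` and `push` are inverse to each other, apart from `τ = 0`, where `pull` is not continuous
at `0` and `push` takes `[-3/4,3/4]` to `0`. -/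
theorem push_pull {s τ : ℝ} (hτ : 0 ≤ τ) (h : 0 < τ ∨ s ≠ 0) :
    push (pull s τ) τ = s := by
  revert h
  refine forall_of_nonneg (P := fun s => (0 < τ ∨ s ≠ 0) → push (pull s τ) τ = s) ?_ ?_ s
  · intro s hs h
    have := hs (by simpa using h)
    rwa [pull_neg, push_neg, neg_inj] at this
  intro s hs h
  rcases le_total s τ with hsτ | hsτ
  · have hτ0 : 0 < τ := by
      rcases h with h | h
      · exact h
      · exact (lt_of_le_of_ne hs h.symm).trans_le hsτ
    rw [pull_of_le hs hsτ, push_of_le hτ (by positivity)]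
    · field_simp
    · have : s / τ ≤ 1 := (div_le_one hτ0).2 hsτ
      linarith
  · have hs0 : 0 < s := by
      rcases h with h | h
      · linarith
      · exact lt_of_le_of_ne hs h.symm
    rw [pull_of_ge hs0 hsτ, push_of_ge hτ (by linarith)]
    ring

theorem pull_push {s τ : ℝ} (hτ : 0 ≤ τ) (h : 0 < τ ∨ 3 / 4 < |s|) :
    pull (push s τ) τ = s := by
  revert h
  refine forall_of_nonneg (P := fun s => (0 < τ ∨ 3 / 4 < |s|) → pull (push s τ) τ = s) ?_ ?_ s
  · intro s hs h
    have := hs (by simpa using h)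
    rwa [push_neg, pull_neg, neg_inj] at this
  intro s hs h
  rw [abs_of_nonneg hs] at h
  rcases le_total (4 * s) (τ + 3) with hsτ | hsτ
  · have hτ0 : 0 < τ := by
      rcases h with h | h
      · exact h
      · linarith
    rw [push_of_le hτ hs hsτ, pull_of_le (by positivity)]
    · field_simp
    · rw [div_le_iff₀ (by positivity)]; nlinarith
  · rw [push_of_ge hτ hsτ, pull_of_ge _ (by linarith)]
    · ring
    · rcases h with h | h <;> linarith

theorem abs_pull_le {s τ : ℝ} (hs : |s| ≤ 1) : |pull s τ| ≤ 1 := by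
  have h : |s / max |s| τ| ≤ 1 := by
    rw [abs_div]
    refine div_le_one_of_le₀ ?_ (abs_nonneg _)
    exact (le_max_left _ _).trans (le_abs_self _)
  rw [abs_le] at *
  constructor <;> simp only [pull] <;> linarith

theorem abs_push_le {s τ : ℝ} (hτ : 0 ≤ τ) (hτ1 : τ ≤ 1) (hs : |s| ≤ 1) : |push s τ| ≤ 1 := by
  revert hs
  refine forall_of_nonneg (P := fun s => |s| ≤ 1 → |push s τ| ≤ 1) ?_ ?_ s
  · intro s hs h
    have := hs (by simpa using h)
    rwa [push_neg, abs_neg] at this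
  intro s hs h
  rw [abs_of_nonneg hs] at h
  rcases le_total (4 * s) (τ + 3) with hsτ | hsτ
  · rw [push_of_le hτ hs hsτ, abs_of_nonneg (by positivity), div_le_iff₀ (by positivity)]
    nlinarith
  · rw [push_of_ge hτ hsτ, abs_of_nonneg (by linarith)]
    linarith

theorem pull_one {s : ℝ} (hs : |s| ≤ 1) : pull s 1 = s := by
  rw [pull, max_eq_right hs]; ring

theorem push_one {s : ℝ} (hs : |s| ≤ 1) : push s 1 = s := by
  simpa only [pull_one hs] using push_pull (s := s) zero_le_one (Or.inl one_pos)

theorem pull_of_abs_eq_one {s τ : ℝ} (hτ1 : τ ≤ 1) (hs : |s| = 1) : pull s τ = s := by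
  rw [pull, hs, max_eq_left hτ1]; ring

theorem push_of_abs_eq_one {s τ : ℝ} (hτ : 0 ≤ τ) (hτ1 : τ ≤ 1) (hs : |s| = 1) :
    push s τ = s := by
  have := push_pull (s := s) hτ (Or.inr (by rintro rfl; simp at hs))
  rwa [pull_of_abs_eq_one hτ1 hs] at this

theorem lt_abs_pull_zero {s : ℝ} (hs : s ≠ 0) : 3 / 4 < |pull s 0| := by
  revert hs
  refine forall_of_nonneg (P := fun s => s ≠ 0 → 3 / 4 < |pull s 0|) ?_ ?_ s
  · intro s hs h
    have := hs (by simpa using h)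
    rwa [pull_neg, abs_neg] at this
  intro s hs h
  have hs0 := lt_of_le_of_ne hs h.symm
  rw [pull_of_ge hs0 hs, abs_of_pos (by linarith)]
  linarith

theorem push_zero_eq_zero_iff {s : ℝ} : push s 0 = 0 ↔ |s| ≤ 3 / 4 := by
  refine forall_of_nonneg (P := fun s => push s 0 = 0 ↔ |s| ≤ 3 / 4) ?_ ?_ s
  · intro s hs
    rwa [push_neg, abs_neg, neg_eq_zero] at hs
  intro s hs
  rw [abs_of_nonneg hs]
  rcases le_total (4 * s) (0 + 3) with h | h
  · rw [push_of_le le_rfl hs h]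
    constructor
    · intro; linarith
    · intro; simp
  · rw [push_of_ge le_rfl h]
    constructor <;> intro h' <;> linarith

/-- The parameter of `pull` and `push` at height `z` over a square, as a function of the distance
from the seam. -/
noncomputable def seamDist (x z : ℝ) : ℝ := min 1 (|x| + z)

theorem seamDist_le (x z : ℝ) : seamDist x z ≤ 1 := min_le_left _ _

theorem seamDist_nonneg {x z : ℝ} (hz : 0 ≤ z) : 0 ≤ seamDist x z :=
  le_min zero_le_one (by positivity)

theorem seamDist_pos {x z : ℝ} (hz : 0 ≤ z) (h : ¬ (x = 0 ∧ z = 0)) : 0 < seamDist x z := by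
  refine lt_min one_pos ?_
  by_contra! h'
  have := abs_nonneg x
  exact h ⟨abs_eq_zero.1 (by linarith), by linarith⟩

/-- The arc `{0} × [-3/4,3/4]` in the `j`-th square. -/
def seam {J : Type} (β : J → ℝ × ℝ → Torus) (j : J) : Set Torus :=
  β j '' {u | u.1 = 0 ∧ |u.2| ≤ 3 / 4}

/-- The centre of the `j`-th square, to which the seam is collapsed. -/
def node {J : Type} (β : J → ℝ × ℝ → Torus) (j : J) : Torus := β j (0, 0)

/-- The map that collapses the seams to the nodes at height `z = 0`, and tends to do so as `z`
tends to `0`. -/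
noncomputable def collapse {J : Type} (β : J → ℝ × ℝ → Torus) (z : ℝ) (p : Torus) : Torus :=
  patch β (fun j u => β j (u.1, push u.2 (seamDist u.1 z))) id p

/-- The inverse of `collapse`, which expands the nodes to the seams. -/
noncomputable def stretch {J : Type} (β : J → ℝ × ℝ → Torus) (z : ℝ) (p : Torus) : Torus :=
  patch β (fun j u => β j (u.1, pull u.2 (seamDist u.1 z))) id p

namespace IsSquareFamily

variable {J : Type} {β : J → ℝ × ℝ → Torus} (hβ : IsSquareFamily β)

include hβ

theorem collapse_apply (z : ℝ) (j : J) {u : ℝ × ℝ} (hu : u ∈ square) :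
    collapse β z (β j u) = β j (u.1, push u.2 (seamDist u.1 z)) := hβ.patch_apply _ _ j hu

theorem stretch_apply (z : ℝ) (j : J) {u : ℝ × ℝ} (hu : u ∈ square) :
    stretch β z (β j u) = β j (u.1, pull u.2 (seamDist u.1 z)) := hβ.patch_apply _ _ j hu

omit hβ in
theorem collapse_of_notMem (z : ℝ) {p : Torus} (hp : ∀ j, p ∉ β j '' square) :
    collapse β z p = p := patch_of_notMem _ _ hp

omit hβ in
theorem stretch_of_notMem (z : ℝ) {p : Torus} (hp : ∀ j, p ∉ β j '' square) :
    stretch β z p = p := patch_of_notMem _ _ hp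

omit hβ in
theorem push_mem {u : ℝ × ℝ} {z : ℝ} (hz : 0 ≤ z) (hu : u ∈ square) :
    (u.1, push u.2 (seamDist u.1 z)) ∈ square := by
  rw [mem_square] at *
  exact ⟨hu.1, abs_push_le (seamDist_nonneg hz) (seamDist_le _ _) hu.2⟩

omit hβ in
theorem pull_mem {u : ℝ × ℝ} {z : ℝ} (hu : u ∈ square) :
    (u.1, pull u.2 (seamDist u.1 z)) ∈ square := by
  rw [mem_square] at *
  exact ⟨hu.1, abs_pull_le hu.2⟩

theorem collapse_stretch {z : ℝ} (hz : 0 ≤ z) {p : Torus} (h : ¬ (p ∈ range (node β) ∧ z = 0)) :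
    collapse β z (stretch β z p) = p := by
  rcases mem_square_or β p with ⟨j, u, hu, rfl⟩ | hn
  · rw [hβ.stretch_apply z j hu, hβ.collapse_apply z j (pull_mem hu), push_pull
      (seamDist_nonneg hz)]
    by_contra! h'
    have h1 : u.1 = 0 ∧ z = 0 := by
      by_contra hc
      exact h'.1.not_gt (seamDist_pos hz hc)
    exact h ⟨⟨j, by rw [node, show u = (0, 0) from Prod.ext h1.1 h'.2]⟩, h1.2⟩
  · rw [stretch_of_notMem z hn, collapse_of_notMem z hn]

theorem stretch_collapse {z : ℝ} (hz : 0 ≤ z) {p : Torus} (h : ¬ (p ∈ ⋃ j, seam β j ∧ z = 0)) :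
    stretch β z (collapse β z p) = p := by
  rcases mem_square_or β p with ⟨j, u, hu, rfl⟩ | hn
  · rw [hβ.collapse_apply z j hu, hβ.stretch_apply z j (push_mem hz hu), pull_push
      (seamDist_nonneg hz)]
    by_contra! h'
    have h1 : u.1 = 0 ∧ z = 0 := by
      by_contra hc
      exact h'.1.not_gt (seamDist_pos hz hc)
    exact h ⟨mem_iUnion.2 ⟨j, u, ⟨h1.1, h'.2⟩, rfl⟩, h1.2⟩
  · rw [collapse_of_notMem z hn, stretch_of_notMem z hn]

theorem stretch_notMem_seam {p : Torus} (hp : p ∉ range (node β)) :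
    stretch β 0 p ∉ ⋃ j, seam β j := by
  intro hmem
  obtain ⟨i, v, ⟨hv1, hv2⟩, hv⟩ := mem_iUnion.1 hmem
  have hvs : v ∈ square := mem_square.2 ⟨by simp [hv1], by linarith⟩
  rcases mem_square_or β p with ⟨j, u, hu, rfl⟩ | hn
  · rw [hβ.stretch_apply 0 j hu] at hv
    obtain ⟨-, rfl⟩ := hβ.inj _ _ _ hvs _ (pull_mem hu) hv
    simp only at hv1 hv2
    have h2 : u.2 ≠ 0 := fun h2 => hp ⟨j, by rw [node, show u = (0, 0) from Prod.ext hv1 h2]⟩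
    rw [hv1, show seamDist 0 0 = 0 by simp [seamDist]] at hv2
    exact hv2.not_gt (lt_abs_pull_zero h2)
  · rw [stretch_of_notMem 0 hn] at hv
    exact hn i ⟨v, hvs, hv⟩

theorem collapse_eq_node_iff {p : Torus} (j : J) : collapse β 0 p = node β j ↔ p ∈ seam β j := by
  have h0 : ((0, 0) : ℝ × ℝ) ∈ square := by simp [mem_square]
  constructor
  · intro h
    rcases mem_square_or β p with ⟨i, u, hu, rfl⟩ | hn
    · rw [hβ.collapse_apply 0 i hu] at h
      obtain ⟨rfl, h'⟩ := hβ.inj _ _ _ (push_mem le_rfl hu) _ h0 h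
      obtain ⟨h1, h2⟩ := Prod.mk.inj h'
      rw [h1, show seamDist 0 0 = 0 by simp [seamDist], push_zero_eq_zero_iff] at h2
      exact ⟨u, ⟨h1, h2⟩, rfl⟩
    · rw [collapse_of_notMem 0 hn] at h
      exact absurd ⟨_, h0, h.symm⟩ (hn j)
  · rintro ⟨u, ⟨h1, h2⟩, rfl⟩
    have hu : u ∈ square := mem_square.2 ⟨by simp [h1], by linarith⟩
    rw [hβ.collapse_apply 0 j hu, h1, show seamDist 0 0 = 0 by simp [seamDist],
      push_zero_eq_zero_iff.2 h2, node]

theorem collapse_notMem_range_node {p : Torus} (hp : p ∉ ⋃ j, seam β j) :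
    collapse β 0 p ∉ range (node β) := by
  rintro ⟨j, hj⟩
  exact hp (mem_iUnion.2 ⟨j, (hβ.collapse_eq_node_iff j).1 hj.symm⟩)

theorem node_injective : Function.Injective (node β) := fun i j h =>
  (hβ.inj i j _ (by simp [mem_square]) _ (by simp [mem_square]) h).1

/-- The collapse is continuous down to height `0`. -/
theorem continuousOn_collapse :
    ContinuousOn (fun q : Torus × ℝ => collapse β q.2 q.1) {q | 0 ≤ q.2} := by
  refine hβ.continuousOn_patch (g := fun j u z => β j (u.1, push u.2 (seamDist u.1 z)))
    (g₀ := fun p _ => p) (fun j => ?_) continuousOn_fst ?_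
  · refine (hβ.cont j).comp ?_ fun q hq => push_mem hq.2 hq.1
    refine (continuous_fst.comp continuous_fst).continuousOn.prodMk ?_
    have h3 : ∀ q : (ℝ × ℝ) × ℝ, q ∈ {q : (ℝ × ℝ) × ℝ | q.1 ∈ square ∧ (β j q.1, q.2) ∈
        {q : Torus × ℝ | 0 ≤ q.2}} → seamDist q.1.1 q.2 + 3 ≠ 0 := fun q hq => by
      have := seamDist_nonneg (x := q.1.1) hq.2
      positivity
    have h4 : Continuous fun q : (ℝ × ℝ) × ℝ => seamDist q.1.1 q.2 := by
      unfold seamDist; fun_prop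
    unfold push
    have h5 : ContinuousOn (fun q : (ℝ × ℝ) × ℝ => 4 * q.1.2 / (seamDist q.1.1 q.2 + 3))
      {q : (ℝ × ℝ) × ℝ | q.1 ∈ square ∧ (β j q.1, q.2) ∈ {q : Torus × ℝ | 0 ≤ q.2}} :=
      ContinuousOn.div (by fun_prop) (h4.add continuous_const).continuousOn h3
    exact ContinuousOn.sub (by fun_prop) (continuousOn_const.mul
      (continuousOn_const.sup (continuousOn_const.inf h5)))
  · intro j u z hu hz
    have hz' : 0 ≤ z := hz
    have hs := mem_square.1 hu.1
    refine congrArg (β j) (Prod.ext rfl ?_)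
    rcases abs_eq_one_of_mem_diff hu with h | h
    · have : seamDist u.1 z = 1 := min_eq_left (by linarith)
      simp only [this, push_one hs.2]
    · exact push_of_abs_eq_one (seamDist_nonneg hz) (seamDist_le _ _) h

/-- The expansion is continuous down to height `0`, except at the nodes. -/
theorem continuousOn_stretch :
    ContinuousOn (fun q : Torus × ℝ => stretch β q.2 q.1)
      {q | 0 ≤ q.2 ∧ ¬ (q.1 ∈ range (node β) ∧ q.2 = 0)} := by
  refine hβ.continuousOn_patch (g := fun j u z => β j (u.1, pull u.2 (seamDist u.1 z)))
    (g₀ := fun p _ => p) (fun j => ?_) continuousOn_fst ?_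
  · refine (hβ.cont j).comp ?_ fun q hq => pull_mem hq.1
    refine (continuous_fst.comp continuous_fst).continuousOn.prodMk ?_
    have h4 : Continuous fun q : (ℝ × ℝ) × ℝ => seamDist q.1.1 q.2 := by
      unfold seamDist; fun_prop
    unfold pull
    refine ContinuousOn.add (by fun_prop) (continuousOn_const.mul
      (ContinuousOn.div (by fun_prop) (by fun_prop) fun q hq => ?_))
    obtain ⟨hq1, hq2, hq3⟩ := hq
    -- the denominator `max |s| τ` of `pull` vanishes only at the node, at height `0`
    refine ne_of_gt ?_
    by_contra! h
    have h1 : q.1.2 = 0 := abs_nonpos_iff.1 ((le_max_left _ _).trans h)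
    have h2 := (le_max_right _ _).trans h
    have h5 : q.1.1 = 0 ∧ q.2 = 0 := by
      by_contra hc
      exact h2.not_gt (seamDist_pos hq2 hc)
    exact hq3 ⟨⟨j, by rw [node, show q.1 = (0, 0) from Prod.ext h5.1 h1]⟩, h5.2⟩
  · intro j u z hu hz
    have hz' : 0 ≤ z := hz.1
    have hs := mem_square.1 hu.1
    refine congrArg (β j) (Prod.ext rfl ?_)
    rcases abs_eq_one_of_mem_diff hu with h | h
    · have : seamDist u.1 z = 1 := min_eq_left (by linarith)
      simp only [this, pull_one hs.2]
    · exact pull_of_abs_eq_one (seamDist_le _ _) h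

end IsSquareFamily

/-! ### Opening a slit: the model in a box -/

/-- Half the width of the hexagon `|t| ≤ wid x`, which is opened to the slit. -/
noncomputable def wid (x : ℝ) : ℝ := max 0 (min (2 / 3) (2 - 8 / 3 * |x|))

/-- The height of the half disk of radius `3/4`. -/
noncomputable def hgt (x : ℝ) : ℝ := √(9 / 16 - x ^ 2)

/-- For fixed `x`, the height to which the point `t` of the hexagon is lifted on the half disk. -/
noncomputable def slitHeight (x t : ℝ) : ℝ := hgt x * max 0 (1 - t / wid x)

/-- For fixed `x`, the point of the hexagon that is lifted to height `z`. -/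
noncomputable def slitWidth (x z : ℝ) : ℝ := wid x * max 0 (1 - z / hgt x)

theorem wid_nonneg (x : ℝ) : 0 ≤ wid x := le_max_left _ _

theorem wid_le (x : ℝ) : wid x ≤ 2 / 3 := max_le (by norm_num) (min_le_left _ _)

theorem wid_pos_iff {x : ℝ} : 0 < wid x ↔ |x| < 3 / 4 := by
  rw [wid, lt_max_iff, lt_min_iff]
  constructor
  · rintro (h | h)
    · exact absurd h (lt_irrefl _)
    · linarith
  · intro h
    exact Or.inr ⟨by norm_num, by linarith⟩

theorem hgt_nonneg (x : ℝ) : 0 ≤ hgt x := Real.sqrt_nonneg _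

theorem hgt_pos_iff {x : ℝ} : 0 < hgt x ↔ |x| < 3 / 4 := by
  rw [hgt, Real.sqrt_pos, sub_pos, show (9 / 16 : ℝ) = (3 / 4) ^ 2 by norm_num, sq_lt_sq,
    abs_of_pos (by norm_num : (0 : ℝ) < 3 / 4)]

theorem hgt_le (x : ℝ) : hgt x ≤ 3 / 4 := by
  rw [hgt, Real.sqrt_le_left (by norm_num)]
  nlinarith [sq_nonneg x]

theorem hgt_sq {x : ℝ} (hx : |x| ≤ 3 / 4) : x ^ 2 + hgt x ^ 2 = 9 / 16 := by
  rw [hgt, Real.sq_sqrt]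
  · ring
  · have := sq_le_sq' (by linarith [abs_nonneg x, neg_abs_le x]) (le_of_abs_le hx) 
    nlinarith

theorem lt_hgt_iff {x z : ℝ} (hz : 0 ≤ z) : z < hgt x ↔ x ^ 2 + z ^ 2 < 9 / 16 := by
  rw [hgt, Real.lt_sqrt hz]
  constructor <;> intro h <;> linarith

theorem hgt_eq_zero_iff {x : ℝ} : hgt x = 0 ↔ wid x = 0 := by
  rw [← not_iff_not]
  exact (hgt_nonneg x).lt_iff_ne'.symm.trans (hgt_pos_iff.trans
    (wid_pos_iff.symm.trans (wid_nonneg x).lt_iff_ne'))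

theorem wid_of_ge {x : ℝ} (hx : 3 / 4 ≤ |x|) : wid x = 0 := by
  by_contra h
  exact (wid_pos_iff.1 (lt_of_le_of_ne (wid_nonneg x) (Ne.symm h))).not_ge hx

theorem slitHeight_nonneg (x t : ℝ) : 0 ≤ slitHeight x t :=
  mul_nonneg (hgt_nonneg x) (le_max_left _ _)

theorem slitWidth_nonneg (x z : ℝ) : 0 ≤ slitWidth x z :=
  mul_nonneg (wid_nonneg x) (le_max_left _ _)

theorem slitHeight_le {x t : ℝ} (ht : 0 ≤ t) : slitHeight x t ≤ hgt x := by
  refine mul_le_of_le_one_right (hgt_nonneg x) (max_le zero_le_one ?_)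
  have := div_nonneg ht (wid_nonneg x)
  linarith

theorem slitWidth_le {x z : ℝ} (hz : 0 ≤ z) : slitWidth x z ≤ wid x := by
  refine mul_le_of_le_one_right (wid_nonneg x) (max_le zero_le_one ?_)
  have := div_nonneg hz (hgt_nonneg x)
  linarith

theorem slitHeight_of_ge {x t : ℝ} (h : wid x ≤ t) : slitHeight x t = 0 := by
  rcases (wid_nonneg x).eq_or_lt with h0 | h0
  · rw [slitHeight, hgt_eq_zero_iff.2 h0.symm, zero_mul]
  · rw [slitHeight, max_eq_left, mul_zero]
    have := (one_le_div h0).2 h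
    linarith

theorem slitWidth_of_ge {x z : ℝ} (h : hgt x ≤ z) : slitWidth x z = 0 := by
  rcases (hgt_nonneg x).eq_or_lt with h0 | h0
  · rw [slitWidth, hgt_eq_zero_iff.1 h0.symm, zero_mul]
  · rw [slitWidth, max_eq_left, mul_zero]
    have := (one_le_div h0).2 h
    linarith

theorem slitWidth_slitHeight {x t : ℝ} (ht : 0 ≤ t) (h : t ≤ wid x) :
    slitWidth x (slitHeight x t) = t := by
  rcases (wid_nonneg x).eq_or_lt with h0 | h0
  · rw [slitWidth, ← h0, zero_mul]; linarith
  · have h1 : 0 < hgt x := hgt_pos_iff.2 (wid_pos_iff.1 h0)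
    have h2 : 0 ≤ 1 - t / wid x := by
      have := (div_le_one h0).2 h
      linarith
    rw [slitWidth, slitHeight, max_eq_right h2, mul_div_cancel_left₀ _ h1.ne', sub_sub_cancel,
      max_eq_right (by positivity), mul_div_cancel₀ _ h0.ne']

theorem slitHeight_slitWidth {x z : ℝ} (hz : 0 ≤ z) (h : z ≤ hgt x) :
    slitHeight x (slitWidth x z) = z := by
  rcases (hgt_nonneg x).eq_or_lt with h0 | h0
  · rw [slitHeight, ← h0, zero_mul]; linarith
  · have h1 : 0 < wid x := wid_pos_iff.2 (hgt_pos_iff.1 h0)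
    have h2 : 0 ≤ 1 - z / hgt x := by
      have := (div_le_one h0).2 h
      linarith
    rw [slitHeight, slitWidth, max_eq_right h2, mul_div_cancel_left₀ _ h1.ne', sub_sub_cancel,
      max_eq_right (by positivity), mul_div_cancel₀ _ h0.ne']

theorem slitHeight_anti {x s t : ℝ} (h : s ≤ t) : slitHeight x t ≤ slitHeight x s := by
  refine mul_le_mul_of_nonneg_left (max_le_max le_rfl ?_) (hgt_nonneg x)
  have := div_le_div_of_nonneg_right h (wid_nonneg x)
  linarith

theorem slitWidth_anti {x s t : ℝ} (h : s ≤ t) : slitWidth x t ≤ slitWidth x s := by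
  refine mul_le_mul_of_nonneg_left (max_le_max le_rfl ?_) (wid_nonneg x)
  have := div_le_div_of_nonneg_right h (hgt_nonneg x)
  linarith

theorem slitWidth_le_of_slitHeight_le {x t z : ℝ} (ht : 0 ≤ t) (hz : 0 ≤ z)
    (h : slitHeight x t ≤ z) : slitWidth x z ≤ t := by
  rcases le_total t (wid x) with h1 | h1
  · exact (slitWidth_anti h).trans_eq (slitWidth_slitHeight ht h1)
  · exact (slitWidth_le hz).trans h1

theorem slitHeight_le_of_slitWidth_le {x t z : ℝ} (ht : 0 ≤ t) (hz : 0 ≤ z)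
    (h : slitWidth x z ≤ t) : slitHeight x t ≤ z := by
  rcases le_total z (hgt x) with h1 | h1
  · exact (slitHeight_anti h).trans_eq (slitHeight_slitWidth hz h1)
  · exact (slitHeight_le ht).trans h1

/-- A product that is continuous although its second factor need not be, where the first factor
vanishes. -/
theorem continuousOn_mul_max_one_sub_div {X : Type} [TopologicalSpace X] {a c d : X → ℝ} {s : Set X}
    (ha : ContinuousOn a s) (hc : ContinuousOn c s) (hd : ContinuousOn d s)
    (hc0 : ∀ p ∈ s, 0 ≤ c p) (hd0 : ∀ p, 0 ≤ d p) (had : ∀ p, d p = 0 → a p = 0) :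
    ContinuousOn (fun p => a p * max 0 (1 - c p / d p)) s := by
  intro p hp
  -- where `d` vanishes, so does `a`, and the second factor is bounded by `1`
  by_cases h : d p = 0
  · have h1 : Tendsto (fun q => |a q|) (𝓝[s] p) (𝓝 0) := by
      have := (ha p hp).abs
      rwa [ContinuousWithinAt, had p h, abs_zero] at this
    have h2 : a p * max 0 (1 - c p / d p) = 0 := by rw [had p h, zero_mul]
    rw [ContinuousWithinAt, h2]
    refine squeeze_zero_norm' ?_ h1
    filter_upwards [self_mem_nhdsWithin] with q hq
    have h3 : 0 ≤ c q / d q := div_nonneg (hc0 q hq) (hd0 q)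
    rw [norm_mul, Real.norm_eq_abs, Real.norm_eq_abs]
    refine mul_le_of_le_one_right (abs_nonneg _) ?_
    rw [abs_of_nonneg (le_max_left _ _)]
    exact max_le zero_le_one (by linarith)
  · exact (ha p hp).mul (continuousWithinAt_const.sup
      (continuousWithinAt_const.sub ((hc p hp).div (hd p hp) h)))

theorem continuous_wid : Continuous wid := by unfold wid; fun_prop

theorem continuous_hgt : Continuous hgt := by unfold hgt; fun_prop

/-- For fixed `x`, the vertical part of the map that opens the slit. -/
noncomputable def lift (x t z : ℝ) : ℝ := slitHeight x |t| + z * (1 - slitHeight x |t|)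

/-- For fixed `x`, the horizontal part of the map that opens the slit. -/
noncomputable def slide (x t z : ℝ) : ℝ :=
  (t - max (-slitWidth x (lift x t z)) (min (slitWidth x (lift x t z)) t)) /
    (1 - slitWidth x (lift x t z))

theorem slitHeight_le' (x t : ℝ) : slitHeight x |t| ≤ 3 / 4 :=
  (slitHeight_le (abs_nonneg t)).trans (hgt_le x)

theorem le_lift {x t z : ℝ} (hz : 0 ≤ z) : slitHeight x |t| ≤ lift x t z := by
  have := slitHeight_le' x t
  have : 0 ≤ z * (1 - slitHeight x |t|) := mul_nonneg hz (by linarith)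
  rw [lift]; linarith

theorem lift_nonneg {x t z : ℝ} (hz : 0 ≤ z) : 0 ≤ lift x t z :=
  (slitHeight_nonneg _ _).trans (le_lift hz)

theorem lift_pos {x t z : ℝ} (hz : 0 < z) : 0 < lift x t z := by
  have := slitHeight_le' x t
  have := slitHeight_nonneg x |t|
  have : 0 < z * (1 - slitHeight x |t|) := mul_pos hz (by linarith)
  rw [lift]; linarith

theorem lift_lt_one {x t z : ℝ} (hz : z < 1) : lift x t z < 1 := by
  have := slitHeight_le' x t
  rw [lift]; nlinarith

theorem lift_one (x t : ℝ) : lift x t 1 = 1 := by rw [lift]; ring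

theorem lift_zero (x t : ℝ) : lift x t 0 = slitHeight x |t| := by rw [lift]; ring

theorem lift_of_ge {x t z : ℝ} (h : wid x ≤ |t|) : lift x t z = z := by
  rw [lift, slitHeight_of_ge h]; ring

theorem slitWidth_lift_le {x t z : ℝ} (hz : 0 ≤ z) : slitWidth x (lift x t z) ≤ |t| :=
  slitWidth_le_of_slitHeight_le (abs_nonneg t) (lift_nonneg hz) (le_lift hz)

theorem slitWidth_le' {x z : ℝ} (hz : 0 ≤ z) : slitWidth x z ≤ 2 / 3 :=
  (slitWidth_le hz).trans (wid_le x)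

theorem slide_neg (x t z : ℝ) : slide x (-t) z = -slide x t z := by
  have h1 : lift x (-t) z = lift x t z := by rw [lift, lift, abs_neg]
  have h2 := slitWidth_nonneg x (lift x t z)
  rw [slide, slide, h1, ← neg_div]
  congr 1
  grind

theorem slide_of_nonneg {x t z : ℝ} (ht : 0 ≤ t) (hz : 0 ≤ z) :
    slide x t z = (t - slitWidth x (lift x t z)) / (1 - slitWidth x (lift x t z)) := by
  have h1 := slitWidth_lift_le (x := x) (t := t) hz
  rw [abs_of_nonneg ht] at h1
  have h2 := slitWidth_nonneg x (lift x t z)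
  rw [slide, min_eq_left h1, max_eq_right (by linarith)]

theorem slide_nonneg {x t z : ℝ} (ht : 0 ≤ t) (hz : 0 ≤ z) : 0 ≤ slide x t z := by
  have h1 := slitWidth_lift_le (x := x) (t := t) hz
  rw [abs_of_nonneg ht] at h1
  have h2 := slitWidth_le' (x := x) (lift_nonneg (x := x) (t := t) hz)
  rw [slide_of_nonneg ht hz]
  exact div_nonneg (by linarith) (by linarith)

theorem slide_nonpos {x t z : ℝ} (ht : t ≤ 0) (hz : 0 ≤ z) : slide x t z ≤ 0 := by
  have := slide_nonneg (x := x) (t := -t) (by linarith) hz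
  rw [slide_neg] at this
  linarith

theorem abs_slide_le {x t z : ℝ} (ht : |t| ≤ 1) (hz : 0 ≤ z) : |slide x t z| ≤ 1 := by
  revert ht
  refine forall_of_nonneg (P := fun t => |t| ≤ 1 → |slide x t z| ≤ 1) ?_ ?_ t
  · intro t h h'
    have := h (by simpa using h')
    rwa [slide_neg, abs_neg] at this
  · intro t ht h
    rw [abs_of_nonneg ht] at h
    have h2 := slitWidth_le' (x := x) (lift_nonneg (x := x) (t := t) hz)
    rw [abs_of_nonneg (slide_nonneg ht hz), slide_of_nonneg ht hz, div_le_one (by linarith)]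
    linarith

theorem slide_zero {x z : ℝ} (hz : 0 ≤ z) : slide x 0 z = 0 :=
  le_antisymm (slide_nonpos le_rfl hz) (slide_nonneg le_rfl hz)

/-- The points that are moved onto the slit. -/
theorem slide_eq_zero_iff {x t z : ℝ} (hz : 0 ≤ z) :
    slide x t z = 0 ↔ t = 0 ∨ (z = 0 ∧ |t| ≤ wid x) := by
  refine forall_of_nonneg (P := fun t => slide x t z = 0 ↔ t = 0 ∨ (z = 0 ∧ |t| ≤ wid x)) ?_ ?_ t
  · intro t h
    rwa [slide_neg, abs_neg, neg_eq_zero, neg_eq_zero] at h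
  intro t ht
  have h2 := slitWidth_le' (x := x) (lift_nonneg (x := x) (t := t) hz)
  rw [slide_of_nonneg ht hz, div_eq_zero_iff, or_iff_left (by linarith), sub_eq_zero,
    abs_of_nonneg ht]
  constructor
  · intro h
    by_cases h0 : t = 0
    · exact Or.inl h0
    refine Or.inr ?_
    have ht0 : 0 < t := lt_of_le_of_ne ht (Ne.symm h0)
    have hl := lift_nonneg (x := x) (t := t) hz
    have h3 : lift x t z ≤ hgt x := by
      by_contra! h3
      rw [slitWidth_of_ge h3.le] at h
      exact h0 h
    -- `t` is the half width at height `lift x t z`, so this is the height of `t` on the half disk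
    have h4 : slitHeight x t = lift x t z := by
      conv_lhs => rw [h]
      exact slitHeight_slitWidth hl h3
    refine ⟨?_, h ▸ slitWidth_le hl⟩
    rw [lift, abs_of_nonneg ht] at h4
    have h5 := slitHeight_le' x t
    rw [abs_of_nonneg ht] at h5
    have h6 : z * (1 - slitHeight x t) = 0 := by linarith
    exact (mul_eq_zero.1 h6).resolve_right (by linarith)
  · rintro (rfl | ⟨rfl, h⟩)
    · have := slitWidth_lift_le (x := x) (t := 0) hz
      rw [abs_zero] at this
      exact le_antisymm (slitWidth_nonneg _ _) this
    · rw [lift_zero, abs_of_nonneg ht, slitWidth_slitHeight ht h]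

/-- The inverse of `slide`. -/
noncomputable def unslide (x t z : ℝ) : ℝ := t * (1 - slitWidth x z) + Real.sign t * slitWidth x z

/-- The inverse of `lift`. -/
noncomputable def unlift (x t z : ℝ) : ℝ := (z - slitHeight x |t|) / (1 - slitHeight x |t|)

theorem unlift_lift (x t z : ℝ) : unlift x t (lift x t z) = z := by
  have := slitHeight_le' x t
  rw [unlift, lift, div_eq_iff (by linarith)]; ring

theorem lift_unlift (x t z : ℝ) : lift x t (unlift x t z) = z := by
  have := slitHeight_le' x t
  rw [unlift, lift, div_mul_cancel₀ _ (by linarith)]; ring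

theorem unslide_neg (x t z : ℝ) : unslide x (-t) z = -unslide x t z := by
  rw [unslide, unslide, Real.sign_neg]; ring

/-- `unslide` undoes `slide`, apart from points that are moved onto the slit. -/
theorem unslide_slide {x t z : ℝ} (hz : 0 ≤ z) (h : t = 0 ∨ slide x t z ≠ 0) :
    unslide x (slide x t z) (lift x t z) = t := by
  revert h
  refine forall_of_nonneg (P := fun t => (t = 0 ∨ slide x t z ≠ 0) →
    unslide x (slide x t z) (lift x t z) = t) ?_ ?_ t
  · intro t h h'
    rw [slide_neg, neg_eq_zero, neg_ne_zero, unslide_neg, lift, abs_neg, neg_inj] at h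
    exact h h'
  intro t ht h
  have h2 := slitWidth_le' (x := x) (lift_nonneg (x := x) (t := t) hz)
  rcases h with rfl | h
  · rw [slide_zero hz, unslide]; simp
  · have h1 : 0 < slide x t z := lt_of_le_of_ne (slide_nonneg ht hz) h.symm
    rw [unslide, Real.sign_of_pos h1, slide_of_nonneg ht hz, div_mul_cancel₀ _ (by linarith)]
    ring

theorem abs_unslide {x t z : ℝ} (hz : 0 ≤ z) (ht : t ≠ 0) :
    |unslide x t z| = |t| * (1 - slitWidth x z) + slitWidth x z := by
  revert ht
  refine forall_of_nonneg (P := fun t => t ≠ 0 →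
    |unslide x t z| = |t| * (1 - slitWidth x z) + slitWidth x z) ?_ ?_ t
  · intro t h h'
    rw [neg_ne_zero, unslide_neg, abs_neg, abs_neg] at h
    exact h h'
  intro t ht h
  have h1 : 0 < t := lt_of_le_of_ne ht h.symm
  have h2 := slitWidth_le' (x := x) hz
  have h3 := slitWidth_nonneg x z
  have h4 : 0 ≤ t * (1 - slitWidth x z) := mul_nonneg ht (by linarith)
  rw [unslide, Real.sign_of_pos h1, one_mul, abs_of_nonneg (by linarith), abs_of_nonneg ht]

theorem slitWidth_le_unslide {x t z : ℝ} (hz : 0 ≤ z) (h : t ≠ 0 ∨ hgt x ≤ z) :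
    slitWidth x z ≤ |unslide x t z| := by
  by_cases ht : t = 0
  · rw [slitWidth_of_ge (h.resolve_left (not_not.2 ht))]
    exact abs_nonneg _
  · rw [abs_unslide hz ht]
    have := slitWidth_le' (x := x) hz
    have := mul_nonneg (abs_nonneg t) (by linarith : 0 ≤ 1 - slitWidth x z)
    linarith

theorem unlift_nonneg {x t z : ℝ} (hz : 0 ≤ z) (h : t ≠ 0 ∨ hgt x ≤ z) :
    0 ≤ unlift x (unslide x t z) z := by
  have h1 := slitHeight_le_of_slitWidth_le (abs_nonneg _) hz (slitWidth_le_unslide hz h)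
  have h2 := slitHeight_le' x (unslide x t z)
  exact div_nonneg (by linarith) (by linarith)

theorem unlift_lt_one {x t z : ℝ} (hz : z < 1) : unlift x t z < 1 := by
  have h2 := slitHeight_le' x t
  rw [unlift, div_lt_one (by linarith)]
  linarith

/-- Off the crossing disk, `unslide` is a right inverse of `slide`. -/
theorem slide_unslide {x t z : ℝ} (hz : 0 ≤ z) (h : t ≠ 0 ∨ hgt x ≤ z) :
    slide x (unslide x t z) (unlift x (unslide x t z) z) = t := by
  revert h
  refine forall_of_nonneg (P := fun t => (t ≠ 0 ∨ hgt x ≤ z) →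
    slide x (unslide x t z) (unlift x (unslide x t z) z) = t) ?_ ?_ t
  · intro t h h'
    have h1 : unlift x (-unslide x t z) z = unlift x (unslide x t z) z := by
      rw [unlift, unlift, abs_neg]
    rw [neg_ne_zero, unslide_neg, slide_neg, h1, neg_inj] at h
    exact h h'
  intro t ht h
  have h2 := slitWidth_le' (x := x) hz
  have h3 := slitWidth_nonneg x z
  have h4 : 0 ≤ unslide x t z := by
    rw [unslide]
    have h5 : 0 ≤ Real.sign t := by
      rcases ht.eq_or_lt with rfl | ht
      · simp
      · rw [Real.sign_of_pos ht]; norm_num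
    have := mul_nonneg ht (by linarith : 0 ≤ 1 - slitWidth x z)
    have := mul_nonneg h5 h3
    linarith
  rw [slide_of_nonneg h4 (unlift_nonneg hz h), lift_unlift, div_eq_iff (by linarith)]
  rcases ht.eq_or_lt with rfl | ht
  · rw [unslide, slitWidth_of_ge (h.resolve_left (by simp))]; simp
  · rw [unslide, Real.sign_of_pos ht]; ring

theorem abs_unslide_le {x t z : ℝ} (hz : 0 ≤ z) (ht : |t| ≤ 1) : |unslide x t z| ≤ 1 := by
  by_cases h : t = 0
  · simp [unslide, h]
  · rw [abs_unslide hz h]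
    have h2 := slitWidth_le' (x := x) hz
    nlinarith

theorem continuousOn_slitHeight :
    ContinuousOn (fun p : ℝ × ℝ => slitHeight p.1 p.2) {p | 0 ≤ p.2} :=
  continuousOn_mul_max_one_sub_div (continuous_hgt.comp continuous_fst).continuousOn
    continuousOn_snd (continuous_wid.comp continuous_fst).continuousOn (fun _ h => h)
    (fun _ => wid_nonneg _) fun _ => hgt_eq_zero_iff.2

theorem continuousOn_slitWidth : ContinuousOn (fun p : ℝ × ℝ => slitWidth p.1 p.2) {p | 0 ≤ p.2} :=
  continuousOn_mul_max_one_sub_div (continuous_wid.comp continuous_fst).continuousOn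
    continuousOn_snd (continuous_hgt.comp continuous_fst).continuousOn (fun _ h => h)
    (fun _ => hgt_nonneg _) fun _ => hgt_eq_zero_iff.1

theorem continuous_lift : Continuous fun q : (ℝ × ℝ) × ℝ => lift q.1.1 q.1.2 q.2 := by
  have h : Continuous fun q : (ℝ × ℝ) × ℝ => slitHeight q.1.1 |q.1.2| :=
    continuousOn_slitHeight.comp_continuous (f := fun q : (ℝ × ℝ) × ℝ => (q.1.1, |q.1.2|))
      (by fun_prop) fun q => abs_nonneg q.1.2
  unfold lift
  fun_prop

theorem continuousOn_slide :
    ContinuousOn (fun q : (ℝ × ℝ) × ℝ => slide q.1.1 q.1.2 q.2) {q | 0 ≤ q.2} := by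
  have h : ContinuousOn (fun q : (ℝ × ℝ) × ℝ => slitWidth q.1.1 (lift q.1.1 q.1.2 q.2))
      {q | 0 ≤ q.2} :=
    continuousOn_slitWidth.comp (f := fun q : (ℝ × ℝ) × ℝ => (q.1.1, lift q.1.1 q.1.2 q.2))
      (Continuous.prodMk (by fun_prop) continuous_lift).continuousOn fun q hq => lift_nonneg hq
  unfold slide
  refine ContinuousOn.div ?_ (continuousOn_const.sub h) fun q hq => ?_
  · exact ContinuousOn.sub (by fun_prop) (h.neg.sup (h.inf (by fun_prop)))
  · have := slitWidth_le' (x := q.1.1) (lift_nonneg (x := q.1.1) (t := q.1.2) hq)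
    linarith

/-! ### Inserting a half twist: the model in a box -/

/-- The height in a box as a function of the height relative to the crossing disk: the crossing disk
is moved from `-1/2` to `0`. -/
noncomputable def eta (t : ℝ) : ℝ := max (-1 / 2 + t / 2) (-1 / 2 + 3 * t / 2)

/-- A cut-off function of the distance from the axis and the height above the crossing disk. It
is `1` up to radius `3/4` and vanishes from radius `1` on. At height `0` it jumps across the
crossing circle, to vanish outside the crossing disk. -/
noncomputable def damp (r t : ℝ) : ℝ := max 0 (t + 4 * (3 / 4 - r)) / (t + 4 * |3 / 4 - r|)

/-- The angle by which the part above the crossing disk is turned, if there are `n` half twists. -/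
noncomputable def twistAngle (n : ℤ) (r t : ℝ) : ℝ :=
  -(Real.pi * n) * (1 - max 0 (eta t)) * damp r t

theorem damp_of_lt {r t : ℝ} (hr : r < 3 / 4) (ht : 0 ≤ t) : damp r t = 1 := by
  rw [damp, abs_of_pos (by linarith), max_eq_right (by linarith), div_self (by linarith)]

theorem damp_of_one_le {r t : ℝ} (hr : 1 ≤ r) (ht : t ≤ 1) : damp r t = 0 := by
  rw [damp, max_eq_left (by linarith), zero_div]

theorem damp_zero_of_ge {r : ℝ} (hr : 3 / 4 ≤ r) : damp r 0 = 0 := by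
  rw [damp, max_eq_left (by linarith), zero_div]

theorem eta_of_nonpos {t : ℝ} (ht : t ≤ 0) : eta t = -1 / 2 + t / 2 := max_eq_left (by linarith)

theorem eta_of_nonneg {t : ℝ} (ht : 0 ≤ t) : eta t = -1 / 2 + 3 * t / 2 :=
  max_eq_right (by linarith)

theorem continuous_eta : Continuous eta := by unfold eta; fun_prop

theorem twistAngle_zero_of_ge {n : ℤ} {r : ℝ} (hr : 3 / 4 ≤ r) : twistAngle n r 0 = 0 := by
  rw [twistAngle, damp_zero_of_ge hr, mul_zero]

theorem twistAngle_zero_of_lt {n : ℤ} {r : ℝ} (hr : r < 3 / 4) :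
    twistAngle n r 0 = -(Real.pi * n) := by
  rw [twistAngle, damp_of_lt hr le_rfl, eta_of_nonneg le_rfl, max_eq_left (by norm_num)]; ring

theorem twistAngle_of_one_le {n : ℤ} {r t : ℝ} (hr : 1 ≤ r) (ht : t ≤ 1) :
    twistAngle n r t = 0 := by
  rw [twistAngle, damp_of_one_le hr ht, mul_zero]

theorem twistAngle_one (n : ℤ) (r : ℝ) : twistAngle n r 1 = 0 := by
  rw [twistAngle, eta_of_nonneg zero_le_one, max_eq_right (by norm_num)]; ring

/-- The rotation of the plane by an angle `θ`. -/
noncomputable def rot (θ : ℝ) (v : ℝ × ℝ) : ℝ × ℝ :=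
  (v.1 * Real.cos θ - v.2 * Real.sin θ, v.1 * Real.sin θ + v.2 * Real.cos θ)

theorem rot_zero (v : ℝ × ℝ) : rot 0 v = v := by simp [rot]

theorem rot_rot_neg (θ : ℝ) (v : ℝ × ℝ) : rot θ (rot (-θ) v) = v := by
  have := Real.sin_sq_add_cos_sq θ
  simp only [rot, Real.cos_neg, Real.sin_neg]
  ext
  · simp only; linear_combination v.1 * this
  · simp only; linear_combination v.2 * this

theorem rot_neg_rot (θ : ℝ) (v : ℝ × ℝ) : rot (-θ) (rot θ v) = v := by
  simpa using rot_rot_neg (-θ) v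

theorem rot_norm (θ : ℝ) (v : ℝ × ℝ) :
    (rot θ v).1 ^ 2 + (rot θ v).2 ^ 2 = v.1 ^ 2 + v.2 ^ 2 := by
  simp only [rot]
  linear_combination (v.1 ^ 2 + v.2 ^ 2) * Real.sin_sq_add_cos_sq θ

/-- The distance from the axis of a box. -/
noncomputable def axisDist (v : ℝ × ℝ) : ℝ := √(v.1 ^ 2 + v.2 ^ 2)

theorem axisDist_rot (θ : ℝ) (v : ℝ × ℝ) : axisDist (rot θ v) = axisDist v := by
  rw [axisDist, rot_norm, axisDist]

theorem axisDist_nonneg (v : ℝ × ℝ) : 0 ≤ axisDist v := Real.sqrt_nonneg _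

theorem axisDist_sq (v : ℝ × ℝ) : axisDist v ^ 2 = v.1 ^ 2 + v.2 ^ 2 :=
  Real.sq_sqrt (by positivity)

theorem axisDist_eq_iff {v : ℝ × ℝ} {r : ℝ} (hr : 0 ≤ r) :
    axisDist v = r ↔ v.1 ^ 2 + v.2 ^ 2 = r ^ 2 := by
  rw [← axisDist_sq, sq_eq_sq₀ (axisDist_nonneg _) hr]

theorem axisDist_lt_iff {v : ℝ × ℝ} {r : ℝ} (hr : 0 ≤ r) :
    axisDist v < r ↔ v.1 ^ 2 + v.2 ^ 2 < r ^ 2 := by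
  rw [← axisDist_sq, sq_lt_sq₀ (axisDist_nonneg _) hr]

theorem abs_fst_le_axisDist (v : ℝ × ℝ) : |v.1| ≤ axisDist v :=
  Real.abs_le_sqrt (by nlinarith [sq_nonneg v.2])

theorem abs_snd_le_axisDist (v : ℝ × ℝ) : |v.2| ≤ axisDist v :=
  Real.abs_le_sqrt (by nlinarith [sq_nonneg v.1])

theorem continuous_axisDist : Continuous axisDist := by unfold axisDist; fun_prop

/-- The position in a plane across the box, and the height along the box, of a point before the
half twist is inserted. The plane has the horizontal coordinate of the box and the vertical
coordinate of the thickened torus. -/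
noncomputable def preModel (k : Bool) (q : (ℝ × ℝ) × ℝ) : (ℝ × ℝ) × ℝ :=
  ((q.1.1, sgn k * lift q.1.1 q.1.2 q.2), slide q.1.1 q.1.2 q.2)

/-- The angle by which a point is turned; it is decided on the side of the slit whether the point is
above the crossing disk. -/
noncomputable def modelAngle (n : ℤ) (k : Bool) (q : (ℝ × ℝ) × ℝ) : ℝ :=
  if 0 < q.1.2 then twistAngle n (axisDist (preModel k q).1) (preModel k q).2 else 0

/-- The map of the box that opens the slits and inserts `n` half twists. -/
noncomputable def model (n : ℤ) (k : Bool) (q : (ℝ × ℝ) × ℝ) : (ℝ × ℝ) × ℝ :=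
  (((rot (modelAngle n k q) (preModel k q).1).1, (preModel k q).2),
    (rot (modelAngle n k q) (preModel k q).1).2)

/-- The position of a point of the box before the half twists are inserted. -/
noncomputable def untwist (n : ℤ) (q : (ℝ × ℝ) × ℝ) : ℝ × ℝ :=
  rot (-(if 0 < q.1.2 then twistAngle n (axisDist (q.1.1, q.2)) q.1.2 else 0)) (q.1.1, q.2)

/-- The inverse of `model` away from the crossing disk. -/
noncomputable def unmodel (n : ℤ) (q : (ℝ × ℝ) × ℝ) : (ℝ × ℝ) × ℝ :=
  (((untwist n q).1, unslide (untwist n q).1 q.1.2 |(untwist n q).2|),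
    unlift (untwist n q).1 (unslide (untwist n q).1 q.1.2 |(untwist n q).2|) |(untwist n q).2|)

/-- The closed crossing disk in a box. -/
def modelDisk : Set ((ℝ × ℝ) × ℝ) := {q | q.1.2 = 0 ∧ q.1.1 ^ 2 + q.2 ^ 2 ≤ 9 / 16}

/-- The closed hexagon at height `0` that is moved onto the crossing disk. -/
def modelHexagon : Set ((ℝ × ℝ) × ℝ) := {q | q.2 = 0 ∧ |q.1.1| ≤ 3 / 4 ∧ |q.1.2| ≤ wid q.1.1}

/-- The diameter of the hexagon, which is moved onto the crossing circle. -/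
def modelSeam : Set ((ℝ × ℝ) × ℝ) := {q | q.2 = 0 ∧ |q.1.1| ≤ 3 / 4 ∧ q.1.2 = 0}

theorem sgn_sq (k : Bool) : sgn k * sgn k = 1 := by cases k <;> simp [sgn]

theorem abs_sgn (k : Bool) : |sgn k| = 1 := by cases k <;> simp [sgn]

theorem sgn_ne_zero (k : Bool) : sgn k ≠ 0 := by cases k <;> simp [sgn]

theorem sgn_mul_sq (k : Bool) (x : ℝ) : (sgn k * x) ^ 2 = x ^ 2 := by
  rw [mul_pow, pow_two (sgn k), sgn_sq, one_mul]

theorem model_radius (n : ℤ) (k : Bool) (q : (ℝ × ℝ) × ℝ) :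
    (model n k q).1.1 ^ 2 + (model n k q).2 ^ 2 = q.1.1 ^ 2 + lift q.1.1 q.1.2 q.2 ^ 2 := by
  have := rot_norm (modelAngle n k q) (preModel k q).1
  rw [model, this, preModel, sgn_mul_sq]

theorem model_slide (n : ℤ) (k : Bool) (q : (ℝ × ℝ) × ℝ) :
    (model n k q).1.2 = slide q.1.1 q.1.2 q.2 := rfl

theorem axisDist_preModel (k : Bool) (q : (ℝ × ℝ) × ℝ) :
    axisDist (preModel k q).1 = √(q.1.1 ^ 2 + lift q.1.1 q.1.2 q.2 ^ 2) := by
  rw [axisDist, preModel, sgn_mul_sq]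

theorem hexagon_le {q : (ℝ × ℝ) × ℝ} (hz : q.2 = 0) (hx : |q.1.1| ≤ 3 / 4) :
    q.1.1 ^ 2 + lift q.1.1 q.1.2 q.2 ^ 2 ≤ 9 / 16 := by
  rw [← hgt_sq hx, hz, lift_zero]
  have h1 := slitHeight_le (x := q.1.1) (abs_nonneg q.1.2)
  have h2 := slitHeight_nonneg q.1.1 |q.1.2|
  nlinarith

/-- Only the hexagon is moved onto the crossing disk. -/
theorem model_mem_modelDisk_iff {n : ℤ} {k : Bool} {q : (ℝ × ℝ) × ℝ} (hz : 0 ≤ q.2) :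
    model n k q ∈ modelDisk ↔ q ∈ modelHexagon := by
  rw [modelDisk, mem_ofPred_eq, model_radius, model_slide, slide_eq_zero_iff hz]
  constructor
  · rintro ⟨h1, h2⟩
    have h3 : |q.1.1| ≤ 3 / 4 := by
      rw [← sq_le_sq₀ (abs_nonneg _) (by norm_num), sq_abs]
      nlinarith [sq_nonneg (lift q.1.1 q.1.2 q.2)]
    rcases h1 with h1 | ⟨h1, h1'⟩
    -- on the axis `t = 0` the lift is at least `hgt`, so the radius is at least `3/4`, with
    -- equality only at height `0`
    · have h4 := le_lift (x := q.1.1) (t := q.1.2) hz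
      have h6 : slitHeight q.1.1 |q.1.2| = hgt q.1.1 := by simp [slitHeight, h1]
      rw [h6] at h4
      have h5 : lift q.1.1 q.1.2 q.2 ≤ hgt q.1.1 := by
        rw [← sq_le_sq₀ (lift_nonneg hz) (hgt_nonneg _)]
        linarith [hgt_sq h3]
      have h7 : q.2 * (1 - hgt q.1.1) = 0 := by
        have h8 : lift q.1.1 q.1.2 q.2 = hgt q.1.1 + q.2 * (1 - hgt q.1.1) := by rw [lift, h6]
        linarith
      refine ⟨(mul_eq_zero.1 h7).resolve_right (by linarith [hgt_le q.1.1]), h3, ?_⟩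
      rw [h1, abs_zero]; exact wid_nonneg _
    · exact ⟨h1, h3, h1'⟩
  · rintro ⟨h1, h2, h3⟩
    exact ⟨Or.inr ⟨h1, h3⟩, hexagon_le h1 h2⟩

/-- Away from the crossing disk, the two definitions of the angle agree. -/
theorem modelAngle_eq {n : ℤ} {k : Bool} {q : (ℝ × ℝ) × ℝ} (hz : 0 ≤ q.2)
    (h : q ∉ modelHexagon) : modelAngle n k q =
      if 0 < (model n k q).1.2 then
        twistAngle n (axisDist ((model n k q).1.1, (model n k q).2)) (model n k q).1.2 else 0 := by
  have h1 : axisDist ((model n k q).1.1, (model n k q).2) = axisDist (preModel k q).1 :=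
    axisDist_rot _ _
  rw [h1, model_slide, modelAngle]
  by_cases ht : 0 < q.1.2
  · rw [if_pos ht]
    have h2 := slide_nonneg (x := q.1.1) ht.le hz
    -- a point with `0 < t` that is moved to height `0` along the box is outside the crossing disk,
    -- as it is not in the hexagon; there the angle vanishes
    rcases h2.eq_or_lt with h2 | h2
    · rw [← h2, if_neg (lt_irrefl _)]
      show twistAngle n _ (slide q.1.1 q.1.2 q.2) = 0
      rw [← h2]
      refine twistAngle_zero_of_ge ?_
      by_contra! h3
      refine h ((model_mem_modelDisk_iff (n := n) (k := k) hz).1 ⟨?_, ?_⟩)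
      · rw [model_slide, ← h2]
      · rw [axisDist_lt_iff (by norm_num)] at h3
        rw [model_radius]
        have h4 : (preModel k q).1.1 ^ 2 + (preModel k q).1.2 ^ 2
          = q.1.1 ^ 2 + lift q.1.1 q.1.2 q.2 ^ 2 := by simp only [preModel, sgn_mul_sq]
        linarith
    · rw [if_pos h2]; rfl
  · rw [if_neg ht, if_neg (slide_nonpos (not_lt.1 ht) hz).not_gt]

theorem untwist_model {n : ℤ} {k : Bool} {q : (ℝ × ℝ) × ℝ} (hz : 0 ≤ q.2)
    (h : q ∉ modelHexagon) :
    untwist n (model n k q) = (q.1.1, sgn k * lift q.1.1 q.1.2 q.2) := by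
  rw [untwist, ← modelAngle_eq hz h]
  exact rot_neg_rot _ _

theorem abs_sgn_mul_lift {k : Bool} {x t z : ℝ} (hz : 0 ≤ z) :
    |sgn k * lift x t z| = lift x t z := by
  rw [abs_mul, abs_sgn, one_mul, abs_of_nonneg (lift_nonneg hz)]

/-- `unmodel` undoes `model` away from the hexagon. -/
theorem unmodel_model {n : ℤ} {k : Bool} {q : (ℝ × ℝ) × ℝ} (hz : 0 ≤ q.2)
    (h : q ∉ modelHexagon) : unmodel n (model n k q) = q := by
  have h1 : q.1.2 = 0 ∨ slide q.1.1 q.1.2 q.2 ≠ 0 := by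
    by_contra! hc
    rcases (slide_eq_zero_iff hz).1 hc.2 with h2 | ⟨h2, h3⟩
    · exact hc.1 h2
    · refine h ⟨h2, ?_, h3⟩
      by_contra! h4
      rw [wid_of_ge h4.le] at h3
      exact hc.1 (abs_nonpos_iff.1 h3)
  rw [unmodel, untwist_model hz h]
  simp only [abs_sgn_mul_lift hz, model_slide]
  rw [unslide_slide hz h1, unlift_lift]

/-- `unmodel` is a right inverse of `model` away from the crossing disk. The sign of the height
before the half twists are inserted decides which of the two models hits a given point. -/
theorem unmodel_spec {n : ℤ} {k : Bool} {q : (ℝ × ℝ) × ℝ} (hq : q ∉ modelDisk)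
    (hk : 0 ≤ sgn k * (untwist n q).2) :
    0 ≤ (unmodel n q).2 ∧ unmodel n q ∉ modelHexagon ∧ model n k (unmodel n q) = q := by
  set v := untwist n q with hv
  have hvr : v.1 ^ 2 + v.2 ^ 2 = q.1.1 ^ 2 + q.2 ^ 2 := rot_norm _ _
  have hk' : sgn k * |v.2| = v.2 := by
    have : |sgn k * v.2| = |v.2| := by rw [abs_mul, abs_sgn, one_mul]
    rw [← this, abs_of_nonneg hk, ← mul_assoc, sgn_sq, one_mul]
  have h1 : q.1.2 ≠ 0 ∨ hgt v.1 ≤ |v.2| := by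
    by_contra! hc
    refine hq ⟨hc.1, ?_⟩
    have := (lt_hgt_iff (abs_nonneg v.2)).1 hc.2
    rw [sq_abs] at this
    linarith
  have h2 : 0 ≤ (unmodel n q).2 := unlift_nonneg (abs_nonneg _) h1
  -- before the half twists are inserted, the slit is opened correctly
  have hpre : preModel k (unmodel n q) = (v, q.1.2) := by
    rw [preModel, unmodel]
    simp only [← hv]
    rw [lift_unlift, slide_unslide (abs_nonneg _) h1, hk']
  have hdisk : unmodel n q ∉ modelHexagon := by
    intro hc
    have := (model_mem_modelDisk_iff (n := 0) (k := k) h2).2 hc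
    obtain ⟨h3, h4⟩ := this
    rw [model_radius] at h4
    rw [model_slide] at h3
    have h5 : slide (unmodel n q).1.1 (unmodel n q).1.2 (unmodel n q).2 = q.1.2 :=
      congrArg Prod.snd hpre
    have h6 : sgn k * lift (unmodel n q).1.1 (unmodel n q).1.2 (unmodel n q).2 = v.2 :=
      congrArg (fun p => p.1.2) hpre
    refine hq ⟨h5 ▸ h3, ?_⟩
    have h7 := sgn_mul_sq k (lift (unmodel n q).1.1 (unmodel n q).1.2 (unmodel n q).2)
    rw [h6] at h7
    have h8 : (unmodel n q).1.1 = v.1 := rfl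
    rw [h8] at h4
    rw [h8] at h7
    rw [← hvr, h7]
    exact h4
  refine ⟨h2, hdisk, ?_⟩
  -- rotations preserve the radius, so the angle is the one by which `q` was turned back
  have h9 : modelAngle n k (unmodel n q) =
      if 0 < q.1.2 then twistAngle n (axisDist (q.1.1, q.2)) q.1.2 else 0 := by
    rw [modelAngle_eq h2 hdisk, show (model n k (unmodel n q)).1.2 = q.1.2 from
      (congrArg Prod.snd hpre :)]
    congr 2
    have h10 : axisDist ((model n k (unmodel n q)).1.1, (model n k (unmodel n q)).2) =
      axisDist (preModel k (unmodel n q)).1 := axisDist_rot _ _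
    rw [h10, hpre, hv, untwist, axisDist_rot]
  rw [model, h9, hpre, hv, untwist, rot_rot_neg]

theorem unmodel_fst_mem {n : ℤ} {q : (ℝ × ℝ) × ℝ} (hq : q.1 ∈ square) :
    (unmodel n q).1 ∈ square := by
  rw [mem_square] at *
  refine ⟨?_, abs_unslide_le (abs_nonneg _) hq.2⟩
  show |(untwist n q).1| ≤ 1
  by_cases h : axisDist (q.1.1, q.2) ≤ 1
  · refine (abs_fst_le_axisDist _).trans ?_
    rwa [untwist, axisDist_rot]
  · rw [untwist]
    split_ifs with h1
    · rw [twistAngle_of_one_le (by linarith) (le_of_abs_le hq.2), neg_zero, rot_zero]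
      exact hq.1
    · rw [neg_zero, rot_zero]; exact hq.1

theorem abs_untwist_lt {n : ℤ} {q : (ℝ × ℝ) × ℝ} (hq : q.1 ∈ square) (hz : |q.2| < 1) :
    |(untwist n q).2| < 1 := by
  rw [mem_square] at hq
  by_cases h : axisDist (q.1.1, q.2) < 1
  · refine (abs_snd_le_axisDist _).trans_lt ?_
    rwa [untwist, axisDist_rot]
  · rw [untwist]
    split_ifs with h1
    · rw [twistAngle_of_one_le (by linarith) (le_of_abs_le hq.2), neg_zero, rot_zero]
      exact hz
    · rw [neg_zero, rot_zero]; exact hz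

theorem unmodel_snd_lt {n : ℤ} {q : (ℝ × ℝ) × ℝ} (hq : q.1 ∈ square) (hz : |q.2| < 1) :
    (unmodel n q).2 < 1 := unlift_lt_one (abs_untwist_lt hq hz)

theorem modelAngle_of_one_le {n : ℤ} {k : Bool} {q : (ℝ × ℝ) × ℝ} (ht : |q.1.2| ≤ 1)
    (hz : 0 ≤ q.2) (h : 1 ≤ axisDist (preModel k q).1) : modelAngle n k q = 0 := by
  rw [modelAngle]
  split_ifs
  · exact twistAngle_of_one_le h (le_of_abs_le (abs_slide_le ht hz))
  · rfl

theorem model_of_one_le {n : ℤ} {k : Bool} {q : (ℝ × ℝ) × ℝ} (ht : |q.1.2| ≤ 1)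
    (hz : 0 ≤ q.2) (h : 1 ≤ axisDist (preModel k q).1) :
    model n k q = ((q.1.1, slide q.1.1 q.1.2 q.2), sgn k * lift q.1.1 q.1.2 q.2) := by
  rw [model, modelAngle_of_one_le ht hz h, rot_zero]; rfl

theorem model_fst_mem {n : ℤ} {k : Bool} {q : (ℝ × ℝ) × ℝ} (hq : q.1 ∈ square) (hz : 0 ≤ q.2) :
    (model n k q).1 ∈ square := by
  rw [mem_square] at *
  refine ⟨?_, abs_slide_le hq.2 hz⟩
  by_cases h : axisDist (preModel k q).1 ≤ 1
  · refine (abs_fst_le_axisDist (rot (modelAngle n k q) (preModel k q).1)).trans ?_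
    rwa [axisDist_rot]
  · rw [model_of_one_le hq.2 hz (by linarith)]
    exact hq.1

theorem abs_model_snd_lt {n : ℤ} {k : Bool} {q : (ℝ × ℝ) × ℝ} (hq : q.1 ∈ square) (hz : 0 ≤ q.2)
    (hz1 : q.2 < 1) : |(model n k q).2| < 1 := by
  rw [mem_square] at *
  by_cases h : axisDist (preModel k q).1 < 1
  · refine (abs_snd_le_axisDist (rot (modelAngle n k q) (preModel k q).1)).trans_lt ?_
    rwa [axisDist_rot]
  · rw [model_of_one_le hq.2 hz (by linarith)]
    rw [abs_sgn_mul_lift hz]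
    exact lift_lt_one hz1

theorem model_of_snd_eq_one {n : ℤ} {k : Bool} {q : (ℝ × ℝ) × ℝ} (hq : q.1 ∈ square)
    (hz1 : q.2 = 1) : |(model n k q).2| = 1 := by
  rw [mem_square] at *
  have hz : 0 ≤ q.2 := by rw [hz1]; exact zero_le_one
  rw [model_of_one_le hq.2 hz, abs_sgn_mul_lift hz, hz1, lift_one]
  rw [axisDist_preModel, hz1, lift_one]
  exact Real.one_le_sqrt.2 (by nlinarith [sq_nonneg q.1.1])

/-- On the boundary of the box nothing is moved, so the model fits to the identity outside. -/
theorem model_of_boundary {n : ℤ} {k : Bool} {q : (ℝ × ℝ) × ℝ} (hq : q.1 ∈ square \ openSquare)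
    (hz : 0 ≤ q.2) : model n k q = (q.1, sgn k * q.2) := by
  have hs := mem_square.1 hq.1
  -- the hexagon is in the interior of the box, so nothing is lifted
  have hw : wid q.1.1 ≤ |q.1.2| := by
    rcases abs_eq_one_of_mem_diff hq with h | h
    · rw [wid_of_ge (by rw [h]; norm_num)]; exact abs_nonneg _
    · rw [h]; linarith [wid_le q.1.1]
  have hl := lift_of_ge (z := q.2) hw
  -- on the sides `x = ±1` the slit has width `0`; the ends `t = ±1` are fixed by `slide`
  have hsl : slide q.1.1 q.1.2 q.2 = q.1.2 := by
    rcases abs_eq_one_of_mem_diff hq with h | h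
    · have : slitWidth q.1.1 (lift q.1.1 q.1.2 q.2) = 0 := by
        rw [slitWidth, wid_of_ge (by rw [h]; norm_num), zero_mul]
      rw [slide, this]
      simp
    · have hc := slitWidth_le' (x := q.1.1) (lift_nonneg (x := q.1.1) (t := q.1.2) hz)
      have hc0 := slitWidth_nonneg q.1.1 (lift q.1.1 q.1.2 q.2)
      rcases (abs_eq zero_le_one).1 h with h' | h'
      · rw [slide, h', min_eq_left, max_eq_right, div_self] <;> rw [h'] at hc hc0 <;> linarith
      · rw [slide, h', min_eq_right, max_eq_left, div_eq_iff] <;> rw [h'] at hc hc0 <;> linarith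
  -- the angle vanishes from radius `1` on, and at the upper end
  have hm : modelAngle n k q = 0 := by
    rcases abs_eq_one_of_mem_diff hq with h | h
    · refine modelAngle_of_one_le hs.2 hz ?_
      rw [← h]
      exact abs_fst_le_axisDist (preModel k q).1
    · rw [modelAngle]
      split_ifs with h0
      · rw [abs_of_pos h0] at h
        rw [preModel, hsl, h, twistAngle_one]
      · rfl
  rw [model, hm, rot_zero, preModel, hsl, hl]

/-- The diameter of the hexagon is moved onto the crossing circle. -/
theorem model_seam {n : ℤ} {k : Bool} {x : ℝ} (hx : |x| ≤ 3 / 4) :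
    (model n k ((x, 0), 0)).1.1 ^ 2 + (model n k ((x, 0), 0)).2 ^ 2 = 9 / 16 := by
  rw [model_radius, lift_zero, abs_zero, ← hgt_sq hx]
  simp [slitHeight]

theorem continuousOn_preModel (k : Bool) : ContinuousOn (preModel k) {q | 0 ≤ q.2} := by
  unfold preModel
  have := continuous_lift
  refine ContinuousOn.prodMk ?_ continuousOn_slide
  fun_prop

/-- The model is continuous down to height `0`, except on the diameter of the hexagon, where it
jumps from one side of the crossing circle to the other. -/
theorem continuousOn_model (n : ℤ) (k : Bool) :
    ContinuousOn (model n k) ({q | 0 ≤ q.2} \ modelSeam) := by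
  have hpre := continuousOn_preModel k
  -- on each side of `t = 0` the angle is continuous; on `t = 0` it vanishes
  have hang : ContinuousOn (modelAngle n k) ({q | 0 ≤ q.2} \ modelSeam) := by
    have h1 : ContinuousOn (modelAngle n k) (({q | 0 ≤ q.2} \ modelSeam) ∩ {q | q.1.2 ≤ 0}) := by
      refine continuousOn_const (c := (0 : ℝ)) |>.congr fun q hq => ?_
      rw [modelAngle, if_neg (not_lt.2 hq.2)]
    -- off the seam, points with `t = 0` are at distance more than `3/4` from the axis
    have hnear : ∀ q ∈ {q : (ℝ × ℝ) × ℝ | 0 ≤ q.2} \ modelSeam, q.1.2 = 0 →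
        3 / 4 < axisDist (preModel k q).1 := by
      intro q hq h0
      by_contra! hle
      rw [← not_lt] at hle
      have hz : 0 ≤ q.2 := hq.1
      have h5 : ¬ model n k q ∉ modelDisk := by
        rw [not_not]
        refine ⟨?_, ?_⟩
        · rw [model_slide, h0, slide_zero hz]
        · rw [model_radius]
          rw [axisDist_preModel, not_lt, Real.sqrt_le_left (by norm_num)] at hle
          linarith
      rw [not_not, model_mem_modelDisk_iff hz] at h5
      exact hq.2 ⟨h5.1, h5.2.1, h0⟩
    have h2 : ContinuousOn (modelAngle n k) (({q | 0 ≤ q.2} \ modelSeam) ∩ {q | 0 ≤ q.1.2}) := by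
      have h3 : ContinuousOn (fun q => twistAngle n (axisDist (preModel k q).1) (preModel k q).2)
          (({q | 0 ≤ q.2} \ modelSeam) ∩ {q | 0 ≤ q.1.2}) := by
        have h4 : ContinuousOn (preModel k) (({q | 0 ≤ q.2} \ modelSeam) ∩ {q | 0 ≤ q.1.2}) :=
          hpre.mono fun q hq => hq.1.1
        have h6 : ContinuousOn (fun q => axisDist (preModel k q).1)
          (({q | 0 ≤ q.2} \ modelSeam) ∩ {q | 0 ≤ q.1.2}) :=
          continuous_axisDist.comp_continuousOn (continuous_fst.comp_continuousOn h4)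
        have h7 : ContinuousOn (fun q => (preModel k q).2)
          (({q | 0 ≤ q.2} \ modelSeam) ∩ {q | 0 ≤ q.1.2}) := continuous_snd.comp_continuousOn h4
        unfold twistAngle damp
        refine ContinuousOn.mul (continuousOn_const.mul (continuousOn_const.sub
          (continuousOn_const.sup (continuous_eta.comp_continuousOn h7)))) ?_
        refine ContinuousOn.div (continuousOn_const.sup (by fun_prop)) (by fun_prop) ?_
        rintro q ⟨hq, ht⟩
        have hz : 0 ≤ q.2 := hq.1
        have h8 : 0 ≤ (preModel k q).2 := slide_nonneg ht hz
        have h9 : 0 ≤ |3 / 4 - axisDist (preModel k q).1| := abs_nonneg _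
        -- the denominator of `damp` vanishes only on the crossing circle, that is on the seam
        intro h10
        have h11 : (preModel k q).2 = 0 := by linarith
        have h12 : 3 / 4 - axisDist (preModel k q).1 = 0 := abs_eq_zero.1 (by linarith)
        have h13 : model n k q ∈ modelDisk := by
          refine ⟨h11, ?_⟩
          rw [model_radius]
          have := axisDist_preModel k q
          rw [show axisDist (preModel k q).1 = 3 / 4 by linarith] at this
          exact (Real.sqrt_le_left (by norm_num : (0:ℝ) ≤ 3 / 4)).1 this.symm.le |>.trans
            (by norm_num)
        rw [model_mem_modelDisk_iff hz] at h13
        have h14 := hnear q hq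
        by_cases h0 : q.1.2 = 0
        · linarith [h14 h0]
        · -- inside the hexagon and off its diameter the radius is less than `3/4`
          have h15 : lift q.1.1 q.1.2 q.2 < hgt q.1.1 := by
            have ht0 : 0 < |q.1.2| := abs_pos.2 h0
            have hw : 0 < wid q.1.1 := ht0.trans_le h13.2.2
            rw [h13.1, lift_zero, slitHeight]
            refine mul_lt_of_lt_one_right (hgt_pos_iff.2 (wid_pos_iff.1 hw)) ?_
            exact max_lt one_pos (by have := div_pos ht0 hw; linarith)
          have h16 := (lt_hgt_iff (lift_nonneg hz)).1 h15
          have := axisDist_preModel k q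
          rw [show axisDist (preModel k q).1 = 3 / 4 by linarith] at this
          have h17 : √(q.1.1 ^ 2 + lift q.1.1 q.1.2 q.2 ^ 2) < 3 / 4 := by
            rw [Real.sqrt_lt' (by norm_num)]; linarith
          linarith
      refine h3.congr ?_
      rintro q ⟨hq, ht⟩
      rw [modelAngle]
      split_ifs with h0
      · rfl
      -- on `t = 0` the point is outside the crossing disk at height `0`, where the angle vanishes
      · have ht0 : q.1.2 = 0 := le_antisymm (not_lt.1 h0) ht
        have h1 : (preModel k q).2 = 0 := by
          rw [preModel, ht0]; exact slide_zero hq.1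
        simp only [h1, twistAngle_zero_of_ge (hnear q hq ht0).le]
    have h3 : ({q | 0 ≤ q.2} \ modelSeam) = ((({q | 0 ≤ q.2} \ modelSeam) ∩ {q | q.1.2 ≤ 0}) ∪
        (({q | 0 ≤ q.2} \ modelSeam) ∩ {q | 0 ≤ q.1.2})) := by
      rw [← inter_union_distrib_left, eq_comm, inter_eq_left]
      exact fun q _ => le_total q.1.2 0
    intro q hq
    rw [h3]
    refine ContinuousWithinAt.union ?_ ?_
    · by_cases h0 : q.1.2 ≤ 0
      · exact h1 q ⟨hq, h0⟩
      · refine continuousWithinAt_of_notMem_closure fun hc => h0 ?_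
        have : IsClosed {q : (ℝ × ℝ) × ℝ | q.1.2 ≤ 0} := isClosed_le (by fun_prop) (by fun_prop)
        exact this.closure_subset_iff.2 inter_subset_right hc
    · by_cases h0 : 0 ≤ q.1.2
      · exact h2 q ⟨hq, h0⟩
      · refine continuousWithinAt_of_notMem_closure fun hc => h0 ?_
        have : IsClosed {q : (ℝ × ℝ) × ℝ | 0 ≤ q.1.2} := isClosed_le (by fun_prop) (by fun_prop)
        exact this.closure_subset_iff.2 inter_subset_right hc
  have hpre' := hpre.mono (sdiff_subset (s := {q : (ℝ × ℝ) × ℝ | 0 ≤ q.2}) (t := modelSeam))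
  have hc := Real.continuous_cos.comp_continuousOn hang
  have hs := Real.continuous_sin.comp_continuousOn hang
  simp only [Function.comp_def] at hc hs
  have hx := continuous_fst.comp_continuousOn (continuous_fst.comp_continuousOn hpre')
  have hz := continuous_snd.comp_continuousOn (continuous_fst.comp_continuousOn hpre')
  exact (((hx.mul hc).sub (hz.mul hs)).prodMk (continuous_snd.comp_continuousOn hpre')).prodMk
    ((hx.mul hs).add (hz.mul hc))

theorem slitWidth_pos {x z : ℝ} (hz : 0 ≤ z) (h : z < hgt x) : 0 < slitWidth x z := by
  have h0 : 0 < hgt x := hz.trans_lt h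
  refine mul_pos (wid_pos_iff.2 (hgt_pos_iff.1 h0)) (lt_max_of_lt_right ?_)
  have := (div_lt_one h0).2 h
  linarith

theorem slitHeight_pos {x t : ℝ} (ht : 0 ≤ t) (h : t < wid x) : 0 < slitHeight x t := by
  have h0 : 0 < wid x := ht.trans_lt h
  refine mul_pos (hgt_pos_iff.2 (wid_pos_iff.1 h0)) (lt_max_of_lt_right ?_)
  have := (div_lt_one h0).2 h
  linarith

/-- The sign by which a crossing disk is turned by `n` half twists. -/
noncomputable def turn (n : ℤ) : ℝ := Real.cos (Real.pi * n)

theorem sin_pi_mul_int (n : ℤ) : Real.sin (Real.pi * n) = 0 := by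
  rw [mul_comm, Real.sin_int_mul_pi]

theorem turn_sq (n : ℤ) : turn n * turn n = 1 := by
  have := Real.sin_sq_add_cos_sq (Real.pi * n)
  rw [sin_pi_mul_int] at this
  rw [turn]; linarith

/-- The model on the two halves of the hexagon; they are moved to the two sides of the crossing
disk, of which the upper one is turned. -/
theorem model_hexagon {n : ℤ} {k b : Bool} {x t : ℝ} (ht : 0 < sgn b * t) (hw : |t| ≤ wid x) :
    model n k ((x, t), 0) = (((if b then turn n else 1) * x, 0),
      (if b then turn n else 1) * (sgn k * slitHeight x |t|)) := by
  have hs : slide x t 0 = 0 := (slide_eq_zero_iff le_rfl).2 (Or.inr ⟨rfl, hw⟩)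
  have hp : preModel k ((x, t), 0) = ((x, sgn k * slitHeight x |t|), 0) := by
    rw [preModel]; simp only [hs, lift_zero]
  cases b
  · have ht' : ¬ 0 < t := by simp [sgn] at ht; linarith
    rw [model, modelAngle, if_neg ht', rot_zero, hp]
    simp
  · have ht' : 0 < t := by simpa [sgn] using ht
    have hw0 : 0 < wid x := (abs_pos.2 ht'.ne').trans_le hw
    have hr : axisDist (x, sgn k * slitHeight x |t|) < 3 / 4 := by
      rw [axisDist_lt_iff (by norm_num)]
      simp only [sgn_mul_sq]
      have h1 : slitHeight x |t| < hgt x := by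
        refine mul_lt_of_lt_one_right (hgt_pos_iff.2 (wid_pos_iff.1 hw0)) ?_
        exact max_lt one_pos (by have := div_pos (abs_pos.2 ht'.ne') hw0; linarith)
      have := (lt_hgt_iff (slitHeight_nonneg _ _)).1 h1
      linarith
    rw [model, modelAngle, if_pos ht', hp, twistAngle_zero_of_lt hr, rot]
    simp only [Real.cos_neg, Real.sin_neg, sin_pi_mul_int, if_true, turn]
    ext <;> simp <;> ring

/-- The strands in a box with `n` half twists. -/
def modelStrand (n : ℤ) : Set ((ℝ × ℝ) × ℝ) :=
  {q | ∃ b, q.1.1 = TwistDiagram.strandX n b (eta q.1.2) ∧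
    q.2 = TwistDiagram.strandZ n b (eta q.1.2)}

theorem turn_eq_sgn (n : ℤ) : ∃ b, turn n = sgn b := by
  have := turn_sq n
  rcases mul_self_eq_one_iff.1 this with h | h
  · exact ⟨true, by simp [h, sgn]⟩
  · exact ⟨false, by simp [h, sgn]⟩

theorem sgn_mul_sgn (b c : Bool) : ∃ d, sgn b * sgn c = sgn d := by
  cases b <;> cases c
  · exact ⟨true, by simp [sgn]⟩
  · exact ⟨false, by simp [sgn]⟩
  · exact ⟨false, by simp [sgn]⟩
  · exact ⟨true, by simp [sgn]⟩

theorem rot_half (θ : ℝ) (b : Bool) : rot θ (sgn b / 2, 0) =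
    (sgn b / 2 * Real.cos θ, sgn b / 2 * Real.sin θ) := by simp [rot]

theorem axisDist_half (b : Bool) : axisDist (sgn b / 2, 0) = 1 / 2 := by
  rw [axisDist_eq_iff (by norm_num)]
  cases b <;> norm_num [sgn]

/-- Away from the crossing disk, untwisting takes the strands to straight strands. -/
theorem mem_modelStrand_iff {n : ℤ} {q : (ℝ × ℝ) × ℝ} (ht : q.1.2 ≠ 0) :
    q ∈ modelStrand n ↔ ∃ b, untwist n q = (sgn b / 2, 0) := by
  rcases lt_or_gt_of_ne ht with h | h
  · have hy : max 0 (eta q.1.2) = 0 := by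
      rw [eta_of_nonpos h.le]; exact max_eq_left (by linarith)
    rw [untwist, if_neg h.not_gt, neg_zero, rot_zero]
    simp only [modelStrand, mem_ofPred_eq, TwistDiagram.strandX, TwistDiagram.strandZ, hy,
      mul_zero, Real.cos_zero, Real.sin_zero, mul_one, Prod.mk.injEq]
  · set Y := max 0 (eta q.1.2) with hY
    -- at radius `1/2` the angle is that of the strands up to a multiple of `π`
    have hang : ∀ r : ℝ, r = 1 / 2 → twistAngle n r q.1.2 = Real.pi * n * Y - Real.pi * n := by
      intro r hr
      rw [twistAngle, damp_of_lt (by rw [hr]; norm_num) h.le, ← hY]; ring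
    obtain ⟨c, hc⟩ := turn_eq_sgn n
    have hcos : Real.cos (Real.pi * n * Y - Real.pi * n) = sgn c * Real.cos (Real.pi * n * Y) := by
      rw [Real.cos_sub, sin_pi_mul_int, ← turn, hc]; ring
    have hsin : Real.sin (Real.pi * n * Y - Real.pi * n) = sgn c * Real.sin (Real.pi * n * Y) := by
      rw [Real.sin_sub, sin_pi_mul_int, ← turn, hc]; ring
    rw [untwist, if_pos h]
    constructor
    · rintro ⟨b, h1, h2⟩
      rw [TwistDiagram.strandX, ← hY] at h1
      rw [TwistDiagram.strandZ, ← hY] at h2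
      obtain ⟨d, hd⟩ := sgn_mul_sgn b c
      have h3 : (q.1.1, q.2) = rot (Real.pi * n * Y - Real.pi * n) (sgn d / 2, 0) := by
        rw [rot_half, hcos, hsin, ← hd, h1, h2]
        have := sgn_sq c
        ext
        · simp only; linear_combination (-(sgn b) / 2 * Real.cos (Real.pi * n * Y)) * this
        · simp only; linear_combination (-(sgn b) / 2 * Real.sin (Real.pi * n * Y)) * this
      refine ⟨d, ?_⟩
      rw [h3, hang _ (by rw [axisDist_rot, axisDist_half]), rot_neg_rot]
    · rintro ⟨b, h1⟩
      have h2 : axisDist (q.1.1, q.2) = 1 / 2 := by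
        rw [← axisDist_half b, ← h1, axisDist_rot]
      rw [hang _ h2] at h1
      obtain ⟨d, hd⟩ := sgn_mul_sgn b c
      have h3 : (q.1.1, q.2) = rot (Real.pi * n * Y - Real.pi * n) (sgn b / 2, 0) := by
        rw [← h1, rot_rot_neg]
      rw [rot_half, hcos, hsin] at h3
      refine ⟨d, ?_, ?_⟩
      · rw [TwistDiagram.strandX, ← hY, ← hd, show q.1.1 = _ from (congrArg Prod.fst h3 :)]; ring
      · rw [TwistDiagram.strandZ, ← hY, ← hd, show q.2 = _ from (congrArg Prod.snd h3 :)]; ring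

/-! ### Opening the slits and inserting the half twists on the thickened torus -/

theorem eta_strictMono : StrictMono eta := by
  intro s t h
  unfold eta
  exact max_lt_max (by linarith) (by linarith)

/-- The inverse of `eta`. -/
noncomputable def etaInv (y : ℝ) : ℝ := min (2 * y + 1) ((2 * y + 1) / 3)

theorem eta_etaInv (y : ℝ) : eta (etaInv y) = y := by
  rcases le_total 0 (2 * y + 1) with h | h
  · rw [etaInv, min_eq_right (by linarith), eta_of_nonneg (by linarith)]; ring
  · rw [etaInv, min_eq_left (by linarith), eta_of_nonpos h]; ring

theorem eta_one : eta 1 = 1 := by rw [eta_of_nonneg zero_le_one]; norm_num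

theorem eta_neg_one : eta (-1) = -1 := by rw [eta_of_nonpos (by norm_num)]; norm_num

theorem eta_sgn (b : Bool) : eta (sgn b) = sgn b := by
  cases b
  · simpa [sgn] using eta_neg_one
  · simpa [sgn] using eta_one

theorem abs_eta_le_one_iff {t : ℝ} : |eta t| ≤ 1 ↔ |t| ≤ 1 := by
  have h1 := eta_strictMono.le_iff_le (a := -1) (b := t)
  have h2 := eta_strictMono.le_iff_le (a := t) (b := 1)
  rw [eta_neg_one] at h1
  rw [eta_one] at h2
  rw [abs_le, abs_le, h1, h2]

namespace TwistDiagram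

variable (K : TwistDiagram)

/-- Coordinates on the box of a twist region in which the crossing disk is at height `0`. -/
noncomputable def chart (i : K.Twist) (u : ℝ × ℝ) : Torus := K.box i (u.1, eta u.2)

theorem eta_mem_square {u : ℝ × ℝ} : (u.1, eta u.2) ∈ square ↔ u ∈ square := by
  rw [mem_square, mem_square, abs_eta_le_one_iff]

theorem isSquareFamily_chart : IsSquareFamily K.chart where
  finite := K.twist_finite
  cont i := (K.box_cont i).comp ((continuous_fst.prodMk
    (continuous_eta.comp continuous_snd)).continuousOn) fun _ hu => eta_mem_square.2 hu
  inj i j u hu v hv h := by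
    obtain ⟨h1, h2⟩ := K.box_inj i j _ (eta_mem_square.2 hu) _ (eta_mem_square.2 hv) h
    obtain ⟨h3, h4⟩ := Prod.mk.inj h2
    exact ⟨h1, Prod.ext h3 (eta_strictMono.injective h4)⟩

theorem box_eq_chart (i : K.Twist) (u : ℝ × ℝ) : K.box i u = K.chart i (u.1, etaInv u.2) := by
  rw [chart, eta_etaInv]

theorem etaInv_mem_square {u : ℝ × ℝ} : (u.1, etaInv u.2) ∈ square ↔ u ∈ square := by
  rw [← eta_mem_square]
  simp only [eta_etaInv]

theorem chart_image_square (i : K.Twist) : K.chart i '' square = K.box i '' square := by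
  ext p
  constructor
  · rintro ⟨u, hu, rfl⟩
    exact ⟨_, eta_mem_square.2 hu, rfl⟩
  · rintro ⟨u, hu, rfl⟩
    exact ⟨_, etaInv_mem_square.2 hu, (K.box_eq_chart i u).symm⟩

/-- The crossing circle, in the coordinates of the box. -/
def circle (i : K.Twist) : Set (Torus × ℝ) :=
  {q | ∃ x : ℝ, q.1 = K.chart i (x, 0) ∧ x ^ 2 + q.2 ^ 2 = 9 / 16}

/-- The augmented link as a subset of `T² × ℝ`. -/
def link : Set (Torus × ℝ) :=
  (⋃ e, {q | q.1 ∈ K.core e ∧ q.2 = 0}) ∪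
  (⋃ i, {q | ∃ u ∈ square, q.1 = K.chart i u ∧ (u, q.2) ∈ modelStrand (K.halfTwist i)}) ∪
  ⋃ i, K.circle i

theorem eta_zero : eta 0 = -1 / 2 := by rw [eta_of_nonpos le_rfl]; norm_num

theorem mem_crossingCircle_iff (i : K.Twist) (q : ThickTorus) :
    q ∈ K.crossingCircle i ↔ (q.1, (q.2 : ℝ)) ∈ K.circle i := by
  rw [crossingCircle, circle, mem_ofPred_eq, mem_ofPred_eq]
  simp only [chart, eta_zero]
  norm_num

theorem abs_strandX_le (n : ℤ) (b : Bool) (y : ℝ) : |strandX n b y| ≤ 1 / 2 := by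
  rw [strandX, abs_mul, abs_div, abs_sgn, abs_of_pos (by norm_num : (0 : ℝ) < 2)]
  exact mul_le_of_le_one_right (by norm_num) (Real.abs_cos_le_one _)

theorem mem_augmentedLink_iff (q : ThickTorus) :
    q ∈ K.augmentedLink ↔ (q.1, (q.2 : ℝ)) ∈ K.link := by
  rw [augmentedLink, link]
  simp only [mem_union, mem_iUnion, mem_crossingCircle_iff]
  refine or_congr (or_congr Iff.rfl (exists_congr fun i => ?_)) Iff.rfl
  constructor
  · rintro ⟨b, y, hy, h1, h2⟩
    refine ⟨(strandX (K.halfTwist i) b y, etaInv y), ?_, ?_, b, ?_⟩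
    · exact (etaInv_mem_square (u := (strandX (K.halfTwist i) b y, y))).2
        (mem_square.2 ⟨(abs_strandX_le _ _ _).trans (by norm_num), abs_le.2 hy⟩)
    · exact h1.trans (K.box_eq_chart i _)
    · simp only [eta_etaInv, true_and]; exact h2
  · rintro ⟨u, hu, h1, b, h2, h3⟩
    refine ⟨b, eta u.2, abs_le.1 (abs_eta_le_one_iff.2 (mem_square.1 hu).2), ?_, h3⟩
    rw [← show u.1 = _ from h2]; exact h1

theorem core_port (e : K.Arc) (b : Bool) : K.band e (0, sgn b) =
    K.chart (K.ends (e, b)).1 (sgn (K.ends (e, b)).2.1 / 2, sgn (K.ends (e, b)).2.2) := by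
  rw [K.band_end e b 0 (by simp), chart, eta_sgn]
  simp

theorem port_mem_square (b c : Bool) : (sgn b / 2, sgn c) ∈ square := by
  rw [mem_square]
  simp only [abs_div, abs_sgn]
  norm_num

/-- Where the core of a band meets a box, it is at a port. -/
theorem core_chart {e : K.Arc} {i : K.Twist} {u : ℝ × ℝ} (hu : u ∈ square)
    (h : K.chart i u ∈ K.core e) : ∃ b c, u = (sgn b / 2, sgn c) := by
  obtain ⟨s, hs, h⟩ := h
  have hc : ∀ c : Bool, s = sgn c → ∃ b c, u = (sgn b / 2, sgn c) := by
    rintro c rfl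
    rw [show (fun s => K.band e (0, s)) (sgn c) = K.band e (0, sgn c) from rfl, core_port] at h
    obtain ⟨-, h2⟩ := K.isSquareFamily_chart.inj _ _ _ (port_mem_square _ _) _ hu h
    exact ⟨_, _, h2.symm⟩
  by_cases h1 : s = 1
  · exact hc true (by simp [h1, sgn])
  by_cases h2 : s = -1
  · exact hc false (by simp [h2, sgn])
  refine absurd ?_ (K.band_box e i 0 (by simp) s
    ⟨lt_of_le_of_ne hs.1 (Ne.symm h2), lt_of_le_of_ne hs.2 h1⟩)
  rw [show K.band e (0, s) = _ from h, ← K.chart_image_square]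
  exact ⟨u, hu, rfl⟩

theorem port_mem_modelStrand (n : ℤ) (b c : Bool) :
    ((sgn b / 2, sgn c), (0 : ℝ)) ∈ modelStrand n := by
  have h : untwist n ((sgn b / 2, sgn c), 0) = (sgn b / 2, 0) := by
    rw [untwist]
    cases c
    · rw [if_neg (by norm_num [sgn]), neg_zero, rot_zero]
    · rw [if_pos (by norm_num [sgn])]
      rw [show sgn true = 1 from rfl, twistAngle_one, neg_zero, rot_zero]
  exact (mem_modelStrand_iff (sgn_ne_zero c)).2 ⟨b, h⟩

/-- The augmented link in a box. -/
theorem link_chart {i : K.Twist} {u : ℝ × ℝ} (hu : u ∈ square) (z : ℝ) :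
    (K.chart i u, z) ∈ K.link ↔
      (u, z) ∈ modelStrand (K.halfTwist i) ∨ (u.2 = 0 ∧ u.1 ^ 2 + z ^ 2 = 9 / 16) := by
  simp only [link, mem_union, mem_iUnion]
  constructor
  · rintro ((⟨e, h1, rfl⟩ | ⟨j, v, hv, h1, h2⟩) | ⟨j, x, h1, h2⟩)
    · obtain ⟨b, c, rfl⟩ := K.core_chart hu h1
      exact Or.inl (port_mem_modelStrand _ b c)
    · obtain ⟨rfl, rfl⟩ := K.isSquareFamily_chart.inj _ _ _ hu _ hv h1
      exact Or.inl h2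
    · have hx : |x| ≤ 1 := by
        rw [← sq_le_one_iff_abs_le_one]
        simp only at h2
        nlinarith [sq_nonneg z]
      obtain ⟨rfl, rfl⟩ := K.isSquareFamily_chart.inj _ _ _ hu (x, 0)
        (mem_square.2 ⟨hx, by simp⟩) h1
      exact Or.inr ⟨rfl, h2⟩
  · rintro (h | ⟨h1, h2⟩)
    · exact Or.inl (Or.inr ⟨i, u, hu, rfl, h⟩)
    · refine Or.inr ⟨i, u.1, ?_, h2⟩
      rw [← h1]

theorem link_of_notMem {p : Torus} (hp : ∀ i, p ∉ K.chart i '' square) (z : ℝ) :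
    (p, z) ∈ K.link ↔ (∃ e, p ∈ K.core e) ∧ z = 0 := by
  simp only [link, mem_union, mem_iUnion]
  constructor
  · rintro ((⟨e, h1, h2⟩ | ⟨j, v, hv, h1, h2⟩) | ⟨j, x, h1, h2⟩)
    · exact ⟨⟨e, h1⟩, h2⟩
    · exact absurd ⟨v, hv, h1.symm⟩ (hp j)
    · refine absurd ⟨(x, 0), ?_, h1.symm⟩ (hp j)
      refine mem_square.2 ⟨?_, by simp⟩
      rw [← sq_le_one_iff_abs_le_one]
      simp only at h2
      nlinarith [sq_nonneg z]
  · rintro ⟨⟨e, h1⟩, h2⟩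
    exact Or.inl (Or.inl ⟨e, h1, h2⟩)

/-- The map from the upper half of `T² × ℝ` that opens the slits and inserts the half twists; it
goes to the upper half if `k` is true, and to the lower half otherwise, up to the half twists. -/
noncomputable def unfold (k : Bool) (z : ℝ) (p : Torus) : Torus × ℝ :=
  patch K.chart (fun i u => (K.chart i (model (K.halfTwist i) k (u, z)).1,
    (model (K.halfTwist i) k (u, z)).2)) (fun p => (p, sgn k * z)) p

/-- The inverse of `unfold` away from the crossing disks. -/
noncomputable def refold (q : Torus × ℝ) : Torus × ℝ :=
  patch K.chart (fun i u => (K.chart i (unmodel (K.halfTwist i) (u, q.2)).1,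
    (unmodel (K.halfTwist i) (u, q.2)).2)) (fun p => (p, |q.2|)) q.1

/-- The height of a point before the half twists are inserted. -/
noncomputable def height (q : Torus × ℝ) : ℝ :=
  patch K.chart (fun i u => (untwist (K.halfTwist i) (u, q.2)).2) (fun _ => q.2) q.1

/-- The union of the closed crossing disks. -/
def disks : Set (Torus × ℝ) :=
  {q | ∃ i, ∃ u ∈ square, q.1 = K.chart i u ∧ (u, q.2) ∈ modelDisk}

/-- The union of the closed hexagons. -/
def hexagons : Set Torus :=
  {p | ∃ i, ∃ u ∈ square, p = K.chart i u ∧ |u.1| ≤ 3 / 4 ∧ |u.2| ≤ wid u.1}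

/-- The arc that is collapsed to a crossing circle. -/
def slot (i : K.Twist) : Set Torus := {p | ∃ x : ℝ, |x| ≤ 3 / 4 ∧ p = K.chart i (x, 0)}

/-- The part of the link, before the half twists are inserted, that the hexagons leave. -/
def strands : Set Torus :=
  (⋃ e, K.core e) ∪ {p | ∃ i b, ∃ t : ℝ, 2 / 3 ≤ |t| ∧ |t| ≤ 1 ∧ p = K.chart i (sgn b / 2, t)}

theorem unfold_chart (k : Bool) (z : ℝ) (i : K.Twist) {u : ℝ × ℝ} (hu : u ∈ square) :
    K.unfold k z (K.chart i u) = (K.chart i (model (K.halfTwist i) k (u, z)).1,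
      (model (K.halfTwist i) k (u, z)).2) := K.isSquareFamily_chart.patch_apply _ _ i hu

theorem unfold_of_notMem (k : Bool) (z : ℝ) {p : Torus} (hp : ∀ i, p ∉ K.chart i '' square) :
    K.unfold k z p = (p, sgn k * z) := IsSquareFamily.patch_of_notMem _ _ hp

theorem refold_chart (z : ℝ) (i : K.Twist) {u : ℝ × ℝ} (hu : u ∈ square) :
    K.refold (K.chart i u, z) = (K.chart i (unmodel (K.halfTwist i) (u, z)).1,
      (unmodel (K.halfTwist i) (u, z)).2) := K.isSquareFamily_chart.patch_apply _ _ i hu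

theorem refold_of_notMem (z : ℝ) {p : Torus} (hp : ∀ i, p ∉ K.chart i '' square) :
    K.refold (p, z) = (p, |z|) := IsSquareFamily.patch_of_notMem _ _ hp

theorem height_chart (z : ℝ) (i : K.Twist) {u : ℝ × ℝ} (hu : u ∈ square) :
    K.height (K.chart i u, z) = (untwist (K.halfTwist i) (u, z)).2 :=
  K.isSquareFamily_chart.patch_apply _ _ i hu

theorem height_of_notMem (z : ℝ) {p : Torus} (hp : ∀ i, p ∉ K.chart i '' square) :
    K.height (p, z) = z := IsSquareFamily.patch_of_notMem _ _ hp

theorem disks_chart {i : K.Twist} {u : ℝ × ℝ} (hu : u ∈ square) (z : ℝ) :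
    (K.chart i u, z) ∈ K.disks ↔ (u, z) ∈ modelDisk := by
  constructor
  · rintro ⟨j, v, hv, h1, h2⟩
    obtain ⟨rfl, rfl⟩ := K.isSquareFamily_chart.inj _ _ _ hu _ hv h1
    exact h2
  · exact fun h => ⟨i, u, hu, rfl, h⟩

theorem disks_of_notMem {p : Torus} (hp : ∀ i, p ∉ K.chart i '' square) (z : ℝ) :
    (p, z) ∉ K.disks := fun ⟨j, v, hv, h1, _⟩ => hp j ⟨v, hv, h1.symm⟩

theorem hexagons_chart {i : K.Twist} {u : ℝ × ℝ} (hu : u ∈ square) :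
    K.chart i u ∈ K.hexagons ↔ |u.1| ≤ 3 / 4 ∧ |u.2| ≤ wid u.1 := by
  constructor
  · rintro ⟨j, v, hv, h1, h2⟩
    obtain ⟨rfl, rfl⟩ := K.isSquareFamily_chart.inj _ _ _ hu _ hv h1
    exact h2
  · exact fun h => ⟨i, u, hu, rfl, h⟩

theorem hexagons_of_notMem {p : Torus} (hp : ∀ i, p ∉ K.chart i '' square) :
    p ∉ K.hexagons := fun ⟨j, v, hv, h1, _⟩ => hp j ⟨v, hv, h1.symm⟩

theorem mem_modelHexagon_iff {i : K.Twist} {u : ℝ × ℝ} (hu : u ∈ square) (z : ℝ) :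
    (u, z) ∈ modelHexagon ↔ z = 0 ∧ K.chart i u ∈ K.hexagons := by
  rw [hexagons_chart K hu]; rfl

/-- Exactly the hexagons in the bottom torus are moved onto the crossing disks. -/
theorem unfold_mem_disks_iff (k : Bool) {z : ℝ} (hz : 0 ≤ z) (p : Torus) :
    K.unfold k z p ∈ K.disks ↔ z = 0 ∧ p ∈ K.hexagons := by
  rcases IsSquareFamily.mem_square_or K.chart p with ⟨i, u, hu, rfl⟩ | hn
  · rw [unfold_chart K k z i hu, disks_chart K (model_fst_mem hu hz), Prod.mk.eta,
      model_mem_modelDisk_iff hz, mem_modelHexagon_iff K hu]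
  · rw [unfold_of_notMem K k z hn]
    exact iff_of_false (disks_of_notMem K hn _) fun h => hexagons_of_notMem K hn h.2

theorem refold_unfold (k : Bool) {z : ℝ} (hz : 0 ≤ z) {p : Torus}
    (h : ¬ (z = 0 ∧ p ∈ K.hexagons)) : K.refold (K.unfold k z p) = (p, z) := by
  rcases IsSquareFamily.mem_square_or K.chart p with ⟨i, u, hu, rfl⟩ | hn
  · rw [unfold_chart K k z i hu, refold_chart K _ i (model_fst_mem hu hz), Prod.mk.eta,
      unmodel_model hz]
    rwa [mem_modelHexagon_iff K hu]
  · rw [unfold_of_notMem K k z hn, refold_of_notMem K _ hn, abs_mul, abs_sgn, one_mul,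
      abs_of_nonneg hz]

theorem lift_eq_zero_iff {x t z : ℝ} (hz : 0 ≤ z) (h : ((x, t), z) ∉ modelHexagon) :
    lift x t z = 0 ↔ z = 0 := by
  constructor
  · intro h1
    by_contra h2
    exact (lift_pos (lt_of_le_of_ne hz (Ne.symm h2))).ne' h1
  · intro h1
    refine (lift_of_ge ?_).trans h1
    by_cases hx : |x| ≤ 3 / 4
    · by_contra! hc
      exact h ⟨h1, hx, hc.le⟩
    · rw [wid_of_ge (by linarith)]; exact abs_nonneg _

/-- Before the half twists are inserted, the two halves of the decomposition lie on different sides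
of the torus at height `0`, which they meet in their white faces only. -/
theorem height_unfold (k : Bool) {z : ℝ} (hz : 0 ≤ z) {p : Torus}
    (h : ¬ (z = 0 ∧ p ∈ K.hexagons)) : 0 ≤ sgn k * K.height (K.unfold k z p) ∧
      (K.height (K.unfold k z p) = 0 ↔ z = 0) := by
  rcases IsSquareFamily.mem_square_or K.chart p with ⟨i, u, hu, rfl⟩ | hn
  · have h' : (u, z) ∉ modelHexagon := by rwa [mem_modelHexagon_iff K hu]
    rw [unfold_chart K k z i hu, height_chart K _ i (model_fst_mem hu hz), Prod.mk.eta,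
      untwist_model hz h', ← mul_assoc, sgn_sq, one_mul, mul_eq_zero, or_iff_right (sgn_ne_zero k)]
    exact ⟨lift_nonneg hz, lift_eq_zero_iff hz h'⟩
  · rw [unfold_of_notMem K k z hn, height_of_notMem K _ hn, ← mul_assoc, sgn_sq, one_mul,
      mul_eq_zero, or_iff_right (sgn_ne_zero k)]
    exact ⟨hz, Iff.rfl⟩

/-- Off the crossing disks, `refold` is a right inverse of `unfold`; the sign of the height tells
which of the two halves a point comes from. -/
theorem refold_spec (k : Bool) {q : Torus × ℝ} (hq : q ∉ K.disks)
    (hk : 0 ≤ sgn k * K.height q) (hq1 : |q.2| < 1) :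
    0 ≤ (K.refold q).2 ∧ (K.refold q).2 < 1 ∧
      ¬ ((K.refold q).2 = 0 ∧ (K.refold q).1 ∈ K.hexagons) ∧
      K.unfold k (K.refold q).2 (K.refold q).1 = q := by
  obtain ⟨p, z⟩ := q
  rcases IsSquareFamily.mem_square_or K.chart p with ⟨i, u, hu, rfl⟩ | hn
  · rw [disks_chart K hu] at hq
    rw [height_chart K _ i hu] at hk
    obtain ⟨h1, h2, h3⟩ := unmodel_spec hq hk
    rw [refold_chart K _ i hu]
    have h4 : (unmodel (K.halfTwist i) (u, z)).1 ∈ square := unmodel_fst_mem hu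
    refine ⟨h1, unmodel_snd_lt hu hq1, ?_, ?_⟩
    · rwa [← mem_modelHexagon_iff K h4]
    · rw [unfold_chart K _ _ _ h4, Prod.mk.eta, h3]
  · rw [refold_of_notMem K _ hn]
    rw [height_of_notMem K _ hn] at hk
    refine ⟨abs_nonneg _, hq1, fun h => hexagons_of_notMem K hn h.2, ?_⟩
    rw [unfold_of_notMem K k _ hn]
    have : |sgn k * z| = |z| := by rw [abs_mul, abs_sgn, one_mul]
    rw [← this, abs_of_nonneg hk, ← mul_assoc, sgn_sq, one_mul]

theorem abs_unfold_snd_lt (k : Bool) {z : ℝ} (hz : 0 ≤ z) (hz1 : z < 1) (p : Torus) :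
    |(K.unfold k z p).2| < 1 := by
  rcases IsSquareFamily.mem_square_or K.chart p with ⟨i, u, hu, rfl⟩ | hn
  · rw [unfold_chart K k z i hu]
    exact abs_model_snd_lt hu hz hz1
  · rw [unfold_of_notMem K k z hn, abs_mul, abs_sgn, one_mul, abs_of_nonneg hz]
    exact hz1

theorem abs_unfold_one_snd (k : Bool) (p : Torus) : |(K.unfold k 1 p).2| = 1 := by
  rcases IsSquareFamily.mem_square_or K.chart p with ⟨i, u, hu, rfl⟩ | hn
  · rw [unfold_chart K k 1 i hu]
    exact model_of_snd_eq_one hu rfl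
  · rw [unfold_of_notMem K k 1 hn, mul_one, abs_sgn]

/-- The map is continuous except at the slots, where points on the two sides of a slit part. -/
theorem continuousOn_unfold (k : Bool) :
    ContinuousOn (fun q : Torus × ℝ => K.unfold k q.2 q.1)
      {q | 0 ≤ q.2 ∧ ¬ (q.2 = 0 ∧ q.1 ∈ ⋃ i, K.slot i)} := by
  refine K.isSquareFamily_chart.continuousOn_patch (g := fun i u z =>
    (K.chart i (model (K.halfTwist i) k (u, z)).1, (model (K.halfTwist i) k (u, z)).2))
    (g₀ := fun p z => (p, sgn k * z)) (fun i => ?_) (by fun_prop) ?_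
  · have h1 : ContinuousOn (fun q : (ℝ × ℝ) × ℝ => model (K.halfTwist i) k q)
        {q | q.1 ∈ square ∧ (K.chart i q.1, q.2) ∈
          {q : Torus × ℝ | 0 ≤ q.2 ∧ ¬ (q.2 = 0 ∧ q.1 ∈ ⋃ i, K.slot i)}} := by
      refine (continuousOn_model (K.halfTwist i) k).mono ?_
      rintro ⟨u, z⟩ ⟨hu, hz, hn⟩
      refine ⟨hz, fun ⟨h0, hx, ht⟩ => hn ⟨h0, mem_iUnion.2 ⟨i, u.1, hx, ?_⟩⟩⟩
      have ht' : u.2 = 0 := ht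
      show K.chart i u = K.chart i (u.1, 0)
      rw [← ht']
    refine ContinuousOn.prodMk ?_ (continuous_snd.comp_continuousOn h1)
    exact (K.isSquareFamily_chart.cont i).comp (continuous_fst.comp_continuousOn h1)
      fun q hq => model_fst_mem hq.1 hq.2.1
  · intro i u z hu hz
    rw [model_of_boundary (q := (u, z)) hu hz.1]

/-- The points that are moved onto the link. -/
theorem unfold_mem_link_iff (k : Bool) {z : ℝ} (hz : 0 ≤ z) (p : Torus) :
    K.unfold k z p ∈ K.link ↔ z = 0 ∧ p ∈ K.strands ∪ ⋃ i, K.slot i := by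
  rcases IsSquareFamily.mem_square_or K.chart p with ⟨i, u, hu, rfl⟩ | hn
  · have hmem : K.chart i u ∈ K.strands ∪ ⋃ i, K.slot i ↔
        ((∃ b, u.1 = sgn b / 2) ∧ 2 / 3 ≤ |u.2|) ∨ (u.2 = 0 ∧ |u.1| ≤ 3 / 4) := by
      constructor
      · rintro ((h | ⟨j, b, t, h1, h2, h3⟩) | h)
        · obtain ⟨e, he⟩ := mem_iUnion.1 h
          obtain ⟨b, c, rfl⟩ := K.core_chart hu he
          exact Or.inl ⟨⟨b, rfl⟩, by rw [abs_sgn]; norm_num⟩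
        · obtain ⟨rfl, rfl⟩ := K.isSquareFamily_chart.inj _ _ _ hu (sgn b / 2, t)
            (mem_square.2 ⟨by simp only [abs_div, abs_sgn]; norm_num, h2⟩) h3
          exact Or.inl ⟨⟨b, rfl⟩, h1⟩
        · obtain ⟨j, x, h1, h2⟩ := mem_iUnion.1 h
          obtain ⟨rfl, rfl⟩ := K.isSquareFamily_chart.inj _ _ _ hu (x, 0)
            (mem_square.2 ⟨by simp only; linarith, by simp⟩) h2
          exact Or.inr ⟨rfl, h1⟩
      · rintro (⟨⟨b, h1⟩, h2⟩ | ⟨h1, h2⟩)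
        · refine Or.inl (Or.inr ⟨i, b, u.2, h2, (mem_square.1 hu).2, ?_⟩)
          rw [← h1]
        · refine Or.inr (mem_iUnion.2 ⟨i, u.1, h2, ?_⟩)
          rw [← h1]
    rw [unfold_chart K k z i hu, link_chart K (model_fst_mem hu hz), Prod.mk.eta, hmem]
    have hhalf : ∀ b : Bool, wid (sgn b / 2) = 2 / 3 := by
      intro b
      rw [wid, abs_div, abs_sgn]
      norm_num
    have hhalfsq : ∀ b : Bool, (sgn b / 2) ^ 2 = 1 / 4 := by
      intro b
      rw [div_pow, pow_two, sgn_sq]; norm_num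
    by_cases hH : (u, z) ∈ modelHexagon
    · obtain ⟨h0, hx, ht⟩ := hH
      obtain rfl : z = 0 := h0
      have hslide : (model (K.halfTwist i) k (u, 0)).1.2 = 0 := by
        rw [model_slide]; exact (slide_eq_zero_iff le_rfl).2 (Or.inr ⟨rfl, ht⟩)
      -- on the disk, the strands are the two punctures
      have hstr : model (K.halfTwist i) k (u, 0) ∈ modelStrand (K.halfTwist i) ↔
          ∃ b, (model (K.halfTwist i) k (u, 0)).1.1 = sgn b / 2 ∧
            (model (K.halfTwist i) k (u, 0)).2 = 0 := by
        rw [modelStrand, mem_ofPred_eq, hslide, eta_zero]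
        simp only [strandX, strandZ]
        norm_num
      rw [hstr, model_radius, hslide]
      simp only [lift_zero, true_and]
      by_cases ht0 : u.2 = 0
      · have hrad : u.1 ^ 2 + slitHeight u.1 |u.2| ^ 2 = 9 / 16 := by
          rw [← hgt_sq hx, ht0]; simp [slitHeight]
        exact iff_of_true (Or.inr hrad) (Or.inr ⟨ht0, hx⟩)
      · have hrad : u.1 ^ 2 + slitHeight u.1 |u.2| ^ 2 ≠ 9 / 16 := by
          have hw0 : 0 < wid u.1 := (abs_pos.2 ht0).trans_le ht
          have h1 : slitHeight u.1 |u.2| < hgt u.1 := by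
            refine mul_lt_of_lt_one_right (hgt_pos_iff.2 (wid_pos_iff.1 hw0)) ?_
            exact max_lt one_pos (by have := div_pos (abs_pos.2 ht0) hw0; linarith)
          exact ((lt_hgt_iff (slitHeight_nonneg _ _)).1 h1).ne
        rw [or_iff_left hrad, or_iff_left (fun h => ht0 h.1)]
        obtain ⟨b, hb⟩ : ∃ b : Bool, 0 < sgn b * u.2 := by
          rcases lt_or_gt_of_ne ht0 with h | h
          · exact ⟨false, by simp [sgn]; linarith⟩
          · exact ⟨true, by simpa [sgn]⟩
        rw [show (u, (0 : ℝ)) = ((u.1, u.2), 0) from rfl, model_hexagon hb ht]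
        set c := (if b then turn (K.halfTwist i) else 1) with hc
        obtain ⟨d, hd⟩ : ∃ d, c = sgn d := by
          cases b
          · exact ⟨true, by simp [hc, sgn]⟩
          · simpa [hc] using turn_eq_sgn _
        simp only [hd]
        constructor
        · rintro ⟨b', h1, h2⟩
          obtain ⟨d', hd'⟩ := sgn_mul_sgn d b'
          have h3 : u.1 = sgn d' / 2 := by
            have := sgn_sq d
            rw [← hd']
            linear_combination sgn d * h1 - u.1 * this
          refine ⟨⟨d', h3⟩, ?_⟩
          have h4 : slitHeight u.1 |u.2| = 0 := by
            simpa [sgn_ne_zero] using h2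
          by_contra! h5
          rw [← hhalf d', ← h3] at h5
          exact (slitHeight_pos (abs_nonneg _) h5).ne' h4
        · rintro ⟨⟨b', h1⟩, h2⟩
          obtain ⟨d', hd'⟩ := sgn_mul_sgn d b'
          refine ⟨d', by rw [h1, ← hd']; ring, ?_⟩
          rw [slitHeight_of_ge (by rw [h1, hhalf]; exact h2)]
          simp
    · have hD : model (K.halfTwist i) k (u, z) ∉ modelDisk := by
        rwa [model_mem_modelDisk_iff hz]
      have hcirc : ¬ ((model (K.halfTwist i) k (u, z)).1.2 = 0 ∧
          (model (K.halfTwist i) k (u, z)).1.1 ^ 2 + (model (K.halfTwist i) k (u, z)).2 ^ 2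
            = 9 / 16) := fun h => hD ⟨h.1, h.2.le⟩
      rw [or_iff_left hcirc]
      have hright : (z = 0 ∧ (((∃ b, u.1 = sgn b / 2) ∧ 2 / 3 ≤ |u.2|) ∨
          (u.2 = 0 ∧ |u.1| ≤ 3 / 4))) ↔ z = 0 ∧ ∃ b, u.1 = sgn b / 2 := by
        refine and_congr_right fun h0 => ?_
        rw [or_iff_left]
        · constructor
          · exact fun h => h.1
          · rintro ⟨b, hb⟩
            refine ⟨⟨b, hb⟩, ?_⟩
            by_contra! hc
            refine hH ⟨h0, ?_, ?_⟩
            · show |u.1| ≤ 3 / 4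
              rw [hb, abs_div, abs_sgn]; norm_num
            · show |u.2| ≤ wid u.1
              rw [hb, hhalf]; exact hc.le
        · rintro ⟨h1, h2⟩
          refine hH ⟨h0, h2, ?_⟩
          show |u.2| ≤ wid u.1
          rw [h1, abs_zero]; exact wid_nonneg _
      rw [hright]
      have hunt := untwist_model (n := K.halfTwist i) (k := k) hz hH
      by_cases hs : (model (K.halfTwist i) k (u, z)).1.2 = 0
      · refine iff_of_false ?_ ?_
        · rintro ⟨b, h1, h2⟩
          rw [hs, eta_zero] at h1 h2
          refine hD ⟨hs, ?_⟩
          rw [h1, h2, strandX, strandZ]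
          norm_num
          have := hhalfsq b
          linarith
        · rintro ⟨h0, b, hb⟩
          refine hD ⟨hs, ?_⟩
          rw [model_radius, (lift_eq_zero_iff hz hH).2 h0]
          have := hhalfsq b
          simp only [hb]
          linarith
      · rw [mem_modelStrand_iff hs, hunt]
        simp only [Prod.mk.injEq, mul_eq_zero, sgn_ne_zero, false_or, lift_eq_zero_iff hz hH]
        tauto
  · rw [unfold_of_notMem K k z hn, link_of_notMem K hn, mul_eq_zero, or_iff_right (sgn_ne_zero k)]
    have : p ∈ K.strands ∪ ⋃ i, K.slot i ↔ ∃ e, p ∈ K.core e := by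
      constructor
      · rintro ((h | ⟨j, b, t, h1, h2, h3⟩) | h)
        · exact mem_iUnion.1 h
        · exact absurd ⟨_, mem_square.2 ⟨by simp only [abs_div, abs_sgn]; norm_num, h2⟩, h3.symm⟩
            (hn j)
        · obtain ⟨j, x, h1, h2⟩ := mem_iUnion.1 h
          exact absurd ⟨_, mem_square.2 ⟨by simp only; linarith, by simp⟩, h2.symm⟩ (hn j)
      · exact fun h => Or.inl (Or.inl (mem_iUnion.2 h))
    rw [this, and_comm]

end TwistDiagram

namespace TwistDiagram

variable (K : TwistDiagram)

/-- Close to a slot, the unfolded points are close to the crossing circle. -/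
theorem exists_tendsto_unfold_of_slot (k : Bool) {U : Ultrafilter (Torus × ℝ)} {i : K.Twist}
    {p : Torus} (hp : p ∈ K.slot i) (hU : ↑U ≤ 𝓝 (p, (0 : ℝ)))
    (hz : ∀ᶠ q : Torus × ℝ in (U : Filter (Torus × ℝ)), 0 ≤ q.2) :
    ∃ l ∈ K.circle i, Tendsto (fun q : Torus × ℝ => K.unfold k q.2 q.1) U (𝓝 l) := by
  obtain ⟨x, hx, rfl⟩ := hp
  have hβ := K.isSquareFamily_chart
  have hxs : ((x, 0) : ℝ × ℝ) ∈ openSquare := mem_openSquare.2 ⟨by simp only; linarith, by simp⟩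
  -- `σ` takes a point to its coordinates in the box
  let σ : Torus × ℝ → (ℝ × ℝ) × ℝ := fun q => (Function.invFunOn (K.chart i) square q.1, q.2)
  have hV : K.chart i '' square ∈ 𝓝 (K.chart i (x, 0)) :=
    mem_of_superset ((hβ.isOpen_image i isOpen_openSquare openSquare_subset).mem_nhds
      ⟨_, hxs, rfl⟩) (image_mono openSquare_subset)
  have hσ : Tendsto σ U (𝓝 ((x, 0), 0)) := by
    have h1 : ContinuousAt (Function.invFunOn (K.chart i) square) (K.chart i (x, 0)) :=
      (hβ.continuousOn_invFunOn i).continuousAt hV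
    have h2 : Tendsto (fun q : Torus × ℝ => Function.invFunOn (K.chart i) square q.1)
        (𝓝 (K.chart i (x, 0), 0)) (𝓝 (x, 0)) := by
      have h3 := (hβ.injOn i).leftInvOn_invFunOn (openSquare_subset hxs)
      rw [ContinuousAt, h3] at h1
      exact h1.comp (continuous_fst.tendsto _)
    exact ((h2.prodMk_nhds (continuous_snd.tendsto _)).mono_left hU)
  have hev : ∀ᶠ q : Torus × ℝ in (U : Filter (Torus × ℝ)),
      q.1 ∈ K.chart i '' square ∧ 0 ≤ q.2 ∧ q.2 < 1 := by
    have h1 : ∀ᶠ q in (U : Filter (Torus × ℝ)), q.1 ∈ K.chart i '' square :=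
      hU ((continuous_fst.tendsto _) hV)
    have h2 : ∀ᶠ q in (U : Filter (Torus × ℝ)), q.2 < 1 :=
      hU ((continuous_snd.tendsto (K.chart i (x, 0), (0 : ℝ))) (gt_mem_nhds one_pos))
    filter_upwards [h1, h2, hz] with q h1 h2 h3 using ⟨h1, h3, h2⟩
  have hσs : ∀ q : Torus × ℝ, q.1 ∈ K.chart i '' square → (σ q).1 ∈ square ∧
      K.chart i (σ q).1 = q.1 := fun q hq =>
    ⟨Function.invFunOn_mem hq, Function.invFunOn_eq hq⟩
  let M := fun q => model (K.halfTwist i) k (σ q)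
  have hMc : ∀ᶠ q in (U : Filter (Torus × ℝ)), M q ∈ square ×ˢ Icc (-1 : ℝ) 1 := by
    filter_upwards [hev] with q ⟨h1, h2, h3⟩
    exact ⟨model_fst_mem (hσs q h1).1 h2, abs_le.1 (abs_model_snd_lt (hσs q h1).1 h2 h3).le⟩
  -- `model` is not continuous at the slot, but along the ultrafilter it converges to some `m`, and
  -- two continuous quantities show that `m` is on the crossing circle
  obtain ⟨m, hm, hUm⟩ := (isCompact_square.prod isCompact_Icc).ultrafilter_le_nhds (U.map M)
    (le_principal_iff.2 hMc)
  have hM : Tendsto M U (𝓝 m) := hUm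
  have hσ' : Tendsto σ U (𝓝[{q | 0 ≤ q.2}] ((x, 0), 0)) :=
    tendsto_nhdsWithin_iff.2 ⟨hσ, hev.mono fun q h => h.2.1⟩
  have hslide : m.1.2 = 0 := by
    have h1 : Tendsto (fun q => (M q).1.2) U (𝓝 m.1.2) :=
      ((continuous_snd.comp continuous_fst).tendsto m).comp hM
    have h2 := (continuousOn_slide ((x, 0), 0) (by simp)).tendsto.comp hσ'
    have h3 := tendsto_nhds_unique h1 h2
    rw [h3]
    exact slide_zero le_rfl
  have hrad : m.1.1 ^ 2 + m.2 ^ 2 = 9 / 16 := by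
    have h0 : Continuous fun w : (ℝ × ℝ) × ℝ => w.1.1 ^ 2 + w.2 ^ 2 := by fun_prop
    have h1 : Tendsto (fun q => (M q).1.1 ^ 2 + (M q).2 ^ 2) U (𝓝 (m.1.1 ^ 2 + m.2 ^ 2)) :=
      (h0.tendsto m).comp hM
    have h00 : Continuous fun w : (ℝ × ℝ) × ℝ => w.1.1 ^ 2 + lift w.1.1 w.1.2 w.2 ^ 2 := by
      have := continuous_lift
      fun_prop
    have h2 := (h00.tendsto ((x, 0), 0)).comp hσ
    simp only [M, model_radius] at h1
    rw [tendsto_nhds_unique h1 h2, ← model_radius 0 k ((x, 0), 0)]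
    exact model_seam hx
  refine ⟨(K.chart i m.1, m.2), ⟨m.1.1, ?_, hrad⟩, ?_⟩
  · show K.chart i m.1 = _
    rw [← hslide]
  · have h1 : Tendsto (fun q => K.chart i (M q).1) U (𝓝 (K.chart i m.1)) := by
      refine ((hβ.cont i) m.1 hm.1).tendsto.comp (tendsto_nhdsWithin_iff.2
        ⟨(continuous_fst.tendsto m).comp hM, hMc.mono fun q h => h.1⟩)
    refine (h1.prodMk_nhds ((continuous_snd.tendsto m).comp hM)).congr' ?_
    filter_upwards [hev] with q ⟨hq, _⟩
    obtain ⟨h2, h3⟩ := hσs q hq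
    conv_rhs => rw [← h3, unfold_chart K k q.2 i h2]
    rfl

theorem finite_arc : Finite K.Arc := by
  have := K.twist_finite
  exact Finite.of_injective (fun e => K.ends (e, true)) fun e e' h =>
    congrArg Prod.fst (K.ends.injective h)

theorem isClosed_core (e : K.Arc) : IsClosed (K.core e) := by
  refine (isCompact_Icc.image_of_continuousOn ?_).isClosed
  refine (K.band_cont e).comp (by fun_prop) fun s hs => ?_
  exact mem_square.2 ⟨by simp, abs_le.2 hs⟩

/-! ### The squares around the strands and the slots -/

/-- The band around an arc, prolonged into the boxes at its ends. The second coordinate is rescaled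
so that the band proper is `|u.2| ≤ 1 / 2`, and `|u.2| = 3 / 4`, where the seam ends, is sent to
`|t| = 2 / 3`, which is a corner of the hexagon. -/
noncomputable def longBand (e : K.Arc) (u : ℝ × ℝ) : Torus :=
  if |u.2| ≤ 1 / 2 then K.band e (u.1, 2 * u.2) else
    K.chart (K.ends (e, decide (0 < u.2))).1
      (sgn (K.ends (e, decide (0 < u.2))).2.1 / 2 + sgn (K.flip (e, decide (0 < u.2))) * u.1 / 4,
        sgn (K.ends (e, decide (0 < u.2))).2.2 * (5 / 3 - 4 / 3 * |u.2|))

/-- The squares whose seams are collapsed to the vertices of the graph: one around each strand, and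
one around each slot. -/
noncomputable def seamChart : K.Arc ⊕ K.Twist → ℝ × ℝ → Torus :=
  Sum.elim K.longBand fun i u => K.chart i (u.2, u.1 / 4)

theorem sgn_decide_mul_abs (s : ℝ) : sgn (decide (0 < s)) * |s| = s := by
  by_cases h : 0 < s
  · simp [sgn, h, abs_of_pos h]
  · simp [sgn, h, abs_of_nonpos (not_lt.1 h)]

theorem longBand_of_ge {e : K.Arc} {u : ℝ × ℝ} (hu : |u.1| ≤ 1) (h : 1 / 2 ≤ |u.2|) :
    K.longBand e u = K.chart (K.ends (e, decide (0 < u.2))).1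
      (sgn (K.ends (e, decide (0 < u.2))).2.1 / 2 + sgn (K.flip (e, decide (0 < u.2))) * u.1 / 4,
        sgn (K.ends (e, decide (0 < u.2))).2.2 * (5 / 3 - 4 / 3 * |u.2|)) := by
  by_cases h1 : |u.2| ≤ 1 / 2
  · have h2 : |u.2| = 1 / 2 := le_antisymm h1 h
    have h3 : 2 * u.2 = sgn (decide (0 < u.2)) := by
      have := sgn_decide_mul_abs u.2
      rw [h2] at this
      linarith
    rw [longBand, if_pos h1, h3, K.band_end e _ _ (abs_le.1 hu), h2, chart]
    congr 2
    rw [show (5 / 3 - 4 / 3 * (1 / 2) : ℝ) = 1 by norm_num, mul_one, eta_sgn]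
  · rw [longBand, if_neg h1]

theorem longBand_coord_mem {b c : Bool} {d : Bool} {x s : ℝ} (hx : |x| ≤ 1) (hs : 1 / 2 ≤ |s|)
    (hs1 : |s| ≤ 1) : (sgn b / 2 + sgn d * x / 4, sgn c * (5 / 3 - 4 / 3 * |s|)) ∈ square := by
  rw [mem_square]
  constructor
  · refine (abs_add_le _ _).trans ?_
    rw [abs_div, abs_div, abs_mul, abs_sgn, abs_sgn, one_mul, abs_of_pos (by norm_num : (0:ℝ) < 2),
      abs_of_pos (by norm_num : (0:ℝ) < 4)]
    linarith
  · simp only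
    rw [abs_mul, abs_sgn, one_mul, abs_le]
    constructor <;> linarith

theorem longBand_notMem {e : K.Arc} {u : ℝ × ℝ} (hu : |u.1| ≤ 1) (h : |u.2| < 1 / 2) (i : K.Twist) :
    K.longBand e u ∉ K.chart i '' square := by
  rw [longBand, if_pos h.le, chart_image_square]
  refine K.band_box e i _ (abs_le.1 hu) _ ?_
  rw [abs_lt] at h
  constructor <;> linarith

/-- The formulas on the band and on its two prolongations are continuous on closed sets. -/
theorem continuousOn_longBand (e : K.Arc) : ContinuousOn (K.longBand e) square := by
  have h0 : ContinuousOn (K.longBand e) (square ∩ {u | |u.2| ≤ 1 / 2}) := by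
    have h1 : ContinuousOn (fun u : ℝ × ℝ => K.band e (u.1, 2 * u.2))
        (square ∩ {u | |u.2| ≤ 1 / 2}) := by
      refine (K.band_cont e).comp (by fun_prop) ?_
      rintro u ⟨hu, h⟩
      have h' : |u.2| ≤ 1 / 2 := h
      rw [mem_square] at *
      refine ⟨hu.1, ?_⟩
      rw [abs_mul, abs_of_pos (by norm_num : (0:ℝ) < 2)]
      linarith
    refine h1.congr fun u hu => ?_
    have h' : |u.2| ≤ 1 / 2 := hu.2
    rw [longBand, if_pos h']
  have hend : ∀ b : Bool, ContinuousOn (K.longBand e)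
      (square ∩ {u | 1 / 2 ≤ sgn b * u.2}) := by
    intro b
    have hb : ∀ u : ℝ × ℝ, u ∈ {u : ℝ × ℝ | 1 / 2 ≤ sgn b * u.2} →
        decide (0 < u.2) = b ∧ 1 / 2 ≤ |u.2| := by
      intro u hu
      have hu' : 1 / 2 ≤ sgn b * u.2 := hu
      refine ⟨?_, ?_⟩
      · cases b
        · simp only [sgn, Bool.false_eq_true, if_false] at hu'
          simp only [decide_eq_false_iff_not, not_lt]; linarith
        · simp only [sgn, if_true] at hu'
          simp only [decide_eq_true_eq]; linarith
      · have := le_abs_self (sgn b * u.2)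
        rw [abs_mul, abs_sgn, one_mul] at this
        linarith
    have h1 : ContinuousOn (fun u : ℝ × ℝ => K.chart (K.ends (e, b)).1
        (sgn (K.ends (e, b)).2.1 / 2 + sgn (K.flip (e, b)) * u.1 / 4,
          sgn (K.ends (e, b)).2.2 * (5 / 3 - 4 / 3 * |u.2|)))
        (square ∩ {u | 1 / 2 ≤ sgn b * u.2}) := by
      refine (K.isSquareFamily_chart.cont _).comp (by fun_prop) ?_
      rintro u ⟨hu, h⟩
      rw [mem_square] at hu
      exact longBand_coord_mem hu.1 (hb u h).2 hu.2
    refine h1.congr ?_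
    rintro u ⟨hu, h⟩
    have := K.longBand_of_ge (e := e) (mem_square.1 hu).1 (hb u h).2
    rw [(hb u h).1] at this
    exact this
  have hcover : square = ((square ∩ {u : ℝ × ℝ | |u.2| ≤ 1 / 2}) ∪
      (square ∩ {u | 1 / 2 ≤ sgn true * u.2})) ∪ (square ∩ {u | 1 / 2 ≤ sgn false * u.2}) := by
    rw [← inter_union_distrib_left, ← inter_union_distrib_left, eq_comm, inter_eq_left]
    intro u _
    rcases le_total |u.2| (1 / 2) with h | h
    · exact Or.inl (Or.inl h)
    · rcases le_abs.1 h with h | h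
      · exact Or.inl (Or.inr (by simpa [sgn] using h))
      · exact Or.inr (by simpa [sgn] using h)
  have hsq : IsClosed square := isCompact_square.isClosed
  have hc0 : IsClosed (square ∩ {u : ℝ × ℝ | |u.2| ≤ 1 / 2}) :=
    hsq.inter (isClosed_le (by fun_prop) (by fun_prop))
  have hc : ∀ b, IsClosed (square ∩ {u : ℝ × ℝ | 1 / 2 ≤ sgn b * u.2}) := fun b =>
    hsq.inter (isClosed_le (by fun_prop) (by fun_prop))
  rw [hcover]
  exact (h0.union_of_isClosed (hend true) hc0 (hc true)).union_of_isClosed (hend false)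
    (hc0.union (hc true)) (hc false)

theorem isSquareFamily_seamChart : IsSquareFamily K.seamChart where
  finite := by
    have := K.twist_finite
    have := K.finite_arc
    infer_instance
  cont := by
    rintro (e | i)
    · exact K.continuousOn_longBand e
    · refine (K.isSquareFamily_chart.cont i).comp (by fun_prop) fun u hu => ?_
      rw [mem_square] at *
      refine ⟨hu.2, ?_⟩
      rw [abs_div, abs_of_pos (by norm_num : (0:ℝ) < 4)]
      linarith
  inj := by
    have htw : ∀ u ∈ square, ((u.2, u.1 / 4) : ℝ × ℝ) ∈ square := by
      intro u hu
      rw [mem_square] at *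
      refine ⟨hu.2, ?_⟩
      rw [abs_div, abs_of_pos (by norm_num : (0:ℝ) < 4)]
      linarith
    -- the prolonged bands stay away from the slots
    have hcross : ∀ e i, ∀ u ∈ square, ∀ v ∈ square,
        K.longBand e u ≠ K.chart i (v.2, v.1 / 4) := by
      intro e i u hu v hv h
      have hu' := mem_square.1 hu
      have hv' := mem_square.1 hv
      rcases lt_or_ge |u.2| (1 / 2) with h1 | h1
      · exact K.longBand_notMem hu'.1 h1 i ⟨_, htw v hv, h.symm⟩
      · rw [K.longBand_of_ge hu'.1 h1] at h
        obtain ⟨-, h2⟩ := K.isSquareFamily_chart.inj _ _ _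
          (longBand_coord_mem hu'.1 h1 hu'.2) _ (htw v hv) h
        have h3 := congrArg abs (Prod.mk.inj h2).2
        rw [abs_mul, abs_sgn, one_mul, abs_of_nonneg (by linarith), abs_div,
          abs_of_pos (by norm_num : (0:ℝ) < 4)] at h3
        linarith
    -- two prolonged bands meet neither in the middle nor in a box, as ports have only one band each
    rintro (e | i) (e' | i') u hu v hv h
    · have h : K.longBand e u = K.longBand e' v := h
      have hu' := mem_square.1 hu
      have hv' := mem_square.1 hv
      rcases lt_or_ge |u.2| (1 / 2) with h1 | h1 <;> rcases lt_or_ge |v.2| (1 / 2) with h2 | h2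
      · rw [longBand, longBand, if_pos h1.le, if_pos h2.le] at h
        have hm : ∀ w ∈ square, |w.2| < 1 / 2 → ((w.1, 2 * w.2) : ℝ × ℝ) ∈ square := by
          intro w hw h
          rw [mem_square] at *
          refine ⟨hw.1, ?_⟩
          rw [abs_mul, abs_of_pos (by norm_num : (0:ℝ) < 2)]
          linarith
        obtain ⟨h3, h4⟩ := K.band_inj e e' _ (hm u hu h1) _ (hm v hv h2) h
        obtain ⟨h5, h6⟩ := Prod.mk.inj h4
        exact ⟨by rw [h3], Prod.ext h5 (by linarith)⟩
      · refine absurd ?_ (K.longBand_notMem (e := e) hu'.1 h1 (K.ends (e', decide (0 < v.2))).1)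
        rw [h, K.longBand_of_ge hv'.1 h2]
        exact ⟨_, longBand_coord_mem hv'.1 h2 hv'.2, rfl⟩
      · refine absurd ?_ (K.longBand_notMem (e := e') hv'.1 h2 (K.ends (e, decide (0 < u.2))).1)
        rw [← h, K.longBand_of_ge hu'.1 h1]
        exact ⟨_, longBand_coord_mem hu'.1 h1 hu'.2, rfl⟩
      · rw [K.longBand_of_ge hu'.1 h1, K.longBand_of_ge hv'.1 h2] at h
        obtain ⟨h3, h4⟩ := K.isSquareFamily_chart.inj _ _ _
          (longBand_coord_mem hu'.1 h1 hu'.2) _ (longBand_coord_mem hv'.1 h2 hv'.2) h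
        obtain ⟨h5, h6⟩ := Prod.mk.inj h4
        have habs : |u.2| = |v.2| := by
          have := congrArg abs h6
          rw [abs_mul, abs_mul, abs_sgn, abs_sgn, one_mul, one_mul,
            abs_of_nonneg (by linarith : (0 : ℝ) ≤ 5 / 3 - 4 / 3 * |u.2|),
            abs_of_nonneg (by linarith : (0 : ℝ) ≤ 5 / 3 - 4 / 3 * |v.2|)] at this
          linarith
        have hsgn : Function.Injective sgn := by
          intro a b
          cases a <;> cases b <;> norm_num [sgn]
        have h7 : (K.ends (e, decide (0 < u.2))).2.2 = (K.ends (e', decide (0 < v.2))).2.2 := by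
          rw [habs] at h6
          exact hsgn (mul_right_cancel₀ (by linarith : (5 / 3 - 4 / 3 * |v.2|) ≠ 0) h6)
        have h8 : (K.ends (e, decide (0 < u.2))).2.1 = (K.ends (e', decide (0 < v.2))).2.1 := by
          have hb1 : |sgn (K.flip (e, decide (0 < u.2))) * u.1| ≤ 1 := by
            rw [abs_mul, abs_sgn, one_mul]; exact hu'.1
          have hb2 : |sgn (K.flip (e', decide (0 < v.2))) * v.1| ≤ 1 := by
            rw [abs_mul, abs_sgn, one_mul]; exact hv'.1
          rw [abs_le] at hb1 hb2
          revert h5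
          generalize (K.ends (e, decide (0 < u.2))).2.1 = a
          generalize (K.ends (e', decide (0 < v.2))).2.1 = b
          intro h5
          cases a <;> cases b <;>
            simp only [sgn, Bool.false_eq_true, if_false, if_true] at h5 hb1 hb2 ⊢ <;>
            exfalso <;> linarith
        obtain ⟨h9, h10⟩ := Prod.mk.inj (K.ends.injective (Prod.ext h3 (Prod.ext h8 h7)))
        subst h9
        refine ⟨rfl, Prod.ext ?_ ?_⟩
        · rw [h10] at h5
          have := sgn_ne_zero (K.flip (e, decide (0 < v.2)))
          refine mul_left_cancel₀ this ?_
          linarith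
        · rw [← sgn_decide_mul_abs u.2, ← sgn_decide_mul_abs v.2, h10, habs]
    · exact absurd h (hcross e i' u hu v hv)
    · exact absurd h.symm (hcross e' i v hv u hu)
    · obtain ⟨h1, h2⟩ := K.isSquareFamily_chart.inj _ _ _ (htw u hu) _ (htw v hv) h
      obtain ⟨h3, h4⟩ := Prod.mk.inj h2
      exact ⟨by rw [h1], Prod.ext (by linarith) h3⟩

/-- The band that ends in a port. -/
def portArc (i : K.Twist) (l b : Bool) : K.Arc := (K.ends.symm (i, l, b)).1

theorem seam_inr (i : K.Twist) : seam K.seamChart (Sum.inr i) = K.slot i := by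
  ext p
  constructor
  · rintro ⟨u, ⟨h1, h2⟩, rfl⟩
    refine ⟨u.2, h2, ?_⟩
    show K.chart i (u.2, u.1 / 4) = _
    rw [h1, zero_div]
  · rintro ⟨x, hx, rfl⟩
    refine ⟨(0, x), ⟨rfl, hx⟩, ?_⟩
    show K.chart i (x, 0 / 4) = _
    rw [zero_div]

theorem sgn_exists (t : ℝ) : ∃ b, t = sgn b * |t| := ⟨_, (sgn_decide_mul_abs t).symm⟩

/-- The part of a strand between a port and the hexagon belongs to the seam of the band at the
port. -/
theorem strand_mem_seam (i : K.Twist) (l b : Bool) {t : ℝ} (ht : 2 / 3 ≤ t) (ht1 : t ≤ 1) :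
    K.chart i (sgn l / 2, sgn b * t) ∈ seam K.seamChart (Sum.inl (K.portArc i l b)) := by
  set a := K.ends.symm (i, l, b) with ha
  have hs : |sgn a.2 * (3 / 4 * (5 / 3 - t))| = 3 / 4 * (5 / 3 - t) := by
    rw [abs_mul, abs_sgn, one_mul, abs_of_nonneg (by linarith)]
  refine ⟨(0, sgn a.2 * (3 / 4 * (5 / 3 - t))), ⟨rfl, ?_⟩, ?_⟩
  · rw [hs]; linarith
  · have hd : decide (0 < sgn a.2 * (3 / 4 * (5 / 3 - t))) = a.2 := by
      cases h : a.2
      · simp only [sgn]; norm_num; linarith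
      · simp only [sgn, decide_eq_true_eq]; norm_num; linarith
    show K.longBand a.1 _ = _
    rw [K.longBand_of_ge (by simp) (by rw [hs]; linarith)]
    simp only [hd, hs, Prod.mk.eta]
    rw [ha, K.ends.apply_symm_apply]
    congr 2
    · ring
    · ring

/-- The arcs that are collapsed to vertices are the strands that the hexagons leave, and the
slots. -/
theorem iUnion_seam : ⋃ j, seam K.seamChart j = K.strands ∪ ⋃ i, K.slot i := by
  ext p
  constructor
  · intro h
    obtain ⟨j, hj⟩ := mem_iUnion.1 h
    rcases j with e | i
    · left
      obtain ⟨u, ⟨h1, h2⟩, rfl⟩ := hj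
      show K.longBand e u ∈ _
      rcases lt_or_ge |u.2| (1 / 2) with h3 | h3
      · refine Or.inl (mem_iUnion.2 ⟨e, 2 * u.2, ?_, ?_⟩)
        · rw [abs_lt] at h3; constructor <;> linarith
        · show K.band e (0, 2 * u.2) = _
          rw [longBand, if_pos h3.le, h1]
      · refine Or.inr ⟨(K.ends (e, decide (0 < u.2))).1, (K.ends (e, decide (0 < u.2))).2.1,
          sgn (K.ends (e, decide (0 < u.2))).2.2 * (5 / 3 - 4 / 3 * |u.2|), ?_, ?_, ?_⟩
        · rw [abs_mul, abs_sgn, one_mul, abs_of_nonneg] <;> linarith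
        · rw [abs_mul, abs_sgn, one_mul, abs_of_nonneg] <;> linarith
        · rw [K.longBand_of_ge (by simp [h1]) h3, h1]
          simp
    · right
      rw [seam_inr] at hj
      exact mem_iUnion.2 ⟨i, hj⟩
  · rintro ((h | ⟨i, l, t, h1, h2, rfl⟩) | h)
    · obtain ⟨e, s, hs, rfl⟩ := mem_iUnion.1 h
      have hs' : |s / 2| ≤ 1 / 2 := by
        have := abs_le.2 hs
        rw [abs_div, abs_of_pos (by norm_num : (0:ℝ) < 2)]; linarith
      refine mem_iUnion.2 ⟨Sum.inl e, (0, s / 2), ⟨rfl, by simp only; linarith⟩, ?_⟩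
      show K.longBand e _ = K.band e (0, s)
      rw [longBand, if_pos hs']
      congr 2
      ring
    · obtain ⟨b, hb⟩ := sgn_exists t
      rw [hb]
      exact mem_iUnion.2 ⟨_, K.strand_mem_seam i l b h1 h2⟩
    · obtain ⟨i, hi⟩ := mem_iUnion.1 h
      refine mem_iUnion.2 ⟨Sum.inr i, ?_⟩
      rwa [seam_inr]

end TwistDiagram

/-! ### Open disks and components -/

/-- A clopen part of a space contains the components of its points. -/
theorem connectedComponentIn_eq_of_isOpen {X : Type*} [TopologicalSpace X] {A U : Set X}
    (hAU : A ⊆ U) (hA : IsOpen A) (hU : IsOpen (U \ A)) {x : X} (hx : x ∈ A) :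
    connectedComponentIn U x = connectedComponentIn A x := by
  refine Subset.antisymm ?_ (connectedComponentIn_mono x hAU)
  refine isPreconnected_connectedComponentIn.subset_connectedComponentIn
    (mem_connectedComponentIn (hAU hx)) ?_
  refine isPreconnected_connectedComponentIn.subset_left_of_subset_union hA hU
    disjoint_sdiff_right ?_ ⟨x, mem_connectedComponentIn (hAU hx), hx⟩
  rw [union_sdiff_cancel hAU]
  exact connectedComponentIn_subset U x

/-- An injective map that is continuous and open on `U` restricts to homeomorphisms of the subsets
of `U` with their images. -/
theorem nonempty_homeomorph_image {X Y : Type*} [TopologicalSpace X] [TopologicalSpace Y]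
    {g : X → Y} {U : Set X} (hU : IsOpen U) (hg : ContinuousOn g U) (hinj : InjOn g U)
    (hopen : ∀ V ⊆ U, IsOpen V → IsOpen (g '' V)) {A : Set X} (hA : A ⊆ U) :
    Nonempty (A ≃ₜ g '' A) := by
  let e : A ≃ g '' A := Equiv.Set.imageOfInjOn g A (hinj.mono hA)
  refine ⟨e.toHomeomorphOfContinuousOpen ?_ ?_⟩
  · exact Continuous.subtype_mk (continuousOn_iff_continuous_domRestrict.1 (hg.mono hA)) _
  · rintro _ ⟨V, hV, rfl⟩
    refine ⟨g '' (V ∩ U), hopen _ inter_subset_right (hV.inter hU), ?_⟩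
    ext ⟨y, hy⟩
    constructor
    · rintro ⟨x, ⟨hxV, hxU⟩, hxy⟩
      obtain ⟨a, ha, rfl⟩ := hy
      obtain rfl := hinj hxU (hA ha) hxy
      exact ⟨⟨x, ha⟩, hxV, Subtype.ext rfl⟩
    · rintro ⟨a, haV, ha⟩
      exact ⟨a.1, ⟨haV, hA a.2⟩, congrArg Subtype.val ha⟩

/-- Bounded convex open sets of the plane are mapped to disks. -/
theorem isOpenDisk_image_of_convex {g : ℝ × ℝ → Torus} {U : Set (ℝ × ℝ)} (hU : IsOpen U)
    (hc : Convex ℝ U) (hb : Bornology.IsBounded U) (hne : U.Nonempty) (hg : ContinuousOn g U)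
    (hinj : InjOn g U) : IsOpenDisk (g '' U) := by
  obtain ⟨e1⟩ := nonempty_homeomorph_image hU hg hinj
    (fun V hV hVo => isOpen_image_of_injOn_plane hVo (hg.mono hV) (hinj.mono hV)) subset_rfl
  let L : (ℝ × ℝ) ≃L[ℝ] EuclideanSpace ℝ (Fin 2) := ContinuousLinearEquiv.ofFinrankEq (by simp)
  have hLo : IsOpen (L '' U) := L.toHomeomorph.isOpenMap U hU
  obtain ⟨h, hh, -⟩ := exists_homeomorph_image_interior_closure_frontier_eq_unitBall
    (s := L '' U) (hc.linear_image L.toLinearMap) (by rw [hLo.interior_eq]; exact hne.image _)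
    (L.lipschitz.isBounded_image hb)
  rw [hLo.interior_eq] at hh
  exact ⟨e1.symm.trans ((L.toHomeomorph.image U).trans ((h.image _).trans (.setCongr hh)))⟩

/-- If `g` embeds an open set `U` as a clopen part of `X`, all of whose components are disks, then
the components of `U` are disks. -/
theorem isOpenDisk_connectedComponentIn {g : Torus → Torus} {U X : Set Torus} (hU : IsOpen U)
    (hg : ContinuousOn g U) (hinj : InjOn g U) (hUX : g '' U ⊆ X) (hX : IsOpen (X \ g '' U))
    (hdisk : ∀ p ∈ X, IsOpenDisk (connectedComponentIn X p)) {x : Torus} (hx : x ∈ U) :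
    IsOpenDisk (connectedComponentIn U x) := by
  have hopen : ∀ V ⊆ U, IsOpen V → IsOpen (g '' V) := fun V hV hVo =>
    isOpen_image_of_injOn hVo (hg.mono hV) (hinj.mono hV)
  -- `g` is a homeomorphism from `U` to its image, so it maps components to components; a component
  -- of the image, which is clopen in `X`, is a component of `X`
  have himg : g '' connectedComponentIn U x = connectedComponentIn (g '' U) (g x) := by
    refine Subset.antisymm ?_ ?_
    · exact (isPreconnected_connectedComponentIn.image g
        (hg.mono (connectedComponentIn_subset U x))).subset_connectedComponentIn
        (mem_image_of_mem g (mem_connectedComponentIn hx))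
        (image_mono (connectedComponentIn_subset U x))
    -- the inverse is continuous because `g` is open
    · have hinv : ContinuousOn (Function.invFunOn g U) (g '' U) := by
        refine continuousOn_iff'.2 fun V hV => ⟨g '' (V ∩ U), hopen _ inter_subset_right
          (hV.inter hU), ?_⟩
        ext p
        constructor
        · rintro ⟨hp, u, hu, rfl⟩
          rw [mem_preimage, hinj.leftInvOn_invFunOn hu] at hp
          exact ⟨⟨u, ⟨hp, hu⟩, rfl⟩, u, hu, rfl⟩
        · rintro ⟨⟨u, hu, rfl⟩, -⟩
          refine ⟨?_, u, hu.2, rfl⟩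
          rw [mem_preimage, hinj.leftInvOn_invFunOn hu.2]
          exact hu.1
      have h1 := (isPreconnected_connectedComponentIn (F := g '' U) (x := g x)).image _
        (hinv.mono (connectedComponentIn_subset _ _))
      have h2 := h1.subset_connectedComponentIn (x := x) (F := U)
        ⟨g x, mem_connectedComponentIn ⟨x, hx, rfl⟩, hinj.leftInvOn_invFunOn hx⟩ (by
          rintro _ ⟨y, hy, rfl⟩
          have hy' : y ∈ g '' U := connectedComponentIn_subset _ _ hy
          exact Function.invFunOn_mem hy')
      intro y hy
      have hy' : y ∈ g '' U := connectedComponentIn_subset _ _ hy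
      exact ⟨_, h2 ⟨y, hy, rfl⟩, Function.invFunOn_eq hy'⟩
  obtain ⟨e⟩ := nonempty_homeomorph_image hU hg hinj hopen (connectedComponentIn_subset U x)
  rw [himg, ← connectedComponentIn_eq_of_isOpen hUX (hopen U subset_rfl hU) hX ⟨x, hx, rfl⟩] at e
  obtain ⟨e'⟩ := hdisk (g x) (hUX ⟨x, hx, rfl⟩)
  exact ⟨e.trans e'⟩

/-- A closed map is an embedding on a saturated set on which it is injective. -/
theorem isEmbedding_of_eq_preimage {X Y : Type*} [TopologicalSpace X] [TopologicalSpace Y]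
    {f : X → Y} (hf : Continuous f) (hcl : IsClosedMap f) {A : Set X} {B : Set Y} (h : A = f ⁻¹' B)
    (hinj : InjOn f A) : IsEmbedding fun a : A => f a := by
  subst h
  have h1 : IsClosedEmbedding (B.restrictPreimage f) :=
    .of_continuous_injective_isClosedMap hf.restrictPreimage
      (fun x y hxy => Subtype.ext (hinj x.2 y.2 (congrArg Subtype.val hxy)))
      (hcl.restrictPreimage B)
  exact IsEmbedding.subtypeVal.comp h1.isEmbedding

namespace IsSquareFamily

variable {J : Type} {β : J → ℝ × ℝ → Torus} (hβ : IsSquareFamily β)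

include hβ

theorem continuous_collapse_zero : Continuous (collapse β 0) := by
  have h : ContinuousOn (fun p : Torus => collapse β 0 p) univ :=
    hβ.continuousOn_collapse.comp (f := fun p : Torus => (p, (0 : ℝ))) (by fun_prop)
      fun p _ => le_refl (0 : ℝ)
  exact continuousOn_univ.1 h

theorem continuousOn_stretch_zero : ContinuousOn (stretch β 0) (range (node β))ᶜ :=
  hβ.continuousOn_stretch.comp (f := fun p : Torus => (p, (0 : ℝ))) (by fun_prop)
    fun p hp => ⟨le_refl (0 : ℝ), fun h => hp h.1⟩

theorem stretch_collapse_zero {p : Torus} (hp : p ∉ ⋃ j, seam β j) :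
    stretch β 0 (collapse β 0 p) = p := hβ.stretch_collapse le_rfl fun h => hp h.1

theorem collapse_mem_range_node {p : Torus} (hp : p ∈ ⋃ j, seam β j) :
    collapse β 0 p ∈ range (node β) := by
  obtain ⟨j, hj⟩ := mem_iUnion.1 hp
  exact ⟨j, ((hβ.collapse_eq_node_iff j).2 hj).symm⟩

theorem collapse_inj {p q : Torus} (hp : p ∉ ⋃ j, seam β j)
    (h : collapse β 0 q = collapse β 0 p) : q = p := by
  by_cases hq : q ∈ ⋃ j, seam β j
  · exact absurd (h ▸ hβ.collapse_mem_range_node hq) (hβ.collapse_notMem_range_node hp)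
  · rw [← hβ.stretch_collapse_zero hp, ← h, hβ.stretch_collapse_zero hq]

theorem exists_collapse_eq {p : Torus} (hp : p ∉ range (node β)) :
    ∃ q ∉ ⋃ j, seam β j, collapse β 0 q = p :=
  ⟨stretch β 0 p, hβ.stretch_notMem_seam hp, hβ.collapse_stretch le_rfl fun h => hp h.1⟩

theorem isClosed_range_node : IsClosed (range (node β)) := by
  have := hβ.finite
  exact (finite_range _).isClosed

theorem isOpen_collapse_image {A : Set Torus} (hA : IsOpen A) (hs : ∀ p ∈ A, p ∉ ⋃ j, seam β j) :
    IsOpen (collapse β 0 '' A) := by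
  have h : collapse β 0 '' A = (range (node β))ᶜ ∩ stretch β 0 ⁻¹' A := by
    ext p
    constructor
    · rintro ⟨q, hq, rfl⟩
      refine ⟨hβ.collapse_notMem_range_node (hs q hq), ?_⟩
      rwa [mem_preimage, hβ.stretch_collapse_zero (hs q hq)]
    · rintro ⟨h1, h2⟩
      exact ⟨_, h2, hβ.collapse_stretch le_rfl fun h => h1 h.1⟩
  rw [h]
  exact hβ.continuousOn_stretch_zero.isOpen_inter_preimage hβ.isClosed_range_node.isOpen_compl hA

end IsSquareFamily

/-! ### The white zone of a twist region -/

/-- The data of a part of a box that consists of the points to the left and to the right of the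
curves `x = ± side t`, and, between the ports, of the points below the curve `t = bot x` and
above the curve `t = top x`. The curves end in the ports, so that all profiles agree on the boundary
of the box, and the last two fields say that the parts are disjoint. -/
structure Profile where
  side : ℝ → ℝ
  bot : ℝ → ℝ
  top : ℝ → ℝ
  continuous_side : Continuous side
  continuous_bot : Continuous bot
  continuous_top : Continuous top
  side_nonneg : ∀ t, 0 ≤ side t
  side_lt : ∀ t, side t < 1
  side_of_abs_eq_one : ∀ t, |t| = 1 → side t = 1 / 2
  neg_one_lt_bot : ∀ x, |x| < 1 / 2 → -1 < bot x
  bot_le_top : ∀ x, |x| < 1 / 2 → bot x ≤ top x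
  top_lt_one : ∀ x, |x| < 1 / 2 → top x < 1
  lt_side_of_lt_bot : ∀ x t, |x| < 1 / 2 → |t| ≤ 1 → t < bot x → |x| < side t
  lt_side_of_top_lt : ∀ x t, |x| < 1 / 2 → |t| ≤ 1 → top x < t → |x| < side t

namespace Profile

variable (P Q : Profile)

/-- The part to the left and to the right. -/
def sideSet : Set (ℝ × ℝ) := {u | P.side u.2 < |u.1|}

/-- The part at the bottom. -/
def botSet : Set (ℝ × ℝ) := {u | |u.1| < 1 / 2 ∧ u.2 < P.bot u.1}

/-- The part at the top. -/
def topSet : Set (ℝ × ℝ) := {u | |u.1| < 1 / 2 ∧ P.top u.1 < u.2}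

/-- The part of the box described by a profile. -/
def zone : Set (ℝ × ℝ) := square ∩ (P.sideSet ∪ (P.botSet ∪ P.topSet))

theorem isOpen_sideSet : IsOpen P.sideSet :=
  isOpen_lt (P.continuous_side.comp continuous_snd) (by fun_prop)

theorem isOpen_botSet : IsOpen P.botSet := by
  unfold botSet
  exact (isOpen_lt (by fun_prop) (by fun_prop)).and
    (isOpen_lt (by fun_prop) (P.continuous_bot.comp continuous_fst))

theorem isOpen_topSet : IsOpen P.topSet := by
  unfold topSet
  exact (isOpen_lt (by fun_prop) (by fun_prop)).and
    (isOpen_lt (P.continuous_top.comp continuous_fst) (by fun_prop))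

theorem isClosed_diff_zone : IsClosed (square \ P.zone) := by
  rw [zone, sdiff_self_inter, sdiff_eq]
  exact isCompact_square.isClosed.inter
    (P.isOpen_sideSet.union (P.isOpen_botSet.union P.isOpen_topSet)).isClosed_compl

variable {P Q}

theorem notMem_sideSet_of_botSet {u : ℝ × ℝ} (hu : u ∈ square) (h : u ∈ P.botSet) :
    u ∉ P.sideSet :=
  fun h' => lt_asymm h' (P.lt_side_of_lt_bot _ _ h.1 (mem_square.1 hu).2 h.2)

theorem notMem_sideSet_of_topSet {u : ℝ × ℝ} (hu : u ∈ square) (h : u ∈ P.topSet) :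
    u ∉ P.sideSet :=
  fun h' => lt_asymm h' (P.lt_side_of_top_lt _ _ h.1 (mem_square.1 hu).2 h.2)

theorem notMem_botSet_of_topSet {u : ℝ × ℝ} (h : u ∈ P.topSet) : u ∉ P.botSet :=
  fun h' => lt_asymm h'.2 ((P.bot_le_top _ h.1).trans_lt h.2)

variable (P Q)

open Classical in
/-- The homeomorphism between the zones of two profiles that is linear on horizontal segments at
the sides, and on vertical segments at the bottom and at the top. -/
noncomputable def transfer (u : ℝ × ℝ) : ℝ × ℝ :=
  if u ∈ P.sideSet then
    (u.1 / |u.1| * (1 - (1 - |u.1|) * ((1 - Q.side u.2) / (1 - P.side u.2))), u.2)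
  else if u ∈ P.botSet then (u.1, -1 + (u.2 + 1) * ((1 + Q.bot u.1) / (1 + P.bot u.1)))
  else (u.1, 1 - (1 - u.2) * ((1 - Q.top u.1) / (1 - P.top u.1)))

variable {P Q}

theorem transfer_of_side {u : ℝ × ℝ} (h : u ∈ P.sideSet) : transfer P Q u =
    (u.1 / |u.1| * (1 - (1 - |u.1|) * ((1 - Q.side u.2) / (1 - P.side u.2))), u.2) := if_pos h

theorem transfer_of_bot {u : ℝ × ℝ} (hu : u ∈ square) (h : u ∈ P.botSet) : transfer P Q u =
    (u.1, -1 + (u.2 + 1) * ((1 + Q.bot u.1) / (1 + P.bot u.1))) := by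
  rw [transfer, if_neg (notMem_sideSet_of_botSet hu h), if_pos h]

theorem transfer_of_top {u : ℝ × ℝ} (hu : u ∈ square) (h : u ∈ P.topSet) : transfer P Q u =
    (u.1, 1 - (1 - u.2) * ((1 - Q.top u.1) / (1 - P.top u.1))) := by
  rw [transfer, if_neg (notMem_sideSet_of_topSet hu h), if_neg (notMem_botSet_of_topSet h)]

/-- On the segment from the curve to the side of the box, the distance from the side is scaled by
the quotient of the lengths. -/
theorem transfer_side {u : ℝ × ℝ} (hu : u ∈ square) (h : u ∈ P.sideSet) :
    transfer P Q u ∈ square ∧ transfer P Q u ∈ Q.sideSet ∧ transfer Q P (transfer P Q u) = u := by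
  obtain ⟨x, t⟩ := u
  have hu' := mem_square.1 hu
  have h' : P.side t < |x| := h
  have hx : x ≠ 0 := abs_pos.1 ((P.side_nonneg t).trans_lt h')
  have hP := P.side_lt t
  have hQ := Q.side_lt t
  simp only at hu'
  have hP' : 0 < 1 - P.side t := by linarith
  set κ := (1 - Q.side t) / (1 - P.side t) with hκ
  have hκ0 : 0 < κ := div_pos (by linarith) hP'
  have h1 : Q.side t < 1 - (1 - |x|) * κ := by
    have h2 : (1 - P.side t) * κ = 1 - Q.side t := by rw [hκ]; field_simp
    have h3 : (1 - |x|) * κ < (1 - P.side t) * κ := by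
      apply mul_lt_mul_of_pos_right _ hκ0
      linarith
    linarith
  have h0 : 0 < 1 - (1 - |x|) * κ := (Q.side_nonneg t).trans_lt h1
  have hle : 1 - (1 - |x|) * κ ≤ 1 := by
    have : 0 ≤ (1 - |x|) * κ := mul_nonneg (by linarith [hu'.1]) hκ0.le
    linarith
  have hnorm : |(x / |x|)| = 1 := by
    rw [abs_div, abs_abs]; exact div_self (abs_ne_zero.2 hx)
  have habs : |x / |x| * (1 - (1 - |x|) * κ)| = 1 - (1 - |x|) * κ := by
    rw [abs_mul, hnorm, one_mul, abs_of_pos h0]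
  have hmem : transfer P Q (x, t) ∈ Q.sideSet := by
    rw [transfer_of_side h]
    show Q.side t < |x / |x| * (1 - (1 - |x|) * κ)|
    rwa [habs]
  refine ⟨?_, hmem, ?_⟩
  · rw [transfer_of_side h, mem_square]
    exact ⟨by rw [habs]; exact hle, hu'.2⟩
  · rw [transfer_of_side hmem, transfer_of_side h]
    simp only
    rw [← hκ, habs, show (1 - P.side t) / (1 - Q.side t) = κ⁻¹ by rw [hκ, inv_div]]
    refine Prod.ext ?_ rfl
    simp only
    have : 1 - (1 - |x|) * κ ≠ 0 := h0.ne'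
    have hx' : |x| ≠ 0 := abs_ne_zero.2 hx
    rw [mul_div_assoc, div_self this, mul_one,
      show 1 - (1 - (1 - (1 - |x|) * κ)) * κ⁻¹ = |x| by field_simp; ring, div_mul_cancel₀ _ hx']

/-- On the segment from the bottom of the box to the curve, the distance from the bottom is scaled
by the quotient of the lengths. -/
theorem transfer_bot {u : ℝ × ℝ} (hu : u ∈ square) (h : u ∈ P.botSet) :
    transfer P Q u ∈ square ∧ transfer P Q u ∈ Q.botSet ∧ transfer Q P (transfer P Q u) = u := by
  obtain ⟨x, t⟩ := u
  have hu' := mem_square.1 hu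
  obtain ⟨hx, ht⟩ : |x| < 1 / 2 ∧ t < P.bot x := h
  have hP := P.neg_one_lt_bot x hx
  have hQ := Q.neg_one_lt_bot x hx
  have hQ1 := (Q.bot_le_top x hx).trans_lt (Q.top_lt_one x hx)
  simp only [abs_le] at hu'
  have hP' : 0 < 1 + P.bot x := by linarith
  set κ := (1 + Q.bot x) / (1 + P.bot x) with hκ
  have hκ0 : 0 < κ := div_pos (by linarith) hP'
  have h1 : -1 + (t + 1) * κ < Q.bot x := by
    have h2 : (1 + P.bot x) * κ = 1 + Q.bot x := by rw [hκ]; field_simp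
    have h3 : (t + 1) * κ < (1 + P.bot x) * κ := by
      apply mul_lt_mul_of_pos_right _ hκ0
      linarith
    linarith
  have h0 : 0 ≤ (t + 1) * κ := mul_nonneg (by linarith [hu'.2.1]) hκ0.le
  have hsq : transfer P Q (x, t) ∈ square := by
    rw [transfer_of_bot hu ⟨hx, ht⟩, mem_square, abs_le, abs_le]
    simp only [← hκ]
    exact ⟨hu'.1, by linarith, by linarith⟩
  have hmem : transfer P Q (x, t) ∈ Q.botSet := by
    rw [transfer_of_bot hu ⟨hx, ht⟩]
    exact ⟨hx, h1⟩
  refine ⟨hsq, hmem, ?_⟩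
  rw [transfer_of_bot hsq hmem, transfer_of_bot hu ⟨hx, ht⟩]
  simp only
  rw [← hκ, show (1 + P.bot x) / (1 + Q.bot x) = κ⁻¹ by rw [hκ, inv_div]]
  refine Prod.ext rfl ?_
  simp only
  field_simp
  ring

/-- On the segment from the curve to the top of the box, the distance from the top is scaled by the
quotient of the lengths. -/
theorem transfer_top {u : ℝ × ℝ} (hu : u ∈ square) (h : u ∈ P.topSet) :
    transfer P Q u ∈ square ∧ transfer P Q u ∈ Q.topSet ∧ transfer Q P (transfer P Q u) = u := by
  obtain ⟨x, t⟩ := u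
  have hu' := mem_square.1 hu
  obtain ⟨hx, ht⟩ : |x| < 1 / 2 ∧ P.top x < t := h
  have hP := P.top_lt_one x hx
  have hQ := Q.top_lt_one x hx
  have hQ1 := (Q.neg_one_lt_bot x hx).trans_le (Q.bot_le_top x hx)
  simp only [abs_le] at hu'
  have hP' : 0 < 1 - P.top x := by linarith
  set κ := (1 - Q.top x) / (1 - P.top x) with hκ
  have hκ0 : 0 < κ := div_pos (by linarith) hP'
  have h1 : Q.top x < 1 - (1 - t) * κ := by
    have h2 : (1 - P.top x) * κ = 1 - Q.top x := by rw [hκ]; field_simp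
    have h3 : (1 - t) * κ < (1 - P.top x) * κ := by
      apply mul_lt_mul_of_pos_right _ hκ0
      linarith
    linarith
  have h0 : 0 ≤ (1 - t) * κ := mul_nonneg (by linarith [hu'.2.2]) hκ0.le
  have hsq : transfer P Q (x, t) ∈ square := by
    rw [transfer_of_top hu ⟨hx, ht⟩, mem_square, abs_le, abs_le]
    simp only [← hκ]
    exact ⟨hu'.1, by linarith, by linarith⟩
  have hmem : transfer P Q (x, t) ∈ Q.topSet := by
    rw [transfer_of_top hu ⟨hx, ht⟩]
    exact ⟨hx, h1⟩
  refine ⟨hsq, hmem, ?_⟩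
  rw [transfer_of_top hsq hmem, transfer_of_top hu ⟨hx, ht⟩]
  simp only
  rw [← hκ, show (1 - P.top x) / (1 - Q.top x) = κ⁻¹ by rw [hκ, inv_div]]
  refine Prod.ext rfl ?_
  simp only
  field_simp
  ring

theorem transfer_mem {u : ℝ × ℝ} (hu : u ∈ P.zone) : transfer P Q u ∈ Q.zone := by
  obtain ⟨hs, h | h | h⟩ := hu
  · exact ⟨(transfer_side hs h).1, Or.inl (transfer_side hs h).2.1⟩
  · exact ⟨(transfer_bot hs h).1, Or.inr (Or.inl (transfer_bot hs h).2.1)⟩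
  · exact ⟨(transfer_top hs h).1, Or.inr (Or.inr (transfer_top hs h).2.1)⟩

theorem transfer_transfer {u : ℝ × ℝ} (hu : u ∈ P.zone) :
    transfer Q P (transfer P Q u) = u := by
  obtain ⟨hs, h | h | h⟩ := hu
  · exact (transfer_side hs h).2.2
  · exact (transfer_bot hs h).2.2
  · exact (transfer_top hs h).2.2

/-- The scaling fixes the boundary of the box, where all profiles agree, so the maps in the boxes
extend by the identity. -/
theorem transfer_of_boundary {u : ℝ × ℝ} (hu : u ∈ P.zone) (hb : u ∈ square \ openSquare) :
    transfer P Q u = u := by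
  obtain ⟨x, t⟩ := u
  obtain ⟨hs, h | h | h⟩ := hu
  · have hx : |x| ≠ 0 := ((P.side_nonneg t).trans_lt h).ne'
    rw [transfer_of_side h]
    refine Prod.ext ?_ rfl
    simp only
    rcases abs_eq_one_of_mem_diff hb with h1 | h1 <;> simp only at h1
    · rw [h1]; simp
    · rw [P.side_of_abs_eq_one t h1, Q.side_of_abs_eq_one t h1, div_self (by norm_num)]
      field_simp
      ring
  · rw [transfer_of_bot hs h]
    obtain ⟨hx, ht⟩ : |x| < 1 / 2 ∧ t < P.bot x := h
    have hP := (P.bot_le_top x hx).trans_lt (P.top_lt_one x hx)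
    have h1 : t = -1 := by
      rcases abs_eq_one_of_mem_diff hb with h1 | h1 <;> simp only at h1
      · linarith
      · rcases eq_or_eq_neg_of_abs_eq h1 with h2 | h2 <;> linarith
    simp [h1]
  · rw [transfer_of_top hs h]
    obtain ⟨hx, ht⟩ : |x| < 1 / 2 ∧ P.top x < t := h
    have hP := (P.neg_one_lt_bot x hx).trans_le (P.bot_le_top x hx)
    have h1 : t = 1 := by
      rcases abs_eq_one_of_mem_diff hb with h1 | h1 <;> simp only at h1
      · linarith
      · rcases eq_or_eq_neg_of_abs_eq h1 with h2 | h2 <;> linarith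
    simp [h1]

theorem continuousOn_transfer : ContinuousOn (transfer P Q) P.zone := by
  have hPs := P.continuous_side
  have hPb := P.continuous_bot
  have hPt := P.continuous_top
  have hQs := Q.continuous_side
  have hQb := Q.continuous_bot
  have hQt := Q.continuous_top
  refine continuousOn_of_locally_continuousOn fun u hu => ?_
  obtain ⟨hs, h | h | h⟩ := hu
  · refine ⟨P.sideSet, P.isOpen_sideSet, h, ?_⟩
    refine ContinuousOn.congr ?_ fun v hv => transfer_of_side hv.2
    refine ContinuousOn.prodMk ?_ continuousOn_snd
    refine ContinuousOn.mul (ContinuousOn.div (by fun_prop) (by fun_prop) ?_) ?_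
    · rintro v ⟨-, hv⟩
      exact ((P.side_nonneg v.2).trans_lt hv).ne'
    · refine ContinuousOn.sub continuousOn_const (ContinuousOn.mul (by fun_prop)
        (ContinuousOn.div (by fun_prop) (by fun_prop) ?_))
      intro v _
      linarith [P.side_lt v.2]
  · refine ⟨P.botSet, P.isOpen_botSet, h, ?_⟩
    refine ContinuousOn.congr ?_ fun v hv => transfer_of_bot hv.1.1 hv.2
    refine continuousOn_fst.prodMk (ContinuousOn.add continuousOn_const
      (ContinuousOn.mul (by fun_prop) (ContinuousOn.div (by fun_prop) (by fun_prop) ?_)))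
    rintro v ⟨-, hv⟩
    linarith [P.neg_one_lt_bot v.1 hv.1]
  · refine ⟨P.topSet, P.isOpen_topSet, h, ?_⟩
    refine ContinuousOn.congr ?_ fun v hv => transfer_of_top hv.1.1 hv.2
    refine continuousOn_fst.prodMk (ContinuousOn.sub continuousOn_const
      (ContinuousOn.mul (by fun_prop) (ContinuousOn.div (by fun_prop) (by fun_prop) ?_)))
    rintro v ⟨-, hv⟩
    linarith [P.top_lt_one v.1 hv.1]

theorem port_notMem_zone (b c : Bool) : (sgn b / 2, sgn c) ∉ P.zone := by
  have hb : |sgn b / 2| = 1 / 2 := by rw [abs_div, abs_sgn]; norm_num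
  rintro ⟨-, h | h | h⟩
  · have h1 : P.side (sgn c) < |sgn b / 2| := h
    rw [P.side_of_abs_eq_one _ (abs_sgn c), hb] at h1
    exact lt_irrefl _ h1
  · exact h.1.ne hb
  · exact h.1.ne hb

end Profile

namespace TwistDiagram

variable (K : TwistDiagram)

/-- The part of the torus that consists of the zones of the given profiles in the boxes, and of the
complement of the arcs outside the boxes. -/
def region (P : K.Twist → Profile) : Set Torus :=
  ((⋃ e, K.core e) ∪ ⋃ i, K.chart i '' (square \ (P i).zone))ᶜ

theorem isOpen_region (P : K.Twist → Profile) : IsOpen (K.region P) := by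
  have := K.twist_finite
  have := K.finite_arc
  exact ((isClosed_iUnion_of_finite K.isClosed_core).union (isClosed_iUnion_of_finite fun i =>
    K.isSquareFamily_chart.isClosed_image i (P i).isClosed_diff_zone sdiff_subset)).isOpen_compl

theorem region_chart (P : K.Twist → Profile) {i : K.Twist} {u : ℝ × ℝ} (hu : u ∈ square) :
    K.chart i u ∈ K.region P ↔ u ∈ (P i).zone := by
  simp only [region, mem_compl_iff, mem_union, mem_iUnion, not_or, not_exists]
  constructor
  · rintro ⟨-, h⟩
    by_contra hc
    exact h i ⟨u, ⟨hu, hc⟩, rfl⟩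
  · refine fun h => ⟨fun e he => ?_, ?_⟩
    · obtain ⟨b, c, rfl⟩ := K.core_chart hu he
      exact Profile.port_notMem_zone b c h
    · rintro j ⟨v, ⟨hv, hvz⟩, hjv⟩
      obtain ⟨rfl, rfl⟩ := K.isSquareFamily_chart.inj _ _ _ hv _ hu hjv
      exact hvz h

theorem region_of_notMem (P : K.Twist → Profile) {p : Torus} (hp : ∀ i, p ∉ K.chart i '' square) :
    p ∈ K.region P ↔ ∀ e, p ∉ K.core e := by
  simp only [region, mem_compl_iff, mem_union, mem_iUnion, not_or, not_exists]
  exact ⟨fun h => h.1, fun h => ⟨h, fun i ⟨v, hv, hiv⟩ => hp i ⟨v, hv.1, hiv⟩⟩⟩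

/-- The homeomorphism between two regions. -/
noncomputable def regionMap (P Q : K.Twist → Profile) (p : Torus) : Torus :=
  patch K.chart (fun i u => K.chart i ((P i).transfer (Q i) u)) id p

theorem regionMap_chart (P Q : K.Twist → Profile) (i : K.Twist) {u : ℝ × ℝ} (hu : u ∈ square) :
    K.regionMap P Q (K.chart i u) = K.chart i ((P i).transfer (Q i) u) :=
  K.isSquareFamily_chart.patch_apply _ _ i hu

theorem regionMap_of_notMem (P Q : K.Twist → Profile) {p : Torus}
    (hp : ∀ i, p ∉ K.chart i '' square) : K.regionMap P Q p = p :=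
  IsSquareFamily.patch_of_notMem _ _ hp

theorem regionMap_mem {P : K.Twist → Profile} (Q : K.Twist → Profile) {p : Torus}
    (hp : p ∈ K.region P) : K.regionMap P Q p ∈ K.region Q := by
  rcases IsSquareFamily.mem_square_or K.chart p with ⟨i, u, hu, rfl⟩ | hn
  · rw [region_chart K P hu] at hp
    have h := Profile.transfer_mem (Q := Q i) hp
    rwa [regionMap_chart K P Q i hu, region_chart K Q h.1]
  · rw [regionMap_of_notMem K P Q hn, region_of_notMem K Q hn]
    rwa [region_of_notMem K P hn] at hp

theorem regionMap_regionMap {P : K.Twist → Profile} (Q : K.Twist → Profile) {p : Torus}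
    (hp : p ∈ K.region P) : K.regionMap Q P (K.regionMap P Q p) = p := by
  rcases IsSquareFamily.mem_square_or K.chart p with ⟨i, u, hu, rfl⟩ | hn
  · rw [region_chart K P hu] at hp
    rw [regionMap_chart K P Q i hu, regionMap_chart K Q P i (Profile.transfer_mem hp).1,
      Profile.transfer_transfer hp]
  · rw [regionMap_of_notMem K P Q hn, regionMap_of_notMem K Q P hn]

theorem continuousOn_regionMap (P Q : K.Twist → Profile) :
    ContinuousOn (K.regionMap P Q) (K.region P) := by
  have h := K.isSquareFamily_chart.continuousOn_patch (Z := Unit)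
    (g := fun i u _ => K.chart i ((P i).transfer (Q i) u)) (g₀ := fun p _ => p)
    (E := {q | q.1 ∈ K.region P}) (fun i => ?_) continuousOn_fst ?_
  · exact h.comp (f := fun p : Torus => (p, ())) (by fun_prop) fun p hp => hp
  · refine (K.isSquareFamily_chart.cont i).comp (Profile.continuousOn_transfer.comp
      continuousOn_fst ?_) ?_
    · rintro q ⟨h1, h2⟩
      exact (K.region_chart P h1).1 h2
    · rintro q ⟨h1, h2⟩
      exact (Profile.transfer_mem ((K.region_chart P h1).1 h2)).1
  · intro i u _ hu hE
    exact congrArg _ (Profile.transfer_of_boundary ((K.region_chart P hu.1).1 hE) hu)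

/-! ### The complement of the projection -/

/-- The profile of a twist region with `m` crossings: the zone is the complement of the strands and
of the bigons between them. -/
noncomputable def crossProfile (m : ℕ) (hm : 0 < m) : Profile := by
  have hm' : (1 : ℝ) ≤ m := by exact_mod_cast hm
  have hπm : 0 < Real.pi * m := by positivity
  have hacos : ∀ x : ℝ, |x| < 1 / 2 → 0 < Real.arccos (2 * |x|) := fun x hx =>
    Real.arccos_pos.2 (by linarith)
  have hacos2 : ∀ x : ℝ, Real.arccos (2 * |x|) / (Real.pi * m) ≤ 1 / 2 := fun x => by
    have h1 : Real.arccos (2 * |x|) ≤ Real.pi / 2 := Real.arccos_le_pi_div_two.2 (by positivity)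
    rw [div_le_iff₀ hπm]
    nlinarith [Real.pi_pos]
  have hcont : Continuous etaInv := by unfold etaInv; fun_prop
  have hmono : StrictMono etaInv := fun y z h => by
    rw [← eta_strictMono.lt_iff_lt, eta_etaInv, eta_etaInv]; exact h
  have hc := continuous_eta
  have hI1 : etaInv 1 = 1 := by norm_num [etaInv]
  have hI0 : etaInv (-1) = -1 := by norm_num [etaInv]
  have hlt : ∀ t y, t < etaInv y → eta t < y := fun t y h => by
    rw [← eta_etaInv y]; exact eta_strictMono h
  have hgt : ∀ t y, etaInv y < t → y < eta t := fun t y h => by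
    rw [← eta_etaInv y]; exact eta_strictMono h
  have hcos : ∀ x θ : ℝ, 0 ≤ θ → θ < Real.arccos (2 * |x|) → |x| < 1 / 2 →
      |x| < 1 / 2 * |Real.cos θ| := fun x θ h0 h hx => by
    have h1 : Real.cos (Real.arccos (2 * |x|)) < Real.cos θ :=
      Real.cos_lt_cos_of_nonneg_of_le_pi h0 (Real.arccos_le_pi _) h
    rw [Real.cos_arccos (by linarith [abs_nonneg x]) (by linarith)] at h1
    linarith [le_abs_self (Real.cos θ)]
  exact
  -- the strands are the curves `|x| = side t`; below the first crossing they form the graph of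
  -- `bot`, and above the last one the graph of `top`
  { side := fun t => 1 / 2 * |Real.cos (Real.pi * m * max 0 (eta t))|
    bot := fun x => etaInv (Real.arccos (2 * |x|) / (Real.pi * m))
    top := fun x => etaInv (1 - Real.arccos (2 * |x|) / (Real.pi * m))
    continuous_side := by fun_prop
    continuous_bot := hcont.comp ((Real.continuous_arccos.comp (by fun_prop)).div_const _)
    continuous_top := hcont.comp
      (continuous_const.sub ((Real.continuous_arccos.comp (by fun_prop)).div_const _))
    side_nonneg := fun t => by positivity
    side_lt := fun t => by
      linarith [Real.abs_cos_le_one (Real.pi * m * max 0 (eta t))]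
    side_of_abs_eq_one := fun t ht => by
      rcases eq_or_eq_neg_of_abs_eq ht with rfl | rfl
      · rw [eta_one, max_eq_right zero_le_one, mul_one, mul_comm Real.pi, Real.cos_nat_mul_pi,
          abs_pow,
          abs_neg, abs_one, one_pow, mul_one]
      · rw [eta_neg_one, max_eq_left (by norm_num)]; simp
    neg_one_lt_bot := fun x hx => by
      rw [← hI0]
      refine hmono ?_
      have : 0 < Real.arccos (2 * |x|) / (Real.pi * m) := div_pos (hacos x hx) hπm
      linarith
    bot_le_top := fun x hx => hmono.monotone (by linarith [hacos2 x])
    top_lt_one := fun x hx => by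
      rw [← hI1]
      refine hmono ?_
      have : 0 < Real.arccos (2 * |x|) / (Real.pi * m) := div_pos (hacos x hx) hπm
      rw [hI1]
      linarith
    lt_side_of_lt_bot := fun x t hx _ ht => by
      refine hcos x _ (by positivity) ?_ hx
      have h1 := hlt _ _ ht
      have h2 : max 0 (eta t) < Real.arccos (2 * |x|) / (Real.pi * m) :=
        max_lt (div_pos (hacos x hx) hπm) h1
      rwa [lt_div_iff₀ hπm, mul_comm] at h2
    lt_side_of_top_lt := fun x t hx ht1 ht => by
      have h1 := hgt _ _ ht
      have h2 : eta t ≤ 1 := (abs_le.1 (abs_eta_le_one_iff.2 ht1)).2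
      -- the strands are symmetric with respect to the middle of the twist region
      have h3 : |Real.cos (Real.pi * m * max 0 (eta t))| =
          |Real.cos (Real.pi * m * (1 - eta t))| := by
        rw [max_eq_right (by linarith [hacos2 x]),
          show Real.pi * m * (1 - eta t) = m * Real.pi - Real.pi * m * eta t by ring,
          Real.cos_nat_mul_pi_sub, abs_mul, abs_pow, abs_neg, abs_one, one_pow, one_mul]
      rw [h3]
      refine hcos x _ (mul_nonneg hπm.le (by linarith)) ?_ hx
      have h4 : 1 - eta t < Real.arccos (2 * |x|) / (Real.pi * m) := by linarith
      rwa [lt_div_iff₀ hπm, mul_comm] at h4 }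

/-- The profiles of the twist regions of the diagram. -/
noncomputable def crossProfiles (i : K.Twist) : Profile :=
  crossProfile (K.crossings i).length (List.length_pos_iff.2 (K.crossings_ne i))

theorem crossProfiles_side (i : K.Twist) (t : ℝ) : (K.crossProfiles i).side t =
    1 / 2 * |Real.cos (Real.pi * (K.crossings i).length * max 0 (eta t))| := rfl

theorem projection_chart {i : K.Twist} {u : ℝ × ℝ} (hu : u ∈ square) :
    K.chart i u ∈ K.projection ↔ |u.1| = (K.crossProfiles i).side u.2 := by
  rw [crossProfiles_side]
  -- the two strands have opposite first coordinates
  have key : ∀ y x : ℝ, (∃ b, x = strandX (K.crossings i).length b y) ↔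
      |x| = 1 / 2 * |Real.cos (Real.pi * (K.crossings i).length * max 0 y)| := by
    intro y x
    simp only [strandX, Int.cast_natCast]
    generalize Real.cos (Real.pi * (K.crossings i).length * max 0 y) = c
    rw [show 1 / 2 * |c| = |c / 2| by rw [abs_div, abs_of_pos (by norm_num : (0 : ℝ) < 2)]; ring,
      abs_eq_abs]
    constructor
    · rintro ⟨b, rfl⟩
      cases b <;> simp only [sgn] <;> norm_num
      · right; ring
      · left; ring
    · rintro (rfl | rfl)
      · exact ⟨true, by simp [sgn]; ring⟩
      · exact ⟨false, by simp [sgn]; ring⟩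
  constructor
  · rintro (h | h)
    · obtain ⟨e, he⟩ := mem_iUnion.1 h
      obtain ⟨b, c, rfl⟩ := K.core_chart hu he
      have := (K.crossProfiles i).side_of_abs_eq_one (sgn c) (abs_sgn c)
      rw [crossProfiles_side] at this
      rw [this, abs_div, abs_sgn]
      norm_num
    · obtain ⟨j, b, y, hy, h⟩ := mem_iUnion.1 h
      obtain ⟨rfl, h1⟩ := K.box_inj _ _ _ (eta_mem_square.2 hu) _
        (mem_square.2 ⟨(abs_strandX_le _ _ _).trans (by norm_num), abs_le.2 ⟨hy.1, hy.2⟩⟩) h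
      obtain ⟨h2, rfl⟩ := Prod.mk.inj h1
      exact (key _ _).1 ⟨b, h2⟩
  · intro h
    obtain ⟨b, hb⟩ := (key _ _).2 h
    refine Or.inr (mem_iUnion.2 ⟨i, b, eta u.2, abs_le.1 (abs_eta_le_one_iff.2
      (mem_square.1 hu).2), ?_⟩)
    rw [chart, hb]

theorem projection_of_notMem {p : Torus} (hp : ∀ i, p ∉ K.chart i '' square) :
    p ∈ K.projection ↔ ∃ e, p ∈ K.core e := by
  constructor
  · rintro (h | h)
    · exact mem_iUnion.1 h
    · obtain ⟨j, b, y, hy, h⟩ := mem_iUnion.1 h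
      refine absurd ?_ (hp j)
      rw [K.chart_image_square]
      exact ⟨_, mem_square.2 ⟨(abs_strandX_le _ _ _).trans (by norm_num),
        abs_le.2 ⟨hy.1, hy.2⟩⟩, h.symm⟩
  · exact fun h => Or.inl (mem_iUnion.2 h)

theorem region_subset_compl_projection : K.region K.crossProfiles ⊆ K.projectionᶜ := by
  intro p hp h
  rcases IsSquareFamily.mem_square_or K.chart p with ⟨i, u, hu, rfl⟩ | hn
  · rw [projection_chart K hu] at h
    obtain ⟨-, h1 | h1 | h1⟩ := (K.region_chart _ hu).1 hp
    · exact (show _ < _ from h1).ne' h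
    · exact ((K.crossProfiles i).lt_side_of_lt_bot _ _ h1.1 (mem_square.1 hu).2 h1.2).ne h
    · exact ((K.crossProfiles i).lt_side_of_top_lt _ _ h1.1 (mem_square.1 hu).2 h1.2).ne h
  · obtain ⟨e, he⟩ := (K.projection_of_notMem hn).1 h
    exact (K.region_of_notMem _ hn).1 hp e he

/-- The curves at the bottom and at the top of the bigons are parts of the strands. -/
theorem crossProfiles_side_bot (i : K.Twist) {x : ℝ} (hx : |x| < 1 / 2) :
    (K.crossProfiles i).side ((K.crossProfiles i).bot x) = |x| ∧
      (K.crossProfiles i).side ((K.crossProfiles i).top x) = |x| := by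
  have hm : (1 : ℝ) ≤ (K.crossings i).length := by
    exact_mod_cast List.length_pos_iff.2 (K.crossings_ne i)
  have hπm : 0 < Real.pi * (K.crossings i).length := by positivity
  have hb : (K.crossProfiles i).bot x =
    etaInv (Real.arccos (2 * |x|) / (Real.pi * (K.crossings i).length)) := rfl
  have ht : (K.crossProfiles i).top x =
    etaInv (1 - Real.arccos (2 * |x|) / (Real.pi * (K.crossings i).length)) := rfl
  have h0 : 0 ≤ Real.arccos (2 * |x|) / (Real.pi * (K.crossings i).length) :=
    div_nonneg (Real.arccos_nonneg _) hπm.le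
  have h1 : Real.arccos (2 * |x|) / (Real.pi * (K.crossings i).length) ≤ 1 / 2 := by
    have h1 : Real.arccos (2 * |x|) ≤ Real.pi / 2 := Real.arccos_le_pi_div_two.2 (by positivity)
    rw [div_le_iff₀ hπm]
    nlinarith [Real.pi_pos]
  have hcos : Real.cos (Real.arccos (2 * |x|)) = 2 * |x| :=
    Real.cos_arccos (by linarith [abs_nonneg x]) (by linarith)
  rw [hb, ht, crossProfiles_side, crossProfiles_side, eta_etaInv, eta_etaInv, max_eq_right h0,
    max_eq_right (by linarith), mul_sub, mul_div_cancel₀ _ hπm.ne', mul_one,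
    mul_comm Real.pi, Real.cos_nat_mul_pi_sub, abs_mul, abs_pow, abs_neg, abs_one, one_pow, one_mul,
    hcos, abs_mul, abs_abs, abs_of_pos (by norm_num : (0 : ℝ) < 2)]
  constructor <;> ring

/-- The bigons are open. -/
theorem isOpen_compl_projection_diff : IsOpen (K.projectionᶜ \ K.region K.crossProfiles) := by
  -- `B i` is the union of the bigons of a twist region
  let B : K.Twist → Set (ℝ × ℝ) := fun i => {u | |u.1| < (K.crossProfiles i).side u.2 ∧
    |u.1| < 1 / 2 ∧ (K.crossProfiles i).bot u.1 < u.2 ∧ u.2 < (K.crossProfiles i).top u.1}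
  have hB : ∀ i, IsOpen (B i) := fun i => by
    have h1 := (K.crossProfiles i).continuous_side
    have h2 := (K.crossProfiles i).continuous_bot
    have h3 := (K.crossProfiles i).continuous_top
    exact (isOpen_lt (by fun_prop) (by fun_prop)).and ((isOpen_lt (by fun_prop)
      (by fun_prop)).and ((isOpen_lt (by fun_prop) (by fun_prop)).and
      (isOpen_lt (by fun_prop) (by fun_prop))))
  have hBs : ∀ i, B i ⊆ square := fun i u hu => by
    obtain ⟨-, h1, h2, h3⟩ := hu
    have h4 := (K.crossProfiles i).neg_one_lt_bot _ h1
    have h5 := (K.crossProfiles i).top_lt_one _ h1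
    exact mem_square.2 ⟨by linarith, abs_le.2 ⟨by linarith, by linarith⟩⟩
  have h : K.projectionᶜ \ K.region K.crossProfiles = ⋃ i, K.chart i '' B i := by
    ext p
    constructor
    · rintro ⟨h1, h2⟩
      rcases IsSquareFamily.mem_square_or K.chart p with ⟨i, u, hu, rfl⟩ | hn
      · rw [mem_compl_iff, projection_chart K hu] at h1
        rw [K.region_chart _ hu] at h2
        have h3 : |u.1| < (K.crossProfiles i).side u.2 := by
          refine lt_of_le_of_ne (not_lt.1 fun h => h2 ⟨hu, Or.inl h⟩) h1
        have h4 : |u.1| < 1 / 2 := by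
          rw [crossProfiles_side] at h3
          linarith [Real.abs_cos_le_one (Real.pi * (K.crossings i).length * max 0 (eta u.2))]
        refine mem_iUnion.2 ⟨i, u, ⟨h3, h4, ?_, ?_⟩, rfl⟩
        · refine lt_of_le_of_ne (not_lt.1 fun h => h2 ⟨hu, Or.inr (Or.inl ⟨h4, h⟩)⟩) fun h => ?_
          rw [← h, (K.crossProfiles_side_bot i h4).1] at h3
          exact lt_irrefl _ h3
        · refine lt_of_le_of_ne (not_lt.1 fun h => h2 ⟨hu, Or.inr (Or.inr ⟨h4, h⟩)⟩) fun h => ?_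
          rw [h, (K.crossProfiles_side_bot i h4).2] at h3
          exact lt_irrefl _ h3
      · rw [mem_compl_iff, projection_of_notMem K hn] at h1
        exact absurd ((K.region_of_notMem _ hn).2 fun e he => h1 ⟨e, he⟩) h2
    · intro h
      obtain ⟨i, u, hu, rfl⟩ := mem_iUnion.1 h
      have hus := hBs i hu
      obtain ⟨h1, h2, h3, h4⟩ := hu
      refine ⟨?_, ?_⟩
      · rw [mem_compl_iff, projection_chart K hus]
        exact h1.ne
      · rw [K.region_chart _ hus]
        rintro ⟨-, h | h | h⟩
        · exact lt_asymm h h1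
        · exact lt_asymm h.2 h3
        · exact lt_asymm h.2 h4
  rw [h]
  exact isOpen_iUnion fun i => K.isSquareFamily_chart.isOpen_image i (hB i) (hBs i)

/-! ### The white region -/

/-- The profile of the complement of the hexagon and of the strands. -/
noncomputable def _root_.hexProfile : Profile where
  side t := max (1 / 2) (3 / 4 - 3 / 8 * |t|)
  bot _ := -(2 / 3)
  top _ := 2 / 3
  continuous_side := by fun_prop
  continuous_bot := by fun_prop
  continuous_top := by fun_prop
  side_nonneg t := le_max_of_le_left (by norm_num)
  side_lt t := max_lt (by norm_num) (by linarith [abs_nonneg t])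
  side_of_abs_eq_one t ht := by rw [ht, max_eq_left (by norm_num)]
  neg_one_lt_bot x _ := by norm_num
  bot_le_top x _ := by norm_num
  top_lt_one x _ := by norm_num
  lt_side_of_lt_bot x t hx _ _ := lt_max_of_lt_left hx
  lt_side_of_top_lt x t hx _ _ := lt_max_of_lt_left hx

/-- The complement of the hexagons and of the strands. -/
def white : Set Torus := K.region fun _ => hexProfile

theorem isOpen_white : IsOpen K.white := K.isOpen_region _

/-- The components of the white region are disks: up to homeomorphism, the white region is the part
of the complement of the projection outside the bigons. -/
theorem isOpenDisk_white (hK : K.IsCellular) {U : Set Torus} (hU : IsOpen U) {g : Torus → Torus}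
    (hg : ContinuousOn g U) (hinj : InjOn g U) (hgU : g '' U = K.white) {x : Torus} (hx : x ∈ U) :
    IsOpenDisk (connectedComponentIn U x) := by
  set m := K.regionMap (fun _ => hexProfile) K.crossProfiles with hm
  have himg : m '' K.white = K.region K.crossProfiles := by
    refine Subset.antisymm ?_ fun p hp => ?_
    · rintro _ ⟨p, hp, rfl⟩
      exact K.regionMap_mem _ hp
    · exact ⟨_, K.regionMap_mem _ hp, K.regionMap_regionMap _ hp⟩
  have hinj' : InjOn m K.white := fun p hp q hq h => by
    rw [← K.regionMap_regionMap K.crossProfiles hp, ← K.regionMap_regionMap K.crossProfiles hq]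
    exact congrArg _ h
  have hmaps : MapsTo g U K.white := fun p hp => hgU ▸ mem_image_of_mem g hp
  have himg' : (m ∘ g) '' U = K.region K.crossProfiles := by rw [image_comp, hgU, himg]
  -- the bigons, which are what the image misses, are open, so the image is clopen
  refine isOpenDisk_connectedComponentIn (X := K.projectionᶜ) hU
    ((K.continuousOn_regionMap _ _).comp hg hmaps) (hinj'.comp hinj hmaps) ?_ ?_
    (fun p hp => hK p hp) hx
  · rw [himg']; exact K.region_subset_compl_projection
  · rw [himg']; exact K.isOpen_compl_projection_diff

end TwistDiagram

/-! ### The hexagon -/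

theorem wid_of_le {x : ℝ} (hx : |x| ≤ 1 / 2) : wid x = 2 / 3 := by
  rw [wid, min_eq_left (by linarith), max_eq_right (by norm_num)]

theorem wid_of_mem {x : ℝ} (hx : 1 / 2 ≤ |x|) (hx' : |x| ≤ 3 / 4) : wid x = 2 - 8 / 3 * |x| := by
  rw [wid, min_eq_right (by linarith), max_eq_right (by linarith)]

/-- The six sides of the hexagon: `b` distinguishes the upper from the lower half, each of which
has a horizontal side, and a side to the left and to the right. -/
noncomputable def edgePath (b : Bool) (m : Option Bool) (s : ℝ) : ℝ × ℝ :=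
  m.elim (s - 1 / 2, sgn b * (2 / 3)) fun σ => (sgn σ * (3 / 4 - s / 4), sgn b * (2 / 3 * s))

theorem continuous_edgePath (b : Bool) (m : Option Bool) : Continuous (edgePath b m) := by
  cases m <;> unfold edgePath Option.elim <;> fun_prop

theorem edgePath_spec (b : Bool) (m : Option Bool) {s : ℝ} (h0 : 0 ≤ s) (h1 : s ≤ 1) :
    |(edgePath b m s).1| ≤ 3 / 4 ∧ |(edgePath b m s).2| = wid (edgePath b m s).1 := by
  cases m with
  | none =>
    have h : |s - 1 / 2| ≤ 1 / 2 := by rw [abs_le]; constructor <;> linarith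
    simp only [edgePath, Option.elim]
    rw [wid_of_le h, abs_mul, abs_sgn]
    exact ⟨by linarith, by norm_num⟩
  | some σ =>
    have h : |sgn σ * (3 / 4 - s / 4)| = 3 / 4 - s / 4 := by
      rw [abs_mul, abs_sgn, one_mul, abs_of_nonneg (by linarith)]
    simp only [edgePath, Option.elim]
    rw [wid_of_mem (by rw [h]; linarith) (by rw [h]; linarith), h, abs_mul, abs_sgn, one_mul,
      abs_of_nonneg (by linarith)]
    constructor <;> linarith

theorem edgePath_mem_square (b : Bool) (m : Option Bool) {s : ℝ} (h0 : 0 ≤ s) (h1 : s ≤ 1) :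
    edgePath b m s ∈ square := by
  obtain ⟨h2, h3⟩ := edgePath_spec b m h0 h1
  exact mem_square.2 ⟨by linarith, by rw [h3]; exact (wid_le _).trans (by norm_num)⟩

theorem edgePath_snd_pos (b : Bool) (m : Option Bool) {s : ℝ} (h0 : 0 < s) :
    0 < sgn b * (edgePath b m s).2 := by
  cases m <;> simp only [edgePath, Option.elim] <;> rw [← mul_assoc, sgn_sq] <;> linarith

theorem eq_of_sgn_mul_pos {b c : Bool} {t : ℝ} (hb : 0 < sgn b * t) (hc : 0 < sgn c * t) :
    b = c := by
  cases b <;> cases c <;> simp only [sgn, Bool.false_eq_true, if_false, if_true] at * <;> linarith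

theorem abs_edgePath_none {b : Bool} {s : ℝ} (hs : s ∈ Ioo (0 : ℝ) 1) :
    |(edgePath b none s).1| < 1 / 2 := by
  simp only [edgePath, Option.elim, abs_lt]
  constructor <;> linarith [hs.1, hs.2]

theorem sgn_mul_edgePath_some (b σ : Bool) (s : ℝ) :
    sgn σ * (edgePath b (some σ) s).1 = 3 / 4 - s / 4 := by
  simp only [edgePath, Option.elim]
  rw [← mul_assoc, sgn_sq, one_mul]

/-- The open sides are embedded and disjoint: the sign of the second coordinate, and the position of
`|x|` relative to `1 / 2`, tell the sides apart. -/
theorem edgePath_inj {b b' : Bool} {m m' : Option Bool} {s s' : ℝ} (hs : s ∈ Ioo (0 : ℝ) 1)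
    (hs' : s' ∈ Ioo (0 : ℝ) 1) (h : edgePath b m s = edgePath b' m' s') :
    b = b' ∧ m = m' ∧ s = s' := by
  have hb : b = b' := eq_of_sgn_mul_pos (edgePath_snd_pos b m hs.1)
    (h ▸ edgePath_snd_pos b' m' hs'.1)
  subst hb
  have hsome : ∀ σ, ∀ s ∈ Ioo (0 : ℝ) 1, 1 / 2 < |(edgePath b (some σ) s).1| := fun σ s hs => by
    have h1 := le_abs_self (sgn σ * (edgePath b (some σ) s).1)
    rw [abs_mul, abs_sgn, one_mul, sgn_mul_edgePath_some] at h1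
    linarith [hs.2]
  refine ⟨rfl, ?_⟩
  cases m with
  | none =>
    cases m' with
    | none => exact ⟨rfl, by simpa [edgePath] using h⟩
    | some σ =>
      have h1 := hsome σ s' hs'
      rw [← h] at h1
      exact absurd h1 (abs_edgePath_none hs).le.not_gt
  | some σ =>
    cases m' with
    | none =>
      have h1 := hsome σ s hs
      rw [h] at h1
      exact absurd h1 (abs_edgePath_none hs').le.not_gt
    | some σ' =>
      have h1 := sgn_mul_edgePath_some b σ s
      have h2 := sgn_mul_edgePath_some b σ' s'
      rw [← h] at h2
      have h3 : σ = σ' := eq_of_sgn_mul_pos (by rw [h1]; linarith [hs.2])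
        (by rw [h2]; linarith [hs'.2])
      subst h3
      exact ⟨rfl, by linarith⟩

/-- The open upper or lower half of the hexagon. -/
def halfHexagon (b : Bool) : Set (ℝ × ℝ) := {u | 0 < sgn b * u.2 ∧ |u.2| < wid u.1}

theorem abs_eq_sgn_mul {b : Bool} {t : ℝ} (h : 0 ≤ sgn b * t) : |t| = sgn b * t := by
  rw [← abs_of_nonneg h, abs_mul, abs_sgn, one_mul]

theorem halfHexagon_subset (b : Bool) : halfHexagon b ⊆ openSquare := by
  rintro u ⟨h1, h2⟩
  have h3 : |u.1| < 3 / 4 := wid_pos_iff.1 ((abs_nonneg _).trans_lt h2)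
  exact mem_openSquare.2 ⟨by linarith, by linarith [wid_le u.1]⟩

theorem isOpen_halfHexagon (b : Bool) : IsOpen (halfHexagon b) := by
  have := continuous_wid
  unfold halfHexagon
  exact (isOpen_lt (by fun_prop) (by fun_prop)).and (isOpen_lt (by fun_prop) (by fun_prop))

theorem convex_lt (α β c : ℝ) : Convex ℝ {u : ℝ × ℝ | α * u.1 + β * u.2 < c} :=
  convex_halfSpace_lt (f := fun u : ℝ × ℝ => α * u.1 + β * u.2)
    ⟨fun u v => by simp; ring, fun r u => by simp; ring⟩ c

theorem convex_halfHexagon (b : Bool) : Convex ℝ (halfHexagon b) := by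
  -- the open half is cut out by four half planes; the bound `wid` is the minimum of two linear ones
  -- where it is positive
  have h : halfHexagon b = ({u | 0 * u.1 + (-sgn b) * u.2 < 0} ∩
      {u | 0 * u.1 + sgn b * u.2 < 2 / 3}) ∩
      ({u | 8 / 3 * u.1 + sgn b * u.2 < 2} ∩ {u | -8 / 3 * u.1 + sgn b * u.2 < 2}) := by
    ext u
    simp only [halfHexagon, mem_inter_iff, mem_ofPred_eq]
    constructor
    · rintro ⟨h1, h2⟩
      rw [abs_eq_sgn_mul h1.le] at h2
      have h3 : wid u.1 = min (2 / 3) (2 - 8 / 3 * |u.1|) := by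
        refine max_eq_right (le_of_not_gt fun h => ?_)
        rw [wid, max_eq_left h.le] at h2
        exact lt_asymm h1 h2
      rw [h3, lt_min_iff] at h2
      have h4 := le_abs_self u.1
      have h5 := neg_abs_le u.1
      refine ⟨⟨?_, ?_⟩, ?_, ?_⟩ <;> linarith
    · rintro ⟨⟨h1, h2⟩, h3, h4⟩
      have h5 : 0 < sgn b * u.2 := by linarith
      refine ⟨h5, ?_⟩
      rw [abs_eq_sgn_mul h5.le]
      refine lt_max_of_lt_right (lt_min (by linarith) ?_)
      rcases abs_cases u.1 with ⟨h, -⟩ | ⟨h, -⟩ <;> rw [h] <;> linarith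
  rw [h]
  exact ((convex_lt _ _ _).inter (convex_lt _ _ _)).inter
    ((convex_lt _ _ _).inter (convex_lt _ _ _))

/-- A neighbourhood of an open side of the hexagon. -/
def edgeNhd (b : Bool) (m : Option Bool) : Set (ℝ × ℝ) :=
  {u | 0 < sgn b * u.2 ∧ sgn b * u.2 < 1} ∩
    m.elim {u | |u.1| < 1 / 2} fun σ => {u | 1 / 2 < sgn σ * u.1 ∧ sgn σ * u.1 < 1}

/-- The part of `edgeNhd` outside the hexagon. -/
def edgeOuter (b : Bool) (m : Option Bool) : Set (ℝ × ℝ) :=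
  edgeNhd b m ∩ m.elim {u | 2 / 3 < sgn b * u.2} fun σ =>
    {u | 3 / 4 - 3 / 8 * (sgn b * u.2) < sgn σ * u.1}

theorem isOpen_edgeNhd (b : Bool) (m : Option Bool) : IsOpen (edgeNhd b m) := by
  refine IsOpen.inter ((isOpen_lt (by fun_prop) (by fun_prop)).and
    (isOpen_lt (by fun_prop) (by fun_prop))) ?_
  cases m with
  | none =>
    have h : IsOpen {u : ℝ × ℝ | |u.1| < 1 / 2} := isOpen_lt (by fun_prop) (by fun_prop)
    exact h
  | some σ =>
    have h : IsOpen {u : ℝ × ℝ | 1 / 2 < sgn σ * u.1 ∧ sgn σ * u.1 < 1} :=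
      (isOpen_lt (by fun_prop) (by fun_prop)).and (isOpen_lt (by fun_prop) (by fun_prop))
    exact h

theorem edgeNhd_subset (b : Bool) (m : Option Bool) : edgeNhd b m ⊆ openSquare := by
  rintro u ⟨⟨h1, h2⟩, h3⟩
  rw [mem_openSquare, abs_eq_sgn_mul h1.le]
  refine ⟨?_, h2⟩
  cases m with
  | none => exact (show |u.1| < 1 / 2 from h3).trans (by norm_num)
  | some σ =>
    obtain ⟨h4, h5⟩ : 1 / 2 < sgn σ * u.1 ∧ sgn σ * u.1 < 1 := h3
    rw [abs_eq_sgn_mul (by linarith)]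
    exact h5

theorem edgePath_mem_edgeNhd (b : Bool) (m : Option Bool) {s : ℝ} (hs : s ∈ Ioo (0 : ℝ) 1) :
    edgePath b m s ∈ edgeNhd b m := by
  have h1 := edgePath_snd_pos b m hs.1
  have h2 := (edgePath_spec b m hs.1.le hs.2.le).2
  rw [abs_eq_sgn_mul h1.le] at h2
  refine ⟨⟨h1, h2 ▸ (wid_le _).trans_lt (by norm_num)⟩, ?_⟩
  cases m with
  | none => exact abs_edgePath_none hs
  | some σ =>
    show 1 / 2 < _ ∧ _ < (1 : ℝ)
    rw [sgn_mul_edgePath_some]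
    constructor <;> linarith [hs.1, hs.2]

/-- Outside the hexagon, the neighbourhood of a side is white. -/
theorem edgeOuter_eq (b : Bool) (m : Option Bool) :
    edgeOuter b m = edgeNhd b m ∩ hexProfile.zone := by
  ext u
  refine and_congr_right fun hu => ?_
  have hsq := openSquare_subset (edgeNhd_subset b m hu)
  obtain ⟨⟨h1, h2⟩, h3⟩ := hu
  have habs := abs_eq_sgn_mul h1.le
  have hside : u ∈ hexProfile.sideSet ↔ 1 / 2 < |u.1| ∧ 3 / 4 - 3 / 8 * |u.2| < |u.1| := by
    show max (1 / 2) (3 / 4 - 3 / 8 * |u.2|) < |u.1| ↔ _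
    exact max_lt_iff
  have hbot : u ∈ hexProfile.botSet ↔ |u.1| < 1 / 2 ∧ u.2 < -(2 / 3) := Iff.rfl
  have htop : u ∈ hexProfile.topSet ↔ |u.1| < 1 / 2 ∧ 2 / 3 < u.2 := Iff.rfl
  rw [Profile.zone, mem_inter_iff, and_iff_right hsq, mem_union, mem_union, hside, hbot, htop,
    habs]
  cases m with
  | none =>
    have h3 : |u.1| < 1 / 2 := h3
    have h4 : u.2 < -(2 / 3) ∨ 2 / 3 < u.2 ↔ 2 / 3 < sgn b * u.2 := by
      rw [← habs, lt_abs, or_comm, lt_neg]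
    show 2 / 3 < sgn b * u.2 ↔ _
    rw [← h4]
    constructor
    · rintro (h | h)
      · exact Or.inr (Or.inl ⟨h3, h⟩)
      · exact Or.inr (Or.inr ⟨h3, h⟩)
    · rintro (h | h | h)
      · exact absurd h.1 h3.not_gt
      · exact Or.inl h.2
      · exact Or.inr h.2
  | some σ =>
    obtain ⟨h4, h5⟩ : 1 / 2 < sgn σ * u.1 ∧ sgn σ * u.1 < 1 := h3
    have habs' := abs_eq_sgn_mul (by linarith : 0 ≤ sgn σ * u.1)
    show 3 / 4 - 3 / 8 * (sgn b * u.2) < sgn σ * u.1 ↔ _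
    rw [habs']
    constructor
    · exact fun h => Or.inl ⟨h4, h⟩
    · rintro (h | h | h)
      · exact h.2
      · linarith [h.1]
      · linarith [h.1]

theorem convex_edgeOuter (b : Bool) (m : Option Bool) : Convex ℝ (edgeOuter b m) := by
  cases m with
  | none =>
    have h : edgeOuter b none = ({u | 0 * u.1 + sgn b * u.2 < 1} ∩
        {u | 0 * u.1 + (-sgn b) * u.2 < -(2 / 3)}) ∩
        ({u | 1 * u.1 + 0 * u.2 < 1 / 2} ∩ {u | (-1) * u.1 + 0 * u.2 < 1 / 2}) := by
      ext u
      simp only [edgeOuter, edgeNhd, Option.elim, mem_inter_iff, mem_ofPred_eq, abs_lt]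
      constructor
      · rintro ⟨⟨⟨h1, h2⟩, h3, h4⟩, h5⟩
        refine ⟨⟨?_, ?_⟩, ?_, ?_⟩ <;> linarith
      · rintro ⟨⟨h1, h2⟩, h3, h4⟩
        refine ⟨⟨⟨?_, ?_⟩, ?_, ?_⟩, ?_⟩ <;> linarith
    rw [h]
    exact ((convex_lt _ _ _).inter (convex_lt _ _ _)).inter
      ((convex_lt _ _ _).inter (convex_lt _ _ _))
  | some σ =>
    have h : edgeOuter b (some σ) = ({u | 0 * u.1 + sgn b * u.2 < 1} ∩
        {u | 0 * u.1 + (-sgn b) * u.2 < 0}) ∩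
        (({u | sgn σ * u.1 + 0 * u.2 < 1} ∩ {u | (-sgn σ) * u.1 + 0 * u.2 < -(1 / 2)}) ∩
        {u | (-sgn σ) * u.1 + (-3 / 8 * sgn b) * u.2 < -(3 / 4)}) := by
      ext u
      simp only [edgeOuter, edgeNhd, Option.elim, mem_inter_iff, mem_ofPred_eq]
      constructor
      · rintro ⟨⟨⟨h1, h2⟩, h3, h4⟩, h5⟩
        refine ⟨⟨?_, ?_⟩, ⟨?_, ?_⟩, ?_⟩ <;> linarith
      · rintro ⟨⟨h1, h2⟩, ⟨h3, h4⟩, h5⟩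
        refine ⟨⟨⟨?_, ?_⟩, ?_, ?_⟩, ?_⟩ <;> linarith
    rw [h]
    exact ((convex_lt _ _ _).inter (convex_lt _ _ _)).inter
      (((convex_lt _ _ _).inter (convex_lt _ _ _)).inter (convex_lt _ _ _))

/-- The outward direction at a side of the hexagon. -/
noncomputable def outward (b : Bool) (m : Option Bool) : ℝ × ℝ :=
  m.elim (0, sgn b) fun σ => (sgn σ, 0)

theorem tendsto_add_smul (u v : ℝ × ℝ) :
    Tendsto (fun ε : ℝ => u + ε • v) (𝓝[>] 0) (𝓝 u) := by
  have h : Continuous fun ε : ℝ => u + ε • v := by fun_prop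
  have h1 := h.tendsto 0
  simp only [zero_smul, add_zero] at h1
  exact h1.mono_left nhdsWithin_le_nhds

/-- A point of a side, moved slightly outwards, leaves the hexagon. -/
theorem edgePath_mem_closure_edgeOuter (b : Bool) (m : Option Bool) {s : ℝ}
    (hs : s ∈ Ioo (0 : ℝ) 1) : edgePath b m s ∈ closure (edgeOuter b m) := by
  have h1 := tendsto_add_smul (edgePath b m s) (outward b m)
  refine mem_closure_of_tendsto h1 ?_
  have hN : ∀ᶠ ε : ℝ in 𝓝[>] 0, edgePath b m s + ε • outward b m ∈ edgeNhd b m :=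
    h1 ((isOpen_edgeNhd b m).mem_nhds (edgePath_mem_edgeNhd b m hs))
  filter_upwards [hN, self_mem_nhdsWithin] with ε h2 h3
  refine ⟨h2, ?_⟩
  have h3 : 0 < ε := h3
  cases m with
  | none =>
    show 2 / 3 < sgn b * _
    simp only [edgePath, outward, Option.elim, Prod.snd_add, Prod.smul_snd, smul_eq_mul]
    linarith [sgn_sq b, show sgn b * (sgn b * (2 / 3) + ε * sgn b) = sgn b * sgn b * (2 / 3 + ε) by
      ring, show sgn b * sgn b * (2 / 3 + ε) = 2 / 3 + ε by rw [sgn_sq, one_mul]]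
  | some σ =>
    show 3 / 4 - 3 / 8 * (sgn b * _) < sgn σ * _
    simp only [edgePath, outward, Option.elim, Prod.snd_add, Prod.smul_snd, smul_eq_mul,
      Prod.fst_add, Prod.smul_fst, mul_zero, add_zero]
    rw [← mul_assoc (sgn b), sgn_sq, one_mul,
      show sgn σ * (sgn σ * (3 / 4 - s / 4) + ε * sgn σ) =
        sgn σ * sgn σ * (3 / 4 - s / 4 + ε) by ring,
      sgn_sq, one_mul]
    linarith

/-- A point of a side, moved slightly inwards, enters the hexagon. -/
theorem edgePath_mem_closure_halfHexagon (b : Bool) (m : Option Bool) {s : ℝ}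
    (hs : s ∈ Ioo (0 : ℝ) 1) : edgePath b m s ∈ closure (halfHexagon b) := by
  have h1 := tendsto_add_smul (edgePath b m s) (-outward b m)
  refine mem_closure_of_tendsto h1 ?_
  have hN : ∀ᶠ ε : ℝ in 𝓝[>] 0, edgePath b m s + ε • -outward b m ∈ edgeNhd b m :=
    h1 ((isOpen_edgeNhd b m).mem_nhds (edgePath_mem_edgeNhd b m hs))
  filter_upwards [hN, self_mem_nhdsWithin] with ε h2 h3
  have h3 : 0 < ε := h3
  obtain ⟨⟨h4, h5⟩, h6⟩ := h2
  refine ⟨h4, ?_⟩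
  rw [abs_eq_sgn_mul h4.le]
  cases m with
  | none =>
    have h6 : |(edgePath b none s + ε • -outward b none).1| < 1 / 2 := h6
    rw [wid_of_le h6.le]
    simp only [edgePath, outward, Option.elim, Prod.snd_add, Prod.smul_snd, smul_eq_mul,
      Prod.snd_neg]
    rw [show sgn b * (sgn b * (2 / 3) + ε * -sgn b) = sgn b * sgn b * (2 / 3 - ε) by ring, sgn_sq]
    linarith
  | some σ =>
    obtain ⟨h7, h8⟩ : 1 / 2 < sgn σ * (edgePath b (some σ) s + ε • -outward b (some σ)).1 ∧ _ := h6
    have h9 := abs_eq_sgn_mul (by linarith :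
      0 ≤ sgn σ * (edgePath b (some σ) s + ε • -outward b (some σ)).1)
    have h10 : sgn σ * (edgePath b (some σ) s + ε • -outward b (some σ)).1 = 3 / 4 - s / 4 - ε := by
      simp only [edgePath, outward, Option.elim, Prod.fst_add, Prod.smul_fst, smul_eq_mul,
        Prod.fst_neg]
      rw [show sgn σ * (sgn σ * (3 / 4 - s / 4) + ε * -sgn σ) =
        sgn σ * sgn σ * (3 / 4 - s / 4 - ε) by ring, sgn_sq, one_mul]
    rw [wid_of_mem (by linarith) (by linarith [hs.1]), h9, h10]
    simp only [edgePath, outward, Option.elim, Prod.snd_add, Prod.smul_snd, smul_eq_mul,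
      Prod.snd_neg, neg_zero, mul_zero, add_zero]
    rw [← mul_assoc (sgn b), sgn_sq]
    linarith

theorem closure_halfHexagon_subset (b : Bool) :
    closure (halfHexagon b) ⊆ {u ∈ square | 0 ≤ sgn b * u.2} := by
  refine closure_minimal (fun u hu => ⟨openSquare_subset (halfHexagon_subset b hu), hu.1.le⟩) ?_
  have h : IsClosed {u : ℝ × ℝ | 0 ≤ sgn b * u.2} := isClosed_le (by fun_prop) (by fun_prop)
  exact isCompact_square.isClosed.inter h

/-- Outside the strands and the slot, a point of a box that is not white belongs to one of the
halves of the hexagon or to one of its sides. -/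
theorem hexagon_cases {u : ℝ × ℝ} (hu : u ∈ square) (hs : ¬ (|u.1| = 1 / 2 ∧ 2 / 3 ≤ |u.2|))
    (h0 : ¬ (u.2 = 0 ∧ |u.1| ≤ 3 / 4)) :
    u ∈ hexProfile.zone ∨ (∃ b, u ∈ halfHexagon b) ∨
      ∃ b m, ∃ s ∈ Ioo (0 : ℝ) 1, u = edgePath b m s := by
  obtain ⟨x, t⟩ := u
  by_contra! h
  obtain ⟨hz, hh, he⟩ := h
  -- a point that is neither white nor in an open half has `|t| = wid x`, so it is on a side
  have hside : ¬ (1 / 2 < |x| ∧ 3 / 4 - 3 / 8 * |t| < |x|) := fun h =>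
    hz ⟨hu, Or.inl (max_lt_iff.2 h)⟩
  have hbot : ¬ (|x| < 1 / 2 ∧ 2 / 3 < |t|) := fun h => hz ⟨hu, by
    rcases lt_abs.1 h.2 with h' | h'
    · exact Or.inr (Or.inr ⟨h.1, h'⟩)
    · exact Or.inr (Or.inl ⟨h.1, lt_neg.1 h'⟩)⟩
  simp only at hs h0
  obtain ⟨b, hb⟩ := TwistDiagram.sgn_exists t
  obtain ⟨σ, hσ⟩ := TwistDiagram.sgn_exists x
  have ht : 0 < |t| := by
    rw [abs_pos]
    rintro rfl
    refine h0 ⟨rfl, not_lt.1 fun h => hside ⟨by linarith, by simpa using h⟩⟩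
  have hbt : sgn b * t = |t| := by
    conv_lhs => rw [hb, ← mul_assoc, sgn_sq, one_mul]
  have hw : wid x ≤ |t| := not_lt.1 fun h => hh b ⟨by rw [hbt]; exact ht, h⟩
  rcases lt_trichotomy |x| (1 / 2) with h1 | h1 | h1
  · rw [wid_of_le h1.le] at hw
    have h2 : |t| = 2 / 3 := le_antisymm (not_lt.1 fun h => hbot ⟨h1, h⟩) hw
    rw [abs_lt] at h1
    refine he b none (x + 1 / 2) ⟨by linarith, by linarith⟩ ?_
    simp only [edgePath, Option.elim]
    rw [← h2, ← hb]
    simp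
  · rw [wid_of_le h1.le] at hw
    exact hs ⟨h1, hw⟩
  · have h2 : |x| ≤ 3 / 4 - 3 / 8 * |t| := not_lt.1 fun h => hside ⟨h1, h⟩
    rw [wid_of_mem h1.le (by linarith)] at hw
    have h3 : |t| = 2 - 8 / 3 * |x| := by linarith
    refine he b (some σ) (3 / 2 * |t|) ⟨by linarith, by linarith⟩ ?_
    simp only [edgePath, Option.elim]
    refine Prod.ext ?_ ?_
    · simp only
      rw [show 3 / 4 - 3 / 2 * |t| / 4 = |x| by rw [h3]; ring]
      exact hσ
    · simp only
      rw [show 2 / 3 * (3 / 2 * |t|) = |t| by ring]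
      exact hb

theorem zone_notMem_hexagon {u : ℝ × ℝ} (hu : u ∈ hexProfile.zone) :
    ¬ (|u.1| ≤ 3 / 4 ∧ |u.2| ≤ wid u.1) ∧ ¬ (|u.1| = 1 / 2 ∧ 2 / 3 ≤ |u.2|) := by
  obtain ⟨-, h | h | h⟩ := hu
  · obtain ⟨h1, h2⟩ : 1 / 2 < |u.1| ∧ 3 / 4 - 3 / 8 * |u.2| < |u.1| := max_lt_iff.1 h
    refine ⟨fun h3 => ?_, fun h3 => h1.ne' h3.1⟩
    rw [wid_of_mem h1.le h3.1] at h3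
    linarith [h3.2]
  · obtain ⟨h1, h2⟩ : |u.1| < 1 / 2 ∧ u.2 < -(2 / 3) := h
    refine ⟨fun h3 => ?_, fun h3 => h1.ne h3.1⟩
    rw [wid_of_le h1.le] at h3
    linarith [neg_abs_le u.2]
  · obtain ⟨h1, h2⟩ : |u.1| < 1 / 2 ∧ 2 / 3 < u.2 := h
    refine ⟨fun h3 => ?_, fun h3 => h1.ne h3.1⟩
    rw [wid_of_le h1.le] at h3
    linarith [le_abs_self u.2]

/-! ### The graph -/

namespace TwistDiagram

variable (K : TwistDiagram)

/-- The union of the arcs that are collapsed to the vertices. -/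
def spine : Set Torus := ⋃ j, seam K.seamChart j

/-- The map of the torus that collapses the arcs of the spine. -/
noncomputable def collapseSpine : Torus → Torus := collapse K.seamChart 0

/-- The open half of the hexagon of a twist region. -/
def half (i : K.Twist) (b : Bool) : Set Torus := K.chart i '' halfHexagon b

/-- An open side of the hexagon of a twist region. -/
def rim (e : K.Twist × Bool × Option Bool) : Set Torus :=
  {p | ∃ s ∈ Ioo (0 : ℝ) 1, p = K.chart e.1 (edgePath e.2.1 e.2.2 s)}

/-- In a box, the spine consists of the ends of the strands and of the slot. -/
theorem spine_chart {i : K.Twist} {u : ℝ × ℝ} (hu : u ∈ square) :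
    K.chart i u ∈ K.spine ↔ (|u.1| = 1 / 2 ∧ 2 / 3 ≤ |u.2|) ∨ (u.2 = 0 ∧ |u.1| ≤ 3 / 4) := by
  rw [spine, iUnion_seam]
  constructor
  · rintro ((h | ⟨j, l, t, h1, h2, h3⟩) | h)
    · obtain ⟨e, he⟩ := mem_iUnion.1 h
      obtain ⟨b, c, rfl⟩ := K.core_chart hu he
      left
      simp only [abs_div, abs_sgn]
      norm_num
    · obtain ⟨-, rfl⟩ := K.isSquareFamily_chart.inj _ _ _ hu _
        (mem_square.2 ⟨by rw [abs_div, abs_sgn]; norm_num, h2⟩) h3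
      left
      refine ⟨?_, h1⟩
      simp only [abs_div, abs_sgn]
      norm_num
    · obtain ⟨j, x, hx, h⟩ := mem_iUnion.1 h
      obtain ⟨-, rfl⟩ := K.isSquareFamily_chart.inj _ _ _ hu _
        (mem_square.2 ⟨by simp only; linarith, by simp⟩) h
      exact Or.inr ⟨rfl, hx⟩
  · rintro (⟨h1, h2⟩ | ⟨h1, h2⟩)
    · obtain ⟨b, hb⟩ := sgn_exists u.1
      refine Or.inl (Or.inr ⟨i, b, u.2, h2, (mem_square.1 hu).2, ?_⟩)
      rw [h1] at hb
      rw [show u = (sgn b / 2, u.2) from Prod.ext (by rw [hb]; ring) rfl]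
    · refine Or.inr (mem_iUnion.2 ⟨i, u.1, h2, ?_⟩)
      rw [← h1]

theorem spine_of_notMem {p : Torus} (hp : ∀ i, p ∉ K.chart i '' square) :
    p ∈ K.spine ↔ ∃ e, p ∈ K.core e := by
  rw [spine, iUnion_seam]
  constructor
  · rintro ((h | ⟨j, l, t, h1, h2, h3⟩) | h)
    · exact mem_iUnion.1 h
    · exact absurd ⟨_, mem_square.2 ⟨by rw [abs_div, abs_sgn]; norm_num, h2⟩, h3.symm⟩ (hp j)
    · obtain ⟨j, x, hx, h⟩ := mem_iUnion.1 h
      exact absurd ⟨_, mem_square.2 ⟨by simp only; linarith, by simp⟩, h.symm⟩ (hp j)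
  · exact fun h => Or.inl (Or.inl (mem_iUnion.2 h))

theorem half_notMem_spine {i : K.Twist} {b : Bool} {p : Torus} (hp : p ∈ K.half i b) :
    p ∉ K.spine := by
  obtain ⟨u, hu, rfl⟩ := hp
  rw [K.spine_chart (openSquare_subset (halfHexagon_subset b hu))]
  rintro (⟨-, h⟩ | ⟨h, -⟩)
  · linarith [hu.2, wid_le u.1]
  · have := hu.1
    rw [h, mul_zero] at this
    exact lt_irrefl _ this

theorem white_notMem_spine {p : Torus} (hp : p ∈ K.white) : p ∉ K.spine := by
  rcases IsSquareFamily.mem_square_or K.chart p with ⟨i, u, hu, rfl⟩ | hn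
  · obtain ⟨h1, h2⟩ := zone_notMem_hexagon ((K.region_chart _ hu).1 hp)
    rw [K.spine_chart hu]
    rintro (h | ⟨h, h'⟩)
    · exact h2 h
    · exact h1 ⟨h', by rw [h, abs_zero]; exact wid_nonneg _⟩
  · rw [K.spine_of_notMem hn]
    rintro ⟨e, he⟩
    exact (K.region_of_notMem _ hn).1 hp e he

theorem white_notMem_hexagons {p : Torus} (hp : p ∈ K.white) : p ∉ K.hexagons := by
  rintro ⟨i, u, hu, rfl, h⟩
  exact (zone_notMem_hexagon ((K.region_chart _ hu).1 hp)).1 h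

theorem rim_subset_hexagons (e : K.Twist × Bool × Option Bool) : K.rim e ⊆ K.hexagons := by
  rintro _ ⟨s, hs, rfl⟩
  obtain ⟨h1, h2⟩ := edgePath_spec e.2.1 e.2.2 hs.1.le hs.2.le
  exact ⟨e.1, _, edgePath_mem_square _ _ hs.1.le hs.2.le, rfl, h1, h2.le⟩

theorem half_subset_hexagons (i : K.Twist) (b : Bool) : K.half i b ⊆ K.hexagons := by
  rintro _ ⟨u, hu, rfl⟩
  exact ⟨i, u, openSquare_subset (halfHexagon_subset b hu), rfl,
    (wid_pos_iff.1 ((abs_nonneg _).trans_lt hu.2)).le, hu.2.le⟩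

theorem rim_notMem_spine {e : K.Twist × Bool × Option Bool} {p : Torus} (hp : p ∈ K.rim e) :
    p ∉ K.spine := by
  obtain ⟨s, hs, rfl⟩ := hp
  have h0 := edgePath_snd_pos e.2.1 e.2.2 hs.1
  have h1 := (edgePath_spec e.2.1 e.2.2 hs.1.le hs.2.le).2
  rw [K.spine_chart (edgePath_mem_square _ _ hs.1.le hs.2.le)]
  rintro (⟨h2, h3⟩ | ⟨h2, -⟩)
  · obtain ⟨i, b, m⟩ := e
    cases m with
    | none => exact (abs_edgePath_none hs).ne h2
    | some σ =>
      have h4 : 2 / 3 ≤ |sgn b * (2 / 3 * s)| := h3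
      rw [abs_mul, abs_sgn, one_mul, abs_of_pos (by linarith [hs.1])] at h4
      linarith [hs.2]
  · rw [h2, mul_zero] at h0
    exact lt_irrefl _ h0

theorem half_disjoint_rim {i : K.Twist} {b : Bool} {e : K.Twist × Bool × Option Bool} {p : Torus}
    (hp : p ∈ K.half i b) : p ∉ K.rim e := by
  rintro ⟨s, hs, h⟩
  obtain ⟨u, hu, rfl⟩ := hp
  obtain ⟨-, rfl⟩ := K.isSquareFamily_chart.inj _ _ _ (openSquare_subset (halfHexagon_subset b hu))
    _ (edgePath_mem_square _ _ hs.1.le hs.2.le) h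
  exact hu.2.ne (edgePath_spec e.2.1 e.2.2 hs.1.le hs.2.le).2

theorem half_eq_of_mem {i j : K.Twist} {b c : Bool} {p : Torus} (hp : p ∈ K.half i b)
    (hp' : p ∈ K.half j c) : (i, b) = (j, c) := by
  obtain ⟨u, hu, rfl⟩ := hp
  obtain ⟨v, hv, h⟩ := hp'
  obtain ⟨rfl, rfl⟩ := K.isSquareFamily_chart.inj _ _ _
    (openSquare_subset (halfHexagon_subset c hv)) _ (openSquare_subset (halfHexagon_subset b hu)) h
  rw [eq_of_sgn_mul_pos hu.1 hv.1]

/-- The torus is the union of the spine, the white region, and the halves and sides of the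
hexagons. -/
theorem mem_white_or {p : Torus} (hp : p ∉ K.spine) :
    p ∈ K.white ∨ (∃ a : K.Twist × Bool, p ∈ K.half a.1 a.2) ∨ ∃ e, p ∈ K.rim e := by
  rcases IsSquareFamily.mem_square_or K.chart p with ⟨i, u, hu, rfl⟩ | hn
  · rw [K.spine_chart hu, not_or] at hp
    rcases hexagon_cases hu hp.1 hp.2 with h | ⟨b, h⟩ | ⟨b, m, s, hs, rfl⟩
    · exact Or.inl ((K.region_chart _ hu).2 h)
    · exact Or.inr (Or.inl ⟨(i, b), u, h, rfl⟩)
    · exact Or.inr (Or.inr ⟨(i, b, m), s, hs, rfl⟩)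
  · rw [K.spine_of_notMem hn] at hp
    exact Or.inl ((K.region_of_notMem _ hn).2 fun e he => hp ⟨e, he⟩)

theorem isOpen_half (i : K.Twist) (b : Bool) : IsOpen (K.half i b) :=
  K.isSquareFamily_chart.isOpen_image i (isOpen_halfHexagon b)
    ((halfHexagon_subset b).trans openSquare_subset)

theorem continuous_collapseSpine : Continuous K.collapseSpine :=
  K.isSquareFamily_seamChart.continuous_collapse_zero

theorem collapseSpine_inj {p q : Torus} (hp : p ∉ K.spine)
    (h : K.collapseSpine q = K.collapseSpine p) : q = p :=
  K.isSquareFamily_seamChart.collapse_inj hp h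

/-- The vertices of the graph. -/
def vertices : Set Torus := range (node K.seamChart)

theorem collapseSpine_mem_vertices_iff {p : Torus} : K.collapseSpine p ∈ K.vertices ↔ p ∈ K.spine :=
  ⟨fun h => by_contra fun hp => K.isSquareFamily_seamChart.collapse_notMem_range_node hp h,
    fun h => K.isSquareFamily_seamChart.collapse_mem_range_node h⟩

theorem isOpen_collapseSpine_image {A : Set Torus} (hA : IsOpen A) (hs : ∀ p ∈ A, p ∉ K.spine) :
    IsOpen (K.collapseSpine '' A) := K.isSquareFamily_seamChart.isOpen_collapse_image hA hs

/-- The complement of the graph. -/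
theorem compl_graph_eq : (K.vertices ∪ ⋃ e, K.collapseSpine '' K.rim e)ᶜ =
    K.collapseSpine '' (K.white ∪ ⋃ a : K.Twist × Bool, K.half a.1 a.2) := by
  ext p
  simp only [mem_compl_iff, mem_union, mem_iUnion, not_or, not_exists]
  constructor
  · rintro ⟨h1, h2⟩
    obtain ⟨q, hq, rfl⟩ := K.isSquareFamily_seamChart.exists_collapse_eq h1
    refine ⟨q, ?_, rfl⟩
    rcases K.mem_white_or hq with h | ⟨a, h⟩ | ⟨e, h⟩
    · exact Or.inl h
    · exact Or.inr (mem_iUnion.2 ⟨a, h⟩)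
    · exact absurd ⟨q, h, rfl⟩ (h2 e)
  · rintro ⟨q, hq, rfl⟩
    have hqs : q ∉ K.spine := by
      rcases hq with h | h
      · exact K.white_notMem_spine h
      · obtain ⟨a, h⟩ := mem_iUnion.1 h
        exact K.half_notMem_spine h
    refine ⟨fun h => hqs (K.collapseSpine_mem_vertices_iff.1 h), ?_⟩
    rintro e ⟨q', hq', h⟩
    obtain rfl := K.collapseSpine_inj hqs h
    rcases hq with h | h
    · exact K.white_notMem_hexagons h (K.rim_subset_hexagons e hq')
    · obtain ⟨a, h⟩ := mem_iUnion.1 h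
      exact K.half_disjoint_rim h hq'

/-- The open triangles of the bow-ties. -/
def triangle (i : K.Twist) (b : Bool) : Set Torus := K.collapseSpine '' K.half i b

/-- The union of the white faces. -/
def whiteFaces : Set Torus := K.collapseSpine '' K.white

theorem isOpen_triangle (i : K.Twist) (b : Bool) : IsOpen (K.triangle i b) :=
  K.isOpen_collapseSpine_image (K.isOpen_half i b) fun _ h => K.half_notMem_spine h

theorem isOpen_whiteFaces : IsOpen K.whiteFaces :=
  K.isOpen_collapseSpine_image K.isOpen_white fun _ h => K.white_notMem_spine h

/-- The complement of the graph is the disjoint union of the white part and of the triangles, all of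
which are open. -/
theorem compl_graph_eq' : (K.vertices ∪ ⋃ e, K.collapseSpine '' K.rim e)ᶜ =
    K.whiteFaces ∪ ⋃ a : K.Twist × Bool, K.triangle a.1 a.2 := by
  rw [compl_graph_eq, image_union, image_iUnion]
  rfl

theorem whiteFaces_disjoint_triangle {i : K.Twist} {b : Bool} {p : Torus} (hp : p ∈ K.whiteFaces) :
    p ∉ K.triangle i b := by
  rintro ⟨q, hq, rfl⟩
  obtain ⟨q', hq', h⟩ := hp
  obtain rfl := K.collapseSpine_inj (K.half_notMem_spine hq) h
  exact K.white_notMem_hexagons hq' (K.half_subset_hexagons i b hq)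

theorem triangle_eq_of_mem {i j : K.Twist} {b c : Bool} {p : Torus} (hp : p ∈ K.triangle i b)
    (hp' : p ∈ K.triangle j c) : (i, b) = (j, c) := by
  obtain ⟨q, hq, rfl⟩ := hp
  obtain ⟨q', hq', h⟩ := hp'
  obtain rfl := K.collapseSpine_inj (K.half_notMem_spine hq) h
  exact K.half_eq_of_mem hq hq'

theorem connectedComponentIn_triangle {i : K.Twist} {b : Bool} {p : Torus}
    (hp : p ∈ K.triangle i b) :
    connectedComponentIn (K.vertices ∪ ⋃ e, K.collapseSpine '' K.rim e)ᶜ p = K.triangle i b := by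
  have hsub : K.triangle i b ⊆ (K.vertices ∪ ⋃ e, K.collapseSpine '' K.rim e)ᶜ := by
    rw [compl_graph_eq']
    exact fun q hq => Or.inr (mem_iUnion.2 ⟨(i, b), hq⟩)
  rw [connectedComponentIn_eq_of_isOpen hsub (K.isOpen_triangle i b) ?_ hp]
  · refine IsPreconnected.connectedComponentIn ?_ hp
    exact ((convex_halfHexagon b).isPreconnected.image _ ((K.isSquareFamily_chart.cont i).mono
      ((halfHexagon_subset b).trans openSquare_subset))).image _
      K.continuous_collapseSpine.continuousOn
  -- the rest of the complement is open, so the triangle is clopen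
  · have h : (K.vertices ∪ ⋃ e, K.collapseSpine '' K.rim e)ᶜ \ K.triangle i b =
        K.whiteFaces ∪ ⋃ a : {a : K.Twist × Bool // a ≠ (i, b)}, K.triangle a.1.1 a.1.2 := by
      rw [compl_graph_eq']
      ext q
      constructor
      · rintro ⟨h1 | h1, h2⟩
        · exact Or.inl h1
        · obtain ⟨a, ha⟩ := mem_iUnion.1 h1
          refine Or.inr (mem_iUnion.2 ⟨⟨a, ?_⟩, ha⟩)
          rintro rfl
          exact h2 ha
      · rintro (h | h)
        · exact ⟨Or.inl h, K.whiteFaces_disjoint_triangle h⟩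
        · obtain ⟨a, ha⟩ := mem_iUnion.1 h
          exact ⟨Or.inr (mem_iUnion.2 ⟨a.1, ha⟩), fun h => a.2 (K.triangle_eq_of_mem ha h)⟩
    rw [h]
    exact K.isOpen_whiteFaces.union (isOpen_iUnion fun a => K.isOpen_triangle _ _)

theorem connectedComponentIn_white {p : Torus} (hp : p ∈ K.whiteFaces) :
    connectedComponentIn (K.vertices ∪ ⋃ e, K.collapseSpine '' K.rim e)ᶜ p =
      connectedComponentIn K.whiteFaces p := by
  refine connectedComponentIn_eq_of_isOpen ?_ K.isOpen_whiteFaces ?_ hp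
  · rw [compl_graph_eq']
    exact subset_union_left
  · have h : (K.vertices ∪ ⋃ e, K.collapseSpine '' K.rim e)ᶜ \ K.whiteFaces =
        ⋃ a : K.Twist × Bool, K.triangle a.1 a.2 := by
      rw [compl_graph_eq']
      ext q
      constructor
      · rintro ⟨h1 | h1, h2⟩
        · exact absurd h1 h2
        · exact h1
      · intro h
        refine ⟨Or.inr h, fun h' => ?_⟩
        obtain ⟨a, ha⟩ := mem_iUnion.1 h
        exact K.whiteFaces_disjoint_triangle h' ha
    rw [h]
    exact isOpen_iUnion fun a => K.isOpen_triangle _ _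

theorem isOpenDisk_triangle (i : K.Twist) (b : Bool) : IsOpenDisk (K.triangle i b) := by
  have hs : halfHexagon b ⊆ square := (halfHexagon_subset b).trans openSquare_subset
  rw [triangle, half, ← image_comp]
  refine isOpenDisk_image_of_convex (isOpen_halfHexagon b) (convex_halfHexagon b)
    (isCompact_square.isBounded.subset hs) ⟨(0, sgn b * (1 / 3)), ?_⟩ ?_ ?_
  · show 0 < sgn b * (sgn b * (1 / 3)) ∧ |sgn b * (1 / 3)| < wid 0
    rw [wid_of_le (by norm_num), ← mul_assoc, sgn_sq, abs_mul, abs_sgn]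
    norm_num
  · exact K.continuous_collapseSpine.comp_continuousOn ((K.isSquareFamily_chart.cont i).mono hs)
  · intro u hu v hv h
    have h1 := K.collapseSpine_inj (K.half_notMem_spine ⟨v, hv, rfl⟩) h
    exact K.isSquareFamily_chart.injOn i (hs hu) (hs hv) h1

/-- All faces of the graph are disks. On the white part the collapse has an inverse, so the white
faces are homeomorphic to components of the white region. -/
theorem isOpenDisk_component (hK : K.IsCellular) {p : Torus}
    (hp : p ∉ K.vertices ∪ ⋃ e, K.collapseSpine '' K.rim e) :
    IsOpenDisk (connectedComponentIn (K.vertices ∪ ⋃ e, K.collapseSpine '' K.rim e)ᶜ p) := by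
  have hp' : p ∈ K.whiteFaces ∪ ⋃ a : K.Twist × Bool, K.triangle a.1 a.2 := by
    rw [← compl_graph_eq']; exact hp
  rcases hp' with h | h
  · rw [K.connectedComponentIn_white h]
    have hleft : ∀ q ∈ K.white, stretch K.seamChart 0 (K.collapseSpine q) = q := fun q hq =>
      K.isSquareFamily_seamChart.stretch_collapse_zero (K.white_notMem_spine hq)
    refine K.isOpenDisk_white hK K.isOpen_whiteFaces (g := stretch K.seamChart 0) ?_ ?_ ?_ h
    · refine K.isSquareFamily_seamChart.continuousOn_stretch_zero.mono ?_
      rintro _ ⟨q, hq, rfl⟩ hv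
      exact K.white_notMem_spine hq (K.collapseSpine_mem_vertices_iff.1 hv)
    · rintro _ ⟨q, hq, rfl⟩ _ ⟨q', hq', rfl⟩ h
      rw [hleft q hq, hleft q' hq'] at h
      rw [h]
    · ext q
      constructor
      · rintro ⟨_, ⟨q, hq, rfl⟩, rfl⟩
        rwa [hleft q hq]
      · exact fun hq => ⟨_, ⟨q, hq, rfl⟩, hleft q hq⟩
  · obtain ⟨a, ha⟩ := mem_iUnion.1 h
    rw [K.connectedComponentIn_triangle ha]
    exact K.isOpenDisk_triangle _ _

/-- The edges of the graph. -/
noncomputable def graphArc (e : K.Twist × Bool × Option Bool) : C(unitInterval, Torus) where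
  toFun s := K.collapseSpine (K.chart e.1 (edgePath e.2.1 e.2.2 s))
  continuous_toFun := by
    refine K.continuous_collapseSpine.comp (continuousOn_univ.1 ((K.isSquareFamily_chart.cont
      e.1).comp ((continuous_edgePath _ _).comp continuous_subtype_val).continuousOn
      fun s _ => edgePath_mem_square _ _ s.2.1 s.2.2))

theorem graphArc_apply (e : K.Twist × Bool × Option Bool) (s : unitInterval) :
    K.graphArc e s = K.collapseSpine (K.chart e.1 (edgePath e.2.1 e.2.2 s)) := rfl

theorem graphArc_image (e : K.Twist × Bool × Option Bool) :
    K.graphArc e '' Ioo 0 1 = K.collapseSpine '' K.rim e := by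
  ext p
  constructor
  · rintro ⟨s, ⟨h1, h2⟩, rfl⟩
    exact ⟨_, ⟨s, ⟨h1, h2⟩, rfl⟩, rfl⟩
  · rintro ⟨_, ⟨s, hs, rfl⟩, rfl⟩
    exact ⟨⟨s, hs.1.le, hs.2.le⟩, ⟨hs.1, hs.2⟩, rfl⟩

/-- The index of the vertex at which an edge starts. -/
def start (e : K.Twist × Bool × Option Bool) : K.Arc ⊕ K.Twist :=
  e.2.2.elim (Sum.inl (K.portArc e.1 false e.2.1)) fun _ => Sum.inr e.1

/-- The index of the vertex at which an edge ends. -/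
def finish (e : K.Twist × Bool × Option Bool) : K.Arc ⊕ K.Twist :=
  Sum.inl (K.portArc e.1 (e.2.2.getD true) e.2.1)

theorem graphArc_zero (e : K.Twist × Bool × Option Bool) :
    K.graphArc e 0 = node K.seamChart (K.start e) := by
  obtain ⟨i, b, m⟩ := e
  refine (K.isSquareFamily_seamChart.collapse_eq_node_iff _).2 ?_
  cases m with
  | none =>
    have h : edgePath b none (0 : unitInterval) = (sgn false / 2, sgn b * (2 / 3)) := by
      simp [edgePath, sgn]; norm_num
    simp only [h]
    exact K.strand_mem_seam i false b le_rfl (by norm_num)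
  | some σ =>
    show _ ∈ seam K.seamChart (Sum.inr i)
    rw [seam_inr]
    refine ⟨sgn σ * (3 / 4), by rw [abs_mul, abs_sgn]; norm_num, ?_⟩
    simp [edgePath]

theorem graphArc_one (e : K.Twist × Bool × Option Bool) :
    K.graphArc e 1 = node K.seamChart (K.finish e) := by
  obtain ⟨i, b, m⟩ := e
  refine (K.isSquareFamily_seamChart.collapse_eq_node_iff _).2 ?_
  cases m with
  | none =>
    have h : edgePath b none (1 : unitInterval) = (sgn true / 2, sgn b * (2 / 3)) := by
      simp [edgePath, sgn]; norm_num
    simp only [h]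
    exact K.strand_mem_seam i true b le_rfl (by norm_num)
  | some σ =>
    have h : edgePath b (some σ) (1 : unitInterval) = (sgn σ / 2, sgn b * (2 / 3)) := by
      simp [edgePath]; ring
    simp only [h]
    exact K.strand_mem_seam i σ b le_rfl (by norm_num)

/-- The graph of the torihedra. -/
noncomputable def graph (hK : K.IsCellular) : CellularGraph where
  vert := K.vertices
  Edge := K.Twist × Bool × Option Bool
  arc := K.graphArc
  vert_finite := by
    have := K.isSquareFamily_seamChart.finite
    exact finite_range _
  edge_finite := by
    have := K.twist_finite
    infer_instance
  arc_zero e := ⟨_, (K.graphArc_zero e).symm⟩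
  arc_one e := ⟨_, (K.graphArc_one e).symm⟩
  arc_notMem e s hs h := by
    have h1 : K.graphArc e s ∈ K.collapseSpine '' K.rim e := by
      rw [← graphArc_image]; exact ⟨s, hs, rfl⟩
    obtain ⟨p, hp, h2⟩ := h1
    rw [← h2] at h
    exact K.rim_notMem_spine hp (K.collapseSpine_mem_vertices_iff.1 h)
  arc_inj e e' s hs s' hs' h := by
    have h1 := K.collapseSpine_inj (K.rim_notMem_spine (e := e') ⟨s', hs', rfl⟩) h
    obtain ⟨h2, h3⟩ := K.isSquareFamily_chart.inj _ _ _ (edgePath_mem_square _ _ s.2.1 s.2.2) _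
      (edgePath_mem_square _ _ s'.2.1 s'.2.2) h1
    obtain ⟨h4, h5, h6⟩ := edgePath_inj hs hs' h3
    exact ⟨Prod.ext h2 (Prod.ext h4 h5), Subtype.ext h6⟩
  cellular p hp := by
    simp only [graphArc_image] at hp ⊢
    exact K.isOpenDisk_component hK hp

end TwistDiagram

/-! ### The triangles -/

/-- Coordinates on a closed half of the hexagon as a cone over its three outer sides, for which the
slot is blown down: the height of a point is `2 / 3 * σ`, and `ρ / σ` is its relative position on
the horizontal line. -/
noncomputable def cone (b : Bool) (σ ρ : ℝ) : ℝ × ℝ :=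
  ((3 / 4 - σ / 4) * ρ / σ, sgn b * (2 / 3 * σ))

theorem abs_cone_fst {b : Bool} {σ ρ : ℝ} (h0 : 0 ≤ σ) (h1 : σ ≤ 1) (hρ : |ρ| ≤ σ) :
    |(cone b σ ρ).1| ≤ 3 / 4 - σ / 4 := by
  simp only [cone]
  rw [mul_div_assoc, abs_mul, abs_of_nonneg (by linarith : (0 : ℝ) ≤ 3 / 4 - σ / 4), abs_div,
    abs_of_nonneg h0]
  exact mul_le_of_le_one_right (by linarith) (div_le_one_of_le₀ hρ h0)

theorem abs_cone_snd {b : Bool} {σ ρ : ℝ} (h0 : 0 ≤ σ) : |(cone b σ ρ).2| = 2 / 3 * σ := by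
  simp only [cone]
  rw [abs_mul, abs_sgn, one_mul, abs_of_nonneg (by linarith)]

theorem cone_mem_square {b : Bool} {σ ρ : ℝ} (h0 : 0 ≤ σ) (h1 : σ ≤ 1) (hρ : |ρ| ≤ σ) :
    cone b σ ρ ∈ square := by
  rw [mem_square, abs_cone_snd h0]
  exact ⟨(abs_cone_fst h0 h1 hρ).trans (by linarith), by linarith⟩

theorem lt_wid_iff {x t : ℝ} (ht : 0 ≤ t) : t < wid x ↔ t < 2 / 3 ∧ |x| < 3 / 4 - 3 / 8 * t := by
  rw [wid, lt_max_iff, or_iff_right ht.not_gt, lt_min_iff]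
  exact and_congr_right fun _ => ⟨fun h => by linarith, fun h => by linarith⟩

theorem cone_mem_halfHexagon_iff {b : Bool} {σ ρ : ℝ} (h0 : 0 ≤ σ) (h1 : σ ≤ 1) :
    cone b σ ρ ∈ halfHexagon b ↔ 0 < σ ∧ σ < 1 ∧ |ρ| < σ := by
  have ht : sgn b * (cone b σ ρ).2 = 2 / 3 * σ := by
    simp only [cone]; rw [← mul_assoc, sgn_sq, one_mul]
  rw [halfHexagon, mem_ofPred_eq, ht, abs_cone_snd h0, lt_wid_iff (by linarith)]
  have hx : |(cone b σ ρ).1| = (3 / 4 - σ / 4) * (|ρ| / σ) := by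
    simp only [cone]
    rw [mul_div_assoc, abs_mul, abs_of_nonneg (by linarith : (0 : ℝ) ≤ 3 / 4 - σ / 4), abs_div,
      abs_of_nonneg h0]
  rw [hx]
  have hs : 0 < 3 / 4 - σ / 4 := by linarith
  constructor
  · rintro ⟨h2, h3, h4⟩
    have h5 : 0 < σ := by linarith
    refine ⟨h5, by linarith, ?_⟩
    rw [← div_lt_one h5]
    by_contra! hc
    nlinarith
  · rintro ⟨h2, h3, h4⟩
    refine ⟨by linarith, by linarith, ?_⟩
    rw [← div_lt_one h2] at h4
    nlinarith

/-- All points of the open half have cone coordinates with `|ρ| < σ < 1`. -/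
theorem exists_cone_eq {b : Bool} {u : ℝ × ℝ} (hu : u ∈ halfHexagon b) :
    ∃ σ ρ, 0 < σ ∧ σ < 1 ∧ |ρ| < σ ∧ cone b σ ρ = u := by
  obtain ⟨h1, h2⟩ := hu
  have habs := abs_eq_sgn_mul h1.le
  rw [lt_wid_iff (abs_nonneg _)] at h2
  have h0 : 0 < |u.2| := by rw [habs]; exact h1
  have hs : 0 < 3 / 4 - 3 / 8 * |u.2| := by linarith
  refine ⟨3 / 2 * |u.2|, 3 / 2 * |u.2| * (u.1 / (3 / 4 - 3 / 8 * |u.2|)), by linarith,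
    by linarith, ?_, ?_⟩
  · rw [abs_mul, abs_of_pos (by linarith : (0 : ℝ) < 3 / 2 * |u.2|), abs_div, abs_of_pos hs]
    refine mul_lt_of_lt_one_right (by linarith) ((div_lt_one hs).2 h2.2)
  · refine Prod.ext ?_ ?_
    · simp only [cone]
      rw [show 3 / 4 - 3 / 2 * |u.2| / 4 = 3 / 4 - 3 / 8 * |u.2| by ring, ← mul_assoc,
        mul_comm (3 / 4 - 3 / 8 * |u.2|), mul_assoc, mul_div_cancel₀ _ hs.ne', mul_comm,
        mul_div_assoc, div_self (by linarith), mul_one]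
    · simp only [cone]
      rw [show 2 / 3 * (3 / 2 * |u.2|) = |u.2| by ring, habs, ← mul_assoc, sgn_sq, one_mul]

theorem cone_inj {b : Bool} {σ ρ σ' ρ' : ℝ} (h0 : 0 < σ) (h1 : σ < 1)
    (h : cone b σ ρ = cone b σ' ρ') : σ = σ' ∧ ρ = ρ' := by
  obtain ⟨h2, h3⟩ := Prod.mk.inj h
  have h4 : σ = σ' := by
    have := mul_left_cancel₀ (sgn_ne_zero b) h3
    linarith
  subst h4
  refine ⟨rfl, ?_⟩
  have hs : 3 / 4 - σ / 4 ≠ 0 := by linarith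
  rw [div_left_inj' h0.ne'] at h2
  exact mul_left_cancel₀ hs h2

namespace TwistDiagram

variable (K : TwistDiagram)

/-- Close to the slot, the coordinates of a triangle are given by a formula that makes sense on the
slot, which is collapsed. -/
theorem collapseSpine_cone (i : K.Twist) (b : Bool) {σ ρ : ℝ} (h0 : 0 ≤ σ) (h1 : σ ≤ 3 / 8)
    (hρ : |ρ| ≤ σ) : K.collapseSpine (K.chart i (cone b σ ρ)) =
      K.chart i ((3 / 4 - σ / 4) * ρ * (32 / 3) / (8 / 3 * σ + 3), sgn b * (2 / 3 * σ)) := by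
  have hx := abs_cone_fst (b := b) h0 (by linarith) hρ
  have hpush : ∀ x τ : ℝ, 0 ≤ τ → 4 * |x| ≤ τ + 3 → push x τ = 4 * x * τ / (τ + 3) := by
    intro x τ hτ
    refine forall_of_nonneg (P := fun x => 4 * |x| ≤ τ + 3 → push x τ = 4 * x * τ / (τ + 3)) ?_ ?_ x
    · intro s hs h
      have := hs (by rwa [abs_neg])
      rw [push_neg] at this
      rw [← neg_inj, this]
      ring
    · intro s hs h
      rw [abs_of_nonneg hs] at h
      exact push_of_le hτ hs h
  have hmem : (4 * (cone b σ ρ).2, (cone b σ ρ).1) ∈ square := by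
    rw [mem_square]
    simp only
    rw [abs_mul, abs_cone_snd h0, abs_of_pos (by norm_num : (0 : ℝ) < 4)]
    constructor <;> linarith
  have h2 : K.chart i (cone b σ ρ) =
      K.seamChart (Sum.inr i) (4 * (cone b σ ρ).2, (cone b σ ρ).1) := by
    show _ = K.chart i _
    congr 1
    exact Prod.ext rfl (by simp)
  have h3 : seamDist (4 * (cone b σ ρ).2) 0 = 8 / 3 * σ := by
    rw [seamDist, add_zero, abs_mul, abs_cone_snd h0, abs_of_pos (by norm_num : (0 : ℝ) < 4),
      min_eq_right (by linarith)]
    ring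
  rw [h2, collapseSpine, K.isSquareFamily_seamChart.collapse_apply 0 _ hmem]
  simp only
  rw [h3, hpush _ _ (by linarith) (by linarith)]
  show K.chart i _ = _
  refine congrArg _ (Prod.ext ?_ ?_)
  · simp only [cone]
    rcases h0.eq_or_lt with rfl | h0
    · have : ρ = 0 := abs_nonpos_iff.1 hρ
      simp [this]
    · field_simp
      ring
  · simp only [cone]
    ring

/-- The parametrisation of a closed triangle by a 2-simplex. -/
noncomputable def triangleMap (i : K.Twist) (b : Bool) (w : stdSimplex ℝ (Fin 3)) : Torus :=
  K.collapseSpine (K.chart i (cone b (w.1 1 + w.1 2) (w.1 2 - w.1 1)))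

theorem simplex_spec (w : stdSimplex ℝ (Fin 3)) : 0 ≤ w.1 1 + w.1 2 ∧ w.1 1 + w.1 2 ≤ 1 ∧
    |w.1 2 - w.1 1| ≤ w.1 1 + w.1 2 ∧ w.1 0 = 1 - (w.1 1 + w.1 2) := by
  have h := w.2.2
  rw [Fin.sum_univ_three] at h
  have h0 := w.2.1 0
  have h1 := w.2.1 1
  have h2 := w.2.1 2
  refine ⟨by linarith, by linarith, ?_, by linarith⟩
  rw [abs_le]
  constructor <;> linarith

/-- The cone coordinates are not continuous at `σ = 0`, but their composition with the collapse
is. -/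
theorem continuousOn_collapseSpine_cone (i : K.Twist) (b : Bool) :
    ContinuousOn (fun v : ℝ × ℝ => K.collapseSpine (K.chart i (cone b v.1 v.2)))
      {v | 0 ≤ v.1 ∧ v.1 ≤ 1 ∧ |v.2| ≤ v.1} := by
  refine continuousOn_of_locally_continuousOn fun v _ => ?_
  rcases lt_or_ge v.1 (3 / 8) with h | h
  · refine ⟨{v | v.1 < 3 / 8}, isOpen_lt (by fun_prop) (by fun_prop), h, ?_⟩
    have h3 : ContinuousOn (fun v : ℝ × ℝ => K.chart i
        ((3 / 4 - v.1 / 4) * v.2 * (32 / 3) / (8 / 3 * v.1 + 3), sgn b * (2 / 3 * v.1)))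
        ({v | 0 ≤ v.1 ∧ v.1 ≤ 1 ∧ |v.2| ≤ v.1} ∩ {v | v.1 < 3 / 8}) := by
      refine (K.isSquareFamily_chart.cont i).comp (ContinuousOn.prodMk
        (ContinuousOn.div (by fun_prop) (by fun_prop) ?_) (by fun_prop)) ?_
      · rintro ⟨σ, ρ⟩ ⟨⟨h4, -⟩, -⟩
        simp only at h4 ⊢
        linarith
      · rintro ⟨σ, ρ⟩ ⟨⟨h4, h5, h6⟩, hv⟩
        have hv : σ < 3 / 8 := hv
        simp only at h4 h5 h6
        rw [mem_square]
        constructor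
        · simp only
          rw [abs_div, abs_of_pos (by linarith : 0 < 8 / 3 * σ + 3), div_le_one (by linarith),
            abs_mul, abs_mul, abs_of_pos (by linarith : 0 < 3 / 4 - σ / 4),
            abs_of_pos (by norm_num : (0 : ℝ) < 32 / 3)]
          nlinarith [abs_nonneg ρ]
        · simp only
          rw [abs_mul, abs_sgn, one_mul, abs_of_nonneg (by linarith)]
          linarith
    refine h3.congr ?_
    rintro ⟨σ, ρ⟩ ⟨⟨h4, h5, h6⟩, hv⟩
    exact K.collapseSpine_cone i b h4 (le_of_lt hv) h6
  · refine ⟨{v | 0 < v.1}, isOpen_lt (by fun_prop) (by fun_prop), by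
      show 0 < v.1; linarith, ?_⟩
    refine K.continuous_collapseSpine.comp_continuousOn ((K.isSquareFamily_chart.cont i).comp ?_ ?_)
    · unfold cone
      refine ContinuousOn.prodMk (ContinuousOn.div (by fun_prop) (by fun_prop) ?_) (by fun_prop)
      rintro v ⟨-, hv⟩
      exact (show 0 < v.1 from hv).ne'
    · rintro v ⟨⟨h4, h5, h6⟩, -⟩
      exact cone_mem_square h4 h5 h6

theorem continuous_triangleMap (i : K.Twist) (b : Bool) : Continuous (K.triangleMap i b) := by
  have hc : ∀ j, Continuous fun w : stdSimplex ℝ (Fin 3) => w.1 j := fun j =>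
    (continuous_apply j).comp continuous_subtype_val
  exact (K.continuousOn_collapseSpine_cone i b).comp_continuous
    (((hc 1).add (hc 2)).prodMk ((hc 2).sub (hc 1))) fun w =>
      ⟨(simplex_spec w).1, (simplex_spec w).2.1, (simplex_spec w).2.2.1⟩

/-- Exactly the interior of the simplex is mapped to the open triangle. -/
theorem triangleMap_mem_triangle_iff (i : K.Twist) (b : Bool) (w : stdSimplex ℝ (Fin 3)) :
    K.triangleMap i b w ∈ K.triangle i b ↔ ∀ j, 0 < w.1 j := by
  obtain ⟨h4, h5, h6, h7⟩ := simplex_spec w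
  have h : K.triangleMap i b w ∈ K.triangle i b ↔
      cone b (w.1 1 + w.1 2) (w.1 2 - w.1 1) ∈ halfHexagon b := by
    constructor
    · rintro ⟨_, ⟨u, hu, rfl⟩, h⟩
      have h8 := K.collapseSpine_inj (K.half_notMem_spine ⟨u, hu, rfl⟩) h.symm
      rwa [K.isSquareFamily_chart.injOn i (cone_mem_square h4 h5 h6)
        (openSquare_subset (halfHexagon_subset b hu)) h8]
    · exact fun h => ⟨_, ⟨_, h, rfl⟩, rfl⟩
  rw [h, cone_mem_halfHexagon_iff h4 h5, abs_lt]
  constructor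
  · rintro ⟨h8, h9, h10, h11⟩ j
    fin_cases j
    · simp only [Fin.zero_eta]; linarith
    · simp only [Fin.mk_one]; linarith
    · simp only [Fin.reduceFinMk]; linarith
  · intro h8
    have h9 := h8 0
    have h10 := h8 1
    have h11 := h8 2
    refine ⟨by linarith, by linarith, by linarith, by linarith⟩

theorem stdSimplex_ext {w v : stdSimplex ℝ (Fin 3)} (h1 : w.1 1 + w.1 2 = v.1 1 + v.1 2)
    (h2 : w.1 2 - w.1 1 = v.1 2 - v.1 1) : w = v := by
  have hw := (simplex_spec w).2.2.2
  have hv := (simplex_spec v).2.2.2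
  refine Subtype.ext (funext fun j => ?_)
  fin_cases j
  · simp only [Fin.zero_eta]; linarith
  · simp only [Fin.mk_one]; linarith
  · simp only [Fin.reduceFinMk]; linarith

/-- The map of the compact simplex is closed, and the open triangle is a saturated set over which it
is injective. -/
theorem isEmbedding_triangleMap (i : K.Twist) (b : Bool) :
    IsEmbedding fun w : {w : stdSimplex ℝ (Fin 3) // ∀ j, 0 < w.1 j} => K.triangleMap i b w.1 := by
  have : CompactSpace (stdSimplex ℝ (Fin 3)) :=
    isCompact_iff_compactSpace.1 (isCompact_stdSimplex ℝ (Fin 3))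
  refine isEmbedding_of_eq_preimage (A := {w | ∀ j, 0 < w.1 j}) (B := K.triangle i b)
    (K.continuous_triangleMap i b) (K.continuous_triangleMap i b).isClosedMap ?_ ?_
  · ext w
    exact (K.triangleMap_mem_triangle_iff i b w).symm
  · intro w hw v hv h
    obtain ⟨h1, h2, h3, -⟩ := simplex_spec w
    obtain ⟨h4, h5, h6, h7⟩ := simplex_spec v
    have hv' := (K.triangleMap_mem_triangle_iff i b v).2 hv
    have hcv : cone b (v.1 1 + v.1 2) (v.1 2 - v.1 1) ∈ halfHexagon b := by
      rw [cone_mem_halfHexagon_iff h4 h5, abs_lt]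
      have h9 := hv 0
      have h10 := hv 1
      have h11 := hv 2
      refine ⟨by linarith, by linarith, by linarith, by linarith⟩
    have h8 := K.isSquareFamily_chart.injOn i (cone_mem_square h1 h2 h3) (cone_mem_square h4 h5 h6)
      (K.collapseSpine_inj (K.half_notMem_spine ⟨_, hcv, rfl⟩) h)
    have hv0 := ((cone_mem_halfHexagon_iff h4 h5).1 hcv)
    obtain ⟨h9, h10⟩ := cone_inj hv0.1 hv0.2.1 h8.symm
    exact stdSimplex_ext h9.symm h10.symm

theorem triangleMap_image (i : K.Twist) (b : Bool) :
    K.triangleMap i b '' {w | ∀ j, 0 < w.1 j} = K.triangle i b := by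
  refine Subset.antisymm ?_ ?_
  · rintro _ ⟨w, hw, rfl⟩
    exact (K.triangleMap_mem_triangle_iff i b w).2 hw
  · rintro _ ⟨_, ⟨u, hu, rfl⟩, rfl⟩
    obtain ⟨σ, ρ, h1, h2, h3, rfl⟩ := exists_cone_eq hu
    rw [abs_lt] at h3
    let w : Fin 3 → ℝ := ![1 - σ, (σ - ρ) / 2, (σ + ρ) / 2]
    have hpos : ∀ j, 0 < w j := by
      intro j
      fin_cases j
      · show 0 < 1 - σ; linarith
      · show 0 < (σ - ρ) / 2; linarith
      · show 0 < (σ + ρ) / 2; linarith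
    have hsum : ∑ j, w j = 1 := by
      rw [Fin.sum_univ_three]
      show 1 - σ + (σ - ρ) / 2 + (σ + ρ) / 2 = 1
      ring
    refine ⟨⟨w, fun j => (hpos j).le, hsum⟩, hpos, ?_⟩
    show K.collapseSpine (K.chart i (cone b ((σ - ρ) / 2 + (σ + ρ) / 2)
      ((σ + ρ) / 2 - (σ - ρ) / 2))) = _
    rw [show (σ - ρ) / 2 + (σ + ρ) / 2 = σ by ring, show (σ + ρ) / 2 - (σ - ρ) / 2 = ρ by ring]

/-- The corner `0` of the simplex is mapped to the slot, and the other two to the strands. -/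
theorem triangleMap_corner (i : K.Twist) (b : Bool) {w : stdSimplex ℝ (Fin 3)}
    (hw : ∃ j, w.1 j = 1) : K.triangleMap i b w ∈ K.vertices := by
  obtain ⟨h1, h2, h3, h4⟩ := simplex_spec w
  have h5 := w.2.1 0
  have h6 := w.2.1 1
  have h7 := w.2.1 2
  refine K.collapseSpine_mem_vertices_iff.2 ((K.spine_chart (cone_mem_square h1 h2 h3)).2 ?_)
  rw [abs_cone_snd h1]
  obtain ⟨j, hj⟩ := hw
  have hside : w.1 1 + w.1 2 = 1 → |w.1 2 - w.1 1| = 1 →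
      |(cone b (w.1 1 + w.1 2) (w.1 2 - w.1 1)).1| = 1 / 2 ∧ 2 / 3 ≤ 2 / 3 * (w.1 1 + w.1 2) := by
    intro h8 h9
    rw [h8]
    refine ⟨?_, by norm_num⟩
    simp only [cone]
    rw [div_one, abs_mul, h9]
    norm_num
  fin_cases j
  · right
    have h8 : w.1 0 = 1 := hj
    have h9 : w.1 1 + w.1 2 = 0 := by linarith
    simp [cone, h9]
    norm_num
  · left
    have h8 : w.1 1 = 1 := hj
    have h9 : w.1 2 = 0 := by linarith
    exact hside (by linarith) (by rw [h8, h9]; norm_num)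
  · left
    have h8 : w.1 2 = 1 := hj
    have h9 : w.1 1 = 0 := by linarith
    exact hside (by linarith) (by rw [h8, h9]; norm_num)

/-- A side of the simplex on which the coordinates agree with the parametrisation of a side of the
hexagon is mapped bijectively to the edge. -/
theorem triangleMap_side (i : K.Twist) (b : Bool) {m k l : Fin 3} (hkm : k ≠ m) (hlm : l ≠ m)
    (hkl : k ≠ l) (M : Option Bool)
    (h : ∀ w : stdSimplex ℝ (Fin 3), w.1 m = 0 → 0 < w.1 k →
      cone b (w.1 1 + w.1 2) (w.1 2 - w.1 1) = edgePath b M (w.1 k)) :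
    InjOn (K.triangleMap i b) {w | w.1 m = 0 ∧ ∀ j, j ≠ m → 0 < w.1 j} ∧
      K.triangleMap i b '' {w | w.1 m = 0 ∧ ∀ j, j ≠ m → 0 < w.1 j} =
        K.collapseSpine '' K.rim (i, b, M) := by
  have hall : ∀ j, j = m ∨ j = k ∨ j = l := by
    clear h
    revert m k l
    decide
  have hsum : ∀ w : Fin 3 → ℝ, ∑ j, w j = w m + w k + w l := by
    intro w
    rw [show (Finset.univ : Finset (Fin 3)) = {m, k, l} from ?_,
      Finset.sum_insert (by simp [hkm.symm, hlm.symm]), Finset.sum_pair hkl, add_assoc]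
    ext j
    simpa using hall j
  have hspec : ∀ w : stdSimplex ℝ (Fin 3), (w.1 m = 0 ∧ ∀ j, j ≠ m → 0 < w.1 j) →
      w.1 k ∈ Ioo (0 : ℝ) 1 ∧ w.1 l = 1 - w.1 k := by
    rintro w ⟨h0, h1⟩
    have h2 := w.2.2
    rw [hsum, h0] at h2
    have h3 := h1 l hlm
    exact ⟨⟨h1 k hkm, by linarith⟩, by linarith⟩
  constructor
  · intro w hw v hv hwv
    obtain ⟨h1, h2⟩ := hspec w hw
    obtain ⟨h3, h4⟩ := hspec v hv
    rw [triangleMap, triangleMap, h w hw.1 h1.1, h v hv.1 h3.1] at hwv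
    have h5 := K.isSquareFamily_chart.injOn i (edgePath_mem_square _ _ h1.1.le h1.2.le)
      (edgePath_mem_square _ _ h3.1.le h3.2.le)
      (K.collapseSpine_inj (K.rim_notMem_spine (e := (i, b, M)) ⟨_, h3, rfl⟩) hwv)
    obtain ⟨-, -, h6⟩ := edgePath_inj h1 h3 h5
    refine Subtype.ext (funext fun j => ?_)
    rcases hall j with rfl | rfl | rfl
    · rw [hw.1, hv.1]
    · exact h6
    · rw [h2, h4, h6]
  · refine Subset.antisymm ?_ ?_
    · rintro _ ⟨w, hw, rfl⟩
      obtain ⟨h1, -⟩ := hspec w hw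
      rw [triangleMap, h w hw.1 h1.1]
      exact ⟨_, ⟨_, h1, rfl⟩, rfl⟩
    · rintro _ ⟨_, ⟨s, hs, rfl⟩, rfl⟩
      let w : Fin 3 → ℝ := fun j => if j = k then s else if j = l then 1 - s else 0
      have hwk : w k = s := if_pos rfl
      have hwl : w l = 1 - s := by simp only [w, if_neg hkl.symm, if_true]
      have hwm : w m = 0 := by simp only [w, if_neg hkm.symm, if_neg hlm.symm]
      have hpos : ∀ j, j ≠ m → 0 < w j := by
        intro j hj
        rcases hall j with rfl | rfl | rfl
        · exact absurd rfl hj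
        · rw [hwk]; exact hs.1
        · rw [hwl]; linarith [hs.2]
      have hw : w ∈ stdSimplex ℝ (Fin 3) := by
        refine ⟨fun j => ?_, ?_⟩
        · by_cases hj : j = m
          · rw [hj, hwm]
          · exact (hpos j hj).le
        · rw [hsum, hwm, hwk, hwl]; ring
      refine ⟨⟨w, hw⟩, ⟨hwm, hpos⟩, ?_⟩
      rw [triangleMap, h ⟨w, hw⟩ hwm (by show 0 < w k; rw [hwk]; exact hs.1)]
      simp only [hwk]

/-- The side opposite to the slot is the horizontal side of the hexagon, and the other two sides are
the slanted ones. -/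
theorem exists_triangleMap_side (i : K.Twist) (b : Bool) (m : Fin 3) : ∃ M : Option Bool,
    InjOn (K.triangleMap i b) {w | w.1 m = 0 ∧ ∀ j, j ≠ m → 0 < w.1 j} ∧
      K.triangleMap i b '' {w | w.1 m = 0 ∧ ∀ j, j ≠ m → 0 < w.1 j} =
        K.collapseSpine '' K.rim (i, b, M) := by
  fin_cases m
  · refine ⟨none, K.triangleMap_side i b (m := 0) (k := 2) (l := 1) (by decide) (by decide)
      (by decide) _ fun w hw _ => ?_⟩
    obtain ⟨-, -, -, h⟩ := simplex_spec w
    have h1 : w.1 1 + w.1 2 = 1 := by linarith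
    have h2 : w.1 2 - w.1 1 = 2 * w.1 2 - 1 := by linarith
    rw [h1, h2]
    simp only [cone, edgePath, Option.elim]
    refine Prod.ext ?_ ?_ <;> simp only <;> ring
  · refine ⟨some true, K.triangleMap_side i b (m := 1) (k := 2) (l := 0) (by decide) (by decide)
      (by decide) _ fun w hw hk => ?_⟩
    rw [hw]
    simp only [cone, edgePath, Option.elim, zero_add, sub_zero]
    rw [mul_div_assoc, div_self hk.ne']
    simp [sgn]
  · refine ⟨some false, K.triangleMap_side i b (m := 2) (k := 1) (l := 0) (by decide) (by decide)
      (by decide) _ fun w hw hk => ?_⟩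
    rw [hw]
    simp only [cone, edgePath, Option.elim, add_zero, zero_sub]
    rw [mul_div_assoc, neg_div, div_self hk.ne']
    simp [sgn]

end TwistDiagram

/-! ### Faces, colours and valences -/

namespace CellularGraph

theorem Face.eq_of_mem {G : CellularGraph} {F F' : G.Face} {p : Torus} (h : p ∈ F.1)
    (h' : p ∈ F'.1) : F = F' := by
  obtain ⟨F, x, hx, rfl⟩ := F
  obtain ⟨F', x', hx', rfl⟩ := F'
  exact Subtype.ext ((connectedComponentIn_eq h).trans (connectedComponentIn_eq h').symm)

theorem Face.subset_compl {G : CellularGraph} (F : G.Face) : F.1 ⊆ G.carrierᶜ := by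
  obtain ⟨F, x, hx, rfl⟩ := F
  exact connectedComponentIn_subset _ _

end CellularGraph

namespace TwistDiagram

variable (K : TwistDiagram) (hK : K.IsCellular)

theorem openEdge_graph (e : K.Twist × Bool × Option Bool) :
    (K.graph hK).openEdge e = K.collapseSpine '' K.rim e := K.graphArc_image e

theorem carrier_graph :
    (K.graph hK).carrier = K.vertices ∪ ⋃ e, K.collapseSpine '' K.rim e := by
  refine congrArg _ (iUnion_congr fun e => K.openEdge_graph hK e)

theorem compl_carrier : (K.graph hK).carrierᶜ =
    K.whiteFaces ∪ ⋃ a : K.Twist × Bool, K.triangle a.1 a.2 := by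
  rw [carrier_graph, compl_graph_eq']

theorem triangle_nonempty (i : K.Twist) (b : Bool) : (K.triangle i b).Nonempty := by
  obtain ⟨e⟩ := K.isOpenDisk_triangle i b
  exact ⟨_, (e.symm ⟨0, by simp⟩).2⟩

/-- The triangles as faces. -/
noncomputable def triangleFace (a : K.Twist × Bool) : (K.graph hK).Face :=
  ⟨K.triangle a.1 a.2, (K.triangle_nonempty a.1 a.2).some, by
    have h := (K.triangle_nonempty a.1 a.2).some_mem
    refine ⟨fun h' => ?_, ?_⟩
    · have h1 : (K.triangle_nonempty a.1 a.2).some ∈ (K.graph hK).carrierᶜ := by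
        rw [compl_carrier]
        exact Or.inr (mem_iUnion.2 ⟨a, h⟩)
      exact h1 h'
    · rw [carrier_graph, K.connectedComponentIn_triangle h]⟩

theorem triangleFace_injective : Function.Injective (K.triangleFace hK) := by
  intro a a' h
  obtain ⟨p, hp⟩ := K.triangle_nonempty a.1 a.2
  have hp' : p ∈ K.triangle a'.1 a'.2 := by
    have h1 : K.triangle a.1 a.2 = K.triangle a'.1 a'.2 := congrArg Subtype.val h
    rwa [← h1]
  exact K.triangle_eq_of_mem hp hp'

/-- The shaded faces. -/
def shadedFaces : Set (K.graph hK).Face := range (K.triangleFace hK)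

theorem face_subset_whiteFaces {F : (K.graph hK).Face} (hF : F ∉ K.shadedFaces hK) :
    F.1 ⊆ K.whiteFaces := by
  intro p hp
  have h := F.subset_compl hp
  rw [compl_carrier] at h
  rcases h with h | h
  · exact h
  · obtain ⟨a, ha⟩ := mem_iUnion.1 h
    exact absurd ⟨a, CellularGraph.Face.eq_of_mem ha hp⟩ hF

theorem notMem_shadedFaces_of_mem {F : (K.graph hK).Face} {p : Torus} (hp : p ∈ F.1)
    (hw : p ∈ K.whiteFaces) : F ∉ K.shadedFaces hK := by
  rintro ⟨a, rfl⟩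
  exact K.whiteFaces_disjoint_triangle hw hp

theorem isTriangle_triangleFace (a : K.Twist × Bool) :
    (K.graph hK).IsTriangle (K.triangleFace hK a) := by
  refine ⟨⟨K.triangleMap a.1 a.2, K.continuous_triangleMap a.1 a.2⟩,
    K.isEmbedding_triangleMap a.1 a.2, K.triangleMap_image a.1 a.2,
    fun w hw => K.triangleMap_corner a.1 a.2 hw, fun m => ?_⟩
  obtain ⟨M, h1, h2⟩ := K.exists_triangleMap_side a.1 a.2 m
  exact ⟨(a.1, a.2, M), h1, by rw [openEdge_graph]; exact h2⟩

theorem rim_subset_closure_half (e : K.Twist × Bool × Option Bool) :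
    K.rim e ⊆ closure (K.half e.1 e.2.1) := by
  rintro _ ⟨s, hs, rfl⟩
  have h1 := edgePath_mem_closure_halfHexagon e.2.1 e.2.2 hs
  have h2 : ContinuousOn (K.chart e.1) (closure (halfHexagon e.2.1)) :=
    (K.isSquareFamily_chart.cont e.1).mono fun u hu => (closure_halfHexagon_subset _ hu).1
  exact h2.image_closure ⟨_, h1, rfl⟩

theorem closure_half_subset (i : K.Twist) (b : Bool) :
    closure (K.half i b) ⊆ K.chart i '' {u ∈ square | 0 ≤ sgn b * u.2} := by
  have h : IsClosed {u : ℝ × ℝ | 0 ≤ sgn b * u.2} := isClosed_le (by fun_prop) (by fun_prop)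
  refine closure_minimal (image_mono fun u hu => ?_) (K.isSquareFamily_chart.isClosed_image i
    (isCompact_square.isClosed.inter h) inter_subset_left)
  exact ⟨openSquare_subset (halfHexagon_subset b hu), hu.1.le⟩

/-- The part of the white region next to a side of a hexagon. -/
def outer (e : K.Twist × Bool × Option Bool) : Set Torus := K.chart e.1 '' edgeOuter e.2.1 e.2.2

theorem outer_subset_white (e : K.Twist × Bool × Option Bool) : K.outer e ⊆ K.white := by
  rintro _ ⟨u, hu, rfl⟩
  have hu' := hu
  rw [edgeOuter_eq] at hu'
  exact (K.region_chart _ hu'.2.1).2 hu'.2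

theorem edgeOuter_subset (b : Bool) (m : Option Bool) : edgeOuter b m ⊆ square :=
  fun _ hu => openSquare_subset (edgeNhd_subset _ _ hu.1)

theorem rim_subset_closure_outer (e : K.Twist × Bool × Option Bool) :
    K.rim e ⊆ closure (K.outer e) := by
  rintro _ ⟨s, hs, rfl⟩
  have h1 := edgePath_mem_closure_edgeOuter e.2.1 e.2.2 hs
  have h2 : ContinuousOn (K.chart e.1) (closure (edgeOuter e.2.1 e.2.2)) :=
    (K.isSquareFamily_chart.cont e.1).mono
      (closure_minimal (edgeOuter_subset _ _) isCompact_square.isClosed)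
  exact h2.image_closure ⟨_, h1, rfl⟩

theorem outer_nonempty (e : K.Twist × Bool × Option Bool) : (K.outer e).Nonempty := by
  have h1 := K.rim_subset_closure_outer e ⟨1 / 2, by norm_num, rfl⟩
  exact closure_nonempty_iff.1 ⟨_, h1⟩

theorem isPreconnected_outer (e : K.Twist × Bool × Option Bool) : IsPreconnected (K.outer e) :=
  (convex_edgeOuter _ _).isPreconnected.image _
    ((K.isSquareFamily_chart.cont e.1).mono (edgeOuter_subset _ _))

theorem whiteFaces_subset_compl : K.whiteFaces ⊆ (K.graph hK).carrierᶜ := by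
  rw [compl_carrier]
  exact subset_union_left

/-- A white face that accumulates at an edge contains points of the part of the white region next to
the edge. -/
theorem exists_mem_outer {e : K.Twist × Bool × Option Bool} {F : (K.graph hK).Face}
    (hF : F ∉ K.shadedFaces hK) (he : (K.graph hK).openEdge e ⊆ closure F.1) :
    ∃ p ∈ K.outer e, K.collapseSpine p ∈ F.1 := by
  have hs : (1 / 2 : ℝ) ∈ Ioo (0 : ℝ) 1 := by norm_num
  have hN := edgeNhd_subset e.2.1 e.2.2
  -- near the edge, the complement of the spine is embedded
  have hO : IsOpen (K.collapseSpine '' ((K.chart e.1 '' edgeNhd e.2.1 e.2.2) \ K.spine)) := by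
    refine K.isOpen_collapseSpine_image ((K.isSquareFamily_chart.isOpen_image e.1
      (isOpen_edgeNhd _ _) (hN.trans openSquare_subset)).sdiff ?_) fun p hp => hp.2
    have := K.isSquareFamily_seamChart.finite
    refine isClosed_iUnion_of_finite fun j => K.isSquareFamily_seamChart.isClosed_image j ?_ ?_
    · exact (isClosed_eq (by fun_prop) (by fun_prop)).and
        (isClosed_le (f := fun u : ℝ × ℝ => |u.2|) (by fun_prop) (by fun_prop))
    · rintro u ⟨h1, h2⟩
      exact mem_square.2 ⟨by simp [h1], by linarith⟩
  have hp : K.chart e.1 (edgePath e.2.1 e.2.2 (1 / 2)) ∈ K.rim e := ⟨_, hs, rfl⟩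
  have h1 : K.collapseSpine (K.chart e.1 (edgePath e.2.1 e.2.2 (1 / 2))) ∈ closure F.1 :=
    he (by rw [openEdge_graph]; exact ⟨_, hp, rfl⟩)
  obtain ⟨_, ⟨_, ⟨⟨u, hu, rfl⟩, hus⟩, rfl⟩, h2⟩ := mem_closure_iff.1 h1 _ hO
    ⟨_, ⟨⟨_, edgePath_mem_edgeNhd _ _ hs, rfl⟩, K.rim_notMem_spine hp⟩, rfl⟩
  refine ⟨K.chart e.1 u, ⟨u, ?_, rfl⟩, h2⟩
  rw [edgeOuter_eq]
  refine ⟨hu, ?_⟩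
  obtain ⟨q, hq, h3⟩ := K.face_subset_whiteFaces hK hF h2
  obtain rfl := K.collapseSpine_inj hus h3
  exact (K.region_chart _ (openSquare_subset (hN hu))).1 hq

/-- An edge, which is a side of a hexagon, has one triangle and one white face next to it: points of
the triangle and of its closure come from the half of the hexagon, and close to the edge all points
outside the hexagon belong to one connected part of the white region. -/
theorem isCheckerboard_graph : (K.graph hK).IsCheckerboard (K.shadedFaces hK) := by
  intro e
  have he := K.openEdge_graph hK e
  constructor
  · refine ⟨K.triangleFace hK (e.1, e.2.1), ⟨⟨_, rfl⟩, ?_⟩, ?_⟩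
    · rw [he]
      exact (image_mono (K.rim_subset_closure_half e)).trans
        (image_closure_subset_closure_image K.continuous_collapseSpine)
    · rintro _ ⟨⟨a, rfl⟩, h⟩
      have hs : (1 / 2 : ℝ) ∈ Ioo (0 : ℝ) 1 := by norm_num
      have hp : K.chart e.1 (edgePath e.2.1 e.2.2 (1 / 2)) ∈ K.rim e := ⟨_, hs, rfl⟩
      have h1 : K.collapseSpine (K.chart e.1 (edgePath e.2.1 e.2.2 (1 / 2))) ∈
          closure (K.triangle a.1 a.2) := h (he ▸ ⟨_, hp, rfl⟩)
      have h2 : closure (K.triangle a.1 a.2) ⊆ K.collapseSpine '' closure (K.half a.1 a.2) :=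
        closure_minimal (image_mono subset_closure)
          (isClosed_closure.isCompact.image K.continuous_collapseSpine).isClosed
      obtain ⟨q, hq, h3⟩ := h2 h1
      obtain rfl := K.collapseSpine_inj (K.rim_notMem_spine hp) h3
      obtain ⟨u, ⟨hu, hub⟩, h4⟩ := K.closure_half_subset _ _ hq
      obtain ⟨h5, rfl⟩ := K.isSquareFamily_chart.inj _ _ _ hu _
        (edgePath_mem_square _ _ hs.1.le hs.2.le) h4
      have h6 := edgePath_snd_pos e.2.1 e.2.2 hs.1
      have h7 : a.2 = e.2.1 := eq_of_sgn_mul_pos (lt_of_le_of_ne hub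
        (mul_ne_zero (sgn_ne_zero _) (right_ne_zero_of_mul h6.ne')).symm) h6
      rw [← h5, ← h7]
  · obtain ⟨q, hq⟩ := K.outer_nonempty e
    have hqw : K.collapseSpine q ∈ K.whiteFaces := ⟨q, K.outer_subset_white e hq, rfl⟩
    have hqc := K.whiteFaces_subset_compl hK hqw
    let F : (K.graph hK).Face :=
      ⟨connectedComponentIn (K.graph hK).carrierᶜ (K.collapseSpine q), _, hqc, rfl⟩
    have hF : K.collapseSpine '' K.outer e ⊆ F.1 :=
      ((K.isPreconnected_outer e).image _
        K.continuous_collapseSpine.continuousOn).subset_connectedComponentIn ⟨q, hq, rfl⟩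
        ((image_mono (K.outer_subset_white e)).trans (K.whiteFaces_subset_compl hK))
    refine ⟨F, ⟨K.notMem_shadedFaces_of_mem hK (hF ⟨q, hq, rfl⟩) hqw, ?_⟩, ?_⟩
    · rw [he]
      exact ((image_mono (K.rim_subset_closure_outer e)).trans
        (image_closure_subset_closure_image K.continuous_collapseSpine)).trans (closure_mono hF)
    · rintro F' ⟨h1, h2⟩
      obtain ⟨p, hp, hpF⟩ := K.exists_mem_outer hK h1 h2
      exact CellularGraph.Face.eq_of_mem hpF (hF ⟨p, hp, rfl⟩)

/-- The four ends of edges at a vertex that comes from an arc of the diagram: at each end of the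
arc, the hexagon has a corner. -/
theorem card_ends_inl (a : K.Arc) :
    Nat.card {e // K.start e = Sum.inl a} + Nat.card {e // K.finish e = Sum.inl a} = 4 := by
  have hfin := K.twist_finite
  rw [← Nat.card_sum, show 4 = Nat.card (Bool × Bool) by simp, eq_comm]
  have hport : ∀ c : Bool,
      K.portArc (K.ends (a, c)).1 (K.ends (a, c)).2.1 (K.ends (a, c)).2.2 = a :=
    fun c => by rw [portArc, Prod.mk.eta, K.ends.symm_apply_apply]
  -- `φ (c, d)` is the edge with an end at the corner of the hexagon at the end `c` of the arc: the
  -- slanted side if `d` is true, otherwise the horizontal side, which starts at the left corner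
  let φ : Bool × Bool → {e // K.start e = Sum.inl a} ⊕ {e // K.finish e = Sum.inl a} := fun w =>
    if h : w.2 = false ∧ (K.ends (a, w.1)).2.1 = false then
      Sum.inl ⟨((K.ends (a, w.1)).1, (K.ends (a, w.1)).2.2, none), by
        have := hport w.1
        rw [h.2] at this
        exact congrArg Sum.inl this⟩
    else Sum.inr ⟨((K.ends (a, w.1)).1, (K.ends (a, w.1)).2.2,
        if w.2 then some (K.ends (a, w.1)).2.1 else none), by
      have h1 := hport w.1
      refine congrArg Sum.inl ?_
      cases hw : w.2
      · have h2 : (K.ends (a, w.1)).2.1 = true := by simpa [hw] using h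
        rw [h2] at h1
        exact h1
      · exact h1⟩
  refine Nat.card_congr (Equiv.ofBijective φ ⟨?_, ?_⟩)
  · rintro ⟨c, d⟩ ⟨c', d'⟩ h
    have key : ∀ l l' : Bool, (K.ends (a, c)).1 = (K.ends (a, c')).1 →
        (K.ends (a, c)).2.2 = (K.ends (a, c')).2.2 → (K.ends (a, c)).2.1 = (K.ends (a, c')).2.1 →
        c = c' := fun _ _ h1 h2 h3 =>
      (Prod.mk.inj (K.ends.injective (Prod.ext h1 (Prod.ext h3 h2)))).2
    by_cases h1 : d = false ∧ (K.ends (a, c)).2.1 = false <;>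
      by_cases h2 : d' = false ∧ (K.ends (a, c')).2.1 = false
    · simp only [φ, dif_pos h1, dif_pos h2, Sum.inl.injEq] at h
      have h := congrArg Subtype.val h
      simp only [Prod.mk.injEq] at h
      rw [key true true h.1 h.2.1 (h1.2.trans h2.2.symm), h1.1, h2.1]
    · simp only [φ, dif_pos h1, dif_neg h2, reduceCtorEq] at h
    · simp only [φ, dif_neg h1, dif_pos h2, reduceCtorEq] at h
    · simp only [φ, dif_neg h1, dif_neg h2, Sum.inr.injEq, Subtype.mk.injEq, Prod.mk.injEq] at h
      obtain ⟨h3, h4, h5⟩ := h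
      cases d <;> cases d'
      · have h6 : (K.ends (a, c)).2.1 = true := by simpa using h1
        have h7 : (K.ends (a, c')).2.1 = true := by simpa using h2
        rw [key true true h3 h4 (h6.trans h7.symm)]
      · simp at h5
      · simp at h5
      · rw [key true true h3 h4 (by simpa using h5)]
  · have hsymm : ∀ i l b, K.portArc i l b = a → ∃ c, K.ends (a, c) = (i, l, b) := fun i l b h =>
      ⟨(K.ends.symm (i, l, b)).2, by
        rw [← h, portArc, Prod.mk.eta, K.ends.apply_symm_apply]⟩
    rintro (⟨⟨i, b, m⟩, h⟩ | ⟨⟨i, b, m⟩, h⟩)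
    · cases m with
      | none =>
        obtain ⟨c, hc⟩ := hsymm i false b (Sum.inl_injective h)
        refine ⟨(c, false), ?_⟩
        have h1 : (false = false) ∧ (K.ends (a, c)).2.1 = false := ⟨rfl, by rw [hc]⟩
        simp only [φ, dif_pos h1, hc]
      | some σ => simp [start] at h
    · have h' := Sum.inl_injective h
      cases m with
      | none =>
        obtain ⟨c, hc⟩ := hsymm i true b h'
        refine ⟨(c, false), ?_⟩
        have h1 : ¬ ((false = false) ∧ (K.ends (a, c)).2.1 = false) := by rw [hc]; simp
        simp only [φ, dif_neg h1, hc]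
        simp
      | some σ =>
        obtain ⟨c, hc⟩ := hsymm i σ b h'
        refine ⟨(c, true), ?_⟩
        have h1 : ¬ ((true = false) ∧ (K.ends (a, c)).2.1 = false) := by simp
        simp only [φ, dif_neg h1, hc]
        simp

/-- The vertex that comes from a slot is the start of the four slanted sides of the hexagon. -/
theorem card_ends_inr (i : K.Twist) :
    Nat.card {e // K.start e = Sum.inr i} + Nat.card {e // K.finish e = Sum.inr i} = 4 := by
  have h1 : IsEmpty {e // K.finish e = Sum.inr i} := ⟨fun e => by simpa [finish] using e.2⟩
  rw [Nat.card_of_isEmpty (α := {e // K.finish e = Sum.inr i}), add_zero,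
    show 4 = Nat.card (Bool × Bool) by simp, eq_comm]
  refine Nat.card_congr (Equiv.ofBijective (fun w => ⟨(i, w.1, some w.2), rfl⟩) ⟨?_, ?_⟩)
  · intro w w' h
    have h := congrArg Subtype.val h
    simp only [Prod.mk.injEq, Option.some.injEq, true_and] at h
    exact Prod.ext h.1 h.2
  · rintro ⟨⟨j, b, m⟩, h⟩
    cases m with
    | none => simp [start] at h
    | some σ =>
      obtain rfl : j = i := Sum.inr_injective h
      exact ⟨(b, σ), rfl⟩

theorem isFourValent_graph : (K.graph hK).IsFourValent := by
  rintro _ ⟨j, rfl⟩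
  have h0 : ∀ e, K.graphArc e 0 = node K.seamChart j ↔ K.start e = j := fun e => by
    rw [graphArc_zero]
    exact K.isSquareFamily_seamChart.node_injective.eq_iff
  have h1 : ∀ e, K.graphArc e 1 = node K.seamChart j ↔ K.finish e = j := fun e => by
    rw [graphArc_one]
    exact K.isSquareFamily_seamChart.node_injective.eq_iff
  show Nat.card {e // K.graphArc e 0 = node K.seamChart j} +
    Nat.card {e // K.graphArc e 1 = node K.seamChart j} = 4
  rw [Nat.card_congr (Equiv.subtypeEquivRight h0), Nat.card_congr (Equiv.subtypeEquivRight h1)]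
  cases j with
  | inl a => exact K.card_ends_inl a
  | inr i => exact K.card_ends_inr i

end TwistDiagram

/-! ### Where the faces and edges go -/

namespace TwistDiagram

variable (K : TwistDiagram)

/-- The white faces of the two torihedra go to the same place. -/
theorem unfold_zero_eq (k l : Bool) {p : Torus} (hp : p ∉ K.hexagons) :
    K.unfold k 0 p = K.unfold l 0 p := by
  rcases IsSquareFamily.mem_square_or K.chart p with ⟨i, u, hu, rfl⟩ | hn
  · have h : (u, (0 : ℝ)) ∉ modelHexagon := by
      rw [mem_modelHexagon_iff K hu]; exact fun h => hp h.2
    have h1 : ∀ k, preModel k (u, 0) = ((u.1, 0), slide u.1 u.2 0) := fun k => by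
      rw [preModel]
      simp only
      rw [(lift_eq_zero_iff le_rfl h).2 rfl, mul_zero]
    rw [unfold_chart K k 0 i hu, unfold_chart K l 0 i hu]
    simp only [model, modelAngle, h1]
  · rw [unfold_of_notMem K k 0 hn, unfold_of_notMem K l 0 hn, mul_zero, mul_zero]

theorem unfold_zero_inj {k l : Bool} {p p' : Torus} (hp : p ∉ K.hexagons) (hp' : p' ∉ K.hexagons)
    (h : K.unfold k 0 p = K.unfold l 0 p') : p = p' := by
  have h1 := K.refold_unfold k le_rfl (p := p) fun h => hp h.2
  have h2 := K.refold_unfold l le_rfl (p := p') fun h => hp' h.2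
  rw [h, h2] at h1
  exact (Prod.mk.inj h1).1.symm

/-- The sign by which the horizontal coordinate is multiplied in one half of a hexagon. -/
noncomputable def bend (i : K.Twist) (b : Bool) : ℝ := if b then turn (K.halfTwist i) else 1

open Classical in
/-- The change of sides that is caused by the half twist: only the triangles on the side of the slit
on which the twist takes place are affected. -/
noncomputable def swap (i : K.Twist) (b : Bool) (s : Bool) : Bool :=
  if K.halfTwist i ≠ 0 ∧ b = true then !s else s

theorem halfTwist_cases (i : K.Twist) :
    K.halfTwist i = 0 ∨ K.halfTwist i = 1 ∨ K.halfTwist i = -1 := by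
  rw [halfTwist]
  generalize ((K.crossings i).map (fun u => (u : ℤ))).sum = a
  have h : (a.tmod 2).natAbs = a.natAbs % 2 := Int.natAbs_tmod a 2
  omega

theorem sgn_not (s : Bool) : sgn (!s) = -sgn s := by cases s <;> simp [sgn]

theorem sgn_swap (i : K.Twist) (b s : Bool) : sgn (K.swap i b s) = K.bend i b * sgn s := by
  cases b
  · simp [swap, bend]
  · rcases K.halfTwist_cases i with h | h | h
    · simp [swap, bend, h, turn]
    · simp [swap, bend, h, turn, sgn_not]
    · simp [swap, bend, h, turn, sgn_not]

theorem bend_mul_bend (i : K.Twist) (b : Bool) (x : ℝ) : K.bend i b * (K.bend i b * x) = x := by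
  rw [← mul_assoc, bend]
  cases b
  · simp
  · simp [turn_sq]

theorem bend_sq (i : K.Twist) (b : Bool) (x : ℝ) : (K.bend i b * x) ^ 2 = x ^ 2 := by
  rw [pow_two, mul_assoc, mul_comm x, ← mul_assoc (K.bend i b), bend_mul_bend, pow_two]

theorem abs_bend_mul (i : K.Twist) (b : Bool) (x : ℝ) : |K.bend i b * x| = |x| := by
  rw [← sq_eq_sq_iff_abs_eq_abs, bend_sq]

theorem unfold_half (k : Bool) {i : K.Twist} {b : Bool} {u : ℝ × ℝ} (hu : u ∈ square)
    (ht : 0 < sgn b * u.2) (hw : |u.2| ≤ wid u.1) : K.unfold k 0 (K.chart i u) =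
      (K.chart i (K.bend i b * u.1, 0), K.bend i b * (sgn k * slitHeight u.1 |u.2|)) := by
  rw [unfold_chart K k 0 i hu, ← Prod.mk.eta (p := u), model_hexagon ht hw]
  rfl

/-- An open half of a crossing disk. -/
def halfDisk (i : K.Twist) (s : Bool) : Set (Torus × ℝ) :=
  {q | ∃ x : ℝ, q.1 = K.chart i (x, 0) ∧ x ^ 2 + q.2 ^ 2 < 9 / 16 ∧ 0 < sgn s * q.2}

theorem mem_crossingHalfDisk_iff (i : K.Twist) (s : Bool) (q : ThickTorus) :
    q ∈ K.crossingHalfDisk i s ↔ (q.1, (q.2 : ℝ)) ∈ K.halfDisk i s := by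
  rw [crossingHalfDisk, halfDisk, mem_ofPred_eq, mem_ofPred_eq]
  simp only [chart, eta_zero]
  norm_num

theorem mem_square_of_sq_le {x z : ℝ} (h : x ^ 2 + z ^ 2 ≤ 9 / 16) : ((x, 0) : ℝ × ℝ) ∈ square := by
  refine mem_square.2 ⟨?_, by simp⟩
  rw [← sq_le_one_iff_abs_le_one]
  nlinarith [sq_nonneg z]

theorem slitHeight_lt {x t : ℝ} (ht : 0 < t) (h : t < wid x) : slitHeight x t < hgt x := by
  have h0 : 0 < wid x := ht.trans h
  refine mul_lt_of_lt_one_right (hgt_pos_iff.2 (wid_pos_iff.1 h0)) (max_lt one_pos ?_)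
  have := div_pos ht h0
  linarith

theorem slitWidth_lt {x z : ℝ} (hz : 0 < z) (h : z < hgt x) : slitWidth x z < wid x := by
  have h0 : 0 < hgt x := hz.trans h
  refine mul_lt_of_lt_one_right (wid_pos_iff.2 (hgt_pos_iff.1 h0)) (max_lt one_pos ?_)
  have := div_pos hz h0
  linarith

/-- The halves of the hexagons are moved onto the halves of the crossing disks. -/
theorem unfold_image_half (k : Bool) (i : K.Twist) (b : Bool) :
    K.unfold k 0 '' K.half i b = K.halfDisk i (K.swap i b k) := by
  ext ⟨p, z⟩
  constructor
  · rintro ⟨_, ⟨u, hu, rfl⟩, h⟩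
    rw [K.unfold_half k (openSquare_subset (halfHexagon_subset b hu)) hu.1 hu.2.le] at h
    obtain ⟨rfl, rfl⟩ := Prod.mk.inj h
    have ht : 0 < |u.2| := by rw [abs_eq_sgn_mul hu.1.le]; exact hu.1
    have h1 := slitHeight_pos (abs_nonneg _) hu.2
    refine ⟨K.bend i b * u.1, rfl, ?_, ?_⟩
    · simp only
      rw [bend_sq, bend_sq, sgn_mul_sq]
      exact (lt_hgt_iff h1.le).1 (slitHeight_lt ht hu.2)
    · simp only
      rw [sgn_swap, show K.bend i b * sgn k * (K.bend i b * (sgn k * slitHeight u.1 |u.2|)) =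
        K.bend i b * (K.bend i b * (sgn k * sgn k * slitHeight u.1 |u.2|)) by ring,
        bend_mul_bend, sgn_sq, one_mul]
      exact h1
  · rintro ⟨x, rfl, h1, h2⟩
    simp only at h1 h2
    rw [sgn_swap] at h2
    -- the inverse is given by `slitWidth`, the inverse of `slitHeight` in its second argument
    have hz : |z| = K.bend i b * sgn k * z := by
      have h3 := abs_of_pos h2
      rw [mul_assoc, abs_bend_mul, abs_mul, abs_sgn, one_mul, ← mul_assoc] at h3
      exact h3
    have hz0 : 0 < |z| := by rw [hz]; exact h2
    have h3 : |z| < hgt (K.bend i b * x) := by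
      rw [lt_hgt_iff hz0.le, bend_sq, sq_abs]; exact h1
    have hw := slitWidth_pos hz0.le h3
    have habs : |sgn b * slitWidth (K.bend i b * x) (|z|)| = slitWidth (K.bend i b * x) |z| := by
      rw [abs_mul, abs_sgn, one_mul, abs_of_pos hw]
    have hu : ((K.bend i b * x, sgn b * slitWidth (K.bend i b * x) |z|) : ℝ × ℝ) ∈
        halfHexagon b := by
      refine ⟨?_, ?_⟩
      · simp only
        rw [← mul_assoc, sgn_sq, one_mul]
        exact hw
      · simp only
        rw [habs]
        exact slitWidth_lt hz0 h3
    refine ⟨_, ⟨_, hu, rfl⟩, ?_⟩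
    rw [K.unfold_half k (openSquare_subset (halfHexagon_subset b hu)) hu.1 hu.2.le]
    simp only
    rw [habs, slitHeight_slitWidth hz0.le h3.le, bend_mul_bend, hz,
      show K.bend i b * (sgn k * (K.bend i b * sgn k * z)) =
        K.bend i b * (K.bend i b * (sgn k * sgn k * z)) by ring, bend_mul_bend, sgn_sq, one_mul]

theorem bend_mul_mem_square (i : K.Twist) (b : Bool) {u : ℝ × ℝ} (hu : u ∈ square) :
    (K.bend i b * u.1, (0 : ℝ)) ∈ square := by
  refine mem_square.2 ⟨?_, by simp⟩
  simp only
  rw [abs_bend_mul]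
  exact (mem_square.1 hu).1

/-- On a half of a hexagon, `slitWidth` recovers the distance from the slot. -/
theorem injOn_unfold_half (k : Bool) (i : K.Twist) (b : Bool) :
    InjOn (K.unfold k 0) (K.half i b) := by
  rintro _ ⟨u, hu, rfl⟩ _ ⟨v, hv, rfl⟩ h
  have hus := openSquare_subset (halfHexagon_subset b hu)
  have hvs := openSquare_subset (halfHexagon_subset b hv)
  rw [K.unfold_half k hus hu.1 hu.2.le, K.unfold_half k hvs hv.1 hv.2.le] at h
  obtain ⟨h1, h2⟩ := Prod.mk.inj h
  have h3 := (Prod.mk.inj (K.isSquareFamily_chart.injOn i (K.bend_mul_mem_square i b hus)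
    (K.bend_mul_mem_square i b hvs) h1)).1
  have h4 : u.1 = v.1 := by rw [← K.bend_mul_bend i b u.1, h3, bend_mul_bend]
  have h5 := congrArg abs h2
  rw [abs_bend_mul, abs_bend_mul, abs_mul, abs_mul, abs_sgn, one_mul, one_mul,
    abs_of_nonneg (slitHeight_nonneg _ _), abs_of_nonneg (slitHeight_nonneg _ _), h4] at h5
  have h6 := congrArg (slitWidth v.1) h5
  rw [slitWidth_slitHeight (abs_nonneg _) (h4 ▸ hu.2.le),
    slitWidth_slitHeight (abs_nonneg _) hv.2.le, abs_eq_sgn_mul hu.1.le,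
    abs_eq_sgn_mul hv.1.le] at h6
  rw [show u = v from Prod.ext h4 (mul_left_cancel₀ (sgn_ne_zero b) h6)]

/-- The three open intervals of the diameter of a crossing disk between the punctures and the
boundary. -/
def diameter (i : K.Twist) (m : Option Bool) : Set (Torus × ℝ) :=
  {q | q.2 = 0 ∧ ∃ x ∈ (m.elim {x | |x| < 1 / 2}
    fun σ => {x | 1 / 2 < sgn σ * x ∧ sgn σ * x < 3 / 4} : Set ℝ), q.1 = K.chart i (x, 0)}

theorem diameter_interval_subset {m : Option Bool} {x : ℝ} (hx : x ∈ (m.elim {x | |x| < 1 / 2}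
    fun σ => {x | 1 / 2 < sgn σ * x ∧ sgn σ * x < 3 / 4} : Set ℝ)) : |x| < 3 / 4 := by
  cases m with
  | none => exact (show |x| < 1 / 2 from hx).trans (by norm_num)
  | some σ =>
    obtain ⟨h1, h2⟩ : 1 / 2 < sgn σ * x ∧ sgn σ * x < 3 / 4 := hx
    rw [abs_eq_sgn_mul (by linarith)]
    exact h2

theorem mem_square_of_abs_lt {x : ℝ} (hx : |x| < 3 / 4) : ((x, 0) : ℝ × ℝ) ∈ square :=
  mem_square.2 ⟨by simp only; linarith, by simp⟩

theorem unfold_edgePath (k : Bool) (e : K.Twist × Bool × Option Bool) {s : ℝ}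
    (hs : s ∈ Ioo (0 : ℝ) 1) : K.unfold k 0 (K.chart e.1 (edgePath e.2.1 e.2.2 s)) =
      (K.chart e.1 (K.bend e.1 e.2.1 * (edgePath e.2.1 e.2.2 s).1, 0), 0) := by
  have h := (edgePath_spec e.2.1 e.2.2 hs.1.le hs.2.le).2
  rw [K.unfold_half k (edgePath_mem_square _ _ hs.1.le hs.2.le) (edgePath_snd_pos _ _ hs.1) h.le,
    slitHeight_of_ge h.ge, mul_zero, mul_zero]

/-- The sides of the hexagons are moved onto the intervals of the diameters of the crossing
disks. -/
theorem unfold_image_rim (k : Bool) (e : K.Twist × Bool × Option Bool) :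
    K.unfold k 0 '' K.rim e = K.diameter e.1 (e.2.2.map (K.swap e.1 e.2.1)) := by
  obtain ⟨i, b, m⟩ := e
  ext ⟨p, z⟩
  constructor
  · rintro ⟨_, ⟨s, hs, rfl⟩, h⟩
    rw [unfold_edgePath K k (i, b, m) hs] at h
    obtain ⟨rfl, rfl⟩ := Prod.mk.inj h
    refine ⟨rfl, _, ?_, rfl⟩
    cases m with
    | none =>
      show |K.bend i b * (edgePath b none s).1| < 1 / 2
      rw [abs_bend_mul]
      exact abs_edgePath_none hs
    | some σ =>
      have h1 : sgn (K.swap i b σ) * (K.bend i b * (edgePath b (some σ) s).1) = 3 / 4 - s / 4 := by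
        rw [sgn_swap, ← sgn_mul_edgePath_some b σ s, mul_assoc, mul_left_comm (sgn σ),
          bend_mul_bend]
      show 1 / 2 < _ ∧ _ < _
      simp only [h1]
      constructor <;> linarith [hs.1, hs.2]
  · rintro ⟨hz, x, hx, hp⟩
    obtain rfl : z = 0 := hz
    obtain rfl : p = _ := hp
    have key : ∀ s ∈ Ioo (0 : ℝ) 1, (edgePath b m s).1 = K.bend i b * x →
        (K.chart i (x, 0), (0 : ℝ)) ∈ K.unfold k 0 '' K.rim (i, b, m) := fun s hs h => by
      refine ⟨_, ⟨s, hs, rfl⟩, ?_⟩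
      rw [unfold_edgePath K k (i, b, m) hs]
      simp only
      rw [h, bend_mul_bend]
    cases m with
    | none =>
      have hx' : |K.bend i b * x| < 1 / 2 := by rw [abs_bend_mul]; exact hx
      rw [abs_lt] at hx'
      exact key (K.bend i b * x + 1 / 2) ⟨by linarith, by linarith⟩ (by simp [edgePath])
    | some σ =>
      obtain ⟨h1, h2⟩ : 1 / 2 < sgn (K.swap i b σ) * x ∧ sgn (K.swap i b σ) * x < 3 / 4 := hx
      refine key (3 - 4 * (sgn (K.swap i b σ) * x)) ⟨by linarith, by linarith⟩ ?_
      simp only [edgePath, Option.elim]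
      rw [show 3 / 4 - (3 - 4 * (sgn (K.swap i b σ) * x)) / 4 = sgn (K.swap i b σ) * x by ring,
        sgn_swap, show sgn σ * (K.bend i b * sgn σ * x) = sgn σ * sgn σ * (K.bend i b * x) by ring,
        sgn_sq, one_mul]

theorem injOn_unfold_rim (k : Bool) (e : K.Twist × Bool × Option Bool) :
    InjOn (K.unfold k 0) (K.rim e) := by
  rintro _ ⟨s, hs, rfl⟩ _ ⟨s', hs', rfl⟩ h
  rw [unfold_edgePath K k e hs, unfold_edgePath K k e hs'] at h
  have hs1 := edgePath_mem_square e.2.1 e.2.2 hs.1.le hs.2.le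
  have hs2 := edgePath_mem_square e.2.1 e.2.2 hs'.1.le hs'.2.le
  have h3 := (Prod.mk.inj (K.isSquareFamily_chart.injOn e.1 (K.bend_mul_mem_square _ e.2.1 hs1)
    (K.bend_mul_mem_square _ e.2.1 hs2) (Prod.mk.inj h).1)).1
  have h4 : (edgePath e.2.1 e.2.2 s).1 = (edgePath e.2.1 e.2.2 s').1 := by
    rw [← K.bend_mul_bend e.1 e.2.1 (edgePath e.2.1 e.2.2 s).1, h3, bend_mul_bend]
  obtain ⟨i, b, m⟩ := e
  have h5 : s = s' := by
    cases m with
    | none => simpa [edgePath] using h4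
    | some σ =>
      have := mul_left_cancel₀ (sgn_ne_zero σ) h4
      linarith
  rw [h5]

/-- The intervals of the diameters are disjoint. -/
theorem eq_of_mem_diameter {i i' : K.Twist} {m m' : Option Bool} {q : Torus × ℝ}
    (h : q ∈ K.diameter i m) (h' : q ∈ K.diameter i' m') : i = i' ∧ m = m' := by
  obtain ⟨-, x, hx, h1⟩ := h
  obtain ⟨-, x', hx', h2⟩ := h'
  obtain ⟨rfl, h3⟩ := K.isSquareFamily_chart.inj _ _ _
    (mem_square_of_abs_lt (diameter_interval_subset hx)) _
    (mem_square_of_abs_lt (diameter_interval_subset hx')) (h1.symm.trans h2)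
  obtain rfl := (Prod.mk.inj h3).1
  refine ⟨rfl, ?_⟩
  have hns : ∀ σ : Bool, |x| < 1 / 2 → ¬ 1 / 2 < sgn σ * x := fun σ h1 h2 => by
    rw [abs_eq_sgn_mul (by linarith)] at h1
    exact lt_asymm h1 h2
  cases m with
  | none =>
    cases m' with
    | none => rfl
    | some σ => exact absurd hx'.1 (hns σ hx)
  | some σ =>
    cases m' with
    | none => exact absurd hx.1 (hns σ hx')
    | some σ' =>
      have h3 : 1 / 2 < sgn σ * x := hx.1
      have h4 : 1 / 2 < sgn σ' * x := hx'.1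
      rw [eq_of_sgn_mul_pos (by linarith : 0 < sgn σ * x) (by linarith : 0 < sgn σ' * x)]

theorem diameter_subset_disks (i : K.Twist) (m : Option Bool) : K.diameter i m ⊆ K.disks := by
  rintro ⟨p, z⟩ ⟨hz, x, hx, hp⟩
  have h := diameter_interval_subset hx
  refine ⟨i, (x, 0), mem_square_of_abs_lt h, hp, rfl, ?_⟩
  obtain rfl : z = 0 := hz
  simp only
  have h1 := sq_abs x
  nlinarith [abs_nonneg x]

theorem halfDisk_subset_disks (i : K.Twist) (s : Bool) : K.halfDisk i s ⊆ K.disks := by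
  rintro ⟨p, z⟩ ⟨x, hp, h, -⟩
  exact ⟨i, (x, 0), mem_square_of_sq_le h.le, hp, rfl, h.le⟩

theorem eq_of_mem_halfDisk {i i' : K.Twist} {s s' : Bool} {q : Torus × ℝ}
    (h : q ∈ K.halfDisk i s) (h' : q ∈ K.halfDisk i' s') : i = i' ∧ s = s' := by
  obtain ⟨x, h1, h2, h3⟩ := h
  obtain ⟨x', h1', h2', h3'⟩ := h'
  obtain ⟨rfl, -⟩ := K.isSquareFamily_chart.inj _ _ _ (mem_square_of_sq_le h2.le) _
    (mem_square_of_sq_le h2'.le) (h1.symm.trans h1')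
  exact ⟨rfl, eq_of_sgn_mul_pos h3 h3'⟩

theorem halfDisk_notMem_diameter {i i' : K.Twist} {s : Bool} {m : Option Bool} {q : Torus × ℝ}
    (h : q ∈ K.halfDisk i s) : q ∉ K.diameter i' m := by
  rintro ⟨h1, -⟩
  obtain ⟨x, -, -, h2⟩ := h
  rw [h1, mul_zero] at h2
  exact lt_irrefl _ h2

theorem unfold_white_notMem_disks (k : Bool) {p : Torus} (hp : p ∈ K.white) :
    K.unfold k 0 p ∉ K.disks := by
  rw [unfold_mem_disks_iff K k le_rfl]
  exact fun h => K.white_notMem_hexagons hp h.2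

/-- Off the link, a crossing disk consists of its open halves and of the intervals of its
diameter. -/
theorem disks_cases {q : Torus × ℝ} (hq : q ∈ K.disks) (hl : q ∉ K.link) :
    (∃ i s, q ∈ K.halfDisk i s) ∨ ∃ i m, q ∈ K.diameter i m := by
  obtain ⟨p, z⟩ := q
  obtain ⟨i, u, hu, rfl, h1, h2⟩ := hq
  obtain ⟨x, t⟩ := u
  obtain rfl : t = 0 := h1
  simp only at h2
  rw [link_chart K hu, not_or] at hl
  have h3 : x ^ 2 + z ^ 2 < 9 / 16 := lt_of_le_of_ne h2 fun h => hl.2 ⟨rfl, h⟩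
  obtain ⟨s, hs⟩ := sgn_exists z
  rcases eq_or_ne z 0 with rfl | hz
  · have h4 : |x| < 3 / 4 := by
      by_contra! h
      have := sq_abs x
      nlinarith
    refine Or.inr ⟨i, ?_⟩
    obtain ⟨σ, hσ⟩ := sgn_exists x
    have h6 : sgn σ * x = |x| := by
      conv_lhs => rw [hσ, ← mul_assoc, sgn_sq, one_mul]
    rcases lt_trichotomy |x| (1 / 2) with h5 | h5 | h5
    · exact ⟨none, rfl, x, h5, rfl⟩
    -- the points `x = ± 1 / 2` of the diameter are where the strands pass through the disk
    · refine absurd ⟨σ, ?_, ?_⟩ hl.1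
      · show x = strandX (K.halfTwist i) σ (eta 0)
        rw [strandX, eta_zero, max_eq_left (by norm_num), hσ, h5]
        simp
        ring
      · show (0 : ℝ) = strandZ (K.halfTwist i) σ (eta 0)
        rw [strandZ, eta_zero, max_eq_left (by norm_num)]
        simp
    · exact ⟨some σ, rfl, x, ⟨by rw [h6]; exact h5, by rw [h6]; exact h4⟩, rfl⟩
  · refine Or.inl ⟨i, s, x, rfl, h3, ?_⟩
    show 0 < sgn s * z
    have : sgn s * z = |z| := by
      conv_lhs => rw [hs, ← mul_assoc, sgn_sq, one_mul]
    rw [this]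
    exact abs_pos.2 hz

end TwistDiagram

/-! ### The map of a torihedron -/

namespace TwistDiagram

variable (K : TwistDiagram)

/-- The map of a torihedron to the thickened torus: the vertices are expanded to the arcs of the
spine, the slits are opened, and the half twists are inserted. -/
noncomputable def develop (k : Bool) (q : Torus × ℝ) : Torus × ℝ :=
  K.unfold k q.2 (stretch K.seamChart q.2 q.1)

/-- The upper half of `T² × ℝ` without the ideal vertices. -/
def domain : Set (Torus × ℝ) := {q | 0 ≤ q.2 ∧ ¬ (q.1 ∈ K.vertices ∧ q.2 = 0)}

theorem develop_collapseSpine (k : Bool) {p : Torus} (hp : p ∉ K.spine) :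
    K.develop k (K.collapseSpine p, 0) = K.unfold k 0 p :=
  congrArg (K.unfold k 0) (K.isSquareFamily_seamChart.stretch_collapse_zero hp)

/-- The points of the bottom that are not ideal vertices are moved off the spine. -/
theorem stretch_notMem_spine {q : Torus × ℝ} (hq : q ∈ K.domain) :
    ¬ (q.2 = 0 ∧ stretch K.seamChart q.2 q.1 ∈ K.spine) := by
  rintro ⟨h1, h2⟩
  rw [h1] at h2
  exact K.isSquareFamily_seamChart.stretch_notMem_seam (fun h => hq.2 ⟨h, h1⟩) h2

theorem notMem_vertices_of_mem {A : Set Torus} (hA : ∀ p ∈ A, p ∉ K.spine) {p : Torus}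
    (hp : p ∈ K.collapseSpine '' A) : p ∉ K.vertices := by
  obtain ⟨q, hq, rfl⟩ := hp
  exact fun h => hA q hq (K.collapseSpine_mem_vertices_iff.1 h)

theorem slot_subset_spine : ⋃ i, K.slot i ⊆ K.spine := by
  rw [spine, iUnion_seam]
  exact subset_union_right

theorem develop_notMem_link (k : Bool) {q : Torus × ℝ} (hq : q ∈ K.domain) :
    K.develop k q ∉ K.link := by
  rw [develop, K.unfold_mem_link_iff k hq.1, ← iUnion_seam]
  exact K.stretch_notMem_spine hq

theorem abs_develop_lt (k : Bool) {q : Torus × ℝ} (hq : 0 ≤ q.2) (h : q.2 < 1) :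
    |(K.develop k q).2| < 1 := K.abs_unfold_snd_lt k hq h _

theorem continuousOn_develop (k : Bool) : ContinuousOn (K.develop k) K.domain :=
  (K.continuousOn_unfold k).comp
    (K.isSquareFamily_seamChart.continuousOn_stretch.prodMk continuousOn_snd) fun _ hq =>
      ⟨hq.1, fun h => K.stretch_notMem_spine hq ⟨h.1, K.slot_subset_spine h.2⟩⟩

/-- Points that tend to an ideal vertex go to points that accumulate at the part of the link that
is collapsed to it. The torus is compact, so along an ultrafilter there is a limit, and the map
that collapses the spine shows that it lies on the arc that belongs to the vertex. -/
theorem exists_tendsto_develop (k : Bool) {U : Ultrafilter (Torus × ℝ)}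
    {j : K.Arc ⊕ K.Twist}
    (hU : ↑U ≤ 𝓝 (node K.seamChart j, (0 : ℝ)))
    (hD : ∀ᶠ q in (U : Filter (Torus × ℝ)), q ∈ K.domain) :
    ∃ l ∈ K.link, |l.2| < 1 ∧ (∀ i, j = Sum.inr i → l ∈ K.circle i) ∧
      Tendsto (K.develop k) U (𝓝 l) := by
  have hβ := K.isSquareFamily_seamChart
  obtain ⟨p, -, hp⟩ := isCompact_univ.ultrafilter_le_nhds
    (U.map fun q => stretch K.seamChart q.2 q.1) (by simp)
  have h1 : Tendsto (fun q => stretch K.seamChart q.2 q.1) (U : Filter (Torus × ℝ)) (𝓝 p) := hp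
  have h2 : Tendsto Prod.snd (U : Filter (Torus × ℝ)) (𝓝 0) :=
    (continuous_snd.tendsto' _ _ rfl).mono_left hU
  have h3 : Tendsto (fun q => (stretch K.seamChart q.2 q.1, q.2)) (U : Filter (Torus × ℝ))
      (𝓝 (p, 0)) := h1.prodMk_nhds h2
  have hmem : p ∈ seam K.seamChart j := by
    rw [← hβ.collapse_eq_node_iff]
    have h4 : Tendsto (fun q : Torus × ℝ => collapse K.seamChart q.2 (stretch K.seamChart q.2 q.1))
        U (𝓝 (collapse K.seamChart 0 p)) := by
      refine Tendsto.comp (hβ.continuousOn_collapse (p, 0) (le_refl (0 : ℝ)))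
        (tendsto_nhdsWithin_iff.2 ⟨h3, ?_⟩)
      filter_upwards [hD] with q hq using hq.1
    have h5 : Tendsto Prod.fst (U : Filter (Torus × ℝ)) (𝓝 (node K.seamChart j)) :=
      (continuous_fst.tendsto' _ _ rfl).mono_left hU
    refine tendsto_nhds_unique (h4.congr' ?_) h5
    filter_upwards [hD] with q hq using hβ.collapse_stretch hq.1 hq.2
  have hslot : ∀ i, p ∈ K.slot i → ∃ l ∈ K.circle i, Tendsto (K.develop k) U (𝓝 l) := fun i hi => by
    have h6 : ∀ᶠ q : Torus × ℝ in (U.map fun q => (stretch K.seamChart q.2 q.1, q.2) :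
        Ultrafilter (Torus × ℝ)), 0 ≤ q.2 := by
      rw [Ultrafilter.coe_map, eventually_map]
      filter_upwards [hD] with q hq using hq.1
    obtain ⟨l, hl, h⟩ := K.exists_tendsto_unfold_of_slot k hi
      ((Ultrafilter.coe_map _ U).trans_le h3) h6
    rw [Ultrafilter.coe_map, tendsto_map'_iff] at h
    exact ⟨l, hl, h⟩
  have hlt : ∀ i, ∀ l ∈ K.circle i, |l.2| < 1 := fun i l ⟨x, _, hx⟩ => by
    rw [← sq_lt_one_iff_abs_lt_one]
    nlinarith [sq_nonneg x]
  -- off the slots, `unfold` is continuous, so the limit is the image of `p`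
  by_cases hs : ∃ i, p ∈ K.slot i
  · obtain ⟨i, hi⟩ : ∃ i, p ∈ K.slot i ∧ ∀ i', j = Sum.inr i' → i = i' := by
      obtain ⟨i, hi⟩ := hs
      cases j with
      | inl e => exact ⟨i, hi, fun i' h => by cases h⟩
      | inr i' => exact ⟨i', by rwa [← seam_inr], fun _ h => Sum.inr_injective h⟩
    obtain ⟨l, hl, h⟩ := hslot i hi.1
    exact ⟨l, Or.inr (mem_iUnion.2 ⟨i, hl⟩), hlt i l hl, fun i' h' => hi.2 i' h' ▸ hl, h⟩
  · refine ⟨K.unfold k 0 p, ?_, K.abs_unfold_snd_lt k le_rfl one_pos p, ?_, ?_⟩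
    · rw [K.unfold_mem_link_iff k le_rfl, ← iUnion_seam]
      exact ⟨rfl, mem_iUnion.2 ⟨j, hmem⟩⟩
    · rintro i rfl
      exact absurd ⟨i, by rwa [← seam_inr]⟩ hs
    · refine Tendsto.comp (K.continuousOn_unfold k (p, 0)
        ⟨le_rfl, fun h => hs (mem_iUnion.1 h.2)⟩) (tendsto_nhdsWithin_iff.2 ⟨h3, ?_⟩)
      filter_upwards [hD] with q hq using
        ⟨hq.1, fun h => K.stretch_notMem_spine hq ⟨h.1, K.slot_subset_spine h.2⟩⟩

/-- Properness: if the image of an ultrafilter converges off the link, the ultrafilter converges.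
The cylinder `T² × [0, 1]` is compact, so there is a limit. It is neither at the top nor an ideal
vertex, where the image would converge to the boundary of the thickened torus or to the link. -/
theorem exists_le_nhds_of_tendsto_develop (k : Bool) {U : Ultrafilter (Torus × ℝ)}
    (hD : ∀ᶠ q in (U : Filter (Torus × ℝ)), q ∈ K.domain ∧ q.2 < 1) {m : Torus × ℝ}
    (hm : m ∉ K.link) (hm1 : |m.2| < 1) (h : Tendsto (K.develop k) U (𝓝 m)) :
    ∃ q ∈ K.domain, q.2 < 1 ∧ ↑U ≤ 𝓝 q := by
  obtain ⟨q, hq, hU⟩ := (isCompact_univ.prod (isCompact_Icc (a := (0 : ℝ)) (b := 1))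
    : IsCompact ((univ : Set Torus) ×ˢ Icc (0 : ℝ) 1)).ultrafilter_le_nhds U (by
      rw [le_principal_iff]
      filter_upwards [hD] with q hq using ⟨mem_univ _, hq.1.1, hq.2.le⟩)
  have hdom : q ∈ K.domain := by
    refine ⟨hq.2.1, ?_⟩
    rintro ⟨⟨j, hj⟩, h0⟩
    obtain ⟨l, hl, -, -, h'⟩ := K.exists_tendsto_develop k (U := U) (j := j)
      (by rw [hj, ← h0]; exact hU) (hD.mono fun _ h => h.1)
    exact hm (tendsto_nhds_unique h h' ▸ hl)
  refine ⟨q, hdom, ?_, hU⟩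
  have h1 : Tendsto (K.develop k) U (𝓝 (K.develop k q)) :=
    (K.continuousOn_develop k q hdom).mono_left
      (le_inf hU (le_principal_iff.2 (hD.mono fun _ h => h.1)))
  rw [tendsto_nhds_unique h h1] at hm1
  refine lt_of_le_of_ne hq.2.2 fun h2 => ?_
  rw [develop, h2, abs_unfold_one_snd] at hm1
  exact lt_irrefl _ hm1

/-- Interior points are identified with no other points: their images are off the crossing disks,
and the height and `refold` recover the torihedron and the point. -/
theorem develop_interior_inj {k l : Bool} {q q' : Torus × ℝ} (hq : q ∈ K.domain)
    (hq' : q' ∈ K.domain) (h0 : 0 < q.2) (h : K.develop k q = K.develop l q') : k = l ∧ q = q' := by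
  have hβ := K.isSquareFamily_seamChart
  have h1 : ¬ (q.2 = 0 ∧ stretch K.seamChart q.2 q.1 ∈ K.hexagons) := fun h => h0.ne' h.1
  have h2 : ¬ (q'.2 = 0 ∧ stretch K.seamChart q'.2 q'.1 ∈ K.hexagons) := by
    rw [← K.unfold_mem_disks_iff k hq.1] at h1
    rw [← K.unfold_mem_disks_iff l hq'.1]
    intro h3
    exact h1 (h.symm ▸ h3 : K.develop k q ∈ K.disks)
  have h3 := K.refold_unfold k hq.1 h1
  have h4 := K.refold_unfold l hq'.1 h2
  obtain ⟨h5, h6⟩ := K.height_unfold k hq.1 h1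
  obtain ⟨h7, -⟩ := K.height_unfold l hq'.1 h2
  unfold develop at h
  rw [h, h4] at h3
  rw [h] at h5 h6
  obtain ⟨h8, h9⟩ := Prod.mk.inj h3
  constructor
  · have hne := fun h => h0.ne' (h6.1 h)
    exact eq_of_sgn_mul_pos (lt_of_le_of_ne h5 (mul_ne_zero (sgn_ne_zero k) hne).symm)
      (lt_of_le_of_ne h7 (mul_ne_zero (sgn_ne_zero l) hne).symm)
  · refine Prod.ext ?_ h9.symm
    rw [← hβ.collapse_stretch hq.1 hq.2, ← h8, h9, hβ.collapse_stretch (h9 ▸ hq'.1)]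
    rw [← h9]
    exact hq'.2

/-- The torihedra fill the complement of the link: a point of a crossing disk comes from a triangle
or an edge, and all other points have a preimage under `unfold`. -/
theorem exists_develop_eq {m : Torus × ℝ} (hm : m ∉ K.link) (hm1 : |m.2| < 1) :
    ∃ k, ∃ q ∈ K.domain, q.2 < 1 ∧ K.develop k q = m := by
  have key : ∀ k, ∀ p ∉ K.spine, K.unfold k 0 p = m →
      ∃ k, ∃ q ∈ K.domain, q.2 < 1 ∧ K.develop k q = m := fun k p hp h =>
    ⟨k, (K.collapseSpine p, 0), ⟨le_rfl, fun h' => hp (K.collapseSpine_mem_vertices_iff.1 h'.1)⟩,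
      one_pos, (K.develop_collapseSpine k hp).trans h⟩
  by_cases hd : m ∈ K.disks
  · rcases K.disks_cases hd hm with ⟨i, s, h⟩ | ⟨i, s, h⟩
    · rw [show s = K.swap i false s by simp [swap], ← unfold_image_half] at h
      obtain ⟨p, hp, h⟩ := h
      exact key s p (K.half_notMem_spine hp) h
    · rw [show s = s.map (K.swap i false) by cases s <;> simp [swap],
        ← K.unfold_image_rim true (i, false, s)] at h
      obtain ⟨p, hp, h⟩ := h
      exact key true p (K.rim_notMem_spine hp) h
  · obtain ⟨k, hk⟩ : ∃ k, 0 ≤ sgn k * K.height m := by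
      rcases le_total 0 (K.height m) with h | h
      · exact ⟨true, by simpa [sgn] using h⟩
      · exact ⟨false, by simpa [sgn] using h⟩
    obtain ⟨h1, h2, h3, h4⟩ := K.refold_spec k hd hk hm1
    have h5 : ¬ ((K.refold m).1 ∈ ⋃ j, seam K.seamChart j ∧ (K.refold m).2 = 0) := fun h => by
      refine hm ?_
      rw [← h4, K.unfold_mem_link_iff k h1, ← iUnion_seam]
      exact ⟨h.2, h.1⟩
    have h6 := K.isSquareFamily_seamChart.stretch_collapse h1 h5
    refine ⟨k, (collapse K.seamChart (K.refold m).2 (K.refold m).1, (K.refold m).2), ⟨h1, ?_⟩, h2,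
      ?_⟩
    · rintro ⟨h7, h8⟩
      simp only at h7 h8
      rw [h8] at h7
      exact h5 ⟨K.collapseSpine_mem_vertices_iff.1 h7, h8⟩
    · rw [develop, h6, h4]

theorem height_eq_snd {q : Torus × ℝ} (hq : q.1 ∉ K.halfTwistBoxes) : K.height q = q.2 := by
  obtain ⟨p, z⟩ := q
  rcases IsSquareFamily.mem_square_or K.chart p with ⟨i, u, hu, rfl⟩ | hn
  · have h0 : K.halfTwist i = 0 := by
      by_contra h
      refine hq (mem_iUnion.2 ⟨i, h, ?_⟩)
      rw [← chart_image_square]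
      exact ⟨u, hu, rfl⟩
    rw [K.height_chart z i hu, h0, untwist]
    simp [twistAngle, rot]
  · exact K.height_of_notMem z hn

/-- Away from the half twists, the torihedra lie on the two sides of the projection torus. -/
theorem develop_snd_pos (k : Bool) {q : Torus × ℝ} (h0 : 0 < q.2)
    (h : (K.develop k q).1 ∉ K.halfTwistBoxes) : 0 < sgn k * (K.develop k q).2 := by
  obtain ⟨h1, h2⟩ := K.height_unfold k h0.le (p := stretch K.seamChart q.2 q.1) fun h => h0.ne' h.1
  rw [← K.height_eq_snd h]
  exact lt_of_le_of_ne h1 (mul_ne_zero (sgn_ne_zero k) fun h => h0.ne' (h2.1 h)).symm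

theorem unfold_white_snd (k : Bool) {p : Torus} (hp : p ∉ K.hexagons)
    (h : (K.unfold k 0 p).1 ∉ K.halfTwistBoxes) : (K.unfold k 0 p).2 = 0 := by
  rw [← K.height_eq_snd h]
  exact (K.height_unfold k le_rfl fun h => hp h.2).2.2 rfl

end TwistDiagram

/-! ### The decomposition of the complement of the augmented link -/

/-- The inclusion of the thickened torus in `T² × ℝ`. -/
def thickCoord (m : ThickTorus) : Torus × ℝ := (m.1, m.2)

theorem isEmbedding_thickCoord : IsEmbedding thickCoord :=
  IsEmbedding.id.prodMap IsEmbedding.subtypeVal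

namespace CellularGraph

/-- The inclusion of an ideal torihedron in `T² × ℝ`. -/
def coord {G : CellularGraph} (x : G.IdealTorihedron) : Torus × ℝ := (x.1.1, x.1.2)

theorem isEmbedding_coord (G : CellularGraph) : IsEmbedding (coord (G := G)) :=
  (IsEmbedding.id.prodMap IsEmbedding.subtypeVal).comp
    (IsEmbedding.subtypeVal (p := fun p : Torus × Ico (0 : ℝ) 1 =>
      ¬ (p.1 ∈ G.vert ∧ (p.2 : ℝ) = 0)))

theorem exists_coord_eq {G : CellularGraph} {q : Torus × ℝ} (h0 : 0 ≤ q.2) (h1 : q.2 < 1)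
    (h : ¬ (q.1 ∈ G.vert ∧ q.2 = 0)) : ∃ x : G.IdealTorihedron, coord x = q :=
  ⟨⟨(q.1, ⟨q.2, h0, h1⟩), h⟩, rfl⟩

theorem tendsto_coord_nearVertex (G : CellularGraph) (v : Torus) :
    Tendsto (coord (G := G)) (G.nearVertex v) (𝓝 (v, 0)) := by
  have h : Continuous fun p : Torus × Ico (0 : ℝ) 1 => (p.1, (p.2 : ℝ)) := by fun_prop
  exact (h.tendsto (v, ⟨0, by simp⟩)).comp tendsto_comap

end CellularGraph

open CellularGraph

/-- A decomposition into torihedra can be moved by a homeomorphism. -/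
theorem IsTorihedralDecomposition.comp_homeomorph {M N : Type} [TopologicalSpace M]
    [TopologicalSpace N] {G : Bool → CellularGraph} {f : ∀ k, (G k).IdealTorihedron → M}
    (h : IsTorihedralDecomposition G f) (e : M ≃ₜ N) :
    IsTorihedralDecomposition G fun k x => e (f k x) := by
  have him : ∀ k (A : Set (G k).IdealTorihedron),
      (fun x => e (f k x)) '' A = e '' (f k '' A) := fun k A => image_comp e (f k) A
  refine ⟨e.isProperMap.comp h.proper, fun m => ?_, fun x y hx hxy => ?_, fun k F => ?_, ?_,
    fun k l F a => ?_, fun k a => ?_, fun k l a b => ?_⟩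
  · obtain ⟨k, x, hx⟩ := h.surjective (e.symm m)
    exact ⟨k, x, by rw [hx, e.apply_symm_apply]⟩
  · exact h.interior_inj x y hx (e.injective hxy)
  · exact e.injective.comp_injOn (h.face_inj k F)
  · obtain ⟨τ, h1, h2, h3, h4⟩ := h.face_pairing
    refine ⟨τ, h1, h2, fun A => ?_, fun A B hA hB => ?_⟩
    · rw [him, him, h3]
    · rw [him, him]
      exact (disjoint_image_iff e.injective).2 (h4 A B hA hB)
  · rw [him, him]
    exact (disjoint_image_iff e.injective).2 (h.face_edge k l F a)
  · exact e.injective.comp_injOn (h.edge_inj k a)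
  · rw [him, him]
    exact (h.edge_edge k l a b).imp (congrArg _) (disjoint_image_iff e.injective).2

namespace TwistDiagram

variable (K : TwistDiagram) (hK : K.IsCellular)

theorem coord_mem_domain (x : (K.graph hK).IdealTorihedron) : coord x ∈ K.domain :=
  ⟨x.1.2.2.1, x.2⟩

/-- The map of an ideal torihedron to the complement of the augmented link. -/
noncomputable def place (k : Bool) (x : (K.graph hK).IdealTorihedron) :
    (K.augmentedLinkᶜ : Set ThickTorus) :=
  ⟨((K.develop k (coord x)).1, ⟨(K.develop k (coord x)).2,
    abs_lt.1 (K.abs_develop_lt k x.1.2.2.1 x.1.2.2.2)⟩), by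
      rw [mem_compl_iff, mem_augmentedLink_iff]
      exact K.develop_notMem_link k (K.coord_mem_domain hK x)⟩

theorem thickCoord_place (k : Bool) (x : (K.graph hK).IdealTorihedron) :
    thickCoord (K.place hK k x) = K.develop k (coord x) := rfl

theorem continuous_place (k : Bool) : Continuous (K.place hK k) := by
  rw [IsEmbedding.subtypeVal.continuous_iff, isEmbedding_thickCoord.continuous_iff]
  exact (K.continuousOn_develop k).comp_continuous (isEmbedding_coord _).continuous
    (K.coord_mem_domain hK)

theorem place_eq_iff {k l : Bool} {x y : (K.graph hK).IdealTorihedron} :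
    K.place hK k x = K.place hK l y ↔ K.develop k (coord x) = K.develop l (coord y) := by
  rw [← thickCoord_place K hK, ← thickCoord_place K hK, isEmbedding_thickCoord.injective.eq_iff,
    Subtype.coe_injective.eq_iff]

/-- Near an ideal vertex, the torihedron is mapped close to the link, and for the vertex that comes
from a crossing circle close to this circle. -/
theorem tendsto_place (k : Bool) (j : K.Arc ⊕ K.Twist) {S : Set ThickTorus}
    (hS : ∀ m : ThickTorus, thickCoord m ∈ K.link →
      (∀ i, j = Sum.inr i → thickCoord m ∈ K.circle i) → m ∈ S) :
    Tendsto (fun x => (K.place hK k x : ThickTorus)) ((K.graph hK).nearVertex (node K.seamChart j))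
      (𝓝ˢ S) := by
  rw [tendsto_iff_ultrafilter]
  intro U hU
  have h1 : Tendsto coord (U : Filter (K.graph hK).IdealTorihedron) (𝓝 (node K.seamChart j, 0)) :=
    (tendsto_coord_nearVertex _ _).mono_left hU
  obtain ⟨l, hl, hl1, hc, h⟩ := K.exists_tendsto_develop k (U := U.map coord) (j := j)
    ((Ultrafilter.coe_map _ U).trans_le h1) (by
      rw [Ultrafilter.coe_map, eventually_map]
      exact Eventually.of_forall (K.coord_mem_domain hK))
  rw [Ultrafilter.coe_map, tendsto_map'_iff] at h
  have hm : Tendsto (fun x => (K.place hK k x : ThickTorus)) U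
      (𝓝 ((l.1, ⟨l.2, abs_lt.1 hl1⟩) : ThickTorus)) := by
    rw [isEmbedding_thickCoord.tendsto_nhds_iff]
    exact h
  exact hm.mono_right (nhds_le_nhdsSet (hS _ hl hc))

/-- An ultrafilter on the disjoint union lives on one of the torihedra. -/
theorem isProperMap_place : IsProperMap
    (fun x : Σ _ : Bool, (K.graph hK).IdealTorihedron => K.place hK x.1 x.2) := by
  rw [isProperMap_iff_ultrafilter_of_t2]
  refine ⟨continuous_sigma fun k => K.continuous_place hK k, fun U m hU => ?_⟩
  obtain ⟨k, hk⟩ : ∃ k, range (Sigma.mk (β := fun _ => (K.graph hK).IdealTorihedron) k) ∈ U := by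
    have h : (⋃ k, range (Sigma.mk (β := fun _ => (K.graph hK).IdealTorihedron) k)) ∈ U := by
      rw [show (⋃ k, range (Sigma.mk (β := fun _ => (K.graph hK).IdealTorihedron) k)) = univ from
        eq_univ_of_forall fun x => mem_iUnion.2 ⟨x.1, x.2, rfl⟩]
      exact univ_mem
    obtain ⟨k, -, h⟩ := (Ultrafilter.finite_biUnion_mem_iff (s := fun k => range
      (Sigma.mk (β := fun _ => (K.graph hK).IdealTorihedron) k)) finite_univ).1 (by simpa using h)
    exact ⟨k, h⟩
  let V : Ultrafilter (K.graph hK).IdealTorihedron := U.comap sigma_mk_injective hk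
  have hV : (U : Filter (Σ _ : Bool, (K.graph hK).IdealTorihedron)) = map
      (Sigma.mk (β := fun _ => (K.graph hK).IdealTorihedron) k)
      (V : Filter (K.graph hK).IdealTorihedron) := by
    rw [Ultrafilter.coe_comap, map_comap_of_mem hk]
  rw [hV, tendsto_map'_iff] at hU
  have h1 : Tendsto (K.develop k) (V.map coord : Ultrafilter (Torus × ℝ)) (𝓝 (thickCoord m)) := by
    rw [Ultrafilter.coe_map, tendsto_map'_iff]
    exact ((isEmbedding_thickCoord.comp IsEmbedding.subtypeVal).continuous.tendsto m).comp hU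
  obtain ⟨q, hq, hq1, h⟩ := K.exists_le_nhds_of_tendsto_develop k (by
      rw [Ultrafilter.coe_map, eventually_map]
      exact Eventually.of_forall fun x => ⟨K.coord_mem_domain hK x, x.1.2.2.2⟩)
    (fun h => m.2 ((K.mem_augmentedLink_iff _).2 h)) (abs_lt.2 m.1.2.2) h1
  obtain ⟨x, rfl⟩ := exists_coord_eq (G := K.graph hK) hq.1 hq1 hq.2
  refine ⟨⟨k, x⟩, ?_⟩
  rw [hV, Sigma.nhds_mk]
  refine map_mono ?_
  rw [(isEmbedding_coord _).nhds_eq_comap, ← map_le_iff_le_comap]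
  exact (Ultrafilter.coe_map _ V).symm.trans_le h

/-! ### Faces and edges in the complement of the link -/

/-- The image in `T² × ℝ` of the part of the torihedron over a set `A`. -/
noncomputable def trace (k : Bool) (A : Set Torus) : Set (Torus × ℝ) :=
  K.unfold k 0 '' (K.collapseSpine ⁻¹' A)

theorem exists_collapseSpine_eq {p : Torus} (hp : p ∉ K.vertices) :
    ∃ q ∉ K.spine, K.collapseSpine q = p := K.isSquareFamily_seamChart.exists_collapse_eq hp

theorem notMem_spine_of_mem_preimage {A : Set Torus} (hA : ∀ p ∈ A, p ∉ K.vertices) {p : Torus}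
    (hp : p ∈ K.collapseSpine ⁻¹' A) : p ∉ K.spine := fun h =>
  hA _ hp (K.collapseSpine_mem_vertices_iff.2 h)

theorem exists_place_eq (k : Bool) {A : Set Torus} {p : Torus} (hp : p ∉ K.spine)
    (hA : K.collapseSpine p ∈ A) : ∃ x ∈ (K.graph hK).bottom A,
      coord x = (K.collapseSpine p, 0) ∧ thickCoord (K.place hK k x) = K.unfold k 0 p := by
  obtain ⟨x, hx⟩ := exists_coord_eq (G := K.graph hK) (q := (K.collapseSpine p, 0)) le_rfl one_pos
    fun h => hp (K.collapseSpine_mem_vertices_iff.1 h.1)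
  refine ⟨x, ⟨?_, congrArg Prod.snd hx⟩, hx, ?_⟩
  · rwa [show x.1.1 = K.collapseSpine p from congrArg Prod.fst hx]
  · rw [thickCoord_place, hx, K.develop_collapseSpine k hp]

theorem exists_of_mem_bottom (k : Bool) {A : Set Torus} (hA : ∀ p ∈ A, p ∉ K.vertices)
    {x : (K.graph hK).IdealTorihedron} (hx : x ∈ (K.graph hK).bottom A) :
    ∃ p ∈ K.collapseSpine ⁻¹' A, coord x = (K.collapseSpine p, 0) ∧
      thickCoord (K.place hK k x) = K.unfold k 0 p := by
  obtain ⟨p, hp, h⟩ := K.exists_collapseSpine_eq (hA _ hx.1)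
  have h1 : coord x = (K.collapseSpine p, 0) := Prod.ext h.symm hx.2
  refine ⟨p, ?_, h1, ?_⟩
  · rw [mem_preimage, h]
    exact hx.1
  · rw [thickCoord_place, h1, K.develop_collapseSpine k hp]

theorem thickCoord_image_place (k : Bool) {A : Set Torus} (hA : ∀ p ∈ A, p ∉ K.vertices) :
    (fun m : (K.augmentedLinkᶜ : Set ThickTorus) => thickCoord m) ''
      (K.place hK k '' (K.graph hK).bottom A) = K.trace k A := by
  ext q
  constructor
  · rintro ⟨_, ⟨x, hx, rfl⟩, rfl⟩
    obtain ⟨p, hp, -, h⟩ := K.exists_of_mem_bottom hK k hA hx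
    exact ⟨p, hp, h.symm⟩
  · rintro ⟨p, hp, rfl⟩
    obtain ⟨x, hx, -, h⟩ := K.exists_place_eq hK k (K.notMem_spine_of_mem_preimage hA hp) hp
    exact ⟨_, ⟨x, hx, rfl⟩, h⟩

theorem injective_thickCoord : Function.Injective
    fun m : (K.augmentedLinkᶜ : Set ThickTorus) => thickCoord m :=
  isEmbedding_thickCoord.injective.comp Subtype.coe_injective

theorem image_place_eq_iff {k l : Bool} {A B : Set Torus} (hA : ∀ p ∈ A, p ∉ K.vertices)
    (hB : ∀ p ∈ B, p ∉ K.vertices) :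
    K.place hK k '' (K.graph hK).bottom A = K.place hK l '' (K.graph hK).bottom B ↔
      K.trace k A = K.trace l B := by
  rw [← K.thickCoord_image_place hK k hA, ← K.thickCoord_image_place hK l hB,
    K.injective_thickCoord.image_injective.eq_iff]

theorem disjoint_image_place_iff {k l : Bool} {A B : Set Torus} (hA : ∀ p ∈ A, p ∉ K.vertices)
    (hB : ∀ p ∈ B, p ∉ K.vertices) :
    Disjoint (K.place hK k '' (K.graph hK).bottom A) (K.place hK l '' (K.graph hK).bottom B) ↔
      Disjoint (K.trace k A) (K.trace l B) := by
  rw [← K.thickCoord_image_place hK k hA, ← K.thickCoord_image_place hK l hB,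
    disjoint_image_iff K.injective_thickCoord]

theorem injOn_place (k : Bool) {A : Set Torus} (hA : ∀ p ∈ A, p ∉ K.vertices)
    (h : InjOn (K.unfold k 0) (K.collapseSpine ⁻¹' A)) :
    InjOn (K.place hK k) ((K.graph hK).bottom A) := by
  intro x hx y hy hxy
  obtain ⟨p, hp, h1, h2⟩ := K.exists_of_mem_bottom hK k hA hx
  obtain ⟨p', hp', h1', h2'⟩ := K.exists_of_mem_bottom hK k hA hy
  rw [hxy, h2'] at h2
  refine (isEmbedding_coord _).injective ?_
  rw [h1, h1', h hp' hp h2]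

theorem notMem_vertices_of_mem_face (F : (K.graph hK).Face) : ∀ p ∈ F.1, p ∉ K.vertices :=
  fun _ hp h => F.subset_compl hp (Or.inl h)

theorem notMem_vertices_of_mem_edge (e : K.Twist × Bool × Option Bool) :
    ∀ p ∈ (K.graph hK).openEdge e, p ∉ K.vertices := by
  intro p hp
  have h := K.openEdge_graph hK e
  rw [h] at hp
  exact K.notMem_vertices_of_mem (fun _ h => K.rim_notMem_spine h) hp

theorem preimage_collapseSpine {A : Set Torus} (hA : ∀ p ∈ A, p ∉ K.spine) :
    K.collapseSpine ⁻¹' (K.collapseSpine '' A) = A := by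
  refine subset_antisymm ?_ (subset_preimage_image _ _)
  rintro p ⟨q, hq, h⟩
  rwa [K.collapseSpine_inj (hA q hq) h.symm]

theorem preimage_triangle (a : K.Twist × Bool) :
    K.collapseSpine ⁻¹' (K.triangleFace hK a).1 = K.half a.1 a.2 :=
  K.preimage_collapseSpine fun _ h => K.half_notMem_spine h

theorem preimage_openEdge (e : K.Twist × Bool × Option Bool) :
    K.collapseSpine ⁻¹' (K.graph hK).openEdge e = K.rim e := by
  have h := K.openEdge_graph hK e
  rw [h]
  exact K.preimage_collapseSpine fun _ h => K.rim_notMem_spine h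

theorem preimage_white {F : (K.graph hK).Face} (hF : F ∉ K.shadedFaces hK) :
    K.collapseSpine ⁻¹' F.1 ⊆ K.white := by
  intro p hp
  have h := K.face_subset_whiteFaces hK hF hp
  have h1 : p ∈ K.collapseSpine ⁻¹' (K.collapseSpine '' K.white) := h
  rwa [K.preimage_collapseSpine fun _ h => K.white_notMem_spine h] at h1

theorem trace_triangle (k : Bool) (a : K.Twist × Bool) :
    K.trace k (K.triangleFace hK a).1 = K.halfDisk a.1 (K.swap a.1 a.2 k) := by
  rw [trace, preimage_triangle, unfold_image_half]

theorem trace_openEdge (k : Bool) (e : K.Twist × Bool × Option Bool) :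
    K.trace k ((K.graph hK).openEdge e) = K.diameter e.1 (e.2.2.map (K.swap e.1 e.2.1)) := by
  have h := K.preimage_openEdge hK e
  rw [trace, h, unfold_image_rim]

theorem trace_white (k l : Bool) {F : (K.graph hK).Face} (hF : F ∉ K.shadedFaces hK) :
    K.trace k F.1 = K.trace l F.1 :=
  image_congr fun _ hp => K.unfold_zero_eq k l (K.white_notMem_hexagons (K.preimage_white hK hF hp))

theorem disjoint_trace_white_disks (k : Bool) {F : (K.graph hK).Face} (hF : F ∉ K.shadedFaces hK) :
    Disjoint (K.trace k F.1) K.disks := by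
  rw [disjoint_left]
  rintro _ ⟨p, hp, rfl⟩
  exact K.unfold_white_notMem_disks k (K.preimage_white hK hF hp)

theorem disjoint_trace_white (k l : Bool) {F F' : (K.graph hK).Face} (hF : F ∉ K.shadedFaces hK)
    (hF' : F' ∉ K.shadedFaces hK) (h : F ≠ F') : Disjoint (K.trace k F.1) (K.trace l F'.1) := by
  rw [disjoint_left]
  rintro _ ⟨p, hp, rfl⟩ ⟨p', hp', h1⟩
  obtain rfl := K.unfold_zero_inj (K.white_notMem_hexagons (K.preimage_white hK hF' hp'))
    (K.white_notMem_hexagons (K.preimage_white hK hF hp)) h1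
  exact h (CellularGraph.Face.eq_of_mem hp hp')

/-- The gluing of the triangles: without a half twist the two triangles of a bow-tie are glued to
each other, and with a half twist a triangle is glued to the opposite triangle of the bow-tie of the
other torihedron. -/
noncomputable def gluing (c : Bool × K.Twist × Bool) : Bool × K.Twist × Bool :=
  (K.swap c.2.1 true c.1, c.2.1, !c.2.2)

theorem swap_swap (i : K.Twist) (b s : Bool) : K.swap i b (K.swap i b s) = s := by
  unfold swap
  split_ifs <;> simp

theorem gluing_gluing (c : Bool × K.Twist × Bool) : K.gluing (K.gluing c) = c := by
  simp [gluing, swap_swap]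

theorem swap_gluing (k : Bool) (i : K.Twist) (b : Bool) :
    K.swap i (!b) (K.swap i true k) = K.swap i b k := by
  cases b
  · simp only [Bool.not_false, swap_swap]
    simp [swap]
  · simp only [Bool.not_true]
    simp [swap]

theorem eq_or_eq_gluing {k l b c : Bool} {i : K.Twist} (h : K.swap i b k = K.swap i c l) :
    (l, i, c) = (k, i, b) ∨ (l, i, c) = K.gluing (k, i, b) := by
  have h1 : l = K.swap i c (K.swap i b k) := by rw [h, swap_swap]
  by_cases hbc : c = b
  · subst hbc
    rw [swap_swap] at h1
    exact Or.inl (by rw [h1])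
  · obtain rfl : c = !b := Bool.eq_not_iff.2 hbc
    refine Or.inr ?_
    rw [gluing, h1, ← K.swap_gluing k i b, swap_swap]

open Classical in
/-- The pairing of the faces. -/
noncomputable def pairing (A : Bool × (K.graph hK).Face) : Bool × (K.graph hK).Face :=
  if h : A.2 ∈ K.shadedFaces hK then
    ((K.gluing (A.1, h.choose)).1, K.triangleFace hK (K.gluing (A.1, h.choose)).2)
  else (!A.1, A.2)

theorem pairing_triangle (k : Bool) (a : K.Twist × Bool) :
    K.pairing hK (k, K.triangleFace hK a) =
      ((K.gluing (k, a)).1, K.triangleFace hK (K.gluing (k, a)).2) := by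
  have h : K.triangleFace hK a ∈ K.shadedFaces hK := ⟨a, rfl⟩
  rw [pairing, dif_pos h, K.triangleFace_injective hK h.choose_spec]

theorem pairing_white (k : Bool) {F : (K.graph hK).Face} (hF : F ∉ K.shadedFaces hK) :
    K.pairing hK (k, F) = (!k, F) := dif_neg hF

theorem pairing_pairing (A : Bool × (K.graph hK).Face) :
    K.pairing hK (K.pairing hK A) = A := by
  obtain ⟨k, F⟩ := A
  by_cases hF : F ∈ K.shadedFaces hK
  · obtain ⟨a, rfl⟩ := hF
    rw [pairing_triangle, pairing_triangle, Prod.mk.eta, gluing_gluing]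
  · rw [pairing_white K hK k hF, pairing_white K hK _ hF, Bool.not_not]

theorem pairing_ne (A : Bool × (K.graph hK).Face) : K.pairing hK A ≠ A := by
  obtain ⟨k, F⟩ := A
  by_cases hF : F ∈ K.shadedFaces hK
  · obtain ⟨a, rfl⟩ := hF
    rw [pairing_triangle]
    intro h
    have h1 := congrArg Prod.snd (K.triangleFace_injective hK (Prod.mk.inj h).2)
    exact Bool.not_ne_self _ h1
  · rw [pairing_white K hK k hF]
    intro h
    exact Bool.not_ne_self _ (Prod.mk.inj h).1

theorem trace_pairing (A : Bool × (K.graph hK).Face) :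
    K.trace (K.pairing hK A).1 (K.pairing hK A).2.1 = K.trace A.1 A.2.1 := by
  obtain ⟨k, F⟩ := A
  by_cases hF : F ∈ K.shadedFaces hK
  · obtain ⟨⟨i, b⟩, rfl⟩ := hF
    rw [pairing_triangle, trace_triangle, trace_triangle]
    exact congrArg _ (K.swap_gluing k i b)
  · rw [pairing_white K hK k hF]
    exact K.trace_white hK _ _ hF

/-- Faces that are not paired have disjoint images: the triangles go to the halves of the disks, and
the white faces, which are moved injectively, avoid the disks. -/
theorem disjoint_trace_face {A B : Bool × (K.graph hK).Face} (h : B ≠ A)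
    (h' : B ≠ K.pairing hK A) : Disjoint (K.trace A.1 A.2.1) (K.trace B.1 B.2.1) := by
  obtain ⟨k, F⟩ := A
  obtain ⟨l, F'⟩ := B
  have hsub : ∀ k (a : K.Twist × Bool), K.trace k (K.triangleFace hK a).1 ⊆ K.disks := fun k a => by
    rw [trace_triangle]
    exact K.halfDisk_subset_disks _ _
  by_cases hF : F ∈ K.shadedFaces hK
  · obtain ⟨a, rfl⟩ := hF
    by_cases hF' : F' ∈ K.shadedFaces hK
    · obtain ⟨c, rfl⟩ := hF'
      rw [pairing_triangle] at h'
      simp only [trace_triangle]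
      rw [disjoint_left]
      intro q hq hq'
      obtain ⟨h1, h2⟩ := K.eq_of_mem_halfDisk hq hq'
      obtain ⟨i, b⟩ := a
      obtain ⟨j, c⟩ := c
      obtain rfl : i = j := h1
      rcases K.eq_or_eq_gluing h2 with h3 | h3
      · obtain ⟨rfl, h4⟩ := Prod.mk.inj h3
        exact h (by rw [h4])
      · refine h' ?_
        rw [← h3]
    · exact (K.disjoint_trace_white_disks hK l hF').symm.mono_left (hsub k a)
  · by_cases hF' : F' ∈ K.shadedFaces hK
    · obtain ⟨c, rfl⟩ := hF'
      exact (K.disjoint_trace_white_disks hK k hF).mono_right (hsub l c)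
    · refine K.disjoint_trace_white hK k l hF hF' ?_
      rintro rfl
      rw [pairing_white K hK k hF] at h'
      cases k <;> cases l <;> simp_all

theorem disjoint_trace_face_edge (k l : Bool) (F : (K.graph hK).Face)
    (e : K.Twist × Bool × Option Bool) :
    Disjoint (K.trace k F.1) (K.trace l ((K.graph hK).openEdge e)) := by
  have he := K.trace_openEdge hK l e
  by_cases hF : F ∈ K.shadedFaces hK
  · obtain ⟨a, rfl⟩ := hF
    rw [trace_triangle, he, disjoint_left]
    exact fun q hq => K.halfDisk_notMem_diameter hq
  · rw [he]
    exact (K.disjoint_trace_white_disks hK k hF).mono_right (K.diameter_subset_disks _ _)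

theorem trace_edge_eq_or_disjoint (k l : Bool) (e e' : K.Twist × Bool × Option Bool) :
    K.trace k ((K.graph hK).openEdge e) = K.trace l ((K.graph hK).openEdge e') ∨
      Disjoint (K.trace k ((K.graph hK).openEdge e)) (K.trace l ((K.graph hK).openEdge e')) := by
  have he := K.trace_openEdge hK k e
  have he' := K.trace_openEdge hK l e'
  rw [or_iff_not_imp_right, not_disjoint_iff]
  rintro ⟨q, hq, hq'⟩
  rw [he] at hq
  rw [he'] at hq'
  obtain ⟨h1, h2⟩ := K.eq_of_mem_diameter hq hq'
  rw [he, he', h2, h1]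

/-- The complement of the augmented link is decomposed into two ideal torihedra. -/
theorem isTorihedralDecomposition_place :
    IsTorihedralDecomposition (fun _ => K.graph hK) (K.place hK) where
  proper := K.isProperMap_place hK
  surjective m := by
    obtain ⟨k, q, hq, hq1, h⟩ := K.exists_develop_eq
      (fun h => m.2 ((K.mem_augmentedLink_iff _).2 h)) (abs_lt.2 m.1.2.2)
    obtain ⟨x, rfl⟩ := exists_coord_eq (G := K.graph hK) hq.1 hq1 hq.2
    exact ⟨k, x, K.injective_thickCoord h⟩
  interior_inj := by
    rintro ⟨k, x⟩ ⟨l, y⟩ hx h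
    obtain ⟨rfl, h2⟩ := K.develop_interior_inj (K.coord_mem_domain hK x) (K.coord_mem_domain hK y)
      hx ((K.place_eq_iff hK).1 h)
    rw [(isEmbedding_coord _).injective h2]
  face_inj k F := by
    refine K.injOn_place hK k (K.notMem_vertices_of_mem_face hK F) ?_
    by_cases hF : F ∈ K.shadedFaces hK
    · obtain ⟨a, rfl⟩ := hF
      rw [preimage_triangle]
      exact K.injOn_unfold_half k _ _
    · exact fun p hp p' hp' h => K.unfold_zero_inj
        (K.white_notMem_hexagons (K.preimage_white hK hF hp))
        (K.white_notMem_hexagons (K.preimage_white hK hF hp')) h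
  face_pairing := by
    refine ⟨fun A => ⟨(K.pairing hK (A.1, A.2)).1, (K.pairing hK (A.1, A.2)).2⟩, ?_, ?_, ?_, ?_⟩
    · rintro ⟨k, F⟩
      simp only [Prod.mk.eta, pairing_pairing]
    · rintro ⟨k, F⟩ h
      refine K.pairing_ne hK (k, F) (Prod.ext ?_ ?_)
      · exact congrArg Sigma.fst h
      · exact eq_of_heq (Sigma.mk.inj h).2
    · intro A
      exact (K.image_place_eq_iff hK (K.notMem_vertices_of_mem_face hK _)
        (K.notMem_vertices_of_mem_face hK _)).2 (K.trace_pairing hK (A.1, A.2))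
    · rintro ⟨k, F⟩ ⟨l, F'⟩ h h'
      refine (K.disjoint_image_place_iff hK (K.notMem_vertices_of_mem_face hK _)
        (K.notMem_vertices_of_mem_face hK _)).2
        (K.disjoint_trace_face hK (A := (k, F)) (B := (l, F')) ?_ ?_)
      · rintro h1
        obtain ⟨rfl, rfl⟩ := Prod.mk.inj h1
        exact h rfl
      · intro h1
        refine h' ?_
        simp only [← h1]
  face_edge k l F e := by
    refine (K.disjoint_image_place_iff hK (K.notMem_vertices_of_mem_face hK _)
      (K.notMem_vertices_of_mem_edge hK _)).2 ?_
    exact K.disjoint_trace_face_edge hK k l F e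
  edge_inj k e := by
    refine K.injOn_place hK k (K.notMem_vertices_of_mem_edge hK e) ?_
    refine Eq.subst (motive := InjOn (K.unfold k 0)) (K.preimage_openEdge hK e).symm ?_
    exact K.injOn_unfold_rim k e
  edge_edge k l e e' := by
    have h := K.notMem_vertices_of_mem_edge hK e
    have h' := K.notMem_vertices_of_mem_edge hK e'
    exact (K.trace_edge_eq_or_disjoint hK k l e e').imp (K.image_place_eq_iff hK h h').2
      (K.disjoint_image_place_iff hK h h').2

end TwistDiagram

/-! ### Fully augmented links -/

namespace TwistDiagram

variable (K : TwistDiagram)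

/-- The vertex to which a crossing circle is collapsed belongs to both triangles of the bow-tie. -/
theorem node_mem_closure_triangle (i : K.Twist) (b : Bool) :
    node K.seamChart (Sum.inr i) ∈ closure (K.triangle i b) := by
  have h0 : K.chart i (0, 0) ∈ seam K.seamChart (Sum.inr i) := by
    rw [seam_inr]
    exact ⟨0, by norm_num, rfl⟩
  rw [← (K.isSquareFamily_seamChart.collapse_eq_node_iff _).2 h0]
  refine map_mem_closure K.continuous_collapseSpine (s := K.half i b) ?_ fun p hp => ⟨p, hp, rfl⟩
  have h1 : ContinuousOn (fun t : ℝ => K.chart i (0, sgn b * t)) (Icc 0 (1 / 3)) := by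
    refine (K.isSquareFamily_chart.cont i).comp (by fun_prop) fun t ht => mem_square.2 ⟨by simp, ?_⟩
    simp only
    rw [abs_mul, abs_sgn, one_mul, abs_of_nonneg ht.1]
    linarith [ht.2]
  rw [← closure_Ioo (by norm_num : (0 : ℝ) ≠ 1 / 3)] at h1
  have h2 : (fun t : ℝ => K.chart i (0, sgn b * t)) 0 ∈
      closure ((fun t : ℝ => K.chart i (0, sgn b * t)) '' Ioo 0 (1 / 3)) := by
    refine h1.image_closure ⟨0, ?_, rfl⟩
    rw [closure_Ioo (by norm_num)]
    norm_num
  simp only [mul_zero] at h2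
  refine closure_mono ?_ h2
  rintro _ ⟨t, ht, rfl⟩
  refine ⟨_, ⟨?_, ?_⟩, rfl⟩
  · simp only
    rw [← mul_assoc, sgn_sq, one_mul]
    exact ht.1
  · simp only
    rw [abs_mul, abs_sgn, one_mul, abs_of_pos ht.1, wid_of_le (by norm_num)]
    linarith [ht.2]

/-- A homeomorphism of the thickened torus restricts to the complements of a link and its image. -/
noncomputable def complHomeomorph (Φ : ThickTorus ≃ₜ ThickTorus) (S : Set ThickTorus) :
    (Sᶜ : Set ThickTorus) ≃ₜ ((Φ '' S)ᶜ : Set ThickTorus) :=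
  Φ.subtype fun m => by
    show m ∉ S ↔ Φ m ∉ Φ '' S
    rw [Φ.injective.mem_set_image]

end TwistDiagram

open TwistDiagram CellularGraph

/-- The complement of a fully augmented link in the thickened torus decomposes into two
combinatorially isomorphic ideal torihedra with 4-valent, checkerboard coloured graphs, whose
shaded faces are the triangles of the bow-ties of the crossing circles. The torihedra lie above
(`true`) and below (`false`) the projection torus. -/
theorem mainTheorem8 (K : TwistDiagram) (Φ : ThickTorus ≃ₜ ThickTorus) (L : Set ThickTorus)
    (hL : IsFullyAugmentedLink K Φ L) :
    ∃ (G : Bool → CellularGraph) (f : ∀ k, (G k).IdealTorihedron → (Lᶜ : Set ThickTorus))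
      (shaded : ∀ k, Set (G k).Face)
      (bowtie : ∀ k, K.Twist × Bool ≃ {F : (G k).Face // F ∈ shaded k})
      (centre : ∀ k, K.Twist → Torus)
      (h : CellularGraph.Iso (G false) (G true)),
      -- the complement is decomposed into the two ideal torihedra
      IsTorihedralDecomposition G f ∧
      -- the graphs are 4-valent and checkerboard coloured with triangular shaded faces
      (∀ k, (G k).IsFourValent) ∧
      (∀ k, (G k).IsCheckerboard (shaded k)) ∧
      (∀ k, ∀ F ∈ shaded k, (G k).IsTriangle F) ∧
      -- the isomorphism of the torihedra respects the bow-ties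
      (∀ i b, h.toHomeo '' (bowtie false (i, b)).1.1 = (bowtie true (i, b)).1.1) ∧
      -- the two triangles of a bow-tie share the vertex to which the crossing circle is collapsed
      (∀ k i, centre k i ∈ (G k).vert ∧
        (∀ b, centre k i ∈ closure (bowtie k (i, b)).1.1) ∧
        Tendsto (fun x => (f k x : ThickTorus)) ((G k).nearVertex (centre k i))
          (𝓝ˢ (Φ '' K.crossingCircle i))) ∧
      -- every ideal vertex is obtained by collapsing part of the link
      (∀ k, ∀ v ∈ (G k).vert,
        Tendsto (fun x => (f k x : ThickTorus)) ((G k).nearVertex v) (𝓝ˢ L)) ∧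
      -- the triangles of a bow-tie are the halves of the disk bounded by the crossing circle, and
      -- they are glued within each torihedron, or across if there is a half twist
      (∀ k i b, (fun x => (f k x : ThickTorus)) '' (G k).bottom (bowtie k (i, b)).1.1 =
        Φ '' K.crossingHalfDisk i (if K.halfTwist i ≠ 0 ∧ b = true then !k else k)) ∧
      -- corresponding white faces are glued to each other
      (∀ F : (G false).Face, F ∉ shaded false →
        f false '' (G false).bottom F.1 = f true '' (G true).bottom (h.toHomeo '' F.1)) ∧
      -- away from half twists, the white faces lie on the projection torus, and the torihedra
      -- lie on the two sides of it
      (∀ k, ∀ F : (G k).Face, F ∉ shaded k → ∀ x ∈ (G k).bottom F.1,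
        (Φ.symm (f k x : ThickTorus)).1 ∉ K.halfTwistBoxes →
          ((Φ.symm (f k x : ThickTorus)).2 : ℝ) = 0) ∧
      (∀ k, ∀ x ∈ (G k).interiorPart,
        (Φ.symm (f k x : ThickTorus)).1 ∉ K.halfTwistBoxes →
          0 < sgn k * ((Φ.symm (f k x : ThickTorus)).2 : ℝ)) := by
  obtain ⟨hK, rfl⟩ := hL
  let e := complHomeomorph Φ K.augmentedLink
  have hcoe : ∀ m, (e m : ThickTorus) = Φ m := fun _ => rfl
  have hsymm : ∀ m, Φ.symm (e m : ThickTorus) = m := fun m => Φ.symm_apply_apply m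
  -- both torihedra have the same graph, so the isomorphism is the identity
  refine ⟨fun _ => K.graph hK, fun k x => e (K.place hK k x), fun _ => K.shadedFaces hK,
    fun _ => Equiv.ofInjective _ (K.triangleFace_injective hK),
    fun _ i => node K.seamChart (Sum.inr i),
    { toHomeo := Homeomorph.refl _, edgeEquiv := Equiv.refl _, map_vert := image_id _,
      map_edge := fun _ => image_id _ },
    (K.isTorihedralDecomposition_place hK).comp_homeomorph e, fun _ => K.isFourValent_graph hK,
    fun _ => K.isCheckerboard_graph hK, ?_, fun i b => image_id _, fun k i => ⟨⟨_, rfl⟩, fun b =>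
      K.node_mem_closure_triangle i b, ?_⟩, ?_, fun k i b => ?_, fun F hF => ?_,
    fun k F hF x hx hp => ?_, fun k x hx hp => ?_⟩
  · rintro k _ ⟨a, rfl⟩
    exact K.isTriangle_triangleFace hK a
  · have h := K.tendsto_place hK k (Sum.inr i) (S := Φ ⁻¹' (Φ '' K.crossingCircle i))
      fun m _ hm => ⟨m, (K.mem_crossingCircle_iff i m).2 (hm i rfl), rfl⟩
    exact (Φ.continuous.tendsto_nhdsSet (mapsTo_preimage _ _)).comp h
  · rintro k _ ⟨j, rfl⟩
    have h := K.tendsto_place hK k j (S := Φ ⁻¹' (Φ '' K.augmentedLink))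
      fun m hm _ => ⟨m, (K.mem_augmentedLink_iff m).2 hm, rfl⟩
    exact (Φ.continuous.tendsto_nhdsSet (mapsTo_preimage _ _)).comp h
  -- the half of the crossing disk to which a triangle goes is `swap i b k`
  · have h : (fun x => (K.place hK k x : ThickTorus)) ''
        (K.graph hK).bottom (K.triangleFace hK (i, b)).1 = K.crossingHalfDisk i (K.swap i b k) := by
      refine isEmbedding_thickCoord.injective.image_injective ?_
      rw [← image_comp]
      have h1 := K.thickCoord_image_place hK k
        (K.notMem_vertices_of_mem_face hK (K.triangleFace hK (i, b)))
      rw [← image_comp, trace_triangle] at h1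
      refine h1.trans ?_
      ext q
      constructor
      · intro hq
        have hq1 : |q.2| < 1 := by
          obtain ⟨x, _, h2, _⟩ := hq
          rw [← sq_lt_one_iff_abs_lt_one]
          nlinarith [sq_nonneg x]
        exact ⟨(q.1, ⟨q.2, abs_lt.1 hq1⟩), (K.mem_crossingHalfDisk_iff i _ _).2 hq, rfl⟩
      · rintro ⟨m, hm, rfl⟩
        exact (K.mem_crossingHalfDisk_iff i _ _).1 hm
    have h2 : (if K.halfTwist i ≠ 0 ∧ b = true then !k else k) = K.swap i b k := by
      unfold swap
      congr
    rw [h2, ← h, ← image_comp]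
    rfl
  · have h := K.notMem_vertices_of_mem_face hK F
    have h1 := (K.image_place_eq_iff hK h h).2 (K.trace_white hK false true hF)
    have h2 : (Homeomorph.refl Torus : Torus → Torus) '' F.1 = F.1 := image_id _
    rw [h2]
    exact (image_comp e _ _).trans ((congrArg _ h1).trans (image_comp e _ _).symm)
  · obtain ⟨p, hp1, -, h⟩ := K.exists_of_mem_bottom hK k (K.notMem_vertices_of_mem_face hK F) hx
    rw [hsymm] at hp ⊢
    have h1 := congrArg Prod.fst h
    have h2 := congrArg Prod.snd h
    refine h2.trans (K.unfold_white_snd k (K.white_notMem_hexagons (K.preimage_white hK hF hp1)) ?_)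
    rwa [← h1]
  · rw [hsymm] at hp ⊢
    exact K.develop_snd_pos k hx hp
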